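/- **Conventions.** Let $n\ge 3$, let $\delta\subset\mathbb R^n\times\mathbb R^n$ be the diagonal, oriented by $x\mapsto(x,x)$, and regard it as the $n$-dimensional current of integration; let $\delta_0$ be the Dirac current at $0\in\mathbb R^n$. $|S^{n-1}|$ is the area of the unit sphere. A $p$-form $\omega$ on $\mathbb R^N$ with locally integrable coefficients represents the current $T_\omega(\eta)=\int\omega\wedge\eta$ of dimension $N-p$. On a current $T$ of dimension $k$ on $\mathbb R^N$ one sets $dT(\eta)=(-1)^{N-k-1}T(d\eta)$ and $d^*T(\eta)=(-1)^{N-k}T(d^*\eta)$, where $d^*=-\sum_i\iota_{e_i}\partial_i$ on forms. For $N\ge3$ the Green operator on compactly supported smooth forms on $\mathbb R^N$ is, coefficientwise, $G(\omega)(y)=\int \frac{\omega(x)}{(N-2)|S^{N-1}|\,|x-y|^{N-2}}\,dx$; on currents $G(T)(\omega)=T(G(\omega))$, where the right hand side means $\lim_{R\to\infty}T(\chi(\cdot/R)\,G(\omega))$ for every smooth compactly supported $\chi$ equal to $1$ near $0$. Kernels of operators $P$ from $k$-forms to $l$-forms on $\mathbb R^n$ are $(n-k,l)$-forms $K$ on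 $\mathbb R^n\times\mathbb R^n$ with locally integrable coefficients such that $P(\omega)=(\pi_2)_*(K\wedge\pi_1^*\omega)$ (integration in the first variable, fiber first) for all smooth compactly supported $\omega$. The operator $d_y^*=-\sum_i\iota_{\partial_{y_i}}\partial_{y_i}$ is the codifferential in the second variable. The oriented blow-up of $\mathbb R^n\times\mathbb R^n$ along $\delta$ is $[0,\infty)\times S(\delta^\perp)\times\delta$ with the map $(t,v,p)\mapsto p+tv$; a smooth form off $\delta$ is blow-up extendible if its pull-back extends to a continuous form on the whole blow-up. **Theorem.** 1. The current $G(\delta)$ is defined and given by the absolutely convergent integrals $G(\delta)(\omega)=\int_\delta G(\omega)$. The Biot–Savart form $\mathrm{BS}(\delta):=d^*G(\delta)$ is represented by the form with locally integrable coefficients $$\frac1{|S^{n-1}|}\frac1{|x-y|^n}\sum_{i=1}^n(-1)^{i-1}(x_i-y_i)\bigwedge_{j\ne i}(dx_j-dy_j),$$ which is smooth off $\delta$ and blow-up extendible along $\delta$, and $d\,\mathrm{BS}(\delta)=\delta$ as currents. 2. $\mathrm{BS}(\delta_0):=d^*G(\delta_0)$ is represented by $\frac1{|S^{n-1}|}\frac1{|x|^n}\sum_i(-1)^{i-1}x_i\bigwedge_{j\ne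 i}dx_j$, and $\mathrm{BS}(\delta)=\beta^*\mathrm{BS}(\delta_0)$ for $\beta(x,y)=x-y$. 3. For $0\le k\le n$ the Green operator $G_k$ on $k$-forms of $\mathbb R^n$ has a kernel $\mathbb G_k$ that is smooth off $\delta$, and for such kernels $\mathrm{BS}(\delta)=\sum_{k=0}^n d_y^*\mathbb G_k$ off $\delta$. Here $d_y^*\mathbb G_0=0$, and for $1\le k\le n$ the form $d_y^*\mathbb G_k$ is the kernel of the Biot–Savart operator $(-1)^nd^*G_k$ from $k$-forms to $(k-1)$-forms. 4. Off $\delta$, $\mathrm{BS}(\delta)=\psi^*\mathrm{vol}_{S^{n-1}}$, where $\psi(x,y)=\frac{x-y}{|x-y|}$ is the Gauss map and $\mathrm{vol}_{S^{n-1}}=\frac1{|S^{n-1}|}\sum_i(-1)^{i-1}x_i\bigwedge_{j\ne i}dx_j$ is the normalized volume form. 5. (Gauss) Let $K_1,K_2\subset\mathbb R^3$ be disjoint oriented knots (compact oriented one-dimensional submanifolds). Then $$\mathrm{lk}(K_1,K_2)=\int_{K_1\times K_2}\mathrm{BS}(\delta)=\deg\bigl(\psi|_{K_1\times K_2}:K_1\times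 K_2\to S^2\bigr),$$ where $\mathrm{lk}(K_1,K_2)=I(S_1\times K_2,\delta)=-I(K_1\times S_2,\delta)=-I(S_1,K_2)=-I(K_1,S_2)$ for any compact oriented immersed surfaces $S_i$ in $\mathbb R^3$ with $\partial S_i=K_i$ (the immersion maps $\partial S_i$ diffeomorphically onto $K_i$, preserving orientations, and no interior point into $K_i$) such that $S_1\pitchfork K_2$ and $S_2\pitchfork K_1$; $I$ denotes intersection numbers counted with signs, and boundaries are oriented with the outward normal first. -/

import Mathlib

open MeasureTheory Set Filter Topology
open scoped ContDiff Manifold Distributions BigOperators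

noncomputable section

namespace BiotSavart

/-! ### Euclidean space, forms, wedge products -/

/-- The Euclidean space `ℝ^N`. -/
abbrev E (N : ℕ) : Type := EuclideanSpace ℝ (Fin N)

/-- Alternating `k`-covectors on `ℝ^N`; a `k`-form on `ℝ^N` is a map `E N → Cov N k`. -/
abbrev Cov (N k : ℕ) : Type := E N [⋀^Fin k]→L[ℝ] ℝ

/-- The standard basis vectors of `ℝ^N`. -/
def stdVec (N : ℕ) (i : Fin N) : E N := EuclideanSpace.single i (1 : ℝ)

/-- The coordinate covector `dx_i` on `ℝ^N`. -/
def coord (N : ℕ) (i : Fin N) : E N →L[ℝ] ℝ := EuclideanSpace.proj i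

theorem continuous_wedgeAux {N p q : ℕ} (a : Cov N p) (b : Cov N q) :
    Continuous (fun v : Fin p ⊕ Fin q → E N =>
      (LinearMap.mul' ℝ ℝ) (a.toAlternatingMap.domCoprod b.toAlternatingMap v)) := by
  have h : ∀ v : Fin p ⊕ Fin q → E N,
      (LinearMap.mul' ℝ ℝ) (a.toAlternatingMap.domCoprod b.toAlternatingMap v) =
        ∑ σ : Equiv.Perm.ModSumCongr (Fin p) (Fin q), (LinearMap.mul' ℝ ℝ)
          (AlternatingMap.domCoprod.summand a.toAlternatingMap b.toAlternatingMap σ v) := by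
    intro v
    rw [AlternatingMap.domCoprod_apply, _root_.sum_apply, map_sum]
  simp_rw [h]
  refine continuous_finsetSum _ fun σ _ => ?_
  induction σ using Quotient.inductionOn' with
  | h σ =>
    have h2 : ∀ v : Fin p ⊕ Fin q → E N, (LinearMap.mul' ℝ ℝ)
        (AlternatingMap.domCoprod.summand a.toAlternatingMap b.toAlternatingMap
          (Quotient.mk'' σ) v) =
        ((Equiv.Perm.sign σ : ℤ) : ℝ) *
          (a (fun i => v (σ (Sum.inl i))) * b (fun j => v (σ (Sum.inr j)))) := by
      intro v
      rw [AlternatingMap.domCoprod.summand_mk'']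
      rcases Int.units_eq_one_or (Equiv.Perm.sign σ) with hs | hs <;>
        simp [hs]
    simp_rw [h2]
    fun_prop

/-- The wedge product of alternating covectors (sum over shuffles, no factorials left over:
`(dx_1 ∧ ⋯ ∧ dx_k)(e_1, …, e_k) = 1`). -/
def wedge {N p q : ℕ} (a : Cov N p) (b : Cov N q) : Cov N (p + q) :=
  { ((LinearMap.mul' ℝ ℝ).compAlternatingMap
      (a.toAlternatingMap.domCoprod b.toAlternatingMap)).domDomCongr finSumFinEquiv with
    cont := (continuous_wedgeAux a b).comp
      (continuous_pi fun i => continuous_apply (finSumFinEquiv i)) }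

/-- The wedge product `φ_1 ∧ ⋯ ∧ φ_p` of one-covectors, `v ↦ det (φ_i (v_j))`. -/
def wedgeOne {N p : ℕ} (φ : Fin p → (E N →L[ℝ] ℝ)) : Cov N p :=
  ContinuousAlternatingMap.compContinuousLinearMap
    { (Matrix.detRowAlternating : (Fin p → ℝ) [⋀^Fin p]→ₗ[ℝ] ℝ) with
      cont := by
        change Continuous fun M : Matrix (Fin p) (Fin p) ℝ => M.det
        exact Continuous.matrix_det continuous_id }
    (ContinuousLinearMap.pi φ)

/-- The coefficient of `a ∧ b` (of top degree `p + q = N`) with respect to `dx_1 ∧ ⋯ ∧ dx_N`. -/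
def topWedge {N p q : ℕ} (h : p + q = N) (a : Cov N p) (b : Cov N q) : ℝ :=
  wedge a b fun i => stdVec N (Fin.cast h i)

/-- The determinant of `N` vectors of `ℝ^N`. -/
def orientDet {N : ℕ} (v : Fin N → E N) : ℝ := Matrix.det (Matrix.of fun i j => v i j)

/-- Contraction `ι_v` (it vanishes on `0`-covectors). -/
def contract {N : ℕ} (v : E N) : (k : ℕ) → (Cov N k →L[ℝ] Cov N (k - 1))
  | 0 => 0
  | _ + 1 => (ContinuousLinearMap.apply ℝ _ v).comp
      (ContinuousAlternatingMap.curryLeftLI (𝕜 := ℝ) (E := E N) (F := ℝ)).toContinuousLinearMap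

/-- The operator `-∑_i ι_{v_i} ∂_{v_i}` on `k`-forms on `ℝ^N`. -/
def codiffAlong {N k m : ℕ} (v : Fin m → E N) (θ : E N → Cov N k) (x : E N) : Cov N (k - 1) :=
  -∑ i, contract (v i) k (fderiv ℝ θ x (v i))

/-- The codifferential `d^*` on forms on `ℝ^N`. -/
def codiff {N k : ℕ} (θ : E N → Cov N k) (x : E N) : Cov N (k - 1) :=
  codiffAlong (stdVec N) θ x

/-! ### Currents -/

/-- Smooth compactly supported `k`-forms on `ℝ^N`, with their LF topology. -/
abbrev TestForm (N k : ℕ) : Type := 𝓓((⊤ : TopologicalSpace.Opens (E N)), Cov N k)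

/-- Currents of dimension `k` on `ℝ^N`. -/
abbrev Current (N k : ℕ) : Type := TestForm N k →L[ℝ] ℝ

/-- The exterior derivative of test forms. -/
def dTest (N k : ℕ) : TestForm N k →L[ℝ] TestForm N (k + 1) :=
  (TestFunction.postcompCLM (ContinuousAlternatingMap.alternatizeUncurryFinCLM ℝ (E N) ℝ)).comp
    (TestFunction.fderivCLM ℝ ⊤ ⊤)

theorem dTest_apply {N k : ℕ} (θ : TestForm N k) (x : E N) :
    dTest N k θ x = extDeriv (θ : E N → Cov N k) x := by
  simp [dTest, extDeriv]

/-- The codifferential of test forms. -/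
def codiffTest (N k : ℕ) : TestForm N k →L[ℝ] TestForm N (k - 1) :=
  (TestFunction.postcompCLM (-∑ i, (contract (stdVec N i) k).comp
    (ContinuousLinearMap.apply ℝ (Cov N k) (stdVec N i)))).comp
    (TestFunction.fderivCLM ℝ ⊤ ⊤)

theorem codiffTest_apply {N k : ℕ} (θ : TestForm N k) (x : E N) :
    codiffTest N k θ x = codiff (θ : E N → Cov N k) x := by
  simp [codiffTest, codiff, codiffAlong]

/-- `dT(η) = (-1)^{N-k-1} T(dη)` for a current `T` of dimension `k` (here `k + 1`). -/
def currentD {N k : ℕ} (T : Current N (k + 1)) : Current N k :=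
  ((-1 : ℝ) ^ (N - k)) • T.comp (dTest N k)

/-- `d^*T(η) = (-1)^{N-k} T(d^*η)` for a current `T` of dimension `k`. -/
def currentCodiff {N k : ℕ} (T : Current N k) : Current N (k + 1) :=
  ((-1 : ℝ) ^ (N - k)) • T.comp (codiffTest N (k + 1))

/-- The current `T` of dimension `q` is represented by the `p`-form `θ`, `p + q = N`: the form has
locally integrable coefficients and `T(η) = ∫ θ ∧ η`. -/
def Represents {N p q : ℕ} (h : p + q = N) (θ : E N → Cov N p) (T : Current N q) : Prop :=
  LocallyIntegrable θ ∧ ∀ η : TestForm N q, T η = ∫ x, topWedge h (θ x) (η x)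

/-- The Dirac current `δ_0` of dimension `0` on `ℝ^n`. -/
def diracCurrent (n : ℕ) : Current n 0 where
  toFun f := f 0 ![]
  map_add' _ _ := rfl
  map_smul' _ _ := rfl
  cont := (ContinuousEvalConst.continuous_eval_const (F := TestForm n 0) (0 : E n)).eval_const ![]

/-! ### Product coordinates on `ℝ^n × ℝ^n = ℝ^{2n}` -/

/-- The point `(x, y)`. -/
def pair {n : ℕ} (x y : E n) : E (n + n) := WithLp.toLp 2 (Fin.append x y)

/-- The projection `π₁(x, y) = x`. -/
def pr1 (n : ℕ) : E (n + n) →L[ℝ] E n :=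
  LinearMap.toContinuousLinearMap
    { toFun := fun z => WithLp.toLp 2 fun i => z (Fin.castAdd n i)
      map_add' := fun _ _ => rfl
      map_smul' := fun _ _ => rfl }

/-- The projection `π₂(x, y) = y`. -/
def pr2 (n : ℕ) : E (n + n) →L[ℝ] E n :=
  LinearMap.toContinuousLinearMap
    { toFun := fun z => WithLp.toLp 2 fun i => z (Fin.natAdd n i)
      map_add' := fun _ _ => rfl
      map_smul' := fun _ _ => rfl }

theorem pr1_apply {n : ℕ} (z : E (n + n)) (i : Fin n) : pr1 n z i = z (Fin.castAdd n i) := rfl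

theorem pr2_apply {n : ℕ} (z : E (n + n)) (i : Fin n) : pr2 n z i = z (Fin.natAdd n i) := rfl

theorem pr1_pair {n : ℕ} (x y : E n) : pr1 n (pair x y) = x := by
  ext i; rw [pr1_apply]; exact Fin.append_left _ _ i

theorem pr2_pair {n : ℕ} (x y : E n) : pr2 n (pair x y) = y := by
  ext i; rw [pr2_apply]; exact Fin.append_right _ _ i

theorem pair_pr {n : ℕ} (z : E (n + n)) : pair (pr1 n z) (pr2 n z) = z := by
  ext i
  refine Fin.addCases (fun j => ?_) (fun j => ?_) i
  · exact Fin.append_left _ _ j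
  · exact Fin.append_right _ _ j

/-- The map `β(x, y) = x - y`. -/
def diffMap (n : ℕ) : E (n + n) →L[ℝ] E n := pr1 n - pr2 n

/-- The diagonal of `ℝ^n × ℝ^n`. -/
def diag (n : ℕ) : Submodule ℝ (E (n + n)) := LinearMap.ker (diffMap n).toLinearMap

theorem mem_diag {n : ℕ} (z : E (n + n)) : z ∈ diag n ↔ pr1 n z = pr2 n z := by
  simp [diag, diffMap, sub_eq_zero]

/-- The diagonal embedding `x ↦ (x, x)`. -/
def diagEmb (n : ℕ) (x : E n) : E (n + n) := pair x x

theorem continuous_pair (n : ℕ) : Continuous fun p : E n × E n => pair p.1 p.2 := by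
  unfold pair
  refine (PiLp.continuous_toLp 2 _).comp (continuous_pi fun i => ?_)
  refine Fin.addCases (fun j => ?_) (fun j => ?_) i
  · simp only [Fin.append_left]; fun_prop
  · simp only [Fin.append_right]; fun_prop

theorem isClosedEmbedding_diagEmb (n : ℕ) : IsClosedEmbedding (diagEmb n) := by
  have hc : Continuous (diagEmb n) := (continuous_pair n).comp (by fun_prop : Continuous
    fun x : E n => (x, x))
  refine ⟨⟨⟨?_⟩, fun x y h => ?_⟩, ?_⟩
  · refine le_antisymm hc.le_induced ?_
    have : (id : E n → E n) = (pr1 n) ∘ diagEmb n := by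
      funext x; simp [diagEmb, pr1_pair]
    calc TopologicalSpace.induced (diagEmb n) inferInstance
        ≤ TopologicalSpace.induced (diagEmb n)
          (TopologicalSpace.induced (pr1 n) inferInstance) :=
          induced_mono (pr1 n).continuous.le_induced
      _ = TopologicalSpace.induced id inferInstance := by rw [induced_compose, ← this]
      _ = _ := induced_id
  · simpa [diagEmb, pr1_pair] using congrArg (pr1 n) h
  · have : range (diagEmb n) = {z | pr1 n z = pr2 n z} := by
      ext z
      constructor
      · rintro ⟨x, rfl⟩; simp [diagEmb, pr1_pair, pr2_pair]
      · intro h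
        refine ⟨pr1 n z, ?_⟩
        conv_rhs => rw [← pair_pr z]
        rw [diagEmb]
        congr 1
    rw [this]
    exact isClosed_eq (pr1 n).continuous (pr2 n).continuous

/-- The value of an `n`-covector on `(e_1,e_1), …, (e_n,e_n)`, the oriented basis of the
diagonal. -/
def diagEval (n : ℕ) : Cov (n + n) n →L[ℝ] ℝ :=
  ContinuousAlternatingMap.apply ℝ (E (n + n)) ℝ fun i => diagEmb n (stdVec n i)

/-- The current of integration over the diagonal of `ℝ^n × ℝ^n`, oriented by `x ↦ (x, x)`
(see `diagCurrent_apply`). -/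
def diagCurrent (n : ℕ) : Current (n + n) n :=
  TestFunction.integralAgainstBilinCLM
    ((ContinuousLinearMap.mul ℝ ℝ).comp (diagEval n))
    (Measure.map (diagEmb n) volume) (fun _ => (1 : ℝ))

theorem diagCurrent_apply {n : ℕ} (η : TestForm (n + n) n) :
    diagCurrent n η = ∫ x : E n, η (diagEmb n x) fun i => diagEmb n (stdVec n i) := by
  have he := isClosedEmbedding_diagEmb n
  have hm : MeasurableEmbedding (diagEmb n) := he.measurableEmbedding
  have hl : LocallyIntegrableOn (fun _ : E (n + n) => (1 : ℝ))
      ((⊤ : TopologicalSpace.Opens (E (n + n))) : Set (E (n + n)))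
      (Measure.map (diagEmb n) volume) := by
    apply LocallyIntegrable.locallyIntegrableOn
    rw [locallyIntegrable_iff]
    intro K hK
    rw [hm.integrableOn_map_iff]
    exact integrableOn_const (he.isCompact_preimage hK).measure_lt_top.ne
  rw [diagCurrent, TestFunction.integralAgainstBilinCLM_eq_integral hl, hm.integral_map]
  simp [diagEval]

/-! ### Green operators, Green kernels, Biot–Savart forms -/

/-- The area `|S^{n-1}|` of the unit sphere of `ℝ^n`. -/
def sphereArea (n : ℕ) : ℝ := (volume : Measure (E n)).toSphere.real univ

/-- The Green operator on forms on `ℝ^N`, `N ≥ 3`: coefficientwise convolution with the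
fundamental solution `1 / ((N-2) |S^{N-1}| |x|^{N-2})` of the (positive) Laplacian. -/
def green {N k : ℕ} (θ : E N → Cov N k) (y : E N) : Cov N k :=
  ∫ x, (((N : ℝ) - 2) * sphereArea N * ‖x - y‖ ^ (N - 2))⁻¹ • θ x

/-- `S = G(T)`: the Green operator on currents, defined by duality, `G(T)(θ) = T(G(θ))`, where `T`
is evaluated on the form `G(θ)`, which is not compactly supported, as the limit of `T(χ(·/R) G(θ))`
for `R → ∞`, for every cut-off function `χ` (equal to `1` near `0`). -/
def IsGreenOf {N k : ℕ} (T S : Current N k) : Prop :=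
  ∀ (θ : TestForm N k) (χ : 𝓓((⊤ : TopologicalSpace.Opens (E N)), ℝ)),
    (∀ᶠ x in 𝓝 (0 : E N), χ x = 1) →
    ∃ η : ℝ → TestForm N k,
      (∀ R : ℝ, 0 < R → ∀ x, η R x = χ (R⁻¹ • x) • green (θ : E N → Cov N k) x) ∧
      Tendsto (fun R => T (η R)) atTop (𝓝 (S θ))

/-- The form `K` on `ℝ^n × ℝ^n` has bidegree `(a, b)` off the diagonal: it vanishes on tuples of
coordinate vectors unless exactly `a` of them are in the first factor and `b` in the second. -/
def HasBidegree {n p : ℕ} (a b : ℕ) (K : E (n + n) → Cov (n + n) p) : Prop :=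
  ∀ z ∉ diag n, ∀ f : Fin p → Fin (n + n),
    ¬ ((Finset.univ.filter fun i => (f i : ℕ) < n).card = a ∧
        (Finset.univ.filter fun i => n ≤ (f i : ℕ)).card = b) →
    K z (fun i => stdVec (n + n) (f i)) = 0

/-- The value at `x` of the density whose integral over `x ∈ ℝ^n` is
`(π₂)_*(K ∧ π₁^*θ)_y (w_1, …, w_l)` (integration along the fibers of `π₂`, fiber first). -/
def fiberDensity {n p k l : ℕ} (h : p + k = n + l) (K : E (n + n) → Cov (n + n) p)
    (θ : E n → Cov n k) (y : E n) (w : Fin l → E n) (x : E n) : ℝ :=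
  wedge (K (pair x y)) ((θ x).compContinuousLinearMap (pr1 n))
    (fun i => Fin.append (fun j => pair (stdVec n j) 0) (fun j => pair 0 (w j)) (Fin.cast h i))

/-- `K` is the kernel of the operator `P` from `k`-forms to `l`-forms on `ℝ^n`: it is an
`(n-k, l)`-form with locally integrable coefficients and `P(θ) = (π₂)_*(K ∧ π₁^*θ)`. -/
def IsKernel {n p k l : ℕ} (h : p + k = n + l) (K : E (n + n) → Cov (n + n) p)
    (P : (E n → Cov n k) → E n → Cov n l) : Prop :=
  LocallyIntegrable K ∧ HasBidegree (n - k) l K ∧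
  ∀ (θ : TestForm n k) (y : E n) (w : Fin l → E n),
    Integrable (fiberDensity h K θ y w) ∧ P θ y w = ∫ x, fiberDensity h K θ y w x

/-- `K` is the kernel of the Green operator on `k`-forms, smooth off the diagonal. -/
def IsGreenKernel (n k : ℕ) (K : E (n + n) → Cov (n + n) n) : Prop :=
  ContDiffOn ℝ ∞ K (diag n : Set (E (n + n)))ᶜ ∧
  IsKernel (k := k) (l := k) rfl K green

/-- The operator `d_y^*` on forms on `ℝ^n × ℝ^n`: the codifferential in the second variable,
`d_y^*(π₂^*η ∧ π₁^*θ) = π₂^*(d^*η) ∧ π₁^*θ`. -/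
def codiffY {n p : ℕ} (K : E (n + n) → Cov (n + n) p) (z : E (n + n)) : Cov (n + n) (p - 1) :=
  codiffAlong (fun i : Fin n => pair 0 (stdVec n i)) K z

/-- The increasing enumeration of the indices different from `i`. -/
def skipIdx {n : ℕ} (i : Fin n) : Fin (n - 1) ↪o Fin n :=
  (Finset.univ.erase i).orderEmbOfFin (by simp)

/-- `∑_i (-1)^{i-1} x_i dx_1 ∧ ⋯ ∧ \hat{dx_i} ∧ ⋯ ∧ dx_n`. -/
def radialForm (n : ℕ) (x : E n) : Cov n (n - 1) :=
  ∑ i : Fin n, ((-1 : ℝ) ^ (i : ℕ) * x i) • wedgeOne fun j => coord n (skipIdx i j)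

/-- The form `|S^{n-1}|⁻¹ |x|⁻ⁿ ∑_i (-1)^{i-1} x_i dx_1 ∧ ⋯ ∧ \hat{dx_i} ∧ ⋯ ∧ dx_n` on `ℝ^n`. -/
def pointForm (n : ℕ) (x : E n) : Cov n (n - 1) :=
  ((sphereArea n)⁻¹ * (‖x‖ ^ n)⁻¹) • radialForm n x

/-- The form `|S^{n-1}|⁻¹ |x-y|⁻ⁿ ∑_i (-1)^{i-1} (x_i-y_i) ∧_{j ≠ i} (dx_j - dy_j)` on
`ℝ^n × ℝ^n`. -/
def diagForm (n : ℕ) (z : E (n + n)) : Cov (n + n) (n - 1) :=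
  ((sphereArea n)⁻¹ * (‖pr1 n z - pr2 n z‖ ^ n)⁻¹) •
    ∑ i : Fin n, ((-1 : ℝ) ^ (i : ℕ) * (pr1 n z i - pr2 n z i)) •
      wedgeOne fun j => coord (n + n) (Fin.castAdd n (skipIdx i j)) -
        coord (n + n) (Fin.natAdd n (skipIdx i j))

/-- The normalized volume form of the unit sphere, as the restriction of a form on `ℝ^n`. -/
def sphereVol (n : ℕ) (x : E n) : Cov n (n - 1) := (sphereArea n)⁻¹ • radialForm n x

/-- The Gauss map `ψ(x, y) = (x - y) / |x - y|`. -/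
def gaussMap (n : ℕ) (z : E (n + n)) : E n := ‖pr1 n z - pr2 n z‖⁻¹ • (pr1 n z - pr2 n z)

/-! ### Oriented blow-up of a linear subspace -/

/-- The oriented blow-up of the linear subspace `L` of `ℝ^N`: `[0,∞) × S(L^⊥) × L`. -/
def blowUp {N : ℕ} (L : Submodule ℝ (E N)) : Set (ℝ × E N × E N) :=
  {b | 0 ≤ b.1 ∧ b.2.1 ∈ Lᗮ ∧ ‖b.2.1‖ = 1 ∧ b.2.2 ∈ L}

/-- The tangent spaces of the blow-up. -/
def blowUpTangent {N : ℕ} (L : Submodule ℝ (E N)) (b : ℝ × E N × E N) : Set (ℝ × E N × E N) :=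
  {u | u.2.1 ∈ Lᗮ ∧ inner ℝ b.2.1 u.2.1 = 0 ∧ u.2.2 ∈ L}

/-- The blow-down map `(t, v, p) ↦ p + t v`. -/
def blowDown {N : ℕ} (b : ℝ × E N × E N) : E N := b.2.2 + b.1 • b.2.1

/-- The form `Ω` is smooth off `L` and its pull-back under the blow-down map extends to a continuous
form on the whole blow-up. (A continuous form on the blow-up is given as the restriction to the
tangent spaces of a continuous family of covectors of the ambient space.) -/
def IsBlowUpExtendible {N k : ℕ} (L : Submodule ℝ (E N)) (Ω : E N → Cov N k) : Prop :=
  ContDiffOn ℝ ∞ Ω (L : Set (E N))ᶜ ∧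
  ∃ Ω' : ℝ × E N × E N → (ℝ × E N × E N) [⋀^Fin k]→L[ℝ] ℝ,
    ContinuousOn Ω' (blowUp L) ∧
    ∀ b ∈ blowUp L, 0 < b.1 → ∀ u : Fin k → ℝ × E N × E N, (∀ i, u i ∈ blowUpTangent L b) →
      Ω' b u = Ω (blowDown b) (fun i => fderiv ℝ (blowDown (N := N)) b (u i))

/-! ### Knots in `ℝ³`, linking numbers, degrees -/

/-- A compact oriented one-dimensional submanifold of `ℝ³` with `r` components, given by disjoint
simple closed smooth regular parametrized curves of period one. -/
structure OrientedKnot (r : ℕ) where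
  curve : Fin r → ℝ → E 3
  smooth : ∀ i, ContDiff ℝ ∞ (curve i)
  periodic : ∀ i, Function.Periodic (curve i) 1
  regular : ∀ i t, deriv (curve i) t ≠ 0
  simple : ∀ i j, ∀ s ∈ Ico (0 : ℝ) 1, ∀ t ∈ Ico (0 : ℝ) 1,
    curve i s = curve j t → i = j ∧ s = t

/-- The underlying set of a knot. -/
def OrientedKnot.carrier {r : ℕ} (K : OrientedKnot r) : Set (E 3) := {p | ∃ i t, K.curve i t = p}

/-- The signed count of a finite set of points, the sign at `q` being that of `J q`, equals `d`. -/
def IsSignedCount {α : Type*} (P : Set α) (J : α → ℝ) (d : ℤ) : Prop :=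
  P.Finite ∧ ∑ᶠ q ∈ P, (SignType.sign (J q) : ℤ) = d

section Surface

variable (S : Type) [TopologicalSpace S] [ChartedSpace (EuclideanHalfSpace 2) S]
  [IsManifold (𝓡∂ 2) ∞ S]

/-- The charts `chartAt x` form an oriented atlas of the surface with boundary `S`; then `S` is
oriented by the standard orientation of `ℝ²` in these charts. -/
def HasOrientedCharts : Prop :=
  ∀ x y : S, ∀ z ∈ (extChartAt (𝓡∂ 2) x).source ∩ (extChartAt (𝓡∂ 2) y).source,
    0 < (tangentCoordChange (𝓡∂ 2) x y z).det

variable {S}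

/-- The images `df(e_1), df(e_2)` of the oriented basis of `T_x S` given by `chartAt x`. -/
def frame (f : S → E 3) (x : S) (i : Fin 2) : E 3 :=
  mfderiv (𝓡∂ 2) 𝓘(ℝ, E 3) f x (EuclideanSpace.single i (1 : ℝ) : EuclideanSpace ℝ (Fin 2))

/-- `f : S → ℝ³` is a smooth immersion with `f⁻¹(K) = ∂S` that maps `∂S` bijectively onto `K`
preserving orientations. In a chart in the half plane `x_1 ≥ 0` the outward normal is `-e_1`, so the
boundary (oriented with the outward normal first) has oriented tangent `-e_2`. -/
def IsSeifertSurface {r : ℕ} (K : OrientedKnot r) (f : S → E 3) : Prop :=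
  ContMDiff (𝓡∂ 2) 𝓘(ℝ, E 3) ∞ f ∧
  (∀ x, Function.Injective (mfderiv (𝓡∂ 2) 𝓘(ℝ, E 3) f x)) ∧
  f ⁻¹' K.carrier = (𝓡∂ 2).boundary S ∧
  BijOn f ((𝓡∂ 2).boundary S) K.carrier ∧
  ∀ x ∈ (𝓡∂ 2).boundary S, ∀ i t, f x = K.curve i t →
    ∃ c : ℝ, 0 < c ∧ -frame f x 1 = c • deriv (K.curve i) t

/-- The set of intersection points of the surface `f : S → ℝ³` with `K`. -/
def meetingPoints {r : ℕ} (f : S → E 3) (K : OrientedKnot r) : Set (S × Fin r × ℝ) :=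
  {q | q.2.2 ∈ Ico (0 : ℝ) 1 ∧ f q.1 = K.curve q.2.1 q.2.2}

/-- `det (ori S, ori K)` at an intersection point. -/
def detSK {r : ℕ} (f : S → E 3) (K : OrientedKnot r) (q : S × Fin r × ℝ) : ℝ :=
  orientDet ![frame f q.1 0, frame f q.1 1, deriv (K.curve q.2.1) q.2.2]

/-- `det (ori K, ori S)` at an intersection point. -/
def detKS {r : ℕ} (f : S → E 3) (K : OrientedKnot r) (q : S × Fin r × ℝ) : ℝ :=
  orientDet ![deriv (K.curve q.2.1) q.2.2, frame f q.1 0, frame f q.1 1]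

/-- `det (ori (S × K), ori δ)` in `ℝ³ × ℝ³` at a point of `S × K` on the diagonal `δ`. -/
def detSKdiag {r : ℕ} (f : S → E 3) (K : OrientedKnot r) (q : S × Fin r × ℝ) : ℝ :=
  orientDet (N := 3 + 3) ![pair (frame f q.1 0) 0, pair (frame f q.1 1) 0,
    pair 0 (deriv (K.curve q.2.1) q.2.2),
    diagEmb 3 (stdVec 3 0), diagEmb 3 (stdVec 3 1), diagEmb 3 (stdVec 3 2)]

/-- `det (ori (K × S), ori δ)` in `ℝ³ × ℝ³` at a point of `K × S` on the diagonal `δ`. -/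
def detKSdiag {r : ℕ} (f : S → E 3) (K : OrientedKnot r) (q : S × Fin r × ℝ) : ℝ :=
  orientDet (N := 3 + 3) ![pair (deriv (K.curve q.2.1) q.2.2) 0,
    pair 0 (frame f q.1 0), pair 0 (frame f q.1 1),
    diagEmb 3 (stdVec 3 0), diagEmb 3 (stdVec 3 1), diagEmb 3 (stdVec 3 2)]

/-- The surface `f` meets `K` transversely. -/
def IsTransverseTo {r : ℕ} (f : S → E 3) (K : OrientedKnot r) : Prop :=
  ∀ q ∈ meetingPoints f K, detSK f K q ≠ 0

end Surface

/-- `ℓ` is the linking number of the disjoint knots `K₁, K₂` of `ℝ³`, that is, for all compact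
oriented surfaces `S₁, S₂` bounded by `K₁, K₂` with `S₁ ⋔ K₂`, `S₂ ⋔ K₁`,
`ℓ = I(S₁ × K₂, δ) = -I(K₁ × S₂, δ) = -I(S₁, K₂) = -I(K₁, S₂)`. -/
def IsLinkingNumber {r₁ r₂ : ℕ} (K₁ : OrientedKnot r₁) (K₂ : OrientedKnot r₂) (ℓ : ℤ) : Prop :=
  (∀ (S₁ : Type) [TopologicalSpace S₁] [ChartedSpace (EuclideanHalfSpace 2) S₁]
    [IsManifold (𝓡∂ 2) ∞ S₁] [CompactSpace S₁] [T2Space S₁] (f₁ : S₁ → E 3),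
    HasOrientedCharts S₁ → IsSeifertSurface K₁ f₁ → IsTransverseTo f₁ K₂ →
      IsSignedCount (meetingPoints f₁ K₂) (detSKdiag f₁ K₂) ℓ ∧
      IsSignedCount (meetingPoints f₁ K₂) (detSK f₁ K₂) (-ℓ)) ∧
  (∀ (S₂ : Type) [TopologicalSpace S₂] [ChartedSpace (EuclideanHalfSpace 2) S₂]
    [IsManifold (𝓡∂ 2) ∞ S₂] [CompactSpace S₂] [T2Space S₂] (f₂ : S₂ → E 3),
    HasOrientedCharts S₂ → IsSeifertSurface K₂ f₂ → IsTransverseTo f₂ K₁ →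
      IsSignedCount (meetingPoints f₂ K₁) (detKSdiag f₂ K₁) (-ℓ) ∧
      IsSignedCount (meetingPoints f₂ K₁) (detKS f₂ K₁) (-ℓ))

/-- The integral of (the restriction of) a two-form on `ℝ³ × ℝ³` over `K₁ × K₂`. -/
def productIntegral {r₁ r₂ : ℕ} (K₁ : OrientedKnot r₁) (K₂ : OrientedKnot r₂)
    (Ω : E (3 + 3) → Cov (3 + 3) 2) : ℝ :=
  ∑ i, ∑ j, ∫ s in (0 : ℝ)..1, ∫ t in (0 : ℝ)..1,
    Ω (pair (K₁.curve i s) (K₂.curve j t))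
      ![pair (deriv (K₁.curve i) s) 0, pair 0 (deriv (K₂.curve j) t)]

/-- The Gauss map on the component `(i, j)` of `K₁ × K₂`. -/
def knotGaussMap {r₁ r₂ : ℕ} (K₁ : OrientedKnot r₁) (K₂ : OrientedKnot r₂) (i : Fin r₁)
    (j : Fin r₂) (p : ℝ × ℝ) : E 3 :=
  gaussMap 3 (pair (K₁.curve i p.1) (K₂.curve j p.2))

/-- For a smooth map `F` from a disjoint union of tori `[0,1)²` to the unit sphere of `ℝ³`: the
Jacobian of `F`, where the sphere is oriented with the outward normal first. -/
def sphereJacobian {r₁ r₂ : ℕ} (F : Fin r₁ → Fin r₂ → ℝ × ℝ → E 3)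
    (q : Fin r₁ × Fin r₂ × ℝ × ℝ) : ℝ :=
  orientDet ![F q.1 q.2.1 q.2.2, fderiv ℝ (F q.1 q.2.1) q.2.2 (1, 0),
    fderiv ℝ (F q.1 q.2.1) q.2.2 (0, 1)]

/-- The preimages of `v` in the union of tori. -/
def torusFiber {r₁ r₂ : ℕ} (F : Fin r₁ → Fin r₂ → ℝ × ℝ → E 3) (v : E 3) :
    Set (Fin r₁ × Fin r₂ × ℝ × ℝ) :=
  {q | q.2.2.1 ∈ Ico (0 : ℝ) 1 ∧ q.2.2.2 ∈ Ico (0 : ℝ) 1 ∧ F q.1 q.2.1 q.2.2 = v}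

/-- `v` is a regular value of `F` in the unit sphere. -/
def IsRegularValue {r₁ r₂ : ℕ} (F : Fin r₁ → Fin r₂ → ℝ × ℝ → E 3) (v : E 3) : Prop :=
  ‖v‖ = 1 ∧ ∀ q ∈ torusFiber F v, sphereJacobian F q ≠ 0

/-- `d` is the degree of `F`: regular values exist and the signed count of the preimages of each
of them is `d`. -/
def IsDegree {r₁ r₂ : ℕ} (F : Fin r₁ → Fin r₂ → ℝ × ℝ → E 3) (d : ℤ) : Prop :=
  (∃ v, IsRegularValue F v) ∧
  ∀ v, IsRegularValue F v → IsSignedCount (torusFiber F v) (sphereJacobian F) d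

end BiotSavart

end

open MeasureTheory Set Filter Topology
open scoped ContDiff Manifold Distributions BigOperators

noncomputable section

namespace BiotSavart

/-! ### Alternating maps -/

/-! Everything rests on the field u / (|S^{n-1}| |u|^n) on ℝ^n, whose divergence is the Dirac
measure at the origin. Contracting the volume form with this field gives `pointForm`, and `diagForm`
is its pull-back under x - y (`diagForm_eq`). Contraction with u ignores multiples of u in the
remaining arguments, and the form is homogeneous of degree zero (`contract_smul_apply_add`); this
yields both the blow-up extension and the description by the Gauss map.

The Newton kernel of ℝ^{2n}, integrated along the diagonal, depends on x - y only and is half the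
Newton kernel of ℝ^n (`integral_green_diag`). Derivatives along the diagonal integrate to zero
against functions of x - y (`integral_comp_diffMap_mul_fderiv_diag`). Hence d^*G(δ) reduces to one
integration by parts in u = x - y, and d BS(δ) to the radial derivative in u, whose integral against
|u|^{-n} is -|S^{n-1}| times the value at u = 0 (`integral_pow_inv_mul_fderiv_self`). The
integrations by parts are done with √(|u|² + ε²) in place of |u|. The divergence of the regularized
field is `peak`, an approximate identity as ε → 0.

The bidegree components of the pull-back of the volume form under x - y are extracted from the forms
vol(x - c y) by interpolation in c. Multiplied by the Newton kernel they are Green kernels, and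
d_y^* of them is explicit. Kernels that are smooth off the diagonal are determined there by their
operator (`IsGreenKernel.eqOn`), so the explicit ones suffice.

For Gauss's formula the regularized two-form on ℝ³ has exterior derivative `peak` times the volume
form (`det3_bsDeriv`). The Gauss integral is then evaluated in two ways as an integral of `peak`
over a three-dimensional family of difference vectors. Sweeping the first knot off to infinity along
-v gives the difference vectors k(s) - l(t) - r v, which vanish at the preimages of v under the
Gauss map (`gaussIntegral_zero_eq_finsum`). Filling the first knot by a surface f gives f(x) - l(t),
which vanishes at the intersection points (`sum_gaussIntegral_zero_eq_finsum`, by Stokes' theorem).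
As ε → 0 each nondegenerate zero contributes the sign of its Jacobian (`tendsto_integral_mul_peak`).
So the same integral is an integer, the degree and the linking number. Regular values exist by
Sard's theorem for a cone (`exists_isRegularValue`), and symmetry of the Gauss integral handles
surfaces bounded by the second knot. -/

theorem alternating_congr_span {ι V : Type*} [Fintype ι] [AddCommGroup V] [Module ℝ V]
    (A : V [⋀^ι]→ₗ[ℝ] ℝ) (I : Set ι) (m m' : ι → V) (h : ∀ i ∈ I, m' i = m i)
    (h' : ∀ j ∉ I, m' j - m j ∈ Submodule.span ℝ (m '' I)) : A m' = A m := by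
  classical
  -- The vectors are exchanged one at a time. Each exchange adds a term in which one slot holds a
  -- combination of vectors already present at indices of I; such a term vanishes by alternation.
  suffices H : ∀ s : Finset ι, A (fun j => if j ∈ s then m' j else m j) = A m by
    simpa using H Finset.univ
  intro s
  induction s using Finset.induction_on with
  | empty => simp
  | insert a s ha ih =>
    set f : ι → V := fun j => if j ∈ s then m' j else m j with hf
    have h1 : (fun j => if j ∈ insert a s then m' j else m j) = Function.update f a (m' a) := by
      funext j
      by_cases hj : j = a
      · subst hj; simp
      · simp [hj, hf]
    have h2 : f = Function.update f a (m a) := by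
      conv_lhs => rw [← Function.update_eq_self a f]
      simp [hf, ha]
    rw [← ih, h1]
    conv_rhs => rw [h2]
    rw [← sub_eq_zero, ← AlternatingMap.map_update_sub]
    by_cases haI : a ∈ I
    · rw [h a haI, sub_self, AlternatingMap.map_update_zero]
    · have hfI : ∀ i ∈ I, f i = m i := by
        intro i hi
        by_cases his : i ∈ s <;> simp [hf, his, h i hi]
      have hm := h' a haI
      clear h1 h2
      generalize m' a - m a = d at hm ⊢
      induction hm using Submodule.span_induction with
      | mem x hx =>
        obtain ⟨i, hi, rfl⟩ := hx
        have hia : i ≠ a := fun e => haI (e ▸ hi)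
        refine A.map_eq_zero_of_eq _ (i := i) (j := a) ?_ hia
        simp [hia, hfI i hi]
      | zero => exact AlternatingMap.map_update_zero _ _ _
      | add x y _ _ hx hy => rw [AlternatingMap.map_update_add, hx, hy, add_zero]
      | smul c x _ hx => rw [AlternatingMap.map_update_smul, hx, smul_zero]

theorem cov_ext {N k : ℕ} {a b : Cov N k}
    (h : ∀ f : Fin k → Fin N, (a fun i => stdVec N (f i)) = b fun i => stdVec N (f i)) : a = b := by
  refine ContinuousAlternatingMap.toAlternatingMap_injective ?_
  refine Module.Basis.ext_alternating (EuclideanSpace.basisFun (Fin N) ℝ).toBasis fun v _ => ?_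
  simpa [stdVec] using h v

/-! ### Wedge products evaluated on vectors -/

theorem wedge_apply {N p q : ℕ} (a : Cov N p) (b : Cov N q) (v : Fin (p + q) → E N) :
    wedge a b v = LinearMap.mul' ℝ ℝ (a.toAlternatingMap.domCoprod b.toAlternatingMap
      (fun i => v (finSumFinEquiv i))) := rfl

/-- The wedge product, as a bilinear map, evaluated on fixed vectors. -/
def wedgeEval {N p q : ℕ} (v : Fin (p + q) → E N) : Cov N p →ₗ[ℝ] Cov N q →ₗ[ℝ] ℝ :=
  LinearMap.mk₂ ℝ (fun a b => wedge a b v)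
    (fun a a' b => by
      simp only [wedge_apply, ← AlternatingMap.domCoprod'_apply,
        ContinuousAlternatingMap.toAlternatingMap_add, TensorProduct.add_tmul, map_add]
      exact map_add (LinearMap.mul' ℝ ℝ) _ _)
    (fun c a b => by
      simp only [wedge_apply, ← AlternatingMap.domCoprod'_apply,
        ContinuousAlternatingMap.toAlternatingMap_smul, ← TensorProduct.smul_tmul', map_smul]
      exact map_smul (LinearMap.mul' ℝ ℝ) _ _)
    (fun a b b' => by
      simp only [wedge_apply, ← AlternatingMap.domCoprod'_apply,
        ContinuousAlternatingMap.toAlternatingMap_add, TensorProduct.tmul_add, map_add]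
      exact map_add (LinearMap.mul' ℝ ℝ) _ _)
    (fun c a b => by
      simp only [wedge_apply, ← AlternatingMap.domCoprod'_apply,
        ContinuousAlternatingMap.toAlternatingMap_smul, TensorProduct.tmul_smul, map_smul]
      exact map_smul (LinearMap.mul' ℝ ℝ) _ _)

@[simp] theorem wedgeEval_apply {N p q : ℕ} (v : Fin (p + q) → E N) (a : Cov N p) (b : Cov N q) :
    wedgeEval v a b = wedge a b v := rfl

theorem wedge_smul_left {N p q : ℕ} (c : ℝ) (a : Cov N p) (b : Cov N q) (v : Fin (p + q) → E N) :
    wedge (c • a) b v = c * wedge a b v := by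
  rw [← wedgeEval_apply, map_smul]
  rfl

theorem wedge_sum_left {N p q : ℕ} {ι : Type*} (s : Finset ι) (a : ι → Cov N p) (b : Cov N q)
    (v : Fin (p + q) → E N) : wedge (∑ i ∈ s, a i) b v = ∑ i ∈ s, wedge (a i) b v := by
  rw [← wedgeEval_apply, map_sum, LinearMap.sum_apply]
  rfl

/-- Among all shuffles only the trivial one survives. Any other one puts some w j into an argument
of a and some v j into an argument of b, so either alternative of the hypothesis kills it. -/
theorem wedge_append {N p q : ℕ} (a : Cov N p) (b : Cov N q) (v : Fin p → E N) (w : Fin q → E N)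
    (h : (∀ m : Fin p → E N, (∃ i j, m i = w j) → a m = 0) ∨
      (∀ m : Fin q → E N, (∃ i j, m i = v j) → b m = 0)) :
    wedge a b (Fin.append v w) = a v * b w := by
  classical
  rw [wedge_apply, AlternatingMap.domCoprod_apply, _root_.sum_apply, map_sum]
  refine (Fintype.sum_eq_single
    (Quotient.mk'' 1 : Equiv.Perm.ModSumCongr (Fin p) (Fin q)) ?_).trans ?_
  rotate_left
  · rw [AlternatingMap.domCoprod.summand_mk'']
    simp
  · intro σ hσ
    induction σ using Quotient.inductionOn' with
    | h σ =>
      rw [AlternatingMap.domCoprod.summand_mk'']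
      -- A permutation that maps one of the two blocks into itself represents the trivial class, so
      -- a nontrivial one crosses the blocks in both directions.
      have key : (∃ i j, σ (Sum.inl i) = Sum.inr j) ∧ (∃ i j, σ (Sum.inr i) = Sum.inl j) := by
        by_contra hcon
        refine hσ ?_
        have hl : MapsTo σ (range Sum.inl) (range Sum.inl) ∨
            MapsTo σ (range Sum.inr) (range Sum.inr) := by
          by_contra! h2
          refine hcon ⟨?_, ?_⟩
          · have := h2.1
            simp only [MapsTo, mem_range, forall_exists_index, forall_apply_eq_imp_iff,
              not_forall] at this
            obtain ⟨i, hi⟩ := this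
            cases hs : σ (Sum.inl i) with
            | inl j => exact absurd ⟨j, hs.symm⟩ hi
            | inr j => exact ⟨i, j, hs⟩
          · have := h2.2
            simp only [MapsTo, mem_range, forall_exists_index, forall_apply_eq_imp_iff,
              not_forall] at this
            obtain ⟨i, hi⟩ := this
            cases hs : σ (Sum.inr i) with
            | inr j => exact absurd ⟨j, hs.symm⟩ hi
            | inl j => exact ⟨i, j, hs⟩
        rcases hl with hl | hl
        · have := Equiv.Perm.mem_sumCongrHom_range_of_perm_mapsTo_inl hl
          exact Quotient.sound' (by
            rw [QuotientGroup.leftRel_apply]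
            simpa using this)
        · have : MapsTo σ (range Sum.inl) (range Sum.inl) := by
            have h3 := Equiv.Perm.perm_mapsTo_inl_iff_mapsTo_inr σ
            exact h3.2 hl
          have := Equiv.Perm.mem_sumCongrHom_range_of_perm_mapsTo_inl this
          exact Quotient.sound' (by
            rw [QuotientGroup.leftRel_apply]
            simpa using this)
      obtain ⟨⟨i, j, hij⟩, ⟨i', j', hij'⟩⟩ := key
      have hz : a (fun k => Fin.append v w (finSumFinEquiv (σ (Sum.inl k)))) *
          b (fun k => Fin.append v w (finSumFinEquiv (σ (Sum.inr k)))) = 0 := by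
        rcases h with h | h
        · rw [h _ ⟨i, j, by simp [hij]⟩, zero_mul]
        · rw [h _ ⟨i', j', by simp [hij']⟩, mul_zero]
      rcases Int.units_eq_one_or (Equiv.Perm.sign σ) with hs | hs <;> simpa [hs] using hz

theorem append_cast_eq_insertNth {V : Type*} {m q : ℕ} (v : Fin (m + 1) → V) (w : Fin q → V)
    (i : Fin (m + 1)) :
    (fun j : Fin (m + q + 1) => Fin.append v w (Fin.cast (by omega) j)) =
      Fin.insertNth (α := fun _ => V) (⟨i, by omega⟩ : Fin (m + q + 1)) (v i)
        (Fin.append (fun j => v (i.succAbove j)) w : Fin (m + q) → V) := by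
  rw [Fin.eq_insertNth_iff]
  refine ⟨?_, ?_⟩
  · exact Fin.append_left v w i
  · funext j
    refine Fin.addCases (fun k => ?_) (fun k => ?_) j
    · rw [Fin.append_left, ← Fin.append_left v w]
      simp only [Fin.removeNth]
      congr 1
      ext
      simp only [Fin.succAbove, Fin.lt_def]
      split_ifs <;> (simp_all; try omega)
    · rw [Fin.append_right, ← Fin.append_right v w]
      simp only [Fin.removeNth]
      congr 1
      ext
      have := i.2
      simp only [Fin.succAbove, Fin.lt_def]
      split_ifs <;> simp_all <;> omega

theorem append_cons_eq_insertNth {V : Type*} {m q : ℕ} (x : V) (v : Fin m → V) (w : Fin q → V) :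
    (Fin.append v (Matrix.vecCons x w : Fin (q + 1) → V) : Fin (m + (q + 1)) → V) =
      Fin.insertNth (α := fun _ => V) (⟨m, by omega⟩ : Fin (m + q + 1)) x
        (Fin.append v w : Fin (m + q) → V) := by
  rw [Fin.eq_insertNth_iff]
  refine ⟨?_, ?_⟩
  · exact Fin.append_right v (Matrix.vecCons x w : Fin (q + 1) → V) 0
  · funext j
    refine Fin.addCases (fun k => ?_) (fun k => ?_) j
    · rw [Fin.append_left, ← Fin.append_left v (Matrix.vecCons x w : Fin (q + 1) → V)]
      simp only [Fin.removeNth]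
      congr 1
      ext
      simp [Fin.succAbove, Fin.lt_def]
    · rw [Fin.append_right]
      have : w k = Fin.append v (Matrix.vecCons x w : Fin (q + 1) → V) (Fin.natAdd m k.succ) := by
        rw [Fin.append_right]; rfl
      rw [this]
      simp only [Fin.removeNth]
      congr 1
      ext
      simp [Fin.succAbove, Fin.lt_def]
      omega

/-- Both sides are linear in x, so x may be taken to be v i. Moving v i from place i to place m
costs (-1)^(i+m), after which the tuple splits as in `wedge_append`; bringing v i to the front of A
costs another (-1)^i, and (-1)^m remains. -/
theorem wedge_contract_append {N m q : ℕ} (A : Cov N (m + 1)) (b : Cov N (q + 1))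
    (v : Fin (m + 1) → E N) (w : Fin q → E N) (x : E N)
    (hx : x ∈ Submodule.span ℝ (range v))
    (hA : ∀ u : Fin (m + 1) → E N, (∃ i j, u i = w j) → A u = 0) :
    wedge (contract x (m + 1) A) b
      (fun i : Fin (m + (q + 1)) => Fin.append v w (Fin.cast (by omega) i)) =
      (-1) ^ m * (A v * b (Matrix.vecCons x w)) := by
  induction hx using Submodule.span_induction with
  | mem x hx =>
    obtain ⟨i, rfl⟩ := hx
    have h1 := append_cast_eq_insertNth v w i
    have h2 := append_cons_eq_insertNth (v i) (fun j => v (i.succAbove j)) w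
    have h3 : v = i.insertNth (v i) (fun j => v (i.succAbove j)) := by
      rw [Fin.eq_insertNth_iff]; exact ⟨rfl, rfl⟩
    have h4 : wedge (contract (v i) (m + 1) A) b
        (Fin.append (fun j => v (i.succAbove j)) (Matrix.vecCons (v i) w)) =
        A (Matrix.vecCons (v i) fun j => v (i.succAbove j)) * b (Matrix.vecCons (v i) w) := by
      refine wedge_append _ _ _ _ (Or.inl ?_)
      rintro u ⟨k, l, hkl⟩
      change A (Matrix.vecCons (v i) u) = 0
      refine Fin.cases (fun hkl => ?_) (fun l hkl => ?_) l hkl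
      · refine A.map_eq_zero_of_eq _ (i := 0) (j := k.succ) ?_ (Fin.succ_ne_zero k).symm
        simpa using hkl.symm
      · exact hA _ ⟨k.succ, l, by simpa using hkl⟩
    replace h4 := (congrArg _ h2.symm).trans h4
    have h5 := ContinuousAlternatingMap.map_insertNth
      (n := m + q) (wedge (p := m) (q := q + 1) (contract (v i) (m + 1) A) b) ⟨m, by omega⟩ (v i)
      (Fin.append (fun j => v (i.succAbove j)) w)
    have h6 := ContinuousAlternatingMap.map_insertNth
      (n := m + q) (wedge (p := m) (q := q + 1) (contract (v i) (m + 1) A) b) ⟨i, by omega⟩ (v i)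
      (Fin.append (fun j => v (i.succAbove j)) w)
    have h7 := A.map_insertNth i (v i) (fun j => v (i.succAbove j))
    rw [← h3] at h7
    refine (congrArg _ h1).trans (h6.trans ?_)
    rw [h5] at h4
    rw [h7]
    simp only [zsmul_eq_mul, Int.cast_pow, Int.cast_neg, Int.cast_one] at h4 ⊢
    rcases neg_one_pow_eq_or ℝ m with hm | hm <;> rcases neg_one_pow_eq_or ℝ (i : ℕ) with hi | hi <;>
      rw [hm] at h4 ⊢ <;> rw [hi] <;> linarith
  | zero =>
    have : b (Matrix.vecCons (0 : E N) w) = 0 := b.map_coord_zero 0 rfl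
    have h2 : contract (0 : E N) (m + 1) A = 0 := by
      ext u; simp [contract]
    rw [this, h2, ← wedgeEval_apply, map_zero]
    simp
  | add x y _ _ hx hy =>
    have : b (Matrix.vecCons (x + y) w) = b (Matrix.vecCons x w) + b (Matrix.vecCons y w) :=
      b.toMultilinearMap.cons_add w x y
    have h2 : contract (x + y) (m + 1) A = contract x (m + 1) A + contract y (m + 1) A := by
      ext u; simp [contract]
    rw [this, h2, ← wedgeEval_apply, map_add, LinearMap.add_apply, wedgeEval_apply,
      wedgeEval_apply, hx, hy]
    ring
  | smul c x _ hx =>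
    have : b (Matrix.vecCons (c • x) w) = c * b (Matrix.vecCons x w) :=
      b.toMultilinearMap.cons_smul w c x
    have h2 : contract (c • x) (m + 1) A = c • contract x (m + 1) A := by
      ext u; simp [contract]
    rw [this, h2, wedge_smul_left, hx]
    ring

theorem alternating_append_congr {V : Type*} [AddCommGroup V] [Module ℝ V] {M p q : ℕ}
    (g : V [⋀^Fin M]→ₗ[ℝ] ℝ) (h : M = p + q) (v : Fin p → V) (w w' : Fin q → V)
    (hw : ∀ j, w' j - w j ∈ Submodule.span ℝ (range v)) :
    (g fun i => Fin.append v w' (Fin.cast h i)) = g fun i => Fin.append v w (Fin.cast h i) := by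
  subst h
  refine alternating_congr_span g (range (Fin.castAdd q)) _ _ ?_ ?_
  · rintro _ ⟨i, rfl⟩
    simp
  · intro j
    refine Fin.addCases (fun k hk => (hk ⟨k, rfl⟩).elim) (fun k _ => ?_) j
    have : ((fun i => Fin.append v w (Fin.cast rfl i)) '' range (Fin.castAdd q)) = range v := by
      rw [← range_comp]
      congr 1
      funext i
      simp
    rw [this]
    simpa using hw k

theorem contract_apply {N k : ℕ} (x : E N) (A : Cov N (k + 1)) (v : Fin k → E N) :
    contract x (k + 1) A v = A (Matrix.vecCons x v) := rfl

theorem contract_apply_add_smul {N k : ℕ} (x : E N) (A : Cov N (k + 1)) (v : Fin k → E N)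
    (c : Fin k → ℝ) :
    (contract x (k + 1) A fun i => v i + c i • x) = contract x (k + 1) A v := by
  refine alternating_congr_span A.toAlternatingMap {0} (Matrix.vecCons x v)
    (Matrix.vecCons x fun i => v i + c i • x) (by simp) ?_
  refine Fin.cases (by simp) (fun j _ => ?_)
  simp [Submodule.mem_span_singleton]

/-! ### Coordinates -/

theorem stdVec_apply {N : ℕ} (i j : Fin N) : stdVec N i j = if j = i then 1 else 0 := by
  simp [stdVec]

theorem sum_smul_stdVec {N : ℕ} (x : E N) : ∑ i, x i • stdVec N i = x := by
  ext j
  simp [stdVec_apply]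

theorem pair_add {n : ℕ} (x x' y y' : E n) : pair (x + x') (y + y') = pair x y + pair x' y' := by
  rw [← pair_pr (pair x y + pair x' y')]
  simp [pr1_pair, pr2_pair]

theorem pair_sub {n : ℕ} (x x' y y' : E n) : pair (x - x') (y - y') = pair x y - pair x' y' := by
  rw [← pair_pr (pair x y - pair x' y')]
  simp [pr1_pair, pr2_pair]

theorem pair_smul {n : ℕ} (c : ℝ) (x y : E n) : pair (c • x) (c • y) = c • pair x y := by
  rw [← pair_pr (c • pair x y)]
  simp [pr1_pair, pr2_pair]

theorem pair_smul_left {n : ℕ} (c : ℝ) (x : E n) : pair (c • x) 0 = c • pair x 0 := by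
  simpa using pair_smul c x 0

theorem pair_zero {n : ℕ} : pair (0 : E n) 0 = 0 := by
  simpa using pair_smul 0 (0 : E n) 0

theorem stdVec_castAdd {n : ℕ} (i : Fin n) : stdVec (n + n) (Fin.castAdd n i) =
    pair (stdVec n i) 0 := by
  rw [← pair_pr (stdVec (n + n) (Fin.castAdd n i))]
  congr 1 <;> ext j
  · rw [pr1_apply, stdVec_apply, stdVec_apply]; simp
  · rw [pr2_apply, stdVec_apply]
    simp [Fin.ext_iff]; omega

theorem stdVec_natAdd {n : ℕ} (i : Fin n) : stdVec (n + n) (Fin.natAdd n i) =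
    pair 0 (stdVec n i) := by
  rw [← pair_pr (stdVec (n + n) (Fin.natAdd n i))]
  congr 1 <;> ext j
  · rw [pr1_apply, stdVec_apply]
    simp [Fin.ext_iff]; omega
  · rw [pr2_apply, stdVec_apply, stdVec_apply]; simp

theorem pair_left_mem_span {n : ℕ} (x : E n) :
    pair x 0 ∈ Submodule.span ℝ (range fun j => pair (stdVec n j) 0) := by
  have : pair x 0 = ∑ i, x i • pair (stdVec n i) 0 := by
    conv_lhs => rw [← sum_smul_stdVec x]
    have : ∀ s : Finset (Fin n), pair (∑ i ∈ s, x i • stdVec n i) 0 =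
        ∑ i ∈ s, x i • pair (stdVec n i) 0 := by
      intro s
      induction s using Finset.induction_on with
      | empty => simpa using pair_zero
      | insert a s ha ih =>
        rw [Finset.sum_insert ha, Finset.sum_insert ha, ← ih, ← pair_smul_left, ← pair_add, add_zero]
    simpa using this Finset.univ
  rw [this]
  exact Submodule.sum_mem _ fun i _ => Submodule.smul_mem _ _ (Submodule.subset_span ⟨i, rfl⟩)

theorem diffMap_apply {n : ℕ} (z : E (n + n)) : diffMap n z = pr1 n z - pr2 n z := rfl

theorem diffMap_pair {n : ℕ} (x y : E n) : diffMap n (pair x y) = x - y := by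
  rw [diffMap_apply, pr1_pair, pr2_pair]

/-! ### The volume form and the radial form -/

/-- The volume form `dx_1 ∧ ⋯ ∧ dx_n`. -/
def volForm (n : ℕ) : Cov n n := wedgeOne (coord n)

theorem wedgeOne_apply {N p : ℕ} (φ : Fin p → (E N →L[ℝ] ℝ)) (v : Fin p → E N) :
    wedgeOne φ v = Matrix.det (Matrix.of fun i j => φ j (v i)) := rfl

theorem volForm_apply {n : ℕ} (v : Fin n → E n) : volForm n v = orientDet v := rfl

theorem volForm_stdVec (n : ℕ) : volForm n (stdVec n) = 1 := by
  rw [volForm_apply, orientDet]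
  convert Matrix.det_one (n := Fin n) (R := ℝ)
  ext i j
  simp [stdVec_apply, Matrix.one_apply, eq_comm]

theorem skipIdx_succ {m : ℕ} (i : Fin (m + 1)) (j : Fin m) : skipIdx i j = i.succAbove j := by
  have := Finset.orderEmbOfFin_unique' (s := Finset.univ.erase i) (k := m) (by simp)
    (f := i.succAboveOrderEmb) (by simp [Fin.succAbove_ne])
  rw [skipIdx]
  exact (DFunLike.congr_fun this j).symm

/-- This is the expansion of the determinant along its first row. -/
theorem radialForm_eq_contract {m : ℕ} (x : E (m + 1)) :
    radialForm (m + 1) x = contract x (m + 1) (volForm (m + 1)) := by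
  ext v
  change _ = volForm (m + 1) (Matrix.vecCons x v)
  rw [volForm_apply, orientDet, Matrix.det_succ_row_zero, radialForm]
  rw [ContinuousAlternatingMap.sum_apply]
  refine Finset.sum_congr rfl fun i _ => ?_
  rw [ContinuousAlternatingMap.smul_apply, wedgeOne_apply, smul_eq_mul]
  congr 2
  ext k l
  exact congrArg (v k) (skipIdx_succ i l)

theorem pointForm_eq {m : ℕ} (x : E (m + 1)) : pointForm (m + 1) x =
    ((sphereArea (m + 1))⁻¹ * (‖x‖ ^ (m + 1))⁻¹) • contract x (m + 1) (volForm (m + 1)) := by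
  rw [pointForm, radialForm_eq_contract]

theorem diagForm_eq {n : ℕ} (z : E (n + n)) :
    diagForm n z = (pointForm n (diffMap n z)).compContinuousLinearMap (diffMap n) := by
  ext v
  rw [diagForm, pointForm, radialForm, diffMap_apply]
  simp only [ContinuousAlternatingMap.smul_apply, ContinuousAlternatingMap.sum_apply,
    ContinuousAlternatingMap.compContinuousLinearMap_apply]
  rfl

/-- The pull-back of the volume form under `(x, y) ↦ x - c y`. -/
def mixForm (n : ℕ) (c : ℝ) : Cov (n + n) n :=
  (volForm n).compContinuousLinearMap (pr1 n - c • pr2 n)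

theorem mixForm_apply {n : ℕ} (c : ℝ) (v : Fin n → E (n + n)) :
    mixForm n c v = volForm n fun i => pr1 n (v i) - c • pr2 n (v i) := rfl

theorem mixForm_eq_zero {n : ℕ} (c : ℝ) (v : Fin n → E (n + n)) (i : Fin n)
    (h : pr1 n (v i) = c • pr2 n (v i)) : mixForm n c v = 0 := by
  rw [mixForm_apply]
  exact (volForm n).map_coord_zero i (by simp [h])

theorem mixForm_fst (n : ℕ) (c : ℝ) : (mixForm n c fun i => pair (stdVec n i) 0) = 1 := by
  rw [mixForm_apply, ← volForm_stdVec n]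
  congr 1
  funext i
  simp [pr1_pair, pr2_pair]

/-- The map (x, y) ↦ x - c y takes the same value at (0, y) and at (-c y, 0), so vectors of the
second factor can be traded for vectors of the first. -/
theorem contract_mixForm {m : ℕ} (c : ℝ) (y : E (m + 1)) :
    contract (pair 0 y) (m + 1) (mixForm (m + 1) c) =
      -c • contract (pair y 0) (m + 1) (mixForm (m + 1) c) := by
  ext v
  rw [ContinuousAlternatingMap.smul_apply, contract_apply, contract_apply, mixForm_apply,
    mixForm_apply]
  have h1 : ∀ x : E (m + 1 + (m + 1)), (fun i => pr1 (m + 1) (Matrix.vecCons x v i) -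
      c • pr2 (m + 1) (Matrix.vecCons x v i)) = Matrix.vecCons (pr1 (m + 1) x - c • pr2 (m + 1) x)
      (fun i => pr1 (m + 1) (v i) - c • pr2 (m + 1) (v i)) := by
    intro x
    funext i
    refine Fin.cases ?_ (fun i => ?_) i <;> simp
  refine (congrArg (volForm (m + 1)) (h1 _)).trans
    (Eq.trans ?_ (congrArg (fun u => -c • volForm (m + 1) u) (h1 _)).symm)
  rw [pr1_pair, pr2_pair, pr1_pair, pr2_pair]
  simp only [zero_sub, smul_zero, sub_zero]
  rw [← neg_smul]
  exact (volForm (m + 1)).toMultilinearMap.cons_smul _ (-c) y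

theorem mixForm_one (n : ℕ) : mixForm n 1 = (volForm n).compContinuousLinearMap (diffMap n) := by
  rw [mixForm, one_smul]
  rfl

theorem contract_mixForm_one {m : ℕ} (z : E (m + 1 + (m + 1))) :
    contract z (m + 1) (mixForm (m + 1) 1) =
      (contract (diffMap (m + 1) z) (m + 1) (volForm (m + 1))).compContinuousLinearMap
        (diffMap (m + 1)) := by
  ext v
  rw [ContinuousAlternatingMap.compContinuousLinearMap_apply, contract_apply, contract_apply,
    mixForm_one, ContinuousAlternatingMap.compContinuousLinearMap_apply]
  congr 1
  funext i
  refine Fin.cases ?_ (fun i => ?_) i <;> simp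

theorem diagForm_eq_contract {m : ℕ} (z : E (m + 1 + (m + 1))) :
    diagForm (m + 1) z =
      ((sphereArea (m + 1))⁻¹ * (‖diffMap (m + 1) z‖ ^ (m + 1))⁻¹) •
        contract (pair (diffMap (m + 1) z) 0) (m + 1) (mixForm (m + 1) 1) := by
  rw [diagForm_eq, pointForm_eq, contract_mixForm_one, diffMap_pair, sub_zero]
  rfl

theorem compContinuousLinearMap_pr1_pair {n k : ℕ} (θ : Cov n k) (c : ℝ) (w : Fin k → E n) :
    (θ.compContinuousLinearMap (pr1 n) fun j => pair (c • w j) (w j)) = c ^ k * θ w := by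
  have := θ.toMultilinearMap.map_smul_univ (fun _ => c) w
  simp only [Finset.prod_const, Finset.card_univ, Fintype.card_fin] at this
  rw [ContinuousAlternatingMap.compContinuousLinearMap_apply, ← smul_eq_mul]
  refine Eq.trans ?_ this
  simp only [Function.comp_def, pr1_pair]
  rfl

theorem pair_shear_mem {n k : ℕ} (c : ℝ) (w : Fin k → E n) (j : Fin k) :
    pair (c • w j) (w j) - pair 0 (w j) ∈
      Submodule.span ℝ (range fun j => pair (stdVec n j) 0) := by
  rw [← pair_sub, sub_self, sub_zero]
  exact pair_left_mem_span _

/-- Adding first-factor vectors to the second block does not change the value, so (0, w j) may be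
replaced by (c w j, w j). These lie in the kernel of x - c y, hence are annihilated by `mixForm n
c`, and all of them must go into the other factor. -/
theorem wedge_mixForm {n k : ℕ} (c : ℝ) (θ : Cov n k) (w : Fin k → E n) :
    wedge (mixForm n c) (θ.compContinuousLinearMap (pr1 n))
      (Fin.append (fun j => pair (stdVec n j) 0) fun j => pair 0 (w j)) = c ^ k * θ w := by
  have h1 := alternating_append_congr (wedge (mixForm n c)
    (θ.compContinuousLinearMap (pr1 n))).toAlternatingMap rfl
    (fun j => pair (stdVec n j) 0) (fun j => pair 0 (w j)) (fun j => pair (c • w j) (w j))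
    (pair_shear_mem c w)
  refine h1.symm.trans ((wedge_append _ _ _ _ (Or.inl ?_)).trans ?_)
  · rintro u ⟨i, j, hij⟩
    exact mixForm_eq_zero c u i (by rw [hij, pr1_pair, pr2_pair])
  · rw [mixForm_fst, one_mul, compContinuousLinearMap_pr1_pair]

theorem wedge_contract_mixForm {m q : ℕ} (c : ℝ) (x : E (m + 1))
    (b : Cov (m + 1 + (m + 1)) (q + 1)) (w : Fin q → E (m + 1)) :
    wedge (contract (pair x 0) (m + 1) (mixForm (m + 1) c)) b
      (fun i : Fin (m + (q + 1)) => Fin.append (fun j => pair (stdVec (m + 1) j) 0)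
        (fun j => pair 0 (w j)) (Fin.cast (by omega) i)) =
      (-1) ^ m * b (Matrix.vecCons (pair x 0) fun j => pair (c • w j) (w j)) := by
  have h1 := alternating_append_congr
    (wedge (contract (pair x 0) (m + 1) (mixForm (m + 1) c)) b).toAlternatingMap
    (by omega : m + (q + 1) = m + 1 + q)
    (fun j => pair (stdVec (m + 1) j) 0) (fun j => pair 0 (w j)) (fun j => pair (c • w j) (w j))
    (pair_shear_mem c w)
  refine h1.symm.trans ((wedge_contract_append _ _ _ _ _ (pair_left_mem_span x) ?_).trans ?_)
  · rintro u ⟨i, j, hij⟩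
    exact mixForm_eq_zero c u i (by rw [hij, pr1_pair, pr2_pair])
  · rw [mixForm_fst, one_mul]

/-- The shear with c = 1 turns the second half of the standard basis of ℝ^{2n} into the oriented
basis of the diagonal. Thus wedging with `diagForm` only sees the test form on the difference vector
followed by that basis. -/
theorem topWedge_diagForm {m : ℕ} (h : m + (m + 1 + 1) = m + 1 + (m + 1))
    (z : E (m + 1 + (m + 1))) (b : Cov (m + 1 + (m + 1)) (m + 1 + 1)) :
    topWedge h (diagForm (m + 1) z) b =
      (-1) ^ m * ((sphereArea (m + 1))⁻¹ * (‖diffMap (m + 1) z‖ ^ (m + 1))⁻¹) *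
        b (Matrix.vecCons (pair (diffMap (m + 1) z) 0) fun j => diagEmb (m + 1) (stdVec _ j)) := by
  have h1 := wedge_contract_mixForm 1 (diffMap (m + 1) z) b (stdVec (m + 1))
  have h2 : (fun i : Fin (m + (m + 1 + 1)) => stdVec (m + 1 + (m + 1)) (Fin.cast h i)) =
      fun i => Fin.append (fun j => pair (stdVec (m + 1) j) 0)
        (fun j => pair 0 (stdVec (m + 1) j)) (Fin.cast h i) := by
    funext i
    generalize Fin.cast h i = k
    refine Fin.addCases (fun k => ?_) (fun k => ?_) k
    · rw [Fin.append_left, stdVec_castAdd]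
    · rw [Fin.append_right, stdVec_natAdd]
  rw [topWedge, diagForm_eq_contract, h2, wedge_smul_left]
  refine (congrArg _ h1).trans ?_
  simp only [one_smul]
  rw [← mul_assoc, mul_comm _ ((-1 : ℝ) ^ m)]
  rfl

theorem topWedge_pointForm {m : ℕ} (h : m + 1 = m + 1) (x : E (m + 1)) (b : Cov (m + 1) 1) :
    topWedge h (pointForm (m + 1) x) b =
      (-1) ^ m * ((sphereArea (m + 1))⁻¹ * (‖x‖ ^ (m + 1))⁻¹) * b ![x] := by
  have h1 := wedge_contract_append (volForm (m + 1)) b (stdVec (m + 1)) ![] x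
    (by
      rw [← sum_smul_stdVec x]
      exact Submodule.sum_mem _ fun i _ => Submodule.smul_mem _ _ (Submodule.subset_span ⟨i, rfl⟩))
    (by rintro u ⟨i, j, _⟩; exact j.elim0)
  have h2 : (fun i : Fin (m + 1) => stdVec (m + 1) (Fin.cast h i)) =
      fun i : Fin (m + (0 + 1)) => Fin.append (stdVec (m + 1)) ![] (Fin.cast (by omega) i) := by
    funext i
    exact (Fin.append_left (stdVec (m + 1)) ![] i).symm
  rw [topWedge, pointForm_eq, h2, wedge_smul_left]
  refine (congrArg _ h1).trans ?_
  rw [volForm_stdVec]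
  ring

/-! ### The measure on a product -/

theorem norm_pair_sq {n : ℕ} (x y : E n) : ‖pair x y‖ ^ 2 = ‖x‖ ^ 2 + ‖y‖ ^ 2 := by
  simp only [EuclideanSpace.norm_sq_eq, pair, Fin.sum_univ_add, Fin.append_left, Fin.append_right]

/-- The isometry `(x, y) ↦ pair x y`. -/
def pairIsometry (n : ℕ) : WithLp 2 (E n × E n) ≃ₗᵢ[ℝ] E (n + n) where
  toFun p := pair p.fst p.snd
  invFun z := WithLp.toLp 2 (pr1 n z, pr2 n z)
  map_add' p q := by simp [pair_add]
  map_smul' c p := by simp [pair_smul]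
  left_inv p := by simp only [pr1_pair, pr2_pair]; rfl
  right_inv z := by simp [pair_pr]
  norm_map' p := by
    have h : ‖pair p.fst p.snd‖ ^ 2 = ‖p‖ ^ 2 := by
      rw [norm_pair_sq, WithLp.prod_norm_sq_eq_of_L2]
    exact (pow_left_inj₀ (norm_nonneg _) (norm_nonneg _) two_ne_zero).1 h

theorem measurePreserving_pair (n : ℕ) :
    MeasurePreserving (fun p : E n × E n => pair p.1 p.2) :=
  (pairIsometry n).measurePreserving.comp (WithLp.volume_preserving_toLp (E n) (E n))

/-- The linear coordinates `(u, y) ↦ (u + y, y)`. -/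
def shear (n : ℕ) (p : E n × E n) : E (n + n) := pair (p.1 + p.2) p.2

theorem measurePreserving_shear (n : ℕ) : MeasurePreserving (shear n) :=
  (measurePreserving_pair n).comp (measurePreserving_add_prod volume volume)

theorem continuous_shear (n : ℕ) : Continuous (shear n) :=
  (continuous_pair n).comp (by fun_prop : Continuous fun p : E n × E n => (p.1 + p.2, p.2))

/-- The homeomorphism `(u, y) ↦ (u + y, y)`. -/
def shearHomeomorph (n : ℕ) : E n × E n ≃ₜ E (n + n) where
  toFun := shear n
  invFun z := (diffMap n z, pr2 n z)
  left_inv p := by simp [shear, diffMap_pair, pr2_pair]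
  right_inv z := by simp [shear, diffMap_apply, pair_pr]
  continuous_toFun := continuous_shear n
  continuous_invFun := by fun_prop

theorem measurableEmbedding_shear (n : ℕ) : MeasurableEmbedding (shear n) :=
  (shearHomeomorph n).measurableEmbedding

theorem diffMap_shear {n : ℕ} (p : E n × E n) : diffMap n (shear n p) = p.1 := by
  simp [shear, diffMap_pair]

theorem integral_shear {n : ℕ} {F : Type*} [NormedAddCommGroup F] [NormedSpace ℝ F]
    {f : E (n + n) → F} (hf : Integrable f) :
    ∫ z, f z = ∫ y : E n, ∫ u : E n, f (shear n (u, y)) := by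
  rw [← (measurePreserving_shear n).integral_comp (measurableEmbedding_shear n)]
  exact integral_prod_symm _
    (((measurePreserving_shear n).integrable_comp_emb (measurableEmbedding_shear n)).2 hf)

/-- In the coordinates (u, y) the function does not involve y, and a compact set is contained in the
product of its two compact projections. -/
theorem locallyIntegrable_comp_diffMap {n : ℕ} {F : Type*} [NormedAddCommGroup F] [NormedSpace ℝ F]
    {f : E n → F} (hf : LocallyIntegrable f) :
    LocallyIntegrable fun z : E (n + n) => f (diffMap n z) := by
  rw [locallyIntegrable_iff]
  intro K hK
  have h1 : IntegrableOn (fun p : E n × E n => f p.1)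
      ((Prod.fst '' (shear n ⁻¹' K)) ×ˢ (Prod.snd '' (shear n ⁻¹' K))) := by
    have hc : IsCompact (shear n ⁻¹' K) := (shearHomeomorph n).isCompact_preimage.2 hK
    have h2 := hf.integrableOn_isCompact (hc.image continuous_fst)
    have h3 : IntegrableOn (fun _ : E n => (1 : ℝ)) (Prod.snd '' (shear n ⁻¹' K)) :=
      integrableOn_const (hc.image continuous_snd).measure_lt_top.ne
    have h4 := Integrable.smul_prod (R := ℝ) h3 h2
    rw [IntegrableOn, Measure.volume_eq_prod, ← Measure.prod_restrict]
    have h5 := h4.swap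
    simpa [Function.comp_def] using h5
  have h2 : IntegrableOn (fun p : E n × E n => f p.1) (shear n ⁻¹' K) :=
    h1.mono_set fun p hp => ⟨⟨p, hp, rfl⟩, ⟨p, hp, rfl⟩⟩
  rw [← (measurePreserving_shear n).integrableOn_comp_preimage (measurableEmbedding_shear n)]
  simpa [Function.comp_def, diffMap_shear] using h2

theorem ae_diffMap_ne_zero {n : ℕ} (hn : 0 < n) : ∀ᵐ z : E (n + n), diffMap n z ≠ 0 := by
  have : Nonempty (Fin n) := ⟨⟨0, hn⟩⟩
  have h : ∀ᵐ p : E n × E n, p.1 ≠ 0 := by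
    have := (Measure.quasiMeasurePreserving_fst (μ := (volume : Measure (E n)))
      (ν := (volume : Measure (E n)))).ae (Measure.ae_ne volume (0 : E n))
    exact this
  rw [← (measurePreserving_shear n).map_eq, (measurableEmbedding_shear n).ae_map_iff]
  simpa [diffMap_shear] using h

/-! ### Radial integrals -/

theorem nontrivial_E {n : ℕ} (hn : 0 < n) : Nontrivial (E n) := by
  have : Nonempty (Fin n) := ⟨⟨0, hn⟩⟩
  infer_instance

theorem sphereArea_eq (n : ℕ) :
    sphereArea n = n * (volume : Measure (E n)).real (Metric.ball 0 1) := by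
  rw [sphereArea, Measure.real, Measure.toSphere_apply_univ, ENNReal.toReal_mul]
  simp [Measure.real]

theorem sphereArea_pos {n : ℕ} (hn : 0 < n) : 0 < sphereArea n := by
  rw [sphereArea_eq]
  have : 0 < (volume : Measure (E n)).real (Metric.ball 0 1) :=
    ENNReal.toReal_pos (Metric.measure_ball_pos _ _ one_pos).ne' measure_ball_lt_top.ne
  positivity

theorem integral_radial {n : ℕ} (hn : 0 < n) (f : ℝ → ℝ) :
    ∫ x : E n, f ‖x‖ = sphereArea n * ∫ r in Ioi (0 : ℝ), r ^ (n - 1) * f r := by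
  have := nontrivial_E hn
  rw [integral_fun_norm_addHaar volume f, sphereArea_eq]
  simp [mul_assoc]

theorem integrable_radial {n : ℕ} (hn : 0 < n) (f : ℝ → ℝ) :
    Integrable (fun x : E n => f ‖x‖) ↔ IntegrableOn (fun r => r ^ (n - 1) * f r) (Ioi (0 : ℝ)) := by
  have := nontrivial_E hn
  rw [integrable_fun_norm_addHaar volume]
  simp

/-- In polar coordinates the integrand on a ball is r^(n-1-k), which is bounded because k < n. -/
theorem locallyIntegrable_norm_pow_inv {n k : ℕ} (hk : k < n) :
    LocallyIntegrable fun x : E n => (‖x‖ ^ k)⁻¹ := by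
  have hball : ∀ R : ℝ, 0 < R → IntegrableOn (fun x : E n => (‖x‖ ^ k)⁻¹) (Metric.ball 0 R) := by
    intro R hR
    rw [← integrable_indicator_iff Metric.isOpen_ball.measurableSet]
    have h1 : (Metric.ball (0 : E n) R).indicator (fun x => (‖x‖ ^ k)⁻¹) =
        fun x => (Iio R).indicator (fun r => (r ^ k)⁻¹) ‖x‖ := by
      funext x
      simp [indicator]
    rw [h1, integrable_radial (by omega)]
    have h2 : IntegrableOn (fun _ : ℝ => R ^ (n - 1 - k)) (Ioc 0 R) :=
      integrableOn_const measure_Ioc_lt_top.ne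
    have h3 : Integrable ((Ioc 0 R).indicator fun _ : ℝ => R ^ (n - 1 - k)) :=
      (integrable_indicator_iff measurableSet_Ioc).2 h2
    refine h3.integrableOn.mono' ?_ ?_
    · refine (Measurable.mul (by fun_prop) ?_).aestronglyMeasurable
      exact Measurable.indicator (by fun_prop) measurableSet_Iio
    · refine (ae_restrict_iff' measurableSet_Ioi).2 (ae_of_all _ fun r hr => ?_)
      have hr : 0 < r := hr
      by_cases hrR : r < R
      · have h4 : r ^ (n - 1) * (r ^ k)⁻¹ = r ^ (n - 1 - k) := by
          rw [pow_sub₀ r hr.ne' (show k ≤ n - 1 by omega)]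
        simp only [indicator, mem_Iio, hrR, if_true, mem_Ioc, hr, hrR.le, and_self, h4]
        rw [Real.norm_of_nonneg (by positivity)]
        exact pow_le_pow_left₀ hr.le hrR.le _
      · simp only [indicator, mem_Iio, hrR, if_false, mul_zero, norm_zero]
        split_ifs <;> positivity
  intro x
  refine ⟨Metric.ball 0 (‖x‖ + 1), Metric.isOpen_ball.mem_nhds (by simp), ?_⟩
  exact hball _ (by positivity)

/-! ### The regularized norm -/

/-- The regularized norm `√(|x|² + ε²)`. -/
def reg {V : Type*} [NormedAddCommGroup V] (ε : ℝ) (x : V) : ℝ := √(‖x‖ ^ 2 + ε ^ 2)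

section Reg

variable {V : Type*} [NormedAddCommGroup V]

theorem reg_sq (ε : ℝ) (x : V) : reg ε x ^ 2 = ‖x‖ ^ 2 + ε ^ 2 := Real.sq_sqrt (by positivity)

theorem norm_le_reg (ε : ℝ) (x : V) : ‖x‖ ≤ reg ε x :=
  Real.le_sqrt_of_sq_le (by nlinarith [sq_nonneg ε])

theorem reg_pos {ε : ℝ} (hε : 0 < ε) (x : V) : 0 < reg ε x := Real.sqrt_pos.2 (by positivity)

theorem reg_nonneg (ε : ℝ) (x : V) : 0 ≤ reg ε x := Real.sqrt_nonneg _

theorem reg_zero_left (x : V) : reg 0 x = ‖x‖ := by simp [reg]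

theorem reg_pow_inv_le {x : V} (hx : x ≠ 0) (ε : ℝ) (k : ℕ) :
    (reg ε x ^ k)⁻¹ ≤ (‖x‖ ^ k)⁻¹ := by
  have := norm_pos_iff.2 hx
  gcongr
  exact norm_le_reg ε x

theorem tendsto_reg_pow_inv {x : V} (hx : x ≠ 0) (k : ℕ) :
    Tendsto (fun ε : ℝ => (reg ε x ^ k)⁻¹) (𝓝[>] 0) (𝓝 (‖x‖ ^ k)⁻¹) := by
  have h : Continuous fun ε : ℝ => reg ε x := by unfold reg; fun_prop
  have h2 := h.tendsto 0
  rw [reg_zero_left] at h2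
  exact ((h2.mono_left nhdsWithin_le_nhds).pow k).inv₀ (pow_ne_zero _ (norm_ne_zero_iff.2 hx))

theorem reg_smul [NormedSpace ℝ V] {a : ℝ} (ha : 0 < a) (x : V) :
    reg a (a • x) = a * reg 1 x := by
  rw [reg, reg, norm_smul, Real.norm_of_nonneg ha.le]
  have : (a * ‖x‖) ^ 2 + a ^ 2 = a ^ 2 * (‖x‖ ^ 2 + 1 ^ 2) := by ring
  rw [this, Real.sqrt_mul (by positivity), Real.sqrt_sq ha.le]

end Reg

theorem hasFDerivAt_reg_pow_inv {V : Type*} [NormedAddCommGroup V] [InnerProductSpace ℝ V] {ε : ℝ}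
    (hε : 0 < ε) (k : ℕ) (x : V) :
    HasFDerivAt (fun x : V => (reg ε x ^ k)⁻¹) ((-k * (reg ε x ^ (k + 2))⁻¹) • innerSL ℝ x) x := by
  have h1 : HasFDerivAt (fun x : V => ‖x‖ ^ 2 + ε ^ 2) (2 • innerSL ℝ x) x :=
    (hasStrictFDerivAt_norm_sq x).hasFDerivAt.add_const _
  have hr := reg_pos hε x
  have h2 : HasDerivAt (fun s : ℝ => (√s ^ k)⁻¹)
      (-(k * √(‖x‖ ^ 2 + ε ^ 2) ^ (k - 1) * (1 / (2 * √(‖x‖ ^ 2 + ε ^ 2)))) /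
        (√(‖x‖ ^ 2 + ε ^ 2) ^ k) ^ 2) (‖x‖ ^ 2 + ε ^ 2) :=
    ((Real.hasDerivAt_sqrt (by positivity)).pow k).inv (pow_ne_zero _ hr.ne')
  refine (h2.comp_hasFDerivAt x h1).congr_fderiv ?_
  change (-(k * reg ε x ^ (k - 1) * (1 / (2 * reg ε x))) / (reg ε x ^ k) ^ 2) • _ = _
  ext v
  rcases k with _ | k
  · simp
  · simp only [_root_.smul_apply, smul_eq_mul, nsmul_eq_mul, Nat.add_sub_cancel]
    push_cast
    field_simp
    ring

/-- Substituting r² = `reg 1 r ^ 2` - 1 in the product rule leaves only radial integrands of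
`bracketIntegral` with exponents k and k + 2. Integration over the half line then gives a recursion
in k. -/
theorem hasDerivAt_pow_mul_reg (n k : ℕ) (hn : 0 < n) (r : ℝ) :
    HasDerivAt (fun r : ℝ => r ^ n * (reg 1 r ^ k)⁻¹)
      ((n - k : ℝ) * (r ^ (n - 1) * (reg 1 r ^ k)⁻¹) +
        k * (r ^ (n - 1) * (reg 1 r ^ (k + 2))⁻¹)) r := by
  have h1 := (hasFDerivAt_reg_pow_inv one_pos k r).hasDerivAt
  refine ((hasDerivAt_pow n r).mul h1).congr_deriv ?_
  have hr := reg_pos one_pos r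
  have h2 : r ^ n = r ^ (n - 1) * r := by rw [← pow_succ, Nat.sub_add_cancel hn]
  have h3 := reg_sq 1 r
  rw [Real.norm_eq_abs, sq_abs] at h3
  have h4 : (reg 1 r ^ k)⁻¹ = reg 1 r ^ 2 * (reg 1 r ^ (k + 2))⁻¹ := by
    rw [pow_add]; field_simp
  rw [h2, h4, h3]
  simp
  ring

/-- `∫ (1 + |x|²)^{-k/2}` over `ℝ^n`. -/
def bracketIntegral (n k : ℕ) : ℝ := ∫ x : E n, (reg 1 x ^ k)⁻¹

theorem integrable_bracket {n k : ℕ} (hk : n < k) :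
    Integrable fun x : E n => (reg 1 x ^ k)⁻¹ := by
  have h := integrable_rpow_neg_one_add_norm_sq (E := E n) (μ := volume) (r := k) (by simpa using hk)
  refine h.congr (ae_of_all _ fun x => ?_)
  have h1 : reg 1 x ^ k = (1 + ‖x‖ ^ 2) ^ ((k : ℝ) / 2) := by
    rw [reg, Real.sqrt_eq_rpow, ← Real.rpow_natCast, ← Real.rpow_mul (by positivity)]
    congr 1 <;> ring
  simp only
  rw [h1, ← Real.rpow_neg (by positivity)]
  congr 1
  ring

theorem reg_norm {V : Type*} [NormedAddCommGroup V] (ε : ℝ) (x : V) : reg ε ‖x‖ = reg ε x := by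
  simp [reg]

theorem bracketIntegral_eq {n : ℕ} (hn : 0 < n) (k : ℕ) :
    bracketIntegral n k = sphereArea n * ∫ r in Ioi (0 : ℝ), r ^ (n - 1) * (reg 1 r ^ k)⁻¹ := by
  rw [← integral_radial hn fun r => (reg 1 r ^ k)⁻¹]
  simp [bracketIntegral, reg_norm]

theorem integrableOn_bracket {n k : ℕ} (hn : 0 < n) (hk : n < k) :
    IntegrableOn (fun r => r ^ (n - 1) * (reg 1 r ^ k)⁻¹) (Ioi (0 : ℝ)) := by
  rw [← integrable_radial hn fun r => (reg 1 r ^ k)⁻¹]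
  simpa [reg_norm] using integrable_bracket hk

theorem tendsto_div_reg : Tendsto (fun r : ℝ => r * (reg 1 r)⁻¹) atTop (𝓝 1) := by
  have h1 : Tendsto (fun r : ℝ => (√(1 + (r⁻¹) ^ 2))⁻¹) atTop (𝓝 (√(1 + 0 ^ 2))⁻¹) := by
    refine Tendsto.inv₀ (Tendsto.sqrt ?_) (by simp)
    exact (tendsto_inv_atTop_zero.pow 2).const_add 1
  simp only [ne_eq, OfNat.ofNat_ne_zero, not_false_eq_true, zero_pow, add_zero, Real.sqrt_one,
    inv_one] at h1
  refine h1.congr' ?_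
  filter_upwards [eventually_gt_atTop 0] with r hr
  have : ‖r‖ ^ 2 + 1 ^ 2 = r ^ 2 * (1 + r⁻¹ ^ 2) := by
    rw [Real.norm_eq_abs, sq_abs]; field_simp
  rw [reg, this, Real.sqrt_mul (by positivity), Real.sqrt_sq hr.le]
  field_simp

theorem tendsto_inv_reg : Tendsto (fun r : ℝ => (reg 1 r)⁻¹) atTop (𝓝 0) := by
  refine Tendsto.inv_tendsto_atTop (tendsto_atTop_mono (fun r => ?_) tendsto_id)
  exact (le_abs_self r).trans (norm_le_reg 1 r)

theorem bracketIntegral_add_two {n k : ℕ} (hn : 0 < n) (hk : n < k) :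
    k * bracketIntegral n (k + 2) = (k - n : ℝ) * bracketIntegral n k := by
  have h1 := integral_Ioi_of_hasDerivAt_of_tendsto' (a := 0) (m := 0)
    (fun r _ => hasDerivAt_pow_mul_reg n k hn r)
    (((integrableOn_bracket hn hk).const_mul _).add
      ((integrableOn_bracket hn (by omega : n < k + 2)).const_mul _)) (by
      have h2 := (tendsto_div_reg.pow n).mul (tendsto_inv_reg.pow (k - n))
      rw [one_pow, zero_pow (by omega), mul_zero] at h2
      refine h2.congr fun r => ?_
      rw [mul_pow, mul_assoc, ← pow_add, Nat.add_sub_cancel' hk.le, inv_pow])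
  rw [integral_add ((integrableOn_bracket hn hk).const_mul _)
    ((integrableOn_bracket hn (by omega : n < k + 2)).const_mul _), integral_const_mul,
    integral_const_mul, zero_pow hn.ne'] at h1
  rw [bracketIntegral_eq hn, bracketIntegral_eq hn]
  linear_combination sphereArea n * h1

/-- This is the borderline case k = n of the recursion: the term with exponent n drops out, and the
boundary value at infinity is 1 instead of 0. -/
theorem bracketIntegral_self {n : ℕ} (hn : 0 < n) :
    n * bracketIntegral n (n + 2) = sphereArea n := by
  have h1 := integral_Ioi_of_hasDerivAt_of_tendsto' (a := 0) (m := 1)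
    (f' := fun r => n * (r ^ (n - 1) * (reg 1 r ^ (n + 2))⁻¹))
    (fun r _ => by simpa using hasDerivAt_pow_mul_reg n n hn r)
    ((integrableOn_bracket hn (by omega : n < n + 2)).const_mul _) (by
      have h2 := tendsto_div_reg.pow n
      rw [one_pow] at h2
      refine h2.congr fun r => ?_
      rw [mul_pow, inv_pow])
  rw [integral_const_mul, zero_pow hn.ne'] at h1
  rw [bracketIntegral_eq hn]
  linear_combination sphereArea n * h1

theorem integral_reg_pow_inv {n : ℕ} {a : ℝ} (ha : 0 < a) (k : ℕ) :
    ∫ x : E n, (reg a x ^ k)⁻¹ = a ^ n * (a ^ k)⁻¹ * bracketIntegral n k := by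
  have h := Measure.integral_comp_smul (volume : Measure (E n)) (fun x => (reg a x ^ k)⁻¹) a
  simp only [reg_smul ha, mul_pow, mul_inv, integral_const_mul, finrank_euclideanSpace,
    Fintype.card_fin, abs_of_pos (inv_pos.2 (pow_pos ha n)), smul_eq_mul] at h
  rw [bracketIntegral, mul_assoc, h, ← mul_assoc, mul_inv_cancel₀ (pow_pos ha n).ne', one_mul]

theorem reg_pair {n : ℕ} (x y : E n) : reg 1 (pair x y) = reg (reg 1 y) x := by
  rw [reg, reg, reg_sq, norm_pair_sq]
  congr 1
  ring

/-- By Fubini on ℝ^n × ℝ^n, the inner integral is a rescaled `bracketIntegral` with scale (1 +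
|y|²)^{1/2}, which leaves the exponent n + 2 for the outer one. `bracketIntegral_self` evaluates the
whole in dimension 2n and the outer integral in dimension n. -/
theorem bracketIntegral_double {n : ℕ} (hn : 0 < n) :
    2 * sphereArea n * bracketIntegral n (n + n + 2) = sphereArea (n + n) := by
  have h1 := bracketIntegral_self (n := n + n) (by omega)
  have hint : Integrable fun z : E (n + n) => (reg 1 z ^ (n + n + 2))⁻¹ :=
    integrable_bracket (by omega)
  have hm : MeasurableEmbedding (fun p : E n × E n => pair p.1 p.2) :=
    (pairIsometry n).toHomeomorph.measurableEmbedding.comp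
      (MeasurableEquiv.toLp 2 (E n × E n)).measurableEmbedding
  have h2 : bracketIntegral (n + n) (n + n + 2) =
      ∫ y : E n, ∫ x : E n, (reg 1 (pair x y) ^ (n + n + 2))⁻¹ := by
    rw [bracketIntegral, ← (measurePreserving_pair n).integral_comp hm]
    exact integral_prod_symm _ (((measurePreserving_pair n).integrable_comp_emb hm).2 hint)
  simp only [reg_pair, integral_reg_pow_inv (reg_pos one_pos _), integral_mul_const] at h2
  have h3 : ∀ y : E n, reg 1 y ^ n * (reg 1 y ^ (n + n + 2))⁻¹ = (reg 1 y ^ (n + 2))⁻¹ := by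
    intro y
    have := reg_pos one_pos y
    rw [add_assoc, pow_add (reg 1 y) n (n + 2), mul_inv, ← mul_assoc, mul_inv_cancel₀ (by positivity),
      one_mul]
  simp only [h3] at h2
  have h4 := bracketIntegral_self hn
  rw [bracketIntegral] at h4
  rw [← h1, h2, ← h4]
  push_cast
  ring

/-- The recursion descends from the exponent 2n + 2 over 2n to 2n - 2; the last exponent exceeds n
exactly when n ≥ 3. The identity compares the normalizing constants of the Newton kernels of ℝ^n and
ℝ^{2n}. -/
theorem bracketIntegral_green {n : ℕ} (hn : 3 ≤ n) :
    ((n : ℝ) - 2) * sphereArea n * bracketIntegral n (n + n - 2) =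
      ((n + n : ℕ) - 2 : ℝ) * sphereArea (n + n) := by
  obtain ⟨m, rfl⟩ : ∃ m, n = m + 3 := ⟨n - 3, by omega⟩
  have h1 := bracketIntegral_double (n := m + 3) (by omega)
  have h2 := bracketIntegral_add_two (n := m + 3) (k := m + 3 + (m + 3)) (by omega) (by omega)
  have h3 := bracketIntegral_add_two (n := m + 3) (k := m + 3 + (m + 3) - 2) (by omega) (by omega)
  have h4 : m + 3 + (m + 3) - 2 + 2 = m + 3 + (m + 3) := by omega
  have h5 : ((m + 3 + (m + 3) - 2 : ℕ) : ℝ) = 2 * m + 4 := by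
    rw [Nat.cast_sub (by omega)]; push_cast; ring
  rw [h4, h5] at h3
  rw [← h1]
  push_cast at h2 h3 ⊢
  have h6 : bracketIntegral (m + 3) (m + 3 + (m + 3)) =
      2 * bracketIntegral (m + 3) (m + 3 + (m + 3) + 2) := by
    have : (0 : ℝ) < m + 3 := by positivity
    apply mul_left_cancel₀ this.ne'
    linear_combination -h2
  rw [h6] at h3
  linear_combination -(sphereArea (m + 3)) * h3

/-! ### The regularized Dirac measure -/

/-- The divergence of the regularized field `|S^{n-1}|⁻¹ (|x|² + ε²)^{-n/2} x`. -/
def peak (n : ℕ) (ε : ℝ) (x : E n) : ℝ :=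
  n * (sphereArea n)⁻¹ * ε ^ 2 * (reg ε x ^ (n + 2))⁻¹

theorem peak_nonneg {n : ℕ} (hn : 0 < n) (ε : ℝ) (x : E n) : 0 ≤ peak n ε x := by
  have := sphereArea_pos hn
  have := reg_nonneg ε x
  unfold peak
  positivity

theorem continuous_peak {n : ℕ} {ε : ℝ} (hε : 0 < ε) : Continuous (peak n ε) := by
  have h : Continuous fun x : E n => reg ε x := by unfold reg; fun_prop
  exact continuous_const.mul ((h.pow _).inv₀ fun x => pow_ne_zero _ (reg_pos hε x).ne')

theorem integral_peak_one {n : ℕ} (hn : 0 < n) : ∫ x : E n, peak n 1 x = 1 := by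
  have h := bracketIntegral_self hn
  rw [bracketIntegral] at h
  simp only [peak]
  rw [integral_const_mul, one_pow, mul_one, mul_right_comm, h,
    mul_inv_cancel₀ (sphereArea_pos hn).ne']

theorem peak_scale {n : ℕ} {ε : ℝ} (hε : 0 < ε) (x : E n) :
    ε⁻¹ ^ n * peak n 1 (ε⁻¹ • x) = peak n ε x := by
  have h1 : reg ε x = ε * reg 1 (ε⁻¹ • x) := by
    rw [← reg_smul hε, smul_inv_smul₀ hε.ne']
  have := reg_pos one_pos (ε⁻¹ • x)
  rw [peak, peak, h1]
  generalize reg 1 (ε⁻¹ • x) = r at this ⊢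
  rw [mul_pow, inv_pow, pow_add ε]
  field_simp

/-- The functions `peak n ε` are the rescalings ε^{-n} `peak n 1` (x/ε) of one nonnegative function
of total integral one, hence an approximate identity. -/
theorem tendsto_integral_peak {n : ℕ} (hn : 0 < n) {g : E n → ℝ} (hg : Integrable g)
    (hg0 : ContinuousAt g 0) :
    Tendsto (fun ε => ∫ x, peak n ε x * g x) (𝓝[>] 0) (𝓝 (g 0)) := by
  have h1 : Tendsto (fun x : E n => ‖x‖ ^ Module.finrank ℝ (E n) * peak n 1 x)
      (Bornology.cobounded (E n)) (𝓝 0) := by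
    rw [finrank_euclideanSpace, Fintype.card_fin]
    have h2 : Tendsto (fun x : E n => n * (sphereArea n)⁻¹ * (reg 1 ‖x‖)⁻¹ ^ 2)
        (Bornology.cobounded (E n)) (𝓝 (n * (sphereArea n)⁻¹ * 0 ^ 2)) :=
      ((tendsto_inv_reg.comp tendsto_norm_cobounded_atTop).pow 2).const_mul _
    rw [zero_pow two_ne_zero, mul_zero] at h2
    refine squeeze_zero (fun x => mul_nonneg (by positivity) (peak_nonneg hn 1 x)) (fun x => ?_) h2
    have h3 := reg_pos one_pos x
    have h4 := sphereArea_pos hn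
    have h5 : ‖x‖ ^ n ≤ reg 1 x ^ n := pow_le_pow_left₀ (norm_nonneg x) (norm_le_reg 1 x) n
    rw [peak, reg_norm]
    calc ‖x‖ ^ n * (n * (sphereArea n)⁻¹ * 1 ^ 2 * (reg 1 x ^ (n + 2))⁻¹)
        ≤ reg 1 x ^ n * (n * (sphereArea n)⁻¹ * 1 ^ 2 * (reg 1 x ^ (n + 2))⁻¹) := by gcongr
      _ = _ := by rw [pow_add]; field_simp
  have h2 := (tendsto_integral_comp_smul_smul_of_integrable (fun x => peak_nonneg hn 1 x)
    (integral_peak_one hn) h1 hg hg0).comp tendsto_inv_nhdsGT_zero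
  refine h2.congr' ?_
  filter_upwards [self_mem_nhdsWithin] with ε hε
  refine integral_congr_ae (ae_of_all _ fun x => ?_)
  simp only [finrank_euclideanSpace, Fintype.card_fin, smul_eq_mul]
  rw [peak_scale hε]

theorem peak_le {n : ℕ} (hn : 0 < n) {ε : ℝ} {x : E n} {r : ℝ} (hr : 0 < r) (hx : r ≤ ‖x‖) :
    peak n ε x ≤ n * (sphereArea n)⁻¹ * ε ^ 2 * (r ^ (n + 2))⁻¹ := by
  have h4 := sphereArea_pos hn
  unfold peak
  gcongr
  exact hx.trans (norm_le_reg ε x)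

/-! ### Integration by parts against the fundamental solution -/

section Parts

variable {n : ℕ} {h : E n → ℝ}

theorem integrable_pow_inv_mul {k : ℕ} (hk : k < n) (hc : Continuous h) (hs : HasCompactSupport h) :
    Integrable fun x => (‖x‖ ^ k)⁻¹ * h x :=
  (locallyIntegrable_norm_pow_inv hk).integrable_smul_right_of_hasCompactSupport hc hs

theorem norm_reg_pow_inv_mul_le {x : E n} (hx : x ≠ 0) (ε : ℝ) (k : ℕ) (t : ℝ) :
    ‖(reg ε x ^ k)⁻¹ * t‖ ≤ ‖(‖x‖ ^ k)⁻¹ * t‖ := by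
  rw [norm_mul, norm_mul, Real.norm_of_nonneg (by have := reg_nonneg ε x; positivity),
    Real.norm_of_nonneg (by positivity : 0 ≤ (‖x‖ ^ k)⁻¹)]
  exact mul_le_mul_of_nonneg_right (reg_pow_inv_le hx ε k) (norm_nonneg t)

theorem tendsto_integral_reg {k : ℕ} (hk : k < n) (hc : Continuous h) (hs : HasCompactSupport h) :
    Tendsto (fun ε => ∫ x, (reg ε x ^ k)⁻¹ * h x) (𝓝[>] 0) (𝓝 (∫ x, (‖x‖ ^ k)⁻¹ * h x)) := by
  have := nontrivial_E (n := n) (by omega)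
  refine tendsto_integral_filter_of_dominated_convergence (fun x => ‖(‖x‖ ^ k)⁻¹ * h x‖) ?_ ?_
    (integrable_pow_inv_mul hk hc hs).norm ?_
  · filter_upwards [self_mem_nhdsWithin] with ε hε
    have h : Continuous fun x : E n => reg ε x := by unfold reg; fun_prop
    exact (((h.pow _).inv₀ fun x => pow_ne_zero _ (reg_pos hε x).ne').mul hc).aestronglyMeasurable
  · refine Eventually.of_forall fun ε => ?_
    filter_upwards [Measure.ae_ne volume (0 : E n)] with x hx
    exact norm_reg_pow_inv_mul_le hx ε k _
  · filter_upwards [Measure.ae_ne volume (0 : E n)] with x hx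
    exact (tendsto_reg_pow_inv hx k).mul_const _

theorem continuous_reg_pow_inv {ε : ℝ} (hε : 0 < ε) (k : ℕ) :
    Continuous fun x : E n => (reg ε x ^ k)⁻¹ := by
  have h : Continuous fun x : E n => reg ε x := by unfold reg; fun_prop
  exact (h.pow _).inv₀ fun x => pow_ne_zero _ (reg_pos hε x).ne'

theorem continuous_fderiv_apply_of_contDiff (hd : ContDiff ℝ 1 h) {v : E n → E n}
    (hv : Continuous v) : Continuous fun x => fderiv ℝ h x (v x) :=
  (hd.continuous_fderiv one_ne_zero).clm_apply hv

theorem hasCompactSupport_fderiv_apply (hs : HasCompactSupport h) (v : E n → E n) :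
    HasCompactSupport fun x => fderiv ℝ h x (v x) := by
  refine (hs.fderiv ℝ).mono' fun x hx => subset_tsupport _ ?_
  rw [Function.mem_support] at hx ⊢
  rintro h0
  simp [h0] at hx

theorem integral_reg_mul_fderiv {ε : ℝ} (hε : 0 < ε) (k : ℕ) (hd : ContDiff ℝ 1 h)
    (hs : HasCompactSupport h) (v : E n) :
    ∫ x, (reg ε x ^ k)⁻¹ * fderiv ℝ h x v =
      k * ∫ x, (reg ε x ^ (k + 2))⁻¹ * (inner ℝ x v * h x) := by
  have hf := fun x : E n => (hasFDerivAt_reg_pow_inv hε k x)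
  have hc := continuous_reg_pow_inv (n := n) hε
  have h0 : Integrable fun x : E n => fderiv ℝ (fun x => (reg ε x ^ k)⁻¹) x v * h x := by
    refine Continuous.integrable_of_hasCompactSupport ?_ hs.mul_left
    have : (fun x : E n => fderiv ℝ (fun x => (reg ε x ^ k)⁻¹) x v) =
        fun x => (-k * (reg ε x ^ (k + 2))⁻¹) * inner ℝ x v := by
      funext x
      rw [(hf x).fderiv]
      rfl
    refine Continuous.mul ?_ hd.continuous
    rw [this]
    exact ((hc _).const_mul _ ).mul (by fun_prop)
  rw [integral_mul_fderiv_eq_neg_fderiv_mul_of_integrable h0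
    (((hc k).mul (continuous_fderiv_apply_of_contDiff hd
      continuous_const)).integrable_of_hasCompactSupport
      (hasCompactSupport_fderiv_apply hs _).mul_left)
    (((hc k).mul hd.continuous).integrable_of_hasCompactSupport hs.mul_left)
    (fun x _ => (hf x).differentiableAt) (fun x _ => hd.differentiable one_ne_zero x),
    ← integral_neg, ← integral_const_mul]
  refine integral_congr_ae (ae_of_all _ fun x => ?_)
  simp only
  rw [(hf x).fderiv]
  simp only [_root_.smul_apply, smul_eq_mul, innerSL_apply_apply]
  ring

theorem integrable_inner_pow_inv_mul (hn : 0 < n) (hc : Continuous h) (hs : HasCompactSupport h)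
    (v : E n) : Integrable fun x => (‖x‖ ^ n)⁻¹ * (inner ℝ x v * h x) := by
  refine ((integrable_pow_inv_mul (k := n - 1) (by omega) hc hs).norm.const_mul ‖v‖).mono' ?_ ?_
  · exact (Measurable.aestronglyMeasurable (by fun_prop)).mul
      ((by fun_prop : Continuous fun x : E n => inner ℝ x v * h x).aestronglyMeasurable)
  · refine ae_of_all _ fun x => ?_
    by_cases hx : x = 0
    · simp only [hx, inner_zero_left, zero_mul, mul_zero, norm_zero]; positivity
    have h1 := norm_pos_iff.2 hx
    have h2 : (‖x‖ ^ n)⁻¹ * ‖x‖ = (‖x‖ ^ (n - 1))⁻¹ := by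
      obtain ⟨m, rfl⟩ : ∃ m, n = m + 1 := ⟨n - 1, by omega⟩
      rw [Nat.add_sub_cancel, pow_succ]; field_simp
    rw [norm_mul, norm_mul, norm_mul, Real.norm_of_nonneg (by positivity : 0 ≤ (‖x‖ ^ n)⁻¹),
      Real.norm_of_nonneg (by positivity : 0 ≤ (‖x‖ ^ (n - 1))⁻¹)]
    calc (‖x‖ ^ n)⁻¹ * (‖inner ℝ x v‖ * ‖h x‖) ≤ (‖x‖ ^ n)⁻¹ * (‖x‖ * ‖v‖ * ‖h x‖) := by
          gcongr; exact norm_inner_le_norm x v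
      _ = ‖v‖ * ((‖x‖ ^ (n - 1))⁻¹ * ‖h x‖) := by rw [← h2]; ring

/-- The formula holds with |x| replaced by √(|x|² + ε²), where there is no singularity. Since the
regularized norm dominates |x|, both sides pass to the limit by dominated convergence. -/
theorem integral_pow_inv_mul_fderiv (hn : 3 ≤ n) (hd : ContDiff ℝ 1 h)
    (hs : HasCompactSupport h) (v : E n) :
    ∫ x, (‖x‖ ^ (n - 2))⁻¹ * fderiv ℝ h x v =
      ((n : ℝ) - 2) * ∫ x, (‖x‖ ^ n)⁻¹ * (inner ℝ x v * h x) := by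
  have := nontrivial_E (n := n) (by omega)
  have h1 := tendsto_integral_reg (k := n - 2) (by omega)
    (continuous_fderiv_apply_of_contDiff hd (continuous_const (y := v)))
    (hasCompactSupport_fderiv_apply hs _)
  refine tendsto_nhds_unique h1 ?_
  have h2 : Tendsto (fun ε => ∫ x : E n, (reg ε x ^ n)⁻¹ * (inner ℝ x v * h x)) (𝓝[>] 0)
      (𝓝 (∫ x, (‖x‖ ^ n)⁻¹ * (inner ℝ x v * h x))) := by
    refine tendsto_integral_filter_of_dominated_convergence
      (fun x => ‖(‖x‖ ^ n)⁻¹ * (inner ℝ x v * h x)‖) ?_ ?_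
      (integrable_inner_pow_inv_mul (by omega) hd.continuous hs v).norm ?_
    · filter_upwards [self_mem_nhdsWithin] with ε hε
      have := hd.continuous
      exact ((continuous_reg_pow_inv hε n).mul
        (by fun_prop : Continuous fun x : E n => inner ℝ x v * h x)).aestronglyMeasurable
    · refine Eventually.of_forall fun ε => ?_
      filter_upwards [Measure.ae_ne volume (0 : E n)] with x hx
      exact norm_reg_pow_inv_mul_le hx ε n _
    · filter_upwards [Measure.ae_ne volume (0 : E n)] with x hx
      exact (tendsto_reg_pow_inv hx n).mul_const _
  refine (h2.const_mul ((n : ℝ) - 2)).congr' ?_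
  filter_upwards [self_mem_nhdsWithin] with ε hε
  rw [integral_reg_mul_fderiv hε (n - 2) hd hs v, Nat.cast_sub (by omega),
    Nat.sub_add_cancel (by omega)]
  rfl

theorem integrable_pow_inv_mul_fderiv_self (hn : 0 < n) (hd : ContDiff ℝ 1 h)
    (hs : HasCompactSupport h) : Integrable fun x => (‖x‖ ^ n)⁻¹ * fderiv ℝ h x x := by
  have h1 : (fun x : E n => (‖x‖ ^ n)⁻¹ * fderiv ℝ h x x) = fun x : E n =>
      ∑ i, (‖x‖ ^ n)⁻¹ * (inner ℝ x (stdVec n i) * fderiv ℝ h x (stdVec n i)) := by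
    funext x
    rw [← Finset.mul_sum]
    congr 1
    conv_lhs => arg 2; rw [← sum_smul_stdVec x]
    simp [stdVec, EuclideanSpace.inner_single_right]
  rw [h1]
  exact integrable_finsetSum _ fun i _ => integrable_inner_pow_inv_mul hn
    (continuous_fderiv_apply_of_contDiff hd continuous_const)
    (hasCompactSupport_fderiv_apply hs _) _

/-- This says that the divergence of x/|x|^n is |S^{n-1}| times the Dirac measure at 0. For ε > 0
the divergence of the regularized field is |S^{n-1}| `peak n ε`, and `tendsto_integral_peak` gives
the limit. -/
theorem integral_pow_inv_mul_fderiv_self (hn : 0 < n) (hd : ContDiff ℝ 1 h)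
    (hs : HasCompactSupport h) :
    ∫ x, (‖x‖ ^ n)⁻¹ * fderiv ℝ h x x = -(sphereArea n * h 0) := by
  have := nontrivial_E hn
  have h2 : Tendsto (fun ε => ∫ x : E n, (reg ε x ^ n)⁻¹ * fderiv ℝ h x x) (𝓝[>] 0)
      (𝓝 (∫ x, (‖x‖ ^ n)⁻¹ * fderiv ℝ h x x)) := by
    refine tendsto_integral_filter_of_dominated_convergence
      (fun x => ‖(‖x‖ ^ n)⁻¹ * fderiv ℝ h x x‖) ?_ ?_
      (integrable_pow_inv_mul_fderiv_self hn hd hs).norm ?_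
    · filter_upwards [self_mem_nhdsWithin] with ε hε
      exact ((continuous_reg_pow_inv hε n).mul
        (continuous_fderiv_apply_of_contDiff hd continuous_id)).aestronglyMeasurable
    · refine Eventually.of_forall fun ε => ?_
      filter_upwards [Measure.ae_ne volume (0 : E n)] with x hx
      exact norm_reg_pow_inv_mul_le hx ε n _
    · filter_upwards [Measure.ae_ne volume (0 : E n)] with x hx
      exact (tendsto_reg_pow_inv hx n).mul_const _
  refine tendsto_nhds_unique h2 ?_
  have h3 := (tendsto_integral_peak hn (hd.continuous.integrable_of_hasCompactSupport hs)
    hd.continuous.continuousAt).const_mul (sphereArea n) |>.neg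
  refine h3.congr' ?_
  filter_upwards [self_mem_nhdsWithin] with ε hε
  have hS := (sphereArea_pos hn).ne'
  have hcoord : ∀ i, ContDiff ℝ 1 fun x : E n => x i * h x := fun i =>
    (coord n i).contDiff.mul hd
  have hcs : ∀ i, HasCompactSupport fun x : E n => x i * h x := fun i => hs.mul_left
  -- Integration by parts in the direction e_i is applied to x_i h and summed over i. The left sides
  -- add up to the radial derivative plus n h, the right sides to n |x|² h with two more powers of
  -- the regularized norm; writing |x|² as its square minus ε² leaves exactly the peak.
  have h4 := fun i => integral_reg_mul_fderiv hε n (hcoord i) (hcs i) (stdVec n i)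
  have h5 : ∀ i, ∀ x : E n, fderiv ℝ (fun x : E n => x i * h x) x (stdVec n i) =
      x i * fderiv ℝ h x (stdVec n i) + h x := by
    intro i x
    have h6 : HasFDerivAt (fun x : E n => x i) (coord n i) x := (coord n i).hasFDerivAt
    rw [(h6.fun_mul (hd.differentiable one_ne_zero x).hasFDerivAt).fderiv]
    simp [coord, stdVec]
  have hc1 : ∀ i, Integrable fun x : E n => (reg ε x ^ n)⁻¹ *
      fderiv ℝ (fun x : E n => x i * h x) x (stdVec n i) := fun i =>
    ((continuous_reg_pow_inv hε n).mul (continuous_fderiv_apply_of_contDiff (hcoord i)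
      continuous_const)).integrable_of_hasCompactSupport
      (hasCompactSupport_fderiv_apply (hcs i) _).mul_left
  have hc2 : ∀ i, Integrable fun x : E n => (reg ε x ^ (n + 2))⁻¹ *
      (inner ℝ x (stdVec n i) * (x i * h x)) := fun i =>
    ((continuous_reg_pow_inv hε _).mul (by
      have := (hcoord i).continuous
      fun_prop)).integrable_of_hasCompactSupport (hcs i).mul_left.mul_left
  have h6 := Finset.sum_congr rfl fun i (_ : i ∈ Finset.univ) => h4 i
  rw [← integral_finsetSum _ fun i _ => hc1 i, ← Finset.mul_sum,
    ← integral_finsetSum _ fun i _ => hc2 i] at h6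
  have hA : Integrable fun x : E n => (reg ε x ^ n)⁻¹ * fderiv ℝ h x x :=
    ((continuous_reg_pow_inv hε n).mul (continuous_fderiv_apply_of_contDiff hd
      continuous_id)).integrable_of_hasCompactSupport (hasCompactSupport_fderiv_apply hs _).mul_left
  have hB : Integrable fun x : E n => (reg ε x ^ n)⁻¹ * h x :=
    ((continuous_reg_pow_inv hε n).mul hd.continuous).integrable_of_hasCompactSupport hs.mul_left
  have hC : Integrable fun x : E n => peak n ε x * h x :=
    ((continuous_peak hε).mul hd.continuous).integrable_of_hasCompactSupport hs.mul_left
  have h7 : ∀ x : E n, ∑ i, (reg ε x ^ n)⁻¹ * fderiv ℝ (fun x : E n => x i * h x) x (stdVec n i) =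
      (reg ε x ^ n)⁻¹ * fderiv ℝ h x x + n * ((reg ε x ^ n)⁻¹ * h x) := by
    intro x
    simp only [h5, mul_add, Finset.sum_add_distrib]
    conv_rhs => arg 1; arg 2; arg 2; rw [← sum_smul_stdVec x]
    simp [Finset.mul_sum]
  have h8 : ∀ x : E n, n * ∑ i, (reg ε x ^ (n + 2))⁻¹ * (inner ℝ x (stdVec n i) * (x i * h x)) =
      n * ((reg ε x ^ n)⁻¹ * h x) - sphereArea n * (peak n ε x * h x) := by
    intro x
    have h9 : ∑ i, (reg ε x ^ (n + 2))⁻¹ * (inner ℝ x (stdVec n i) * (x i * h x)) =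
        (reg ε x ^ (n + 2))⁻¹ * (‖x‖ ^ 2 * h x) := by
      rw [← Finset.mul_sum, EuclideanSpace.norm_sq_eq, Finset.sum_mul]
      congr 1
      refine Finset.sum_congr rfl fun i _ => ?_
      simp [stdVec, EuclideanSpace.inner_single_right]
      ring
    have hr := reg_pos hε x
    have h10 : ‖x‖ ^ 2 = reg ε x ^ 2 - ε ^ 2 := by rw [reg_sq]; ring
    rw [h9, h10, peak, pow_add]
    field_simp
  rw [← integral_const_mul] at h6
  simp only [h7, h8] at h6
  rw [integral_add hA (hB.const_mul _), integral_sub (hB.const_mul _) (hC.const_mul _),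
    integral_const_mul _ fun x => peak n ε x * h x] at h6
  linarith

end Parts

/-- With midpoint p = (x + y)/2 and half distance a = |x - y|/2, the parallelogram law gives squared
distance 2(|q - p|² + a²) from (x, y) to (q, q). The integral is therefore a rescaled
`bracketIntegral` with exponent 2n - 2, and `bracketIntegral_green` turns the constant into one half
of that of the Newton kernel of ℝ^n. -/
theorem integral_green_diag {n : ℕ} (hn : 3 ≤ n) {z : E (n + n)} (hz : diffMap n z ≠ 0) :
    ∫ x : E n, ((((n + n : ℕ) : ℝ) - 2) * sphereArea (n + n) * ‖z - diagEmb n x‖ ^ (n + n - 2))⁻¹ =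
      (2 * (((n : ℝ) - 2) * sphereArea n))⁻¹ * (‖diffMap n z‖ ^ (n - 2))⁻¹ := by
  obtain ⟨m, rfl⟩ : ∃ m, n = m + 3 := ⟨n - 3, by omega⟩
  set a := ‖diffMap (m + 3) z‖ / 2 with ha
  have ha0 : 0 < a := half_pos (norm_pos_iff.2 hz)
  set p : E (m + 3) := (2 : ℝ)⁻¹ • (pr1 _ z + pr2 _ z) with hp
  have h1 : ∀ x : E (m + 3), ‖z - diagEmb (m + 3) x‖ ^ (m + 3 + (m + 3) - 2) =
      2 ^ (m + 2) * reg a (x - p) ^ (m + 3 + (m + 3) - 2) := by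
    intro x
    have h2 : ‖z - diagEmb (m + 3) x‖ ^ 2 = 2 * reg a (x - p) ^ 2 := by
      conv_lhs => rw [← pair_pr z, diagEmb, ← pair_sub, norm_pair_sq]
      have e1 : pr1 _ z - x = (2 : ℝ)⁻¹ • diffMap _ z - (x - p) := by
        rw [hp, diffMap_apply]; module
      have e2 : pr2 _ z - x = -((2 : ℝ)⁻¹ • diffMap _ z + (x - p)) := by
        rw [hp, diffMap_apply]; module
      rw [e1, e2, norm_neg, reg_sq]
      have e3 := parallelogram_law_with_norm ℝ ((2 : ℝ)⁻¹ • diffMap _ z) (x - p)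
      have e4 : ‖(2 : ℝ)⁻¹ • diffMap _ z‖ = a := by
        rw [norm_smul, ha]; norm_num; ring
      rw [e4] at e3
      linarith
    have h3 : m + 3 + (m + 3) - 2 = 2 * (m + 2) := by omega
    rw [h3, pow_mul, h2, mul_pow, ← pow_mul]
  simp only [h1]
  have hb := bracketIntegral_green (n := m + 3) (by omega)
  have hS := sphereArea_pos (n := m + 3) (by omega)
  have hS2 := sphereArea_pos (n := m + 3 + (m + 3)) (by omega)
  set B := bracketIntegral (m + 3) (m + 3 + (m + 3) - 2) with hB
  have h4 : ∫ x : E (m + 3), (reg a (x - p) ^ (m + 3 + (m + 3) - 2))⁻¹ =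
      a ^ (m + 3) * (a ^ (m + 3 + (m + 3) - 2))⁻¹ * B := by
    rw [← integral_reg_pow_inv ha0]
    exact integral_sub_right_eq_self (fun x : E (m + 3) => (reg a x ^ (m + 3 + (m + 3) - 2))⁻¹) p
  simp only [mul_inv]
  rw [integral_const_mul, integral_const_mul, h4]
  have h5 : m + 3 + (m + 3) - 2 = (m + 3) + (m + 1) := by omega
  have h6 : ‖diffMap (m + 3) z‖ = 2 * a := by rw [ha]; ring
  rw [h5, h6, show m + 3 - 2 = m + 1 by omega, pow_add a (m + 3) (m + 1)]
  have h7 : ((m + 3 + (m + 3) : ℕ) : ℝ) - 2 = 2 * m + 4 := by push_cast; ring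
  have h8 : ((m + 3 : ℕ) : ℝ) - 2 = m + 1 := by push_cast; ring
  have h9 : B = (((m + 3 + (m + 3) : ℕ) : ℝ) - 2) * sphereArea (m + 3 + (m + 3)) /
      ((((m + 3 : ℕ) : ℝ) - 2) * sphereArea (m + 3)) := by
    rw [eq_div_iff (by rw [h8]; positivity)]
    linear_combination hb
  rw [h9, h7, h8]
  field_simp
  ring_nf

/-! ### The Green operator -/

instance finiteDimensional_cov (N k : ℕ) : FiniteDimensional ℝ (Cov N k) := by
  let ev : Cov N k →ₗ[ℝ] ((Fin k → Fin N) → ℝ) :=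
    { toFun := fun a f => a fun i => stdVec N (f i)
      map_add' := fun _ _ => rfl
      map_smul' := fun _ _ => rfl }
  exact FiniteDimensional.of_injective ev fun a b h => cov_ext fun f => congrFun h f

/-- Evaluation of covectors. -/
abbrev evalAt {N k : ℕ} (v : Fin k → E N) : Cov N k →L[ℝ] ℝ :=
  ContinuousAlternatingMap.apply ℝ (E N) ℝ v

theorem contDiff_evalAt {N k : ℕ} {θ : E N → Cov N k} {r : WithTop ℕ∞} (h : ContDiff ℝ r θ)
    (v : Fin k → E N) : ContDiff ℝ r fun x => θ x v := (evalAt v).contDiff.comp h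

theorem hasCompactSupport_evalAt {N k : ℕ} {θ : E N → Cov N k} (h : HasCompactSupport θ)
    (v : Fin k → E N) : HasCompactSupport fun x => θ x v :=
  h.comp_left (g := fun a : Cov N k => a v) rfl

theorem fderiv_evalAt {N k : ℕ} {θ : E N → Cov N k} {x : E N} (h : DifferentiableAt ℝ θ x)
    (v : Fin k → E N) (y : E N) : fderiv ℝ (fun x => θ x v) x y = fderiv ℝ θ x y v := by
  have := ((evalAt v).hasFDerivAt.comp x h.hasFDerivAt).fderiv
  exact congrArg (fun L => L y) this

/-- The fundamental solution of the Laplacian. -/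
def newton (N : ℕ) (x : E N) : ℝ := (((N : ℝ) - 2) * sphereArea N * ‖x‖ ^ (N - 2))⁻¹

theorem newton_eq (N : ℕ) (x : E N) :
    newton N x = (((N : ℝ) - 2) * sphereArea N)⁻¹ * (‖x‖ ^ (N - 2))⁻¹ := by
  rw [newton, mul_inv]

theorem locallyIntegrable_newton {N : ℕ} (hN : 3 ≤ N) : LocallyIntegrable (newton N) := by
  have := (locallyIntegrable_norm_pow_inv (n := N) (k := N - 2) (by omega)).smul
    (((N : ℝ) - 2) * sphereArea N)⁻¹
  refine this.congr (ae_of_all _ fun x => ?_)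
  rw [newton_eq]
  rfl

theorem newton_neg (N : ℕ) (x : E N) : newton N (-x) = newton N x := by
  rw [newton, newton, norm_neg]

theorem green_eq_convolution {N k : ℕ} (θ : E N → Cov N k) :
    green θ = convolution (newton N) θ (ContinuousLinearMap.lsmul ℝ ℝ) volume := by
  funext y
  rw [green, convolution, ← integral_sub_left_eq_self _ volume y]
  refine integral_congr_ae (ae_of_all _ fun t => ?_)
  simp only [ContinuousLinearMap.lsmul_apply]
  congr 1
  rw [← newton, ← newton_neg]
  congr 1
  abel

theorem contDiff_green {N k : ℕ} (hN : 3 ≤ N) (θ : TestForm N k) : ContDiff ℝ ∞ (green θ) := by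
  rw [green_eq_convolution]
  exact θ.hasCompactSupport.contDiff_convolution_right (n := ⊤) _ (locallyIntegrable_newton hN)
    θ.contDiff

theorem integrable_newton_smul {N : ℕ} {F : Type*} [NormedAddCommGroup F] [NormedSpace ℝ F]
    (hN : 3 ≤ N) {θ : E N → F}
    (hc : Continuous θ) (hs : HasCompactSupport θ) (y : E N) :
    Integrable fun x => newton N (x - y) • θ x := by
  have h1 := (locallyIntegrable_newton hN).integrable_smul_right_of_hasCompactSupport
    (g := fun x => θ (x + y)) (by fun_prop) (hs.comp_homeomorph (Homeomorph.addRight y))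
  have h2 := h1.comp_sub_right y
  simpa using h2

theorem green_apply {N k : ℕ} (hN : 3 ≤ N) {θ : E N → Cov N k} (hc : Continuous θ)
    (hs : HasCompactSupport θ) (y : E N) (v : Fin k → E N) :
    green θ y v = ∫ x, newton N (x - y) * θ x v := by
  have := (evalAt v).integral_comp_comm (integrable_newton_smul hN hc hs y)
  exact this.symm

theorem fderiv_green {N k : ℕ} (hN : 3 ≤ N) (θ : TestForm N k) (y v : E N) :
    fderiv ℝ (green θ) y v = green (fun x => fderiv ℝ θ x v) y := by
  have hd : ContDiff ℝ 1 θ := θ.contDiff.of_le (by exact_mod_cast le_top)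
  have h := θ.hasCompactSupport.hasFDerivAt_convolution_right (ContinuousLinearMap.lsmul ℝ ℝ)
    (locallyIntegrable_newton hN) hd y
  rw [← green_eq_convolution] at h
  rw [h.fderiv, green_eq_convolution, convolution_precompR_apply _ (locallyIntegrable_newton hN)
    (θ.hasCompactSupport.fderiv ℝ) (hd.continuous_fderiv one_ne_zero)]

/-- As for every convolution with a locally integrable kernel, the derivative first falls on the
form. Integration by parts centred at y returns it to the Newton kernel, and the factor N - 2
cancels. -/
theorem fderiv_green_apply {N k : ℕ} (hN : 3 ≤ N) (θ : TestForm N k) (y v : E N)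
    (w : Fin k → E N) :
    fderiv ℝ (green θ) y v w =
      (sphereArea N)⁻¹ * ∫ x, (‖x - y‖ ^ N)⁻¹ * (inner ℝ (x - y) v * θ x w) := by
  have hd : ContDiff ℝ 1 θ := θ.contDiff.of_le (by exact_mod_cast le_top)
  have hd2 := contDiff_evalAt hd w
  have hs2 := hasCompactSupport_evalAt θ.hasCompactSupport w
  rw [fderiv_green hN, green_apply hN ((hd.continuous_fderiv one_ne_zero).clm_apply continuous_const)
    ((θ.hasCompactSupport.fderiv ℝ).comp_left (g := fun L : E N →L[ℝ] Cov N k => L v) rfl)]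
  have h1 := integral_pow_inv_mul_fderiv hN (h := fun x => θ (x + y) w)
    (hd2.comp (contDiff_id.add contDiff_const)) (hs2.comp_homeomorph (Homeomorph.addRight y)) v
  rw [← integral_sub_right_eq_self _ y, ← integral_sub_right_eq_self (fun x => (‖x‖ ^ N)⁻¹ * _) y]
    at h1
  simp only [sub_add_cancel] at h1
  have h2 : ∀ x, fderiv ℝ (fun x => θ (x + y) w) (x - y) v = fderiv ℝ θ x v w := by
    intro x
    rw [fderiv_comp_add_right (f := fun x => θ x w), sub_add_cancel,
      fderiv_evalAt (hd.differentiable one_ne_zero x)]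
  simp only [h2] at h1
  simp only [newton_eq, mul_assoc]
  rw [integral_const_mul, h1]
  have h3 : (N : ℝ) - 2 ≠ 0 := by
    have : (3 : ℝ) ≤ N := by exact_mod_cast hN
    linarith
  have h4 := (sphereArea_pos (n := N) (by omega)).ne'
  field_simp

theorem exists_cutoff_green {N k : ℕ} (hN : 3 ≤ N) (θ : TestForm N k)
    (χ : 𝓓((⊤ : TopologicalSpace.Opens (E N)), ℝ)) :
    ∃ η : ℝ → TestForm N k, ∀ R : ℝ, 0 < R → ∀ x, η R x = χ (R⁻¹ • x) • green θ x := by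
  have h : ∀ R : ℝ, ∃ η : TestForm N k, 0 < R → ∀ x, η x = χ (R⁻¹ • x) • green θ x := by
    intro R
    by_cases hR : 0 < R
    · have h1 : ContDiff ℝ ∞ fun x : E N => R⁻¹ • x := by fun_prop
      have h2 : HasCompactSupport fun x : E N => χ (R⁻¹ • x) :=
        χ.hasCompactSupport.comp_homeomorph
          (Homeomorph.smulOfNeZero (α := E N) R⁻¹ (inv_pos.2 hR).ne')
      exact ⟨⟨fun x => χ (R⁻¹ • x) • green θ x,
        (χ.contDiff.comp h1).smul (contDiff_green hN θ), h2.smul_right, subset_univ _⟩,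
        fun _ x => rfl⟩
    -- Nothing is required for R ≤ 0, and any test form will do.
    · exact ⟨0, fun h => (hR h).elim⟩
  choose η hη using h
  exact ⟨η, hη⟩

theorem tendsto_cutoff {N : ℕ} (χ : 𝓓((⊤ : TopologicalSpace.Opens (E N)), ℝ))
    (hχ : ∀ᶠ x in 𝓝 (0 : E N), χ x = 1) (x : E N) :
    Tendsto (fun R : ℝ => χ (R⁻¹ • x)) atTop (𝓝 1) := by
  have h1 : Tendsto (fun R : ℝ => R⁻¹ • x) atTop (𝓝 0) := by
    have h2 := (tendsto_inv_atTop_zero (𝕜 := ℝ)).smul_const x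
    rwa [zero_smul] at h2
  exact tendsto_const_nhds.congr' (by filter_upwards [h1.eventually hχ] with R hR; exact hR.symm)

/-! ### Calculus in the coordinates `x - y, y` -/

section Shear

variable {n : ℕ} {h : E (n + n) → ℝ}

theorem contDiff_shear (n : ℕ) : ContDiff ℝ ∞ (shear n) := by
  have : shear n = fun p => (pairIsometry n) (WithLp.toLp 2 (p.1 + p.2, p.2)) := rfl
  rw [this]
  exact (pairIsometry n).contDiff.comp ((WithLp.contDiff_toLp).comp
    ((contDiff_fst.add contDiff_snd).prodMk contDiff_snd))

theorem contDiff_shear_left (hd : ContDiff ℝ 1 h) (y : E n) :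
    ContDiff ℝ 1 fun u => h (shear n (u, y)) :=
  hd.comp ((contDiff_shear n).of_le (by exact_mod_cast le_top) |>.comp
    (contDiff_id.prodMk contDiff_const))

theorem shear_hasFDerivAt_left (u y v : E n) (hd : ContDiff ℝ 1 h) :
    fderiv ℝ (fun u => h (shear n (u, y))) u v = fderiv ℝ h (shear n (u, y)) (pair v 0) := by
  have h1 : HasLineDerivAt ℝ (fun u => h (shear n (u, y)))
      (fderiv ℝ h (shear n (u, y)) (pair v 0)) u v := by
    have h2 := ((hd.differentiable one_ne_zero (shear n (u, y))).hasFDerivAt.hasLineDerivAt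
      (pair v 0))
    have h3 : ∀ t : ℝ, shear n (u + t • v, y) = shear n (u, y) + t • pair v 0 := by
      intro t
      rw [shear, shear, ← pair_smul_left, ← pair_add, add_zero]
      congr 1
      simp only; abel
    simpa [HasLineDerivAt, h3] using h2
  have h4 := contDiff_shear_left hd y
  rw [← (h4.differentiable one_ne_zero u).lineDeriv_eq_fderiv, h1.lineDeriv]

theorem shear_hasFDerivAt_right (u y v : E n) (hd : ContDiff ℝ 1 h) :
    fderiv ℝ (fun y => h (shear n (u, y))) y v = fderiv ℝ h (shear n (u, y)) (diagEmb n v) := by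
  have h1 : HasLineDerivAt ℝ (fun y => h (shear n (u, y)))
      (fderiv ℝ h (shear n (u, y)) (diagEmb n v)) y v := by
    have h2 := ((hd.differentiable one_ne_zero (shear n (u, y))).hasFDerivAt.hasLineDerivAt
      (diagEmb n v))
    have h3 : ∀ t : ℝ, shear n (u, y + t • v) = shear n (u, y) + t • diagEmb n v := by
      intro t
      rw [shear, shear, diagEmb, ← pair_smul, ← pair_add]
      congr 1
      simp only; abel
    simpa [HasLineDerivAt, h3] using h2
  have h4 : ContDiff ℝ 1 fun y => h (shear n (u, y)) :=
    hd.comp ((contDiff_shear n).of_le (by exact_mod_cast le_top) |>.comp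
      (contDiff_const.prodMk contDiff_id))
  rw [← (h4.differentiable one_ne_zero y).lineDeriv_eq_fderiv, h1.lineDeriv]

theorem hasCompactSupport_shear_left (hs : HasCompactSupport h) (y : E n) :
    HasCompactSupport fun u => h (shear n (u, y)) := by
  have hc : IsClosedEmbedding fun u : E n => shear n (u, y) :=
    Function.LeftInverse.isClosedEmbedding (f := diffMap n) (fun u => diffMap_shear (u, y))
      (diffMap n).continuous ((continuous_shear n).comp (by fun_prop))
  exact hs.comp_isClosedEmbedding hc

theorem hasCompactSupport_shear_right (hs : HasCompactSupport h) (u : E n) :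
    HasCompactSupport fun y => h (shear n (u, y)) := by
  have hc : IsClosedEmbedding fun y : E n => shear n (u, y) :=
    Function.LeftInverse.isClosedEmbedding (f := pr2 n) (fun y => pr2_pair _ _)
      (pr2 n).continuous ((continuous_shear n).comp (by fun_prop))
  exact hs.comp_isClosedEmbedding hc

theorem integrable_comp_diffMap_mul {w : E n → ℝ} (hw : LocallyIntegrable w) (hc : Continuous h)
    (hs : HasCompactSupport h) : Integrable fun z => w (diffMap n z) * h z :=
  (locallyIntegrable_comp_diffMap hw).integrable_smul_right_of_hasCompactSupport hc hs

theorem integral_fderiv_eq_zero_of_hasCompactSupport {f : E n → ℝ} (hd : ContDiff ℝ 1 f)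
    (hs : HasCompactSupport f) (v : E n) : ∫ x, fderiv ℝ f x v = 0 := by
  have hc := continuous_fderiv_apply_of_contDiff hd (continuous_const (y := v))
  have h := integral_mul_fderiv_eq_neg_fderiv_mul_of_integrable (μ := (volume : Measure (E n)))
    (f := fun _ => (1 : ℝ)) (g := f) (v := v) (by simp)
    (by simpa using hc.integrable_of_hasCompactSupport (hasCompactSupport_fderiv_apply hs _))
    (by simpa using hd.continuous.integrable_of_hasCompactSupport hs)
    (fun _ _ => differentiableAt_const _) (fun x _ => hd.differentiable one_ne_zero x)
  simpa using h

/-- The weight is constant along the diagonal direction. In the coordinates (u, y) the derivative is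
a y-derivative of a compactly supported function, so the integral over y vanishes for each u. -/
theorem integral_comp_diffMap_mul_fderiv_diag {w : E n → ℝ} (hw : LocallyIntegrable w)
    (hd : ContDiff ℝ 1 h) (hs : HasCompactSupport h) (v : E n) :
    ∫ z, w (diffMap n z) * fderiv ℝ h z (diagEmb n v) = 0 := by
  have hint := integrable_comp_diffMap_mul hw
    (continuous_fderiv_apply_of_contDiff hd (continuous_const (y := diagEmb n v)))
    (hasCompactSupport_fderiv_apply hs _)
  rw [← (measurePreserving_shear n).integral_comp (measurableEmbedding_shear n),
    Measure.volume_eq_prod]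
  refine (integral_prod _ (((measurePreserving_shear n).integrable_comp_emb
      (measurableEmbedding_shear n)).2 hint)).trans ?_
  refine integral_eq_zero_of_ae (ae_of_all _ fun u => ?_)
  simp only [Function.comp_apply, diffMap_shear, Pi.zero_apply]
  rw [integral_const_mul]
  simp only [← shear_hasFDerivAt_right u _ v hd]
  rw [integral_fderiv_eq_zero_of_hasCompactSupport _ (hasCompactSupport_shear_right hs u), mul_zero]
  exact hd.comp ((contDiff_shear n).of_le (by exact_mod_cast le_top) |>.comp
    (contDiff_const.prodMk contDiff_id))

theorem locallyIntegrable_pow_inv_mul_inner (hn : 0 < n) (v : E n) :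
    LocallyIntegrable fun u : E n => (‖u‖ ^ n)⁻¹ * inner ℝ u v := by
  refine LocallyIntegrable.mono ((locallyIntegrable_norm_pow_inv (n := n) (k := n - 1)
    (by omega)).smul ‖v‖) (Measurable.aestronglyMeasurable (by fun_prop)) (ae_of_all _ fun x => ?_)
  by_cases hx : x = 0
  · simp only [hx, inner_zero_left, mul_zero, norm_zero]; positivity
  have h1 := norm_pos_iff.2 hx
  have h2 : (‖x‖ ^ n)⁻¹ * ‖x‖ = (‖x‖ ^ (n - 1))⁻¹ := by
    obtain ⟨m, rfl⟩ : ∃ m, n = m + 1 := ⟨n - 1, by omega⟩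
    rw [Nat.add_sub_cancel, pow_succ]; field_simp
  simp only [Pi.smul_apply, smul_eq_mul]
  rw [norm_mul, norm_mul, norm_norm, Real.norm_of_nonneg (by positivity : 0 ≤ (‖x‖ ^ n)⁻¹),
    Real.norm_of_nonneg (by positivity : 0 ≤ (‖x‖ ^ (n - 1))⁻¹), ← h2]
  calc (‖x‖ ^ n)⁻¹ * ‖inner ℝ x v‖ ≤ (‖x‖ ^ n)⁻¹ * (‖x‖ * ‖v‖) := by
        gcongr; exact norm_inner_le_norm x v
    _ = _ := by ring

theorem integral_diffMap_pow_inv_mul_fderiv (hn : 3 ≤ n) (hd : ContDiff ℝ 1 h)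
    (hs : HasCompactSupport h) (v : E n) :
    ∫ z, (‖diffMap n z‖ ^ (n - 2))⁻¹ * fderiv ℝ h z (pair v 0) =
      ((n : ℝ) - 2) * ∫ z, (‖diffMap n z‖ ^ n)⁻¹ * inner ℝ (diffMap n z) v * h z := by
  have h1 := integrable_comp_diffMap_mul
    (locallyIntegrable_norm_pow_inv (n := n) (k := n - 2) (by omega))
    (continuous_fderiv_apply_of_contDiff hd (continuous_const (y := pair v 0)))
    (hasCompactSupport_fderiv_apply hs _)
  have h2 := integrable_comp_diffMap_mul
    (locallyIntegrable_pow_inv_mul_inner (n := n) (by omega) v) hd.continuous hs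
  rw [integral_shear h1, integral_shear h2, ← integral_const_mul]
  refine integral_congr_ae (ae_of_all _ fun y => ?_)
  simp only [diffMap_shear]
  have h3 := integral_pow_inv_mul_fderiv hn (contDiff_shear_left hd y)
    (hasCompactSupport_shear_left hs y) v
  simp only [shear_hasFDerivAt_left _ y v hd] at h3
  rw [h3]
  simp only [mul_assoc]

theorem integral_diffMap_pow_inv_mul_fderiv_self (hn : 0 < n) (hd : ContDiff ℝ 1 h)
    (hs : HasCompactSupport h)
    (hint : Integrable fun z => (‖diffMap n z‖ ^ n)⁻¹ * fderiv ℝ h z (pair (diffMap n z) 0)) :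
    ∫ z, (‖diffMap n z‖ ^ n)⁻¹ * fderiv ℝ h z (pair (diffMap n z) 0) =
      -(sphereArea n * ∫ y, h (diagEmb n y)) := by
  rw [integral_shear hint, ← integral_const_mul, ← integral_neg]
  refine integral_congr_ae (ae_of_all _ fun y => ?_)
  simp only [diffMap_shear]
  have h3 := integral_pow_inv_mul_fderiv_self hn (contDiff_shear_left hd y)
    (hasCompactSupport_shear_left hs y)
  simp only [shear_hasFDerivAt_left _ y _ hd] at h3
  rw [h3]
  simp [shear, diagEmb]

end Shear

/-! ### The Green operator applied to the diagonal and to a point -/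

/-- The oriented basis of the diagonal. -/
abbrev diagVec (n : ℕ) (i : Fin n) : E (n + n) := diagEmb n (stdVec n i)

/-- The coefficient of `G(δ)`. -/
def diagNewton (n : ℕ) (u : E n) : ℝ :=
  (2 * (((n : ℝ) - 2) * sphereArea n))⁻¹ * (‖u‖ ^ (n - 2))⁻¹

theorem locallyIntegrable_diagNewton {n : ℕ} (hn : 3 ≤ n) : LocallyIntegrable (diagNewton n) :=
  (locallyIntegrable_norm_pow_inv (n := n) (k := n - 2) (by omega)).smul
    (2 * (((n : ℝ) - 2) * sphereArea n))⁻¹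

theorem sub_two_pos {n : ℕ} (hn : 3 ≤ n) : (0 : ℝ) < (n : ℝ) - 2 := by
  have : (3 : ℝ) ≤ n := by exact_mod_cast hn
  linarith

theorem diagNewton_pos {n : ℕ} (hn : 3 ≤ n) {u : E n} (hu : u ≠ 0) : 0 < diagNewton n u := by
  have h1 := sub_two_pos hn
  have h2 := sphereArea_pos (n := n) (by omega)
  have h3 := norm_pos_iff.2 hu
  unfold diagNewton
  positivity

theorem newton_nonneg {N : ℕ} (hN : 3 ≤ N) (x : E N) : 0 ≤ newton N x := by
  have h1 := sub_two_pos hN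
  have h2 := sphereArea_pos (n := N) (by omega)
  unfold newton
  positivity

theorem measurable_newton (N : ℕ) : Measurable (newton N) := by
  unfold newton; fun_prop

theorem integral_newton_diag {n : ℕ} (hn : 3 ≤ n) {z : E (n + n)} (hz : diffMap n z ≠ 0) :
    ∫ x, newton (n + n) (z - diagEmb n x) = diagNewton n (diffMap n z) :=
  integral_green_diag hn hz

/-- The integral has a positive value, whereas the integral of a nonintegrable function is zero by
convention. -/
theorem integrable_newton_diag {n : ℕ} (hn : 3 ≤ n) {z : E (n + n)} (hz : diffMap n z ≠ 0) :
    Integrable fun x => newton (n + n) (z - diagEmb n x) := by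
  by_contra h
  have h1 := integral_newton_diag hn hz
  rw [integral_undef h] at h1
  exact (diagNewton_pos hn hz).ne h1

/-- The kernel is nonnegative, so Tonelli needs only the inner integral along the diagonal, which is
`diagNewton`; this is locally integrable in (x, y). The lemma provides both the absolute convergence
of the integrals defining G(δ) and their evaluation by Fubini. -/
theorem integrable_newton_diag_prod {n : ℕ} (hn : 3 ≤ n) {h : E (n + n) → ℝ} (hc : Continuous h)
    (hs : HasCompactSupport h) :
    Integrable (fun p : E n × E (n + n) => newton (n + n) (p.2 - diagEmb n p.1) * h p.2)
      (volume.prod volume) := by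
  have hm : AEStronglyMeasurable
      (fun p : E n × E (n + n) => newton (n + n) (p.2 - diagEmb n p.1) * h p.2)
      (volume.prod volume) := by
    refine Measurable.aestronglyMeasurable (Measurable.mul ((measurable_newton _).comp ?_) ?_)
    · exact (continuous_snd.sub
        ((isClosedEmbedding_diagEmb n).continuous.comp continuous_fst)).measurable
    · exact (hc.comp continuous_snd).measurable
  rw [integrable_prod_iff' hm]
  have hae := ae_diffMap_ne_zero (n := n) (by omega)
  refine ⟨?_, ?_⟩
  · filter_upwards [hae] with z hz
    exact (integrable_newton_diag hn hz).mul_const _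
  · have h1 := (integrable_comp_diffMap_mul (locallyIntegrable_diagNewton hn) hc hs).norm
    refine h1.congr ?_
    filter_upwards [hae] with z hz
    simp only [norm_mul, Real.norm_of_nonneg (newton_nonneg (by omega : 3 ≤ n + n) _)]
    rw [integral_mul_const, integral_newton_diag hn hz, Real.norm_of_nonneg (diagNewton_pos hn hz).le]

theorem integrable_green_diag {n : ℕ} (hn : 3 ≤ n) (θ : TestForm (n + n) n) :
    Integrable fun x : E n => green θ (diagEmb n x) (diagVec n) := by
  have h := (integrable_newton_diag_prod hn (contDiff_evalAt θ.contDiff (diagVec n)).continuous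
    (hasCompactSupport_evalAt θ.hasCompactSupport (diagVec n))).integral_prod_left
  refine h.congr (ae_of_all _ fun x => ?_)
  simp only
  rw [green_apply (by omega) θ.continuous θ.hasCompactSupport]

theorem integral_green_diag_eq {n : ℕ} (hn : 3 ≤ n) (θ : TestForm (n + n) n) :
    ∫ x : E n, green θ (diagEmb n x) (diagVec n) =
      ∫ z, diagNewton n (diffMap n z) * θ z (diagVec n) := by
  have h := integrable_newton_diag_prod hn (contDiff_evalAt θ.contDiff (diagVec n)).continuous
    (hasCompactSupport_evalAt θ.hasCompactSupport (diagVec n))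
  have h2 := integral_integral_swap
    (f := fun (x : E n) (z : E (n + n)) => newton (n + n) (z - diagEmb n x) * θ z (diagVec n)) h
  calc ∫ x : E n, green θ (diagEmb n x) (diagVec n)
      = ∫ x : E n, ∫ z, newton (n + n) (z - diagEmb n x) * θ z (diagVec n) := by
        refine integral_congr_ae (ae_of_all _ fun x => ?_)
        exact green_apply (by omega) θ.continuous θ.hasCompactSupport _ _
    _ = _ := h2
    _ = _ := by
        refine integral_congr_ae ?_
        filter_upwards [ae_diffMap_ne_zero (n := n) (by omega)] with z hz
        rw [integral_mul_const, integral_newton_diag hn hz]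

/-- The current `G(δ)`. -/
def greenDiag (n : ℕ) : Current (n + n) n :=
  TestFunction.integralAgainstBilinCLM ((ContinuousLinearMap.mul ℝ ℝ).comp (diagEval n)) volume
    fun z => diagNewton n (diffMap n z)

theorem greenDiag_apply {n : ℕ} (hn : 3 ≤ n) (θ : TestForm (n + n) n) :
    greenDiag n θ = ∫ z, diagNewton n (diffMap n z) * θ z (diagVec n) := by
  rw [greenDiag, TestFunction.integralAgainstBilinCLM_eq_integral
    ((locallyIntegrable_comp_diffMap (locallyIntegrable_diagNewton hn)).locallyIntegrableOn _)]
  refine integral_congr_ae (ae_of_all _ fun z => ?_)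
  exact mul_comm _ _

/-- Dominated convergence: the cut-offs are bounded by the supremum of χ, tend to 1 pointwise, and
G(ω) is integrable over the diagonal. -/
theorem isGreenOf_diag {n : ℕ} (hn : 3 ≤ n) : IsGreenOf (diagCurrent n) (greenDiag n) := by
  intro θ χ hχ
  obtain ⟨η, hη⟩ := exists_cutoff_green (by omega) θ χ
  refine ⟨η, hη, ?_⟩
  rw [greenDiag_apply hn, ← integral_green_diag_eq hn]
  obtain ⟨C, hC⟩ := χ.hasCompactSupport.exists_bound_of_continuous χ.continuous
  have h1 : Tendsto (fun R : ℝ => ∫ x : E n, χ (R⁻¹ • diagEmb n x) *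
      green θ (diagEmb n x) (diagVec n)) atTop
      (𝓝 (∫ x : E n, green θ (diagEmb n x) (diagVec n))) := by
    refine tendsto_integral_filter_of_dominated_convergence
      (fun x => C * ‖green θ (diagEmb n x) (diagVec n)‖) ?_ ?_
      ((integrable_green_diag hn θ).norm.const_mul C) ?_
    · refine Eventually.of_forall fun R => ?_
      refine AEStronglyMeasurable.mul ?_ (integrable_green_diag hn θ).aestronglyMeasurable
      exact (χ.continuous.comp
        ((isClosedEmbedding_diagEmb n).continuous.const_smul R⁻¹)).aestronglyMeasurable
    · refine Eventually.of_forall fun R => ae_of_all _ fun x => ?_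
      rw [norm_mul]
      exact mul_le_mul_of_nonneg_right (hC _) (norm_nonneg _)
    · refine ae_of_all _ fun x => ?_
      simpa using (tendsto_cutoff χ hχ (diagEmb n x)).mul_const _
  refine h1.congr' ?_
  filter_upwards [eventually_gt_atTop 0] with R hR
  rw [diagCurrent_apply]
  refine integral_congr_ae (ae_of_all _ fun x => ?_)
  simp only [hη R hR]
  rfl

/-- The current `G(δ_0)`. -/
def greenPoint (n : ℕ) : Current n 0 :=
  TestFunction.integralAgainstBilinCLM ((ContinuousLinearMap.mul ℝ ℝ).comp (evalAt ![])) volume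
    (newton n)

theorem greenPoint_apply {n : ℕ} (hn : 3 ≤ n) (θ : TestForm n 0) :
    greenPoint n θ = ∫ x, newton n x * θ x ![] := by
  rw [greenPoint, TestFunction.integralAgainstBilinCLM_eq_integral
    ((locallyIntegrable_newton hn).locallyIntegrableOn _)]
  refine integral_congr_ae (ae_of_all _ fun z => ?_)
  exact mul_comm _ _

/-- The Dirac current sees only the origin, where every rescaled cut-off equals 1, so no limit has
to be taken. -/
theorem isGreenOf_point {n : ℕ} (hn : 3 ≤ n) : IsGreenOf (diracCurrent n) (greenPoint n) := by
  intro θ χ hχ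
  obtain ⟨η, hη⟩ := exists_cutoff_green hn θ χ
  refine ⟨η, hη, tendsto_const_nhds.congr' ?_⟩
  filter_upwards [eventually_gt_atTop 0] with R hR
  change _ = η R 0 ![]
  rw [hη R hR, smul_zero, hχ.self_of_nhds, one_smul, greenPoint_apply hn,
    green_apply hn θ.continuous θ.hasCompactSupport]
  simp

/-! ### The Biot–Savart forms -/

theorem continuous_contract {N k : ℕ} (A : Cov N (k + 1)) :
    Continuous fun x => contract x (k + 1) A := A.curryLeft.continuous

theorem locallyIntegrable_pointForm {n : ℕ} (hn : 0 < n) : LocallyIntegrable (pointForm n) := by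
  obtain ⟨m, rfl⟩ : ∃ m, n = m + 1 := ⟨n - 1, by omega⟩
  refine LocallyIntegrable.mono ((locallyIntegrable_norm_pow_inv (n := m + 1) (k := m)
    (by omega)).smul ((sphereArea (m + 1))⁻¹ * ‖volForm (m + 1)‖)) ?_ (ae_of_all _ fun x => ?_)
  · have : pointForm (m + 1) = fun x => ((sphereArea (m + 1))⁻¹ * (‖x‖ ^ (m + 1))⁻¹) •
      contract x (m + 1) (volForm (m + 1)) := funext pointForm_eq
    rw [this]
    have h1 : Measurable fun x : E (m + 1) => (sphereArea (m + 1))⁻¹ * (‖x‖ ^ (m + 1))⁻¹ := by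
      fun_prop
    exact h1.aestronglyMeasurable.smul
      (continuous_contract _).aestronglyMeasurable
  · have hS := sphereArea_pos (n := m + 1) (by omega)
    have h1 : ‖contract x (m + 1) (volForm (m + 1))‖ ≤ ‖volForm (m + 1)‖ * ‖x‖ := by
      have := (volForm (m + 1)).curryLeft.le_opNorm x
      rwa [ContinuousAlternatingMap.norm_curryLeft] at this
    by_cases hx : x = 0
    · have h2 : contract x (m + 1) (volForm (m + 1)) = 0 := by
        rw [← norm_le_zero_iff]; simpa [hx] using h1
      rw [pointForm_eq, h2, smul_zero, norm_zero]
      positivity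
    have h2 := norm_pos_iff.2 hx
    rw [pointForm_eq, norm_smul, Pi.smul_apply, smul_eq_mul, norm_mul, norm_mul, norm_mul,
      norm_norm, mul_assoc, mul_assoc]
    refine mul_le_mul_of_nonneg_left ?_ (norm_nonneg _)
    rw [Real.norm_of_nonneg (by positivity), Real.norm_of_nonneg (by positivity)]
    calc (‖x‖ ^ (m + 1))⁻¹ * ‖contract x (m + 1) (volForm (m + 1))‖
        ≤ (‖x‖ ^ (m + 1))⁻¹ * (‖volForm (m + 1)‖ * ‖x‖) := by gcongr
      _ = _ := by rw [pow_succ]; field_simp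

theorem LocallyIntegrable.clm_apply {X F G : Type*} [TopologicalSpace X] [MeasurableSpace X]
    {μ : Measure X} [NormedAddCommGroup F] [NormedSpace ℝ F] [NormedAddCommGroup G]
    [NormedSpace ℝ G] {f : X → F} (hf : LocallyIntegrable f μ) (L : F →L[ℝ] G) :
    LocallyIntegrable (fun x => L (f x)) μ := by
  intro x
  obtain ⟨s, hs, h⟩ := hf x
  exact ⟨s, hs, L.integrable_comp h⟩

theorem locallyIntegrable_diagForm {n : ℕ} (hn : 0 < n) : LocallyIntegrable (diagForm n) := by
  have h := LocallyIntegrable.clm_apply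
    (locallyIntegrable_comp_diffMap (locallyIntegrable_pointForm hn))
    (ContinuousAlternatingMap.compContinuousLinearMapCLM (diffMap n) :
      Cov n (n - 1) →L[ℝ] Cov (n + n) (n - 1))
  refine h.congr (ae_of_all _ fun z => ?_)
  exact (diagForm_eq z).symm

theorem codiffAlong_apply {N k m : ℕ} (v : Fin m → E N) (θ : E N → Cov N (k + 1)) (x : E N)
    (w : Fin k → E N) :
    codiffAlong v θ x w = -∑ i, fderiv ℝ θ x (v i) (Matrix.vecCons (v i) w) := by
  rw [codiffAlong, ContinuousAlternatingMap.neg_apply, ContinuousAlternatingMap.sum_apply]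
  rfl

/-- The sum of (0, e_i) and (e_i, 0) is already one of the diagonal vectors in the tuple. -/
theorem cons_pair_diagVec {n : ℕ} (A : Cov (n + n) (n + 1)) (i : Fin n) :
    A (Matrix.vecCons (pair 0 (stdVec n i)) (diagVec n)) =
      -A (Matrix.vecCons (pair (stdVec n i) 0) (diagVec n)) := by
  rw [eq_neg_iff_add_eq_zero]
  have h1 := A.toMultilinearMap.cons_add (diagVec n) (pair 0 (stdVec n i)) (pair (stdVec n i) 0)
  refine Eq.trans h1.symm ?_
  refine A.map_eq_zero_of_eq _ (i := 0) (j := i.succ) ?_ (Fin.succ_ne_zero i).symm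
  simp [← pair_add, diagVec, diagEmb]

theorem vecCons_sum_smul {N k : ℕ} {ι : Type*} (A : Cov N (k + 1)) (s : Finset ι) (c : ι → ℝ)
    (x : ι → E N) (w : Fin k → E N) :
    A (Matrix.vecCons (∑ i ∈ s, c i • x i) w) = ∑ i ∈ s, c i * A (Matrix.vecCons (x i) w) := by
  change contract (∑ i ∈ s, c i • x i) (k + 1) A w = _
  have : contract (∑ i ∈ s, c i • x i) (k + 1) A = ∑ i ∈ s, c i • contract (x i) (k + 1) A := by
    change A.curryLeft _ = _
    rw [map_sum]
    simp only [map_smul]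
    rfl
  rw [this, ContinuousAlternatingMap.sum_apply]
  rfl

theorem pair_left_eq_sum {n : ℕ} (x : E n) : pair x 0 = ∑ i, x i • pair (stdVec n i) 0 := by
  have h : ∀ s : Finset (Fin n), pair (∑ i ∈ s, x i • stdVec n i) 0 =
      ∑ i ∈ s, x i • pair (stdVec n i) 0 := by
    intro s
    induction s using Finset.induction_on with
    | empty => simpa using pair_zero
    | insert a s ha ih =>
      rw [Finset.sum_insert ha, Finset.sum_insert ha, ← ih, ← pair_smul_left, ← pair_add, add_zero]
  rw [← h, sum_smul_stdVec]

theorem inner_stdVec {n : ℕ} (x : E n) (i : Fin n) : inner ℝ x (stdVec n i) = x i := by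
  simp [stdVec, EuclideanSpace.inner_single_right]

/-- The vector (0, e_i) = (e_i, e_i) - (e_i, 0) occurs twice, as direction of differentiation and as
contracted vector. In the latter place only -(e_i, 0) counts, so the two halves of the basis
contribute 2 ∂_{(e_i,0)} minus a derivative along the diagonal. -/
theorem codiff_diagVec {n : ℕ} (η : TestForm (n + n) (n + 1)) (z : E (n + n)) :
    codiff η z (diagVec n) = -∑ i, (2 * fderiv ℝ (fun z => η z
      (Matrix.vecCons (pair (stdVec n i) 0) (diagVec n))) z (pair (stdVec n i) 0) -
      fderiv ℝ (fun z => η z (Matrix.vecCons (pair (stdVec n i) 0) (diagVec n))) z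
        (diagVec n i)) := by
  have hd : DifferentiableAt ℝ η z := η.contDiff.differentiable (by simp) z
  refine (codiffAlong_apply (stdVec (n + n)) η z (diagVec n)).trans ?_
  rw [Fin.sum_univ_add, ← Finset.sum_add_distrib]
  congr 1
  refine Finset.sum_congr rfl fun i _ => ?_
  rw [fderiv_evalAt hd, fderiv_evalAt hd, stdVec_castAdd, stdVec_natAdd, cons_pair_diagVec]
  have : diagVec n i = pair (stdVec n i) 0 + pair 0 (stdVec n i) := by
    rw [← pair_add, add_zero, zero_add, diagVec, diagEmb]
  rw [this, map_add]
  rw [ContinuousAlternatingMap.add_apply]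
  ring

theorem integrable_pow_inv_diffMap_cons {n : ℕ} (hn : 0 < n) (η : TestForm (n + n) (n + 1)) :
    Integrable fun z => (‖diffMap n z‖ ^ n)⁻¹ *
      η z (Matrix.vecCons (pair (diffMap n z) 0) (diagVec n)) := by
  have h : ∀ i, Integrable fun z => (‖diffMap n z‖ ^ n)⁻¹ * inner ℝ (diffMap n z) (stdVec n i) *
      η z (Matrix.vecCons (pair (stdVec n i) 0) (diagVec n)) := fun i =>
    integrable_comp_diffMap_mul (locallyIntegrable_pow_inv_mul_inner hn (stdVec n i))
      (contDiff_evalAt η.contDiff _).continuous (hasCompactSupport_evalAt η.hasCompactSupport _)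
  refine (integrable_finsetSum Finset.univ fun i _ => h i).congr (ae_of_all _ fun z => ?_)
  simp only
  rw [pair_left_eq_sum, vecCons_sum_smul, Finset.mul_sum]
  refine Finset.sum_congr rfl fun i _ => ?_
  rw [inner_stdVec, mul_assoc]

/-- The diagonal derivatives of `codiff_diagVec` integrate to zero. The factor 2 cancels the one
half in `diagNewton`, and the factor n - 2 from integration by parts cancels its remaining
normalization. -/
theorem currentCodiff_greenDiag_apply {n : ℕ} (hn : 3 ≤ n) (η : TestForm (n + n) (n + 1)) :
    currentCodiff (greenDiag n) η = (-1) ^ (n + 1) * ((sphereArea n)⁻¹ *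
      ∫ z, (‖diffMap n z‖ ^ n)⁻¹ * η z (Matrix.vecCons (pair (diffMap n z) 0) (diagVec n))) := by
  have h0 : currentCodiff (greenDiag n) η = (-1) ^ n * greenDiag n (codiffTest (n + n) (n + 1) η) := by
    rw [currentCodiff, Nat.add_sub_cancel]
    rfl
  have hd : ContDiff ℝ 1 η := η.contDiff.of_le (by exact_mod_cast le_top)
  let f : Fin n → E (n + n) → ℝ := fun i z =>
    η z (Matrix.vecCons (pair (stdVec n i) 0) (diagVec n))
  have hfd : ∀ i, ContDiff ℝ 1 (f i) := fun i => contDiff_evalAt hd _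
  have hfs : ∀ i, HasCompactSupport (f i) := fun i =>
    hasCompactSupport_evalAt η.hasCompactSupport _
  have hlin : ∀ i (v : E (n + n)), Integrable fun z =>
      diagNewton n (diffMap n z) * fderiv ℝ (f i) z v := fun i v =>
    integrable_comp_diffMap_mul (locallyIntegrable_diagNewton hn)
      (continuous_fderiv_apply_of_contDiff (hfd i) continuous_const)
      (hasCompactSupport_fderiv_apply (hfs i) _)
  have hi : ∀ i, Integrable fun z => (‖diffMap n z‖ ^ n)⁻¹ *
      inner ℝ (diffMap n z) (stdVec n i) * f i z := fun i =>
    integrable_comp_diffMap_mul (locallyIntegrable_pow_inv_mul_inner (by omega) (stdVec n i))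
      (hfd i).continuous (hfs i)
  have h1 : ∀ i, ∫ z, diagNewton n (diffMap n z) * (2 * fderiv ℝ (f i) z (pair (stdVec n i) 0) -
      fderiv ℝ (f i) z (diagVec n i)) = (sphereArea n)⁻¹ * ∫ z, (‖diffMap n z‖ ^ n)⁻¹ *
      inner ℝ (diffMap n z) (stdVec n i) * f i z := by
    intro i
    have h2 : ∀ z, diagNewton n (diffMap n z) * (2 * fderiv ℝ (f i) z (pair (stdVec n i) 0) -
        fderiv ℝ (f i) z (diagVec n i)) =
        2 * (diagNewton n (diffMap n z) * fderiv ℝ (f i) z (pair (stdVec n i) 0)) -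
        diagNewton n (diffMap n z) * fderiv ℝ (f i) z (diagVec n i) := fun z => by ring
    simp only [h2]
    rw [integral_sub ((hlin i _).const_mul 2) (hlin i _), integral_const_mul,
      integral_comp_diffMap_mul_fderiv_diag (locallyIntegrable_diagNewton hn) (hfd i) (hfs i),
      sub_zero]
    simp only [diagNewton, mul_assoc]
    rw [integral_const_mul, integral_diffMap_pow_inv_mul_fderiv hn (hfd i) (hfs i)]
    have h3 := (sub_two_pos hn).ne'
    have h4 := (sphereArea_pos (n := n) (by omega)).ne'
    simp only [mul_assoc]
    field_simp
  rw [h0, greenDiag_apply hn]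
  have h5 : ∀ z, diagNewton n (diffMap n z) * codiffTest (n + n) (n + 1) η z (diagVec n) =
      -∑ i, diagNewton n (diffMap n z) * (2 * fderiv ℝ (f i) z (pair (stdVec n i) 0) -
        fderiv ℝ (f i) z (diagVec n i)) := by
    intro z
    rw [codiffTest_apply]
    refine (congrArg _ (codiff_diagVec η z)).trans ?_
    rw [← Finset.mul_sum, mul_neg]
  simp only [h5]
  rw [integral_neg, integral_finsetSum]
  · simp only [h1]
    rw [← Finset.mul_sum, ← integral_finsetSum _ fun i _ => hi i, pow_succ]
    have h6 : ∀ z, ∑ i, (‖diffMap n z‖ ^ n)⁻¹ * inner ℝ (diffMap n z) (stdVec n i) * f i z =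
        (‖diffMap n z‖ ^ n)⁻¹ * η z (Matrix.vecCons (pair (diffMap n z) 0) (diagVec n)) := by
      intro z
      rw [pair_left_eq_sum, vecCons_sum_smul, Finset.mul_sum]
      refine Finset.sum_congr rfl fun i _ => ?_
      rw [inner_stdVec, mul_assoc]
    simp only [h6]
    ring
  · intro i _
    refine (((hlin i (pair (stdVec n i) 0)).const_mul 2).sub (hlin i (diagVec n i))).congr
      (ae_of_all _ fun z => ?_)
    simp only [Pi.sub_apply]
    ring

theorem represents_diagForm {n : ℕ} (hn : 3 ≤ n) (h : n - 1 + (n + 1) = n + n) :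
    Represents h (diagForm n) (currentCodiff (greenDiag n)) := by
  refine ⟨locallyIntegrable_diagForm (by omega), fun η => ?_⟩
  rw [currentCodiff_greenDiag_apply hn, ← integral_const_mul, ← integral_const_mul]
  obtain ⟨m, rfl⟩ : ∃ m, n = m + 1 := ⟨n - 1, by omega⟩
  refine integral_congr_ae (ae_of_all _ fun z => ?_)
  refine Eq.trans ?_ (topWedge_diagForm (m := m) h z (η z)).symm
  simp only
  ring

/-- Of all the terms of the exterior derivative, only the first differentiates across the diagonal.
The others are diagonal derivatives, and expanding the difference vector in coordinates gives each
of them a coefficient depending on x - y alone. -/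
theorem dTest_cons_diagVec {m : ℕ} (θ : TestForm (m + 1 + (m + 1)) (m + 1)) (c : ℝ)
    (z : E (m + 1 + (m + 1))) :
    c * dTest (m + 1 + (m + 1)) (m + 1) θ z
      (Matrix.vecCons (pair (diffMap (m + 1) z) 0) (diagVec (m + 1))) =
      c * fderiv ℝ (fun z => θ z (diagVec (m + 1))) z (pair (diffMap (m + 1) z) 0) +
      ∑ j : Fin (m + 1), ∑ k : Fin (m + 1), (-1) ^ ((j : ℕ) + 1) * (c *
        inner ℝ (diffMap (m + 1) z) (stdVec (m + 1) k) * fderiv ℝ (fun z =>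
          θ z (Matrix.vecCons (pair (stdVec (m + 1) k) 0)
            (fun i : Fin m => diagVec (m + 1) (j.succAbove i)))) z (diagVec (m + 1) j)) := by
  have hd : ContDiff ℝ 1 θ := θ.contDiff.of_le (by exact_mod_cast le_top)
  have hdz := hd.differentiable one_ne_zero z
  rw [dTest_apply, extDeriv_apply hdz, Fin.sum_univ_succ, mul_add, Finset.mul_sum]
  congr 1
  · refine congrArg (c * ·) ?_
    rw [fderiv_evalAt hdz, fderiv_evalAt hdz]
    simp
  · refine Finset.sum_congr rfl fun j _ => ?_
    have h1 : (j.succ.removeNth (Matrix.vecCons (pair (diffMap (m + 1) z) 0) (diagVec (m + 1))) :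
        Fin (m + 1) → E (m + 1 + (m + 1))) = Matrix.vecCons (pair (diffMap (m + 1) z) 0)
        (fun i : Fin m => diagVec (m + 1) (j.succAbove i)) := by
      funext i
      refine Fin.cases ?_ (fun i => ?_) i
      · rw [Fin.removeNth, Fin.succ_succAbove_zero]; rfl
      · rw [Fin.removeNth, Fin.succ_succAbove_succ]; rfl
    have h2 : (Matrix.vecCons (pair (diffMap (m + 1) z) 0) (diagVec (m + 1)) : Fin (m + 1 + 1) → E (m + 1 + (m + 1))) j.succ =
        diagVec (m + 1) j := rfl
    rw [h1, h2, fderiv_evalAt hdz, pair_left_eq_sum, vecCons_sum_smul, Fin.val_succ, zsmul_eq_mul, Finset.mul_sum,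
      Finset.mul_sum]
    refine Finset.sum_congr rfl fun k _ => ?_
    rw [inner_stdVec, fderiv_evalAt hdz]
    push_cast
    ring

/-- After the diagonal derivatives are discarded, the radial derivative contributes -|S^{n-1}| times
the integral over the diagonal. The sign conventions for d and d^* together contribute another -1.
-/
theorem currentD_currentCodiff_greenDiag_succ {m : ℕ} (hn : 3 ≤ m + 1) :
    currentD (currentCodiff (greenDiag (m + 1))) = diagCurrent (m + 1) := by
  ext θ
  have h0 : currentD (currentCodiff (greenDiag (m + 1))) θ =
      (-1) ^ (m + 1) * currentCodiff (greenDiag (m + 1)) (dTest (m + 1 + (m + 1)) (m + 1) θ) := by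
    rw [currentD, Nat.add_sub_cancel]
    rfl
  have hd : ContDiff ℝ 1 θ := θ.contDiff.of_le (by exact_mod_cast le_top)
  let f : E (m + 1 + (m + 1)) → ℝ := fun z => θ z (diagVec (m + 1))
  let g : Fin (m + 1) → Fin (m + 1) → E (m + 1 + (m + 1)) → ℝ := fun j k z =>
    θ z (Matrix.vecCons (pair (stdVec (m + 1) k) 0) (fun i : Fin m => diagVec (m + 1) (j.succAbove i)))
  have hg : ∀ j k, ∫ z, (‖diffMap (m + 1) z‖ ^ (m + 1))⁻¹ * inner ℝ (diffMap (m + 1) z) (stdVec (m + 1) k) *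
      fderiv ℝ (g j k) z (diagVec (m + 1) j) = 0 := fun j k =>
    integral_comp_diffMap_mul_fderiv_diag (locallyIntegrable_pow_inv_mul_inner (by omega) _)
      (contDiff_evalAt hd _) (hasCompactSupport_evalAt θ.hasCompactSupport _) _
  have hgi : ∀ j k, Integrable fun z => (‖diffMap (m + 1) z‖ ^ (m + 1))⁻¹ *
      inner ℝ (diffMap (m + 1) z) (stdVec (m + 1) k) * fderiv ℝ (g j k) z (diagVec (m + 1) j) := fun j k =>
    integrable_comp_diffMap_mul (locallyIntegrable_pow_inv_mul_inner (by omega) _)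
      (continuous_fderiv_apply_of_contDiff (contDiff_evalAt hd _) continuous_const)
      (hasCompactSupport_fderiv_apply (hasCompactSupport_evalAt θ.hasCompactSupport _) _)
  have key := fun z => dTest_cons_diagVec θ (‖diffMap (m + 1) z‖ ^ (m + 1))⁻¹ z
  have hint := integrable_pow_inv_diffMap_cons (n := m + 1) (by omega) (dTest (m + 1 + (m + 1)) (m + 1) θ)
  have hsum : Integrable fun z => ∑ j : Fin (m + 1), ∑ k : Fin (m + 1), (-1) ^ ((j : ℕ) + 1) *
      ((‖diffMap (m + 1) z‖ ^ (m + 1))⁻¹ * inner ℝ (diffMap (m + 1) z) (stdVec (m + 1) k) *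
        fderiv ℝ (g j k) z (diagVec (m + 1) j)) :=
    integrable_finsetSum _ fun j _ => integrable_finsetSum _ fun k _ => (hgi j k).const_mul _
  simp only [key] at hint
  -- The radial term is integrable as the difference of the full expression and the diagonal terms.
  have hint1 : Integrable fun z => (‖diffMap (m + 1) z‖ ^ (m + 1))⁻¹ *
      fderiv ℝ f z (pair (diffMap (m + 1) z) 0) := by
    exact (hint.sub hsum).congr (ae_of_all _ fun z => add_sub_cancel_right _ _)
  have h7 := integral_diffMap_pow_inv_mul_fderiv_self (n := m + 1) (by omega)
    (contDiff_evalAt hd (diagVec (m + 1))) (hasCompactSupport_evalAt θ.hasCompactSupport _) hint1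
  rw [h0, currentCodiff_greenDiag_apply hn, diagCurrent_apply]
  simp only [key]
  rw [integral_add hint1 hsum, h7, integral_finsetSum _ fun j _ =>
    integrable_finsetSum _ fun k _ => (hgi j k).const_mul _]
  have h8 : ∀ j : Fin (m + 1), ∫ z, ∑ k : Fin (m + 1), (-1) ^ ((j : ℕ) + 1) * ((‖diffMap (m + 1) z‖ ^ (m + 1))⁻¹ *
      inner ℝ (diffMap (m + 1) z) (stdVec (m + 1) k) * fderiv ℝ (g j k) z (diagVec (m + 1) j)) = 0 := by
    intro j
    rw [integral_finsetSum _ fun k _ => (hgi j k).const_mul _]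
    refine Finset.sum_eq_zero fun k _ => ?_
    rw [integral_const_mul, hg, mul_zero]
  simp only [h8, Finset.sum_const_zero, add_zero]
  have hS := (sphereArea_pos (n := m + 1) (by omega)).ne'
  rw [pow_succ (-1 : ℝ) (m + 1)]
  have h9 : ((-1 : ℝ) ^ (m + 1)) * (-1) ^ (m + 1) = 1 := by rw [← mul_pow]; simp
  set I := ∫ y, θ (diagEmb (m + 1) y) (diagVec (m + 1))
  calc (-1 : ℝ) ^ (m + 1) * ((-1) ^ (m + 1) * -1 * ((sphereArea (m + 1))⁻¹ * -(sphereArea (m + 1) * I)))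
      = ((-1 : ℝ) ^ (m + 1) * (-1) ^ (m + 1)) * (((sphereArea (m + 1))⁻¹ * sphereArea (m + 1)) * I) := by ring
    _ = I := by rw [h9, inv_mul_cancel₀ hS, one_mul, one_mul]

theorem currentD_currentCodiff_greenDiag {n : ℕ} (hn : 3 ≤ n) :
    currentD (currentCodiff (greenDiag n)) = diagCurrent n := by
  obtain ⟨m, rfl⟩ : ∃ m, n = m + 1 := ⟨n - 1, by omega⟩
  exact currentD_currentCodiff_greenDiag_succ hn

theorem represents_pointForm {n : ℕ} (hn : 3 ≤ n) (h : n - 1 + 1 = n) :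
    Represents h (pointForm n) (currentCodiff (greenPoint n)) := by
  refine ⟨locallyIntegrable_pointForm (by omega), fun η => ?_⟩
  have h0 : currentCodiff (greenPoint n) η = (-1) ^ n * greenPoint n (codiffTest n 1 η) := by
    rw [currentCodiff]
    rfl
  have hd : ContDiff ℝ 1 η := η.contDiff.of_le (by exact_mod_cast le_top)
  let f : Fin n → E n → ℝ := fun i z => η z ![stdVec n i]
  have hfd : ∀ i, ContDiff ℝ 1 (f i) := fun i => contDiff_evalAt hd _
  have hfs : ∀ i, HasCompactSupport (f i) := fun i =>
    hasCompactSupport_evalAt η.hasCompactSupport _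
  have hl : ∀ i, Integrable fun z => newton n z * fderiv ℝ (f i) z (stdVec n i) := fun i =>
    (locallyIntegrable_newton hn).integrable_smul_right_of_hasCompactSupport
      (continuous_fderiv_apply_of_contDiff (hfd i) continuous_const)
      (hasCompactSupport_fderiv_apply (hfs i) _)
  have hi : ∀ i, Integrable fun z => (‖z‖ ^ n)⁻¹ * (inner ℝ z (stdVec n i) * f i z) := fun i =>
    integrable_inner_pow_inv_mul (by omega) (hfd i).continuous (hfs i) _
  have h1 : ∀ i, ∫ z, newton n z * fderiv ℝ (f i) z (stdVec n i) =
      (sphereArea n)⁻¹ * ∫ z, (‖z‖ ^ n)⁻¹ * (inner ℝ z (stdVec n i) * f i z) := by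
    intro i
    simp only [newton_eq, mul_assoc]
    rw [integral_const_mul, integral_pow_inv_mul_fderiv hn (hfd i) (hfs i)]
    have h3 := (sub_two_pos hn).ne'
    have h4 := (sphereArea_pos (n := n) (by omega)).ne'
    field_simp
  have h5 : ∀ z, newton n z * codiffTest n 1 η z ![] =
      -∑ i, newton n z * fderiv ℝ (f i) z (stdVec n i) := by
    intro z
    rw [codiffTest_apply]
    refine (congrArg _ (codiffAlong_apply (k := 0) (stdVec n) η z ![])).trans ?_
    rw [← Finset.mul_sum, mul_neg]
    congr 2
    refine Finset.sum_congr rfl fun i _ => ?_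
    rw [fderiv_evalAt (hd.differentiable one_ne_zero z)]
  rw [h0, greenPoint_apply hn]
  simp only [h5]
  rw [integral_neg, integral_finsetSum _ fun i _ => hl i]
  simp only [h1]
  rw [← Finset.mul_sum, ← integral_finsetSum _ fun i _ => hi i, mul_neg, ← integral_const_mul,
    ← integral_const_mul, ← integral_neg]
  refine integral_congr_ae (ae_of_all _ fun z => ?_)
  obtain ⟨m, rfl⟩ : ∃ m, n = m + 1 := ⟨n - 1, by omega⟩
  refine Eq.trans ?_ (topWedge_pointForm h z (η z)).symm
  have h6 : η z ![z] = ∑ i, z i * f i z := by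
    have := vecCons_sum_smul (η z) Finset.univ (fun i => z i) (stdVec (m + 1)) ![]
    rw [sum_smul_stdVec] at this
    exact this
  rw [h6]
  simp only [Nat.add_sub_cancel, inner_stdVec, Finset.mul_sum, ← Finset.sum_neg_distrib]
  refine Finset.sum_congr rfl fun i _ => ?_
  ring

/-! ### The Green kernels -/

/-- The coefficients `c_{kj}` with `∑_j c_{kj} j^l = δ_{kl}`. -/
def interpCoeff (n : ℕ) (k j : Fin (n + 1)) : ℝ :=
  (Matrix.vandermonde fun i : Fin (n + 1) => ((i : ℕ) : ℝ))⁻¹ k j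

theorem sum_interpCoeff {n : ℕ} (k l : Fin (n + 1)) :
    ∑ j, interpCoeff n k j * ((j : ℕ) : ℝ) ^ (l : ℕ) = if k = l then 1 else 0 := by
  have hdet : IsUnit (Matrix.vandermonde fun i : Fin (n + 1) => ((i : ℕ) : ℝ)).det := by
    rw [isUnit_iff_ne_zero, Matrix.det_vandermonde_ne_zero_iff]
    intro i j h
    exact Fin.ext (Nat.cast_injective (R := ℝ) h)
  have h := congrFun (congrFun (Matrix.nonsing_inv_mul _ hdet) k) l
  rw [Matrix.mul_apply, Matrix.one_apply] at h
  exact h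

/-- The part of bidegree `(n - k, k)` of the pull-back of the volume form under `x - y`. -/
def volPart (n : ℕ) (k : Fin (n + 1)) : Cov (n + n) n :=
  ∑ j, interpCoeff n k j • mixForm n ((j : ℕ) : ℝ)

/-- The number of coordinate vectors of the second factor. -/
def sndCount {n p : ℕ} (f : Fin p → Fin (n + n)) : ℕ :=
  (Finset.univ.filter fun i => n ≤ (f i : ℕ)).card

theorem fstCount_add_sndCount {n p : ℕ} (f : Fin p → Fin (n + n)) :
    (Finset.univ.filter fun i => (f i : ℕ) < n).card + sndCount f = p := by
  have := Finset.card_filter_add_card_filter_not (s := Finset.univ) fun i => (f i : ℕ) < n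
  simpa [sndCount, not_lt] using this

/-- Each coordinate vector of the second factor contributes one factor c. Hence `mixForm n c` is a
polynomial in c whose coefficients are the bidegree components, and these can be recovered by
interpolation at c = 0, …, n. -/
theorem mixForm_stdVec {n : ℕ} (c : ℝ) (f : Fin n → Fin (n + n)) :
    (mixForm n c fun i => stdVec (n + n) (f i)) =
      c ^ sndCount f * mixForm n 1 fun i => stdVec (n + n) (f i) := by
  rw [mixForm_apply, mixForm_apply]
  have h : ∀ i, pr1 n (stdVec (n + n) (f i)) - c • pr2 n (stdVec (n + n) (f i)) =
      (if n ≤ (f i : ℕ) then c else 1) •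
        (pr1 n (stdVec (n + n) (f i)) - (1 : ℝ) • pr2 n (stdVec (n + n) (f i))) := by
    intro i
    refine Fin.addCases (fun a => ?_) (fun a => ?_) (f i)
    · rw [stdVec_castAdd, pr1_pair, pr2_pair]
      simp
    · rw [stdVec_natAdd, pr1_pair, pr2_pair]
      simp
  simp only [h]
  have h2 := (volForm n).toMultilinearMap.map_smul_univ
    (fun i => if n ≤ (f i : ℕ) then c else 1) fun i =>
      pr1 n (stdVec (n + n) (f i)) - (1 : ℝ) • pr2 n (stdVec (n + n) (f i))
  refine Eq.trans h2 ?_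
  rw [smul_eq_mul]
  congr 1
  rw [Finset.prod_ite]
  simp [sndCount]

theorem volPart_stdVec {n : ℕ} (k : Fin (n + 1)) (f : Fin n → Fin (n + n)) :
    (volPart n k fun i => stdVec (n + n) (f i)) =
      if (k : ℕ) = sndCount f then mixForm n 1 fun i => stdVec (n + n) (f i) else 0 := by
  have hl : sndCount f < n + 1 := by
    have := fstCount_add_sndCount f
    omega
  have h := fun j : Fin (n + 1) => mixForm_stdVec ((j : ℕ) : ℝ) f
  rw [volPart, ContinuousAlternatingMap.sum_apply]
  simp only [ContinuousAlternatingMap.smul_apply, h, smul_eq_mul, ← mul_assoc]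
  rw [← Finset.sum_mul, sum_interpCoeff k ⟨_, hl⟩]
  simp [Fin.ext_iff]

theorem sum_volPart (n : ℕ) : ∑ k, volPart n k = mixForm n 1 := by
  refine cov_ext fun f => ?_
  have hl : sndCount f < n + 1 := by
    have := fstCount_add_sndCount f
    omega
  rw [ContinuousAlternatingMap.sum_apply]
  simp only [volPart_stdVec]
  rw [Finset.sum_eq_single ⟨_, hl⟩]
  · simp
  · intro k _ hk
    rw [if_neg fun h => hk (Fin.ext h)]
  · simp

/-- By `wedge_mixForm` the form with parameter c acts as c^k, and the interpolation coefficients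
pick out exactly this power. So `volPart n k` is the kernel of the identity on k-covectors, and the
Newton kernel times it is a Green kernel. -/
theorem wedge_volPart {n : ℕ} (k : Fin (n + 1)) (θ : Cov n k) (w : Fin k → E n) :
    wedge (volPart n k) (θ.compContinuousLinearMap (pr1 n))
      (Fin.append (fun j => pair (stdVec n j) 0) fun j => pair 0 (w j)) = θ w := by
  rw [volPart, wedge_sum_left]
  simp only [wedge_smul_left, wedge_mixForm, ← mul_assoc]
  rw [← Finset.sum_mul, sum_interpCoeff, if_pos rfl, one_mul]

theorem contDiffAt_newton {n : ℕ} {u : E n} (hu : u ≠ 0) : ContDiffAt ℝ ∞ (newton n) u := by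
  have : newton n = fun x => (((n : ℝ) - 2) * sphereArea n)⁻¹ * (‖x‖ ^ (n - 2))⁻¹ :=
    funext (newton_eq n)
  rw [this]
  exact contDiffAt_const.mul (((contDiffAt_norm ℝ hu).pow _).inv (by simpa using fun h => absurd h hu))

theorem hasFDerivAt_newton {n : ℕ} (hn : 3 ≤ n) {u : E n} (hu : u ≠ 0) :
    HasFDerivAt (newton n) ((-((sphereArea n)⁻¹ * (‖u‖ ^ n)⁻¹)) • innerSL ℝ u) u := by
  have h0 := norm_pos_iff.2 hu
  have h1 : HasFDerivAt (fun x : E n => ‖x‖ ^ 2) (2 • innerSL ℝ u) u :=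
    (hasStrictFDerivAt_norm_sq u).hasFDerivAt
  have h2 : HasDerivAt (fun s : ℝ => s ^ (-((n : ℝ) - 2) / 2))
      (-((n : ℝ) - 2) / 2 * (‖u‖ ^ 2) ^ (-((n : ℝ) - 2) / 2 - 1)) (‖u‖ ^ 2) :=
    Real.hasDerivAt_rpow_const (Or.inl (by positivity))
  have h3 := (h2.comp_hasFDerivAt u h1).const_mul (((n : ℝ) - 2) * sphereArea n)⁻¹
  have h4 : ∀ x : E n, (‖x‖ ^ (n - 2))⁻¹ = (‖x‖ ^ 2) ^ (-((n : ℝ) - 2) / 2) := by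
    intro x
    rw [← Real.rpow_natCast ‖x‖ 2, ← Real.rpow_mul (norm_nonneg _), ← Real.rpow_natCast,
      ← Real.rpow_neg (norm_nonneg _)]
    congr 1
    rw [Nat.cast_sub (by omega)]
    push_cast
    ring
  have h5 : (‖u‖ ^ 2) ^ (-((n : ℝ) - 2) / 2 - 1) = (‖u‖ ^ n)⁻¹ := by
    rw [← Real.rpow_natCast ‖u‖ 2, ← Real.rpow_mul (norm_nonneg _), ← Real.rpow_natCast ‖u‖ n,
      ← Real.rpow_neg (norm_nonneg _)]
    congr 1
    push_cast
    ring
  have h6 : newton n = fun x => (((n : ℝ) - 2) * sphereArea n)⁻¹ *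
      ((fun s : ℝ => s ^ (-((n : ℝ) - 2) / 2)) ∘ fun x : E n => ‖x‖ ^ 2) x := by
    funext x
    rw [newton_eq, h4]
    rfl
  have h7 := (sub_two_pos hn).ne'
  have h8 := (sphereArea_pos (n := n) (by omega)).ne'
  have h9 : (-((sphereArea n)⁻¹ * (‖u‖ ^ n)⁻¹)) • innerSL ℝ u = (((n : ℝ) - 2) * sphereArea n)⁻¹ •
      (-((n : ℝ) - 2) / 2 * (‖u‖ ^ 2) ^ (-((n : ℝ) - 2) / 2 - 1)) • 2 • innerSL ℝ u := by
    rw [h5, ← Nat.cast_smul_eq_nsmul ℝ, smul_smul, smul_smul]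
    congr 1
    push_cast
    field_simp
  rw [h6, h9]
  exact h3

theorem diffMap_ne_zero {n : ℕ} {z : E (n + n)} (hz : z ∉ diag n) : diffMap n z ≠ 0 :=
  fun h => hz (LinearMap.mem_ker.2 h)

theorem isClosed_diag (n : ℕ) : IsClosed (diag n : Set (E (n + n))) :=
  Submodule.closed_of_finiteDimensional _

/-- The kernel `|x - y|^{2-n} / ((n-2)|S^{n-1}|) A` with constant `A`. -/
def newtonForm {n : ℕ} (A : Cov (n + n) n) (z : E (n + n)) : Cov (n + n) n :=
  newton n (diffMap n z) • A

theorem contDiffOn_newtonForm {n : ℕ} (A : Cov (n + n) n) :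
    ContDiffOn ℝ ∞ (newtonForm A) (diag n : Set (E (n + n)))ᶜ := by
  intro z hz
  exact (((contDiffAt_newton (diffMap_ne_zero hz)).comp z
    (diffMap n).contDiff.contDiffAt).smul contDiffAt_const).contDiffWithinAt

theorem isGreenKernel_newtonForm {n : ℕ} (hn : 3 ≤ n) (k : Fin (n + 1)) :
    IsGreenKernel n k (newtonForm (volPart n k)) := by
  refine ⟨contDiffOn_newtonForm _, ?_, ?_, fun θ y w => ?_⟩
  · exact LocallyIntegrable.clm_apply
      (locallyIntegrable_comp_diffMap (locallyIntegrable_newton hn))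
      (ContinuousLinearMap.toSpanSingleton ℝ (volPart n k))
  · intro z _ f hf
    have h1 := fstCount_add_sndCount f
    rw [newtonForm, ContinuousAlternatingMap.smul_apply, volPart_stdVec, if_neg, smul_zero]
    intro h
    refine hf ⟨?_, h.symm⟩
    omega
  · have h1 : fiberDensity rfl (newtonForm (volPart n k)) θ y w =
        fun x => newton n (x - y) * θ x w := by
      funext x
      rw [← wedge_volPart k (θ x) w, ← wedge_smul_left, ← diffMap_pair]
      rfl
    rw [h1]
    refine ⟨?_, green_apply hn θ.continuous θ.hasCompactSupport y w⟩
    exact integrable_newton_smul hn (contDiff_evalAt θ.contDiff w).continuous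
      (hasCompactSupport_evalAt θ.hasCompactSupport w) y

/-! ### The codifferential of the Green kernels -/

theorem pair_right_eq_sum {n : ℕ} (x : E n) : pair 0 x = ∑ i, x i • pair 0 (stdVec n i) := by
  have h := (sum_smul_stdVec (pair 0 x)).symm
  rw [Fin.sum_univ_add] at h
  refine h.trans ?_
  rw [Finset.sum_eq_zero, zero_add]
  · refine Finset.sum_congr rfl fun i _ => ?_
    rw [stdVec_natAdd, ← pr2_apply, pr2_pair]
  · intro i _
    rw [← pr1_apply, pr1_pair]
    simp

theorem contract_sum_smul {N k : ℕ} {ι : Type*} (s : Finset ι) (c : ι → ℝ) (x : ι → E N)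
    (A : Cov N (k + 1)) :
    contract (∑ i ∈ s, c i • x i) (k + 1) A = ∑ i ∈ s, c i • contract (x i) (k + 1) A := by
  change A.curryLeft _ = _
  rw [map_sum]
  simp only [map_smul]
  rfl

/-- The gradient of the Newton kernel is -|S^{n-1}|⁻¹ |u|^{-n} u. Differentiation in y and the
definition of the codifferential each add a sign, and the coordinate directions recombine to a
contraction with (0, x - y). -/
theorem codiffY_newtonForm {m : ℕ} (hn : 3 ≤ m + 1) (A : Cov (m + 1 + (m + 1)) (m + 1))
    {z : E (m + 1 + (m + 1))} (hz : z ∉ diag (m + 1)) :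
    codiffY (newtonForm A) z =
      (-((sphereArea (m + 1))⁻¹ * (‖diffMap (m + 1) z‖ ^ (m + 1))⁻¹)) •
        contract (pair 0 (diffMap (m + 1) z)) (m + 1) A := by
  have h1 := ((hasFDerivAt_newton hn (diffMap_ne_zero hz)).comp z
    (diffMap (m + 1)).hasFDerivAt).smul_const A
  have h2 : fderiv ℝ (newtonForm A) z = _ := h1.fderiv
  rw [codiffY, codiffAlong, h2, pair_right_eq_sum, contract_sum_smul, Finset.smul_sum,
    ← Finset.sum_neg_distrib]
  refine Finset.sum_congr rfl fun i _ => ?_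
  have h3 : diffMap (m + 1) (pair 0 (stdVec (m + 1) i)) = -stdVec (m + 1) i := by
    rw [diffMap_pair, zero_sub]
  have h4 : ∀ c : ℝ, contract (pair 0 (stdVec (m + 1) i)) (m + 1) (c • A) =
      c • contract (pair 0 (stdVec (m + 1) i)) (m + 1) A := fun c => map_smul _ c A
  rw [ContinuousLinearMap.smulRight_apply, h4, ContinuousLinearMap.comp_apply, h3]
  rw [_root_.smul_apply, innerSL_apply_apply, inner_neg_right, inner_stdVec, smul_smul]
  refine (neg_smul _ (contract (pair 0 (stdVec (m + 1) i)) (m + 1) A)).symm.trans ?_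
  congr 1
  simp

theorem contract_volPart {m : ℕ} (k : Fin (m + 1 + 1)) (y : E (m + 1)) :
    contract (pair 0 y) (m + 1) (volPart (m + 1) k) =
      -∑ j, (interpCoeff (m + 1) k j * ((j : ℕ) : ℝ)) •
        contract (pair y 0) (m + 1) (mixForm (m + 1) ((j : ℕ) : ℝ)) := by
  rw [volPart, map_sum, ← Finset.sum_neg_distrib]
  refine Finset.sum_congr rfl fun j _ => ?_
  rw [map_smul, contract_mixForm, smul_smul, mul_neg]
  exact neg_smul (interpCoeff (m + 1) k j * ((j : ℕ) : ℝ))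
    (contract (pair y 0) (m + 1) (mixForm (m + 1) ((j : ℕ) : ℝ)))

/-- Contraction with a vector of the second factor uses up one of its degrees. -/
theorem contract_volPart_stdVec {m : ℕ} (k : Fin (m + 1 + 1)) (y : E (m + 1))
    (f : Fin m → Fin (m + 1 + (m + 1))) (h : (k : ℕ) ≠ sndCount f + 1) :
    (contract (pair 0 y) (m + 1) (volPart (m + 1) k) fun i => stdVec _ (f i)) = 0 := by
  rw [contract_apply, pair_right_eq_sum, vecCons_sum_smul]
  refine Finset.sum_eq_zero fun i _ => ?_
  have h1 : (Matrix.vecCons (pair 0 (stdVec (m + 1) i)) fun i => stdVec _ (f i)) =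
      fun j => stdVec (m + 1 + (m + 1))
        ((Matrix.vecCons (Fin.natAdd (m + 1) i) f : Fin (m + 1) → Fin (m + 1 + (m + 1))) j) := by
    funext j
    refine Fin.cases ?_ (fun j => ?_) j
    · exact (stdVec_natAdd i).symm
    · simp
  refine (congrArg (fun v => y i * volPart (m + 1) k v) h1).trans ?_
  rw [volPart_stdVec, if_neg, mul_zero]
  rw [sndCount, Fin.univ_succ, Finset.filter_cons]
  simpa [Finset.filter_map, sndCount, Function.comp_def] using h

/-- The bidegree components add up to the pull-back of the volume form under x - y. For c = 1,
contraction with (0, u) is minus contraction with (u, 0), which cancels the sign of the gradient. -/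
theorem sum_codiffY_newtonForm {m : ℕ} (hn : 3 ≤ m + 1) {z : E (m + 1 + (m + 1))}
    (hz : z ∉ diag (m + 1)) :
    ∑ k, codiffY (newtonForm (volPart (m + 1) k)) z = diagForm (m + 1) z := by
  simp only [codiffY_newtonForm hn _ hz]
  rw [← Finset.smul_sum, ← map_sum, sum_volPart, contract_mixForm, diagForm_eq_contract, smul_smul]
  congr 1
  ring

theorem codiffY_newtonForm_zero {m : ℕ} (hn : 3 ≤ m + 1) {z : E (m + 1 + (m + 1))}
    (hz : z ∉ diag (m + 1)) : codiffY (newtonForm (volPart (m + 1) 0)) z = 0 := by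
  have h : contract (pair 0 (diffMap (m + 1) z)) (m + 1) (volPart (m + 1) 0) = 0 := by
    refine cov_ext fun f => ?_
    exact contract_volPart_stdVec 0 _ f (by simp)
  rw [codiffY_newtonForm hn _ hz, h, smul_zero]

/-- In the interpolation sum, the contraction supplies one factor c and the remaining j arguments of
θ supply c^j. So it is again the moment c^(j+1) that is extracted, with value one. -/
theorem wedge_codiffY_newtonForm {m j : ℕ} (hn : 3 ≤ m + 1) (hj : j + 1 < m + 1 + 1)
    (h : m + (j + 1) = m + 1 + j) (θ : Cov (m + 1) (j + 1))
    (w : Fin j → E (m + 1)) {z : E (m + 1 + (m + 1))} (hz : z ∉ diag (m + 1)) :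
    (wedge (codiffY (newtonForm (volPart (m + 1) ⟨j + 1, hj⟩)) z)
      (θ.compContinuousLinearMap (pr1 (m + 1))) fun i : Fin (m + (j + 1)) =>
        Fin.append (fun j => pair (stdVec (m + 1) j) 0) (fun j => pair 0 (w j)) (Fin.cast h i)) =
      (-1) ^ m * ((sphereArea (m + 1))⁻¹ * (‖diffMap (m + 1) z‖ ^ (m + 1))⁻¹ *
        θ (Matrix.vecCons (diffMap (m + 1) z) w)) := by
  set u := diffMap (m + 1) z
  have h1 : ∀ c : ℝ, (θ.compContinuousLinearMap (pr1 (m + 1)))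
      (Matrix.vecCons (pair u 0) fun j => pair (c • w j) (w j)) =
      c ^ j * θ (Matrix.vecCons u w) := by
    intro c
    have h2 : (fun i => pr1 (m + 1) ((Matrix.vecCons (pair u 0) fun j => pair (c • w j) (w j) :
        Fin (j + 1) → E (m + 1 + (m + 1))) i)) = Matrix.vecCons u (fun j => c • w j) := by
      funext i
      refine Fin.cases ?_ (fun i => ?_) i <;> simp [pr1_pair]
    refine (congrArg θ h2).trans ?_
    have h3 := (contract u (j + 1) θ).toMultilinearMap.map_smul_univ (fun _ => c) w
    have h4 : (contract u (j + 1) θ fun i => c • w i) = c ^ j * contract u (j + 1) θ w := by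
      simpa using h3
    exact h4
  rw [codiffY_newtonForm hn _ hz, contract_volPart, wedge_smul_left]
  have h4 : ∀ s : Cov (m + 1 + (m + 1)) m, -s = (-1 : ℝ) • s := fun s =>
    (neg_one_smul ℝ s).symm
  rw [h4, wedge_smul_left, wedge_sum_left]
  have h5 : ∀ i : Fin (m + 1 + 1), (wedge ((interpCoeff (m + 1) ⟨j + 1, hj⟩ i * ((i : ℕ) : ℝ)) •
      contract (pair u 0) (m + 1) (mixForm (m + 1) ((i : ℕ) : ℝ)))
      (θ.compContinuousLinearMap (pr1 (m + 1))) fun i : Fin (m + (j + 1)) =>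
        Fin.append (fun j => pair (stdVec (m + 1) j) 0) (fun j => pair 0 (w j)) (Fin.cast h i)) =
      interpCoeff (m + 1) ⟨j + 1, hj⟩ i * ((i : ℕ) : ℝ) ^ (j + 1) *
        ((-1) ^ m * θ (Matrix.vecCons u w)) := by
    intro i
    refine (wedge_smul_left _ _ _ _).trans ?_
    rw [wedge_contract_mixForm, h1]
    ring
  have h6 := sum_interpCoeff (n := m + 1) ⟨j + 1, hj⟩ ⟨j + 1, hj⟩
  rw [if_pos rfl] at h6
  refine (congrArg (fun s : ℝ => _ * (-1 * s)) (Finset.sum_congr rfl fun i _ => h5 i)).trans ?_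
  rw [← Finset.sum_mul, h6]
  ring

/-! ### Uniqueness of kernels -/

theorem exists_equiv_of_range_subset {α X : Type*} [Finite α] {a b : α → X}
    (ha : Function.Injective a) (h : range a ⊆ range b) : ∃ σ : Equiv.Perm α, a = b ∘ σ := by
  choose g hg using fun i => h ⟨i, rfl⟩
  have hgi : Function.Injective g := fun i j hij => ha (by rw [← hg i, ← hg j, hij])
  exact ⟨Equiv.ofBijective g (Finite.injective_iff_bijective.1 hgi), funext fun i => (hg i).symm⟩

theorem cov_stdVec_eq_zero {N p : ℕ} (A : Cov N p) {f : Fin p → Fin N}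
    (hf : ¬ Function.Injective f) : (A fun i => stdVec N (f i)) = 0 := by
  simp only [Function.Injective, not_forall] at hf
  obtain ⟨i, j, hij, hne⟩ := hf
  exact A.map_eq_zero_of_eq _ (by simp only [hij]) hne

theorem wedgeOne_coord_stdVec {n k : ℕ} {I : Fin k → Fin n} (hI : Function.Injective I) :
    (wedgeOne (fun i => coord n (I i)) fun i => stdVec n (I i)) = 1 := by
  rw [wedgeOne_apply, ← Matrix.det_one (n := Fin k) (R := ℝ)]
  congr 1
  ext i j
  rw [Matrix.of_apply, Matrix.one_apply]
  change stdVec n (I i) (I j) = _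
  rw [stdVec_apply]
  simp [hI.eq_iff, eq_comm]

theorem wedgeOne_coord_eq_zero {n k : ℕ} {I : Fin k → Fin n} (v : Fin k → E n) (i : Fin k)
    (h : ∀ j, v i (I j) = 0) : wedgeOne (fun i => coord n (I i)) v = 0 := by
  rw [wedgeOne_apply]
  exact Matrix.det_eq_zero_of_row_eq_zero i h

/-- Every coefficient of bidegree `(n - k, k)` is detected, up to sign, by wedging with the
pull-back of some `k`-form. -/
theorem exists_wedge_eq_coeff {n k : ℕ} {f : Fin n → Fin (n + n)}
    (hf : Function.Injective f) (hs : sndCount f = k) :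
    ∃ (θ : Cov n k) (w : Fin k → E n) (s : ℝ), ∀ A : Cov (n + n) n,
      (A fun i => stdVec (n + n) (f i)) = s * wedge A (θ.compContinuousLinearMap (pr1 n))
        (Fin.append (fun j => pair (stdVec n j) 0) fun j => pair 0 (w j)) := by
  classical
  have hc := fstCount_add_sndCount f
  -- B consists of the second-factor indices that occur in f, C of the first-factor indices that do
  -- not. Both have k elements, so wedging with dx_C completes the first factor while B remains to
  -- be evaluated.
  let B : Finset (Fin n) := Finset.univ.filter fun b => ∃ i, f i = Fin.natAdd n b
  let C : Finset (Fin n) := Finset.univ.filter fun a => ¬ ∃ i, f i = Fin.castAdd n a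
  have hB : B.card = k := by
    rw [← hs, sndCount, ← Finset.card_map (Fin.natAddEmb n), ← Finset.card_map ⟨f, hf⟩]
    congr 1
    ext z
    simp only [Finset.mem_map, B, Finset.mem_filter, Finset.mem_univ, true_and,
      Function.Embedding.coeFn_mk, Fin.natAddEmb_apply]
    constructor
    · rintro ⟨b, ⟨i, hi⟩, rfl⟩
      exact ⟨i, by rw [hi]; simp, hi⟩
    · rintro ⟨i, hi, rfl⟩
      refine ⟨Fin.subNat n (Fin.cast (by omega) (f i)) (by simpa using hi), ⟨i, ?_⟩, ?_⟩
      all_goals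
        apply Fin.ext
        simp
  have hC : C.card = k := by
    have h1 : (Finset.univ.filter fun a : Fin n => ∃ i, f i = Fin.castAdd n a).card =
        (Finset.univ.filter fun i => (f i : ℕ) < n).card := by
      rw [← Finset.card_map (Fin.castAddEmb n), ← Finset.card_map ⟨f, hf⟩]
      congr 1
      ext z
      simp only [Finset.mem_map, Finset.mem_filter, Finset.mem_univ, true_and,
        Function.Embedding.coeFn_mk, Fin.castAddEmb_apply]
      constructor
      · rintro ⟨b, ⟨i, hi⟩, rfl⟩
        exact ⟨i, by rw [hi]; simp, hi⟩
      · rintro ⟨i, hi, rfl⟩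
        exact ⟨⟨f i, hi⟩, ⟨i, Fin.ext rfl⟩, Fin.ext rfl⟩
    have h2 := Finset.card_filter_add_card_filter_not (s := Finset.univ)
      fun a : Fin n => ∃ i, f i = Fin.castAdd n a
    rw [h1, Finset.card_univ, Fintype.card_fin] at h2
    change _ + C.card = n at h2
    omega
  let J := B.orderEmbOfFin hB
  let I := C.orderEmbOfFin hC
  have hI : ∀ j i, f i ≠ Fin.castAdd n (I j) := fun j i h =>
    (Finset.mem_filter.1 (Finset.orderEmbOfFin_mem C hC j)).2 ⟨i, h⟩
  -- The tuple a, consisting of f followed by C, isolates the wanted coefficient; b is the tuple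
  -- used in `fiberDensity`. They enumerate the same indices, so the two values differ by the sign
  -- of a permutation.
  let a : Fin (n + k) → Fin (n + n) := Fin.append f fun j => Fin.castAdd n (I j)
  let b : Fin (n + k) → Fin (n + n) := Fin.append (Fin.castAdd n) fun j => Fin.natAdd n (J j)
  have ha : Function.Injective a := by
    rw [Fin.append_injective_iff]
    refine ⟨hf, (Fin.castAdd_injective n n).comp I.injective, fun i j => hI j i⟩
  have hab : range a ⊆ range b := by
    rintro _ ⟨i, rfl⟩
    have hl : ∀ x : Fin n, Fin.castAdd n x ∈ range b := fun x =>
      ⟨Fin.castAdd k x, Fin.append_left _ _ _⟩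
    refine Fin.addCases (fun i => ?_) (fun i => ?_) i
    · have h0 : a (Fin.castAdd k i) = f i := Fin.append_left _ _ _
      rw [h0]
      have h1 : ∀ z, f i = z → z ∈ range b := by
        intro z
        refine Fin.addCases (fun x _ => hl x) (fun x hx => ?_) z
        have hxB : x ∈ B := Finset.mem_filter.2 ⟨Finset.mem_univ _, i, hx⟩
        obtain ⟨j, rfl⟩ : ∃ j, J j = x := by
          have := Finset.range_orderEmbOfFin B hB
          have h3 : x ∈ range J := by rw [this]; exact hxB
          exact h3
        exact ⟨Fin.natAdd n j, Fin.append_right _ _ _⟩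
      exact h1 _ rfl
    · have h0 : a (Fin.natAdd n i) = Fin.castAdd n (I i) := Fin.append_right _ _ _
      rw [h0]
      exact hl _
  obtain ⟨σ, hσ⟩ := exists_equiv_of_range_subset ha hab
  refine ⟨wedgeOne fun i => coord n (I i), fun j => stdVec n (J j),
    ((Equiv.Perm.sign σ : ℤ) : ℝ), fun A => ?_⟩
  set T := (wedgeOne fun i => coord n (I i)).compContinuousLinearMap (pr1 n)
  have h1 : wedge A T (fun i => stdVec (n + n) (a i)) = A fun i => stdVec (n + n) (f i) := by
    have h2 : (fun i => stdVec (n + n) (a i)) = Fin.append (fun i => stdVec (n + n) (f i))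
        (fun j => stdVec (n + n) (Fin.castAdd n (I j))) := by
      funext i
      refine Fin.addCases (fun i => ?_) (fun i => ?_) i <;> simp [a]
    rw [h2, wedge_append _ _ _ _ (Or.inr _)]
    · have h3 : (T fun j => stdVec (n + n) (Fin.castAdd n (I j))) = 1 := by
        rw [← wedgeOne_coord_stdVec I.injective]
        change (wedgeOne fun i => coord n (I i)) _ = _
        congr 1
        funext j
        exact (congrArg (pr1 n) (stdVec_castAdd (I j))).trans (pr1_pair _ _)
      rw [h3, mul_one]
    · rintro m ⟨i, j, hij⟩
      refine wedgeOne_coord_eq_zero _ i fun l => ?_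
      refine (congrArg (fun v => pr1 n v (I l)) hij).trans ?_
      exact (stdVec_apply _ _).trans (if_neg (hI l j).symm)
  have h4 : (fun i => stdVec (n + n) (b i)) =
      Fin.append (fun j => pair (stdVec n j) 0) fun j => pair 0 (stdVec n (J j)) := by
    funext i
    refine Fin.addCases (fun i => ?_) (fun i => ?_) i
    · simp only [b, Fin.append_left, stdVec_castAdd]
    · simp only [b, Fin.append_right, stdVec_natAdd]
  rw [← h1, ← h4, hσ]
  have h5 := (wedge A T).toAlternatingMap.map_perm (fun i => stdVec (n + n) (b i)) σ
  refine Eq.trans h5 ?_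
  rw [Units.smul_def, zsmul_eq_mul]
  rfl

theorem continuous_pair_left {n : ℕ} (y : E n) : Continuous fun x : E n => pair x y :=
  (continuous_pair n).comp (by fun_prop : Continuous fun x : E n => (x, y))

theorem pair_notMem_diag {n : ℕ} {x y : E n} (h : x ≠ y) : pair x y ∉ diag n := by
  rw [mem_diag, pr1_pair, pr2_pair]
  exact h

/-- Coefficients of the wrong bidegree or with a repeated index vanish for both kernels. Any other
one is tested by g(x) θ with θ constant and g an arbitrary bump function, so for fixed y the two
coefficients agree almost everywhere in x, and by continuity everywhere off the diagonal. -/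
theorem IsGreenKernel.eqOn {n k : ℕ} {K K' : E (n + n) → Cov (n + n) n}
    (hK : IsGreenKernel n k K) (hK' : IsGreenKernel n k K') {z : E (n + n)} (hz : z ∉ diag n) :
    K z = K' z := by
  refine cov_ext fun f => ?_
  have hc := fstCount_add_sndCount f
  by_cases hs : sndCount f = k
  swap
  · have : ¬ ((Finset.univ.filter fun i => (f i : ℕ) < n).card = n - k ∧
        (Finset.univ.filter fun i => n ≤ (f i : ℕ)).card = k) := fun h => hs h.2
    rw [hK.2.2.1 z hz f this, hK'.2.2.1 z hz f this]
  by_cases hf : Function.Injective f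
  swap
  · rw [cov_stdVec_eq_zero _ hf, cov_stdVec_eq_zero _ hf]
  obtain ⟨θ, w, s, h⟩ := exists_wedge_eq_coeff hf hs
  set y := pr2 n z
  set F : E n → ℝ := fun x => (K (pair x y) - K' (pair x y)) fun i => stdVec (n + n) (f i)
  have hF : ContinuousOn F {y}ᶜ := by
    have h1 : ContinuousOn (fun x : E n => K (pair x y) - K' (pair x y)) {y}ᶜ :=
      (hK.1.continuousOn.sub hK'.1.continuousOn).comp (continuous_pair_left y).continuousOn
        fun x hx => pair_notMem_diag hx
    exact (evalAt fun i => stdVec (n + n) (f i)).continuous.comp_continuousOn h1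
  have hU : IsOpen ({y}ᶜ : Set (E n)) := isOpen_compl_singleton
  have hz' : pr1 n z ∈ ({y}ᶜ : Set (E n)) := fun h => hz ((mem_diag z).2 h)
  have key : ∀ g : E n → ℝ, ContDiff ℝ ∞ g → HasCompactSupport g → ∫ x, g x • F x = 0 := by
    intro g hg hgs
    let T : TestForm n k := ⟨fun x => g x • θ, hg.smul contDiff_const, hgs.smul_right,
      subset_univ _⟩
    have h1 : ∀ K'' : E (n + n) → Cov (n + n) n, ∀ x,
        g x * (K'' (pair x y) fun i => stdVec (n + n) (f i)) =
          s * fiberDensity rfl K'' T y w x := by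
      intro K'' x
      have h2 : (T x).compContinuousLinearMap (pr1 n) =
          g x • θ.compContinuousLinearMap (pr1 n) := rfl
      have h3 : fiberDensity rfl K'' T y w x =
          g x * wedge (K'' (pair x y)) (θ.compContinuousLinearMap (pr1 n))
            (Fin.append (fun j => pair (stdVec n j) 0) fun j => pair 0 (w j)) := by
        rw [fiberDensity, h2]
        exact map_smul (wedgeEval _ (K'' (pair x y))) (g x) (θ.compContinuousLinearMap (pr1 n))
      rw [h3, h]
      ring
    obtain ⟨hi, he⟩ := hK.2.2.2 T y w
    obtain ⟨hi', he'⟩ := hK'.2.2.2 T y w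
    calc ∫ x, g x • F x = ∫ x, (s * fiberDensity rfl K T y w x - s * fiberDensity rfl K' T y w x) := by
          refine integral_congr_ae (ae_of_all _ fun x => ?_)
          simp only [← h1, F, ContinuousAlternatingMap.sub_apply, smul_eq_mul, mul_sub]
      _ = 0 := by
          rw [integral_sub (hi.const_mul s) (hi'.const_mul s), integral_const_mul,
            integral_const_mul, ← he, ← he', sub_self]
  have hae := hU.ae_eq_zero_of_integral_contDiff_smul_eq_zero (μ := volume)
    (hF.locallyIntegrableOn hU.measurableSet) fun g hg hgs _ => key g hg hgs
  have h0 : EqOn F 0 {y}ᶜ := Measure.eqOn_open_of_ae_eq (μ := volume)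
    ((ae_restrict_iff' hU.measurableSet).2 hae) hU hF continuousOn_const
  have h1 : F (pr1 n z) = 0 := h0 hz'
  simp only [F, y, pair_pr, ContinuousAlternatingMap.sub_apply] at h1
  exact sub_eq_zero.1 h1

/-! ### The Biot–Savart form as the sum of the Biot–Savart kernels -/

theorem codiffY_congr {n p : ℕ} {K K' : E (n + n) → Cov (n + n) p}
    (h : ∀ z ∉ diag n, K z = K' z) {z : E (n + n)} (hz : z ∉ diag n) :
    codiffY K z = codiffY K' z := by
  have h1 : K =ᶠ[𝓝 z] K' := by
    filter_upwards [(isClosed_diag n).isOpen_compl.mem_nhds hz] with x hx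
    exact h x hx
  rw [codiffY, codiffY, codiffAlong, codiffAlong, h1.fderiv_eq]

theorem diagForm_eq_sum_codiffY {n : ℕ} (hn : 3 ≤ n) {K : ℕ → E (n + n) → Cov (n + n) n}
    (hK : ∀ k ≤ n, IsGreenKernel n k (K k)) {z : E (n + n)} (hz : z ∉ diag n) :
    diagForm n z = ∑ k ∈ Finset.range (n + 1), codiffY (K k) z := by
  obtain ⟨m, rfl⟩ : ∃ m, n = m + 1 := ⟨n - 1, by omega⟩
  rw [← sum_codiffY_newtonForm hn hz, ← Fin.sum_univ_eq_sum_range fun k => codiffY (K k) z]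
  refine Finset.sum_congr rfl fun k _ => codiffY_congr (fun x hx => ?_) hz
  have hk : (k : ℕ) ≤ m + 1 := by omega
  exact (isGreenKernel_newtonForm hn k).eqOn (hK k hk) hx

theorem codiffY_green_zero {n : ℕ} (hn : 3 ≤ n) {K : E (n + n) → Cov (n + n) n}
    (hK : IsGreenKernel n 0 K) {z : E (n + n)} (hz : z ∉ diag n) : codiffY K z = 0 := by
  obtain ⟨m, rfl⟩ : ∃ m, n = m + 1 := ⟨n - 1, by omega⟩
  rw [← codiffY_newtonForm_zero hn hz]
  refine codiffY_congr (fun x hx => ?_) hz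
  exact hK.eqOn (isGreenKernel_newtonForm hn 0) hx

theorem codiff_green_apply {n j : ℕ} (hn : 3 ≤ n) (θ : TestForm n (j + 1)) (y : E n)
    (w : Fin j → E n) :
    Integrable (fun x => (‖x - y‖ ^ n)⁻¹ * θ x (Matrix.vecCons (x - y) w)) ∧
    codiff (green θ) y w =
      -((sphereArea n)⁻¹ * ∫ x, (‖x - y‖ ^ n)⁻¹ * θ x (Matrix.vecCons (x - y) w)) := by
  have h1 : ∀ x : E n, (‖x - y‖ ^ n)⁻¹ * θ x (Matrix.vecCons (x - y) w) = ∑ i,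
      (‖x - y‖ ^ n)⁻¹ * (inner ℝ (x - y) (stdVec n i) *
        θ x (Matrix.vecCons (stdVec n i) w)) := by
    intro x
    have h2 := vecCons_sum_smul (θ x) Finset.univ (fun i => (x - y) i) (stdVec n) w
    rw [sum_smul_stdVec] at h2
    rw [h2, Finset.mul_sum]
    simp only [inner_stdVec]
  have h3 : ∀ i, Integrable fun x : E n => (‖x - y‖ ^ n)⁻¹ * (inner ℝ (x - y) (stdVec n i) *
      θ x (Matrix.vecCons (stdVec n i) w)) := by
    intro i
    have hs : HasCompactSupport fun u : E n => θ (u + y) (Matrix.vecCons (stdVec n i) w) :=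
      (hasCompactSupport_evalAt θ.hasCompactSupport _).comp_homeomorph (Homeomorph.addRight y)
    have hc : Continuous fun u : E n => θ (u + y) (Matrix.vecCons (stdVec n i) w) :=
      (contDiff_evalAt θ.contDiff _).continuous.comp (continuous_add_const y)
    have := (integrable_inner_pow_inv_mul (n := n) (by omega) hc hs (stdVec n i)).comp_sub_right y
    simpa using this
  refine ⟨(integrable_finsetSum Finset.univ fun i _ => h3 i).congr
    (ae_of_all _ fun x => (h1 x).symm), ?_⟩
  refine (codiffAlong_apply (stdVec n) (green θ) y w).trans ?_
  simp only [fderiv_green_apply hn, h1]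
  rw [integral_finsetSum _ fun i _ => h3 i, Finset.mul_sum]

/-- By uniqueness, K may be replaced by the explicit kernel off the diagonal, which is a null set.
There `wedge_codiffY_newtonForm` yields the integrand of `codiff_green_apply` up to the sign (-1)^n.
-/
theorem isKernel_codiffY {n j : ℕ} (hn : 3 ≤ n) (hj : j + 1 ≤ n) (h : n - 1 + (j + 1) = n + j)
    {K : E (n + n) → Cov (n + n) n} (hK : IsGreenKernel n (j + 1) K) :
    IsKernel (k := j + 1) (l := j) h (codiffY K)
      (fun θ y => (-1 : ℝ) ^ n • codiff (green θ) y) := by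
  obtain ⟨m, rfl⟩ : ∃ m, n = m + 1 := ⟨n - 1, by omega⟩
  have hj' : j + 1 < m + 1 + 1 := by omega
  have hcod : ∀ z ∉ diag (m + 1), codiffY K z =
      codiffY (newtonForm (volPart (m + 1) ⟨j + 1, hj'⟩)) z := fun z hz =>
    codiffY_congr (fun x hx => hK.eqOn (isGreenKernel_newtonForm hn ⟨j + 1, hj'⟩) hx) hz
  refine ⟨?_, ?_, fun θ y w => ?_⟩
  -- Off the diagonal the form is a finite sum of the locally integrable functions |u|^{-n} u_i, u =
  -- x - y, times constant covectors.
  · have hloc : LocallyIntegrable fun z : E (m + 1 + (m + 1)) =>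
        -∑ i, ((sphereArea (m + 1))⁻¹ * ((‖diffMap (m + 1) z‖ ^ (m + 1))⁻¹ *
          inner ℝ (diffMap (m + 1) z) (stdVec (m + 1) i))) •
          contract (pair 0 (stdVec (m + 1) i)) (m + 1) (volPart (m + 1) ⟨j + 1, hj'⟩) := by
      refine LocallyIntegrable.neg ?_
      refine locallyIntegrable_finsetSum _ fun i _ => ?_
      exact LocallyIntegrable.clm_apply (locallyIntegrable_comp_diffMap
        ((locallyIntegrable_pow_inv_mul_inner (by omega) (stdVec (m + 1) i)).smul
          (sphereArea (m + 1))⁻¹)) (ContinuousLinearMap.toSpanSingleton ℝ _)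
    refine hloc.congr ?_
    filter_upwards [ae_diffMap_ne_zero (n := m + 1) (by omega)] with z hz
    have hz' : z ∉ diag (m + 1) := fun h => hz (LinearMap.mem_ker.1 h)
    rw [hcod z hz', codiffY_newtonForm hn _ hz', pair_right_eq_sum, contract_sum_smul,
      Finset.smul_sum, ← Finset.sum_neg_distrib]
    refine Finset.sum_congr rfl fun i _ => ?_
    rw [inner_stdVec, smul_smul]
    refine (neg_smul _ (contract (pair 0 (stdVec (m + 1) i)) (m + 1)
      (volPart (m + 1) ⟨j + 1, hj'⟩))).symm.trans ?_
    congr 1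
    ring
  · intro z hz f hf
    have h1 := fstCount_add_sndCount f
    rw [hcod z hz, codiffY_newtonForm hn _ hz]
    refine (ContinuousAlternatingMap.smul_apply _ _ _).trans ?_
    rw [contract_volPart_stdVec (m := m) _ _ f, smul_zero]
    intro h
    refine hf ⟨?_, ?_⟩
    · simp only at h h1 ⊢
      omega
    · change sndCount f = j
      simp only at h
      omega
  · obtain ⟨hi, he⟩ := codiff_green_apply hn θ y w
    have hd : fiberDensity h (codiffY K) θ y w =ᵐ[volume] fun x =>
        ((-1) ^ m * (sphereArea (m + 1))⁻¹) *
          ((‖x - y‖ ^ (m + 1))⁻¹ * θ x (Matrix.vecCons (x - y) w)) := by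
      have : Nontrivial (E (m + 1)) := nontrivial_E (by omega)
      have hne : ∀ᵐ x : E (m + 1), x ≠ y := by
        rw [ae_iff]
        simp
      filter_upwards [hne] with x hx
      have hz := pair_notMem_diag hx
      rw [fiberDensity, hcod _ hz]
      refine (wedge_codiffY_newtonForm hn hj' h (θ x) w hz).trans ?_
      rw [diffMap_pair]
      ring
    refine ⟨(hi.const_mul _).congr hd.symm, ?_⟩
    rw [integral_congr_ae hd, integral_const_mul]
    refine (ContinuousAlternatingMap.smul_apply _ _ _).trans ?_
    refine (congrArg (fun s : ℝ => (-1 : ℝ) ^ (m + 1) • s) he).trans ?_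
    rw [smul_eq_mul, pow_succ]
    ring

/-! ### Blow-up and Gauss map -/

/-- The multiples of x in the other arguments are killed by alternation. What remains is pure
scaling, which is why radial components of a differential never matter below. -/
theorem contract_smul_apply_add {N k : ℕ} (a b : ℝ) (x : E N) (A : Cov N (k + 1))
    (v : Fin k → E N) (c : Fin k → ℝ) :
    (contract (a • x) (k + 1) A fun i : Fin k => b • v i + c i • x) =
      a * b ^ k * contract x (k + 1) A v := by
  have h1 : contract (a • x) (k + 1) A = a • contract x (k + 1) A := A.curryLeft.map_smul a x
  rw [h1]
  refine (congrArg (fun s : ℝ => a • s)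
    (contract_apply_add_smul x A (fun i => b • v i) c)).trans ?_
  have h2 : (contract x (k + 1) A fun i => b • v i) = b ^ k * contract x (k + 1) A v := by
    simpa using (contract x (k + 1) A).toMultilinearMap.map_smul_univ (fun _ => b) v
  refine (congrArg (fun s : ℝ => a • s) h2).trans ?_
  rw [smul_eq_mul, mul_assoc]

theorem pointForm_apply {m : ℕ} (x : E (m + 1)) (v : Fin m → E (m + 1)) :
    pointForm (m + 1) x v = (sphereArea (m + 1))⁻¹ * (‖x‖ ^ (m + 1))⁻¹ *
      contract x (m + 1) (volForm (m + 1)) v := by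
  rw [pointForm_eq]
  rfl

theorem sphereVol_apply {m : ℕ} (x : E (m + 1)) (v : Fin m → E (m + 1)) :
    sphereVol (m + 1) x v = (sphereArea (m + 1))⁻¹ *
      contract x (m + 1) (volForm (m + 1)) v := by
  rw [sphereVol, radialForm_eq_contract]
  rfl

theorem contDiffAt_pointForm {n : ℕ} (hn : 0 < n) {x : E n} (hx : x ≠ 0) :
    ContDiffAt ℝ ∞ (pointForm n) x := by
  obtain ⟨m, rfl⟩ : ∃ m, n = m + 1 := ⟨n - 1, by omega⟩
  have h : pointForm (m + 1) = fun x => ((sphereArea (m + 1))⁻¹ * (‖x‖ ^ (m + 1))⁻¹) •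
    (volForm (m + 1)).curryLeft x := funext pointForm_eq
  rw [h]
  exact (contDiffAt_const.mul (((contDiffAt_norm ℝ hx).pow _).inv
    (pow_ne_zero _ (norm_ne_zero_iff.2 hx)))).smul (volForm (m + 1)).curryLeft.contDiff.contDiffAt

theorem contDiffOn_diagForm {n : ℕ} (hn : 0 < n) :
    ContDiffOn ℝ ∞ (diagForm n) (diag n : Set (E (n + n)))ᶜ := by
  have h : diagForm n = fun z => (ContinuousAlternatingMap.compContinuousLinearMapCLM (diffMap n) :
      Cov n (n - 1) →L[ℝ] Cov (n + n) (n - 1)) (pointForm n (diffMap n z)) := funext diagForm_eq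
  rw [h]
  intro z hz
  exact (ContinuousLinearMap.contDiff _ |>.contDiffAt.comp z
    ((contDiffAt_pointForm hn (diffMap_ne_zero hz)).comp z
      (diffMap n).contDiff.contDiffAt)).contDiffWithinAt

theorem hasFDerivAt_blowDown {N : ℕ} (b : ℝ × E N × E N) (w : ℝ × E N × E N) :
    fderiv ℝ (blowDown (N := N)) b w = w.2.2 + (b.1 • w.2.1 + w.1 • b.2.1) := by
  have h1 : HasFDerivAt (fun b : ℝ × E N × E N => b.1)
    (ContinuousLinearMap.fst ℝ ℝ (E N × E N)) b := hasFDerivAt_fst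
  have h2 : HasFDerivAt (fun b : ℝ × E N × E N => b.2.1)
    ((ContinuousLinearMap.fst ℝ (E N) (E N)).comp (ContinuousLinearMap.snd ℝ ℝ (E N × E N))) b :=
    hasFDerivAt_fst.comp b hasFDerivAt_snd
  have h3 : HasFDerivAt (fun b : ℝ × E N × E N => b.2.2)
    ((ContinuousLinearMap.snd ℝ (E N) (E N)).comp (ContinuousLinearMap.snd ℝ ℝ (E N × E N))) b :=
    hasFDerivAt_snd.comp b hasFDerivAt_snd
  have h4 : HasFDerivAt (blowDown (N := N)) _ b := h3.add (h1.smul h2)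
  rw [h4.fderiv]
  simp

/-- The extension is the pull-back of `pointForm` under (t, v, p) ↦ β(v). It involves neither t nor
p, since β(p) = 0, the component along dt is radial, and the powers of t cancel by homogeneity. -/
theorem isBlowUpExtendible_diagForm {n : ℕ} (hn : 0 < n) :
    IsBlowUpExtendible (diag n) (diagForm n) := by
  refine ⟨contDiffOn_diagForm hn, fun b => (pointForm n (diffMap n b.2.1)).compContinuousLinearMap
    ((diffMap n).comp ((ContinuousLinearMap.fst ℝ _ _).comp (ContinuousLinearMap.snd ℝ ℝ _))),
    ?_, ?_⟩
  · have h : ContinuousOn (fun b : ℝ × E (n + n) × E (n + n) => pointForm n (diffMap n b.2.1))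
        (blowUp (diag n)) := by
      intro b hb
      -- A unit vector normal to the diagonal does not lie on the diagonal, so `pointForm` is smooth
      -- near β(v), even for t = 0.
      have hb' : diffMap n b.2.1 ≠ 0 := by
        refine diffMap_ne_zero fun h => ?_
        have h1 := Submodule.inner_right_of_mem_orthogonal h hb.2.1
        rw [inner_self_eq_zero] at h1
        have h2 := hb.2.2.1
        rw [h1, norm_zero] at h2
        exact zero_ne_one h2
      have h2 : Continuous fun b : ℝ × E (n + n) × E (n + n) => diffMap n b.2.1 := by fun_prop
      exact (ContinuousAt.comp (f := fun b : ℝ × E (n + n) × E (n + n) => diffMap n b.2.1)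
        (contDiffAt_pointForm hn hb').continuousAt h2.continuousAt).continuousWithinAt
    exact (ContinuousAlternatingMap.compContinuousLinearMapCLM ((diffMap n).comp
      ((ContinuousLinearMap.fst ℝ (E (n + n)) (E (n + n))).comp
        (ContinuousLinearMap.snd ℝ ℝ _))) :
      Cov n (n - 1) →L[ℝ] _).continuous.comp_continuousOn h
  · rintro ⟨t, v, p⟩ hb ht w hw
    obtain ⟨m, rfl⟩ : ∃ m, n = m + 1 := ⟨n - 1, by omega⟩
    change Fin m → _ at w
    have ht' : (0 : ℝ) < t := ht
    have hp : diffMap (m + 1) p = 0 := LinearMap.mem_ker.1 hb.2.2.2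
    have h1 : diffMap (m + 1) (blowDown (t, v, p)) = t • diffMap (m + 1) v := by
      rw [blowDown, map_add, map_smul, hp, zero_add]
    have h2 : ∀ i, diffMap (m + 1) (fderiv ℝ (blowDown (N := m + 1 + (m + 1))) (t, v, p) (w i)) =
        t • diffMap (m + 1) (w i).2.1 + (w i).1 • diffMap (m + 1) v := by
      intro i
      have h3 : diffMap (m + 1) (w i).2.2 = 0 := LinearMap.mem_ker.1 (hw i).2.2
      rw [hasFDerivAt_blowDown, map_add, h3, zero_add, map_add, map_smul, map_smul]
    rw [diagForm_eq]
    change pointForm (m + 1) (diffMap (m + 1) v) (fun i : Fin m => diffMap (m + 1) (w i).2.1) =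
      pointForm (m + 1) (diffMap (m + 1) (blowDown (t, v, p))) fun i : Fin m =>
        diffMap (m + 1) (fderiv ℝ (blowDown (N := m + 1 + (m + 1))) (t, v, p) (w i))
    simp only [h1, h2]
    refine (pointForm_apply _ _).trans (Eq.trans ?_ (pointForm_apply _ _).symm)
    rw [contract_smul_apply_add t t (diffMap (m + 1) v) (volForm (m + 1))
      (fun i => diffMap (m + 1) (w i).2.1) fun i => (w i).1, norm_smul, mul_pow,
      Real.norm_of_nonneg ht'.le, mul_inv]
    have h5 : (t ^ (m + 1))⁻¹ * (t * t ^ m) = 1 := by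
      rw [← pow_succ', inv_mul_cancel₀ (pow_pos ht' _).ne']
    linear_combination (-((sphereArea (m + 1))⁻¹ * (‖diffMap (m + 1) v‖ ^ (m + 1))⁻¹ *
      contract (diffMap (m + 1) v) (m + 1) (volForm (m + 1))
        (fun i : Fin m => diffMap (m + 1) (w i).2.1))) * h5

theorem norm_gaussMap {n : ℕ} {z : E (n + n)} (hz : z ∉ diag n) : ‖gaussMap n z‖ = 1 := by
  have h := norm_pos_iff.2 (diffMap_ne_zero hz)
  rw [gaussMap, ← diffMap_apply, norm_smul, norm_inv, norm_norm, inv_mul_cancel₀ h.ne']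

theorem hasFDerivAt_gaussMap {n : ℕ} {z : E (n + n)} (hz : z ∉ diag n) :
    ∃ L : E (n + n) →L[ℝ] ℝ, HasFDerivAt (gaussMap n)
      (‖diffMap n z‖⁻¹ • diffMap n + L.smulRight (diffMap n z)) z := by
  have hu := diffMap_ne_zero hz
  have h1 : DifferentiableAt ℝ (fun z => ‖diffMap n z‖⁻¹) z :=
    (DifferentiableAt.comp z ((contDiffAt_norm ℝ hu (n := 1)).differentiableAt one_ne_zero)
      (diffMap n).differentiableAt).inv (norm_ne_zero_iff.2 hu)
  exact ⟨_, h1.hasFDerivAt.smul (diffMap n).hasFDerivAt⟩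

/-- The derivative of ψ is β/|u| plus a multiple of the radial vector u. The radial part is
annihilated, and the n factors 1/|u| are those of `pointForm`. -/
theorem diagForm_eq_sphereVol {n : ℕ} (hn : 0 < n) {z : E (n + n)} (hz : z ∉ diag n) :
    diagForm n z = (sphereVol n (gaussMap n z)).compContinuousLinearMap
      (fderiv ℝ (gaussMap n) z) := by
  obtain ⟨m, rfl⟩ : ∃ m, n = m + 1 := ⟨n - 1, by omega⟩
  obtain ⟨L, hL⟩ := hasFDerivAt_gaussMap hz
  have hu := norm_pos_iff.2 (diffMap_ne_zero hz)
  rw [hL.fderiv, diagForm_eq]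
  ext w
  change Fin m → _ at w
  set u := diffMap (m + 1) z with hudef
  change pointForm (m + 1) u (fun i : Fin m => diffMap (m + 1) (w i)) =
    sphereVol (m + 1) (gaussMap (m + 1) z) fun i : Fin m =>
      ‖u‖⁻¹ • diffMap (m + 1) (w i) + L (w i) • u
  have h1 : gaussMap (m + 1) z = ‖u‖⁻¹ • u := rfl
  rw [h1]
  refine (pointForm_apply _ _).trans (Eq.trans ?_ (sphereVol_apply _ _).symm)
  rw [contract_smul_apply_add ‖u‖⁻¹ ‖u‖⁻¹ u (volForm (m + 1))
    (fun i => diffMap (m + 1) (w i)) fun i => L (w i), ← pow_succ', inv_pow,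
    mul_assoc]

/-! ### Local degrees as limits of integrals -/

section LocalDegree

variable {n : ℕ} {Z : E n → E n} {g w : E n → ℝ}

/-- This is the inverse function theorem on a neighbourhood so small that the sign of the Jacobian
is constant. The last clause says that the local inverse is continuous at Z z. -/
theorem exists_nhds_injOn {z : E n} (hZ : ContDiffAt ℝ 1 Z z) (hdet : (fderiv ℝ Z z).det ≠ 0)
    {V : Set (E n)} (hV : V ∈ 𝓝 z) :
    ∃ U ⊆ V, IsOpen U ∧ z ∈ U ∧ InjOn Z U ∧ IsOpen (Z '' U) ∧
      (∀ x ∈ U, DifferentiableAt ℝ Z x ∧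
        SignType.sign (fderiv ℝ Z x).det = SignType.sign (fderiv ℝ Z z).det) ∧
      ∀ W ∈ 𝓝 z, Z '' (U ∩ W) ∈ 𝓝 (Z z) := by
  have hs : HasStrictFDerivAt Z (fderiv ℝ Z z) z := hZ.hasStrictFDerivAt one_ne_zero
  let L : E n ≃L[ℝ] E n := (fderiv ℝ Z z).toContinuousLinearEquivOfDetNeZero hdet
  have hL : (L : E n →L[ℝ] E n) = fderiv ℝ Z z :=
    ContinuousLinearMap.coe_toContinuousLinearEquivOfDetNeZero _ hdet
  have hs' : HasStrictFDerivAt Z (L : E n →L[ℝ] E n) z := by rw [hL]; exact hs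
  let e := hs'.toOpenPartialHomeomorph Z
  have he : ⇑e = Z := hs'.toOpenPartialHomeomorph_coe
  have hze : z ∈ e.source := hs'.mem_toOpenPartialHomeomorph_source
  have hc : ContinuousAt (fun x => (fderiv ℝ Z x).det) z :=
    ContinuousLinearMap.continuous_det.continuousAt.comp
      ((hZ.fderiv_right (m := 0) le_rfl).continuousAt)
  have h1 : ∀ᶠ x in 𝓝 z, SignType.sign (fderiv ℝ Z x).det = SignType.sign (fderiv ℝ Z z).det := by
    rcases lt_or_gt_of_ne hdet with h | h
    · filter_upwards [hc.eventually_lt continuousAt_const h] with x hx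
      rw [sign_neg hx, sign_neg h]
    · filter_upwards [continuousAt_const.eventually_lt hc h] with x hx
      rw [sign_pos hx, sign_pos h]
  have h2 : ∀ᶠ x in 𝓝 z, DifferentiableAt ℝ Z x := by
    filter_upwards [hZ.eventually (by simp)] with x hx
    exact hx.differentiableAt one_ne_zero
  obtain ⟨U, hU, hUo, hzU⟩ := mem_nhds_iff.1 (inter_mem (h2.and h1) hV)
  refine ⟨U ∩ e.source, fun x hx => (hU hx.1).2, hUo.inter e.open_source, ⟨hzU, hze⟩, ?_, ?_,
    fun x hx => (hU hx.1).1, fun W hW => ?_⟩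
  · rw [← he]
    exact e.injOn.mono inter_subset_right
  · rw [← he]
    exact e.isOpen_image_of_subset_source (hUo.inter e.open_source) inter_subset_right
  · rw [← he]
    have h3 := e.map_nhds_eq hze
    rw [← h3]
    exact image_mem_map (inter_mem ((hUo.inter e.open_source).mem_nhds ⟨hzU, hze⟩) hW)

/-- Near z the map Z is a change of variables y = Z x. Since g agrees with w times the Jacobian, the
integral becomes the sign of the Jacobian times the integral of the peak against w ∘ Z⁻¹, and the
approximate identity evaluates this at y = 0. -/
theorem tendsto_setIntegral_mul_peak (hn : 0 < n) {z : E n} (hz : Z z = 0)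
    (hZ : ContDiffAt ℝ 1 Z z) (hdet : (fderiv ℝ Z z).det ≠ 0) (hgm : AEStronglyMeasurable g)
    {M : ℝ} (hg : ∀ x, |g x| ≤ M) (hw : ContinuousAt w z)
    (hgw : g =ᶠ[𝓝 z] fun x => w x * (fderiv ℝ Z x).det) {V : Set (E n)} (hV : V ∈ 𝓝 z) :
    ∃ U ⊆ V, IsOpen U ∧ z ∈ U ∧ (∀ x ∈ U, Z x = 0 → x = z) ∧
      Tendsto (fun ε => ∫ x in U, g x * peak n ε (Z x)) (𝓝[>] 0)
        (𝓝 (w z * (SignType.sign (fderiv ℝ Z z).det : ℝ))) := by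
  obtain ⟨U, hUV, hUo, hzU, hinj, hopen, hdiff, hnhds⟩ := exists_nhds_injOn hZ hdet
    (inter_mem (inter_mem hgw hV) (Metric.ball_mem_nhds z one_pos))
  refine ⟨U, fun x hx => (hUV hx).1.2, hUo, hzU, fun x hx h => hinj hx hzU (by rw [h, hz]), ?_⟩
  set σ : ℝ := (SignType.sign (fderiv ℝ Z z).det : ℝ)
  -- G is w transported by the local inverse. Extended by zero outside the image, it is the function
  -- to which the approximate identity is applied.
  let G : E n → ℝ := fun y => w (Function.invFunOn Z U y)
  have hG : ∀ x ∈ U, G (Z x) = w x := fun x hx => by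
    simp only [G]
    rw [hinj.leftInvOn_invFunOn hx]
  have hfd : ∀ x ∈ U, HasFDerivWithinAt Z (fderiv ℝ Z x) U x := fun x hx =>
    (hdiff x hx).1.hasFDerivAt.hasFDerivWithinAt
  have habs : ∀ x ∈ U, |(fderiv ℝ Z x).det| = σ * (fderiv ℝ Z x).det := by
    intro x hx
    rw [← sign_mul_self, (hdiff x hx).2]
  have hgx : ∀ x ∈ U, |(fderiv ℝ Z x).det| * w x = σ * g x := by
    intro x hx
    have h1 : g x = w x * (fderiv ℝ Z x).det := (hUV hx).1.1
    rw [habs x hx, h1]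
    ring
  have hUf : volume U < ⊤ := lt_of_le_of_lt (measure_mono fun x hx => (hUV hx).2)
    measure_ball_lt_top
  have hgint : IntegrableOn g U := by
    refine Measure.integrableOn_of_bounded (M := M) hUf.ne hgm ?_
    exact ae_of_all _ fun x => hg x
  have hGi : IntegrableOn G (Z '' U) := by
    rw [integrableOn_image_iff_integrableOn_abs_det_fderiv_smul volume hUo.measurableSet hfd hinj]
    refine (hgint.const_mul σ).congr ?_
    rw [EventuallyEq, ae_restrict_iff' hUo.measurableSet]
    refine ae_of_all _ fun x hx => ?_
    rw [hG x hx, smul_eq_mul, hgx x hx]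
  have hGi' : Integrable ((Z '' U).indicator G) :=
    (integrable_indicator_iff hopen.measurableSet).2 hGi
  have hZ0 : (Z '' U).indicator G 0 = w z := by
    rw [← hz, indicator_of_mem (mem_image_of_mem Z hzU), hG z hzU]
  -- Images of neighbourhoods of z are neighbourhoods of 0, so continuity of w at z carries over.
  have hGc : ContinuousAt ((Z '' U).indicator G) 0 := by
    rw [ContinuousAt, hZ0]
    intro s hs
    have h1 := hnhds _ (hw hs)
    rw [hz] at h1
    rw [mem_map]
    filter_upwards [h1] with y hy
    obtain ⟨x, hx, rfl⟩ := hy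
    rw [mem_preimage]
    rw [indicator_of_mem (mem_image_of_mem Z hx.1), hG x hx.1]
    exact hx.2
  have hT := (tendsto_integral_peak hn hGi' hGc).mul_const σ
  rw [hZ0] at hT
  refine hT.congr fun ε => ?_
  have h1 : (fun y => peak n ε y * (Z '' U).indicator G y) =
      (Z '' U).indicator fun y => peak n ε y * G y := by
    funext y
    by_cases hy : y ∈ Z '' U <;> simp [hy]
  have hσ : σ * σ = 1 := by
    rcases lt_or_gt_of_ne hdet with h | h
    · simp [σ, sign_neg h]
    · simp [σ, sign_pos h]
  rw [h1, integral_indicator hopen.measurableSet,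
    integral_image_eq_integral_abs_det_fderiv_smul volume hUo.measurableSet hfd hinj,
    ← integral_mul_const]
  refine setIntegral_congr_fun hUo.measurableSet fun x hx => ?_
  simp only [smul_eq_mul]
  rw [hG x hx]
  calc |(fderiv ℝ Z x).det| * (peak n ε (Z x) * w x) * σ
      = (|(fderiv ℝ Z x).det| * w x) * peak n ε (Z x) * σ := by ring
    _ = (σ * σ) * (g x * peak n ε (Z x)) := by rw [hgx x hx]; ring
    _ = _ := by rw [hσ, one_mul]

/-- The zeros of `Z` in a compact set, weighted by their local degrees, as a limit of integrals. -/
theorem tendsto_integral_mul_peak (hn : 0 < n) {C : Set (E n)} (hC : IsCompact C)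
    (hZ : ContinuousOn Z C) (hgm : AEStronglyMeasurable g) {M : ℝ} (hg : ∀ x, |g x| ≤ M)
    (hg0 : ∀ x ∉ C, g x = 0)
    (h : ∀ z ∈ C, Z z = 0 → ContDiffAt ℝ 1 Z z ∧ (fderiv ℝ Z z).det ≠ 0 ∧ ContinuousAt w z ∧
      g =ᶠ[𝓝 z] fun x => w x * (fderiv ℝ Z x).det) :
    {z | z ∈ C ∧ Z z = 0}.Finite ∧
    Tendsto (fun ε => ∫ x, g x * peak n ε (Z x)) (𝓝[>] 0)
      (𝓝 (∑ᶠ z ∈ {z | z ∈ C ∧ Z z = 0}, w z * (SignType.sign (fderiv ℝ Z z).det : ℝ))) := by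
  classical
  set N : Set (E n) := {z | z ∈ C ∧ Z z = 0}
  have hNc : IsCompact N := hC.of_isClosed_subset
    (hZ.preimage_isClosed_of_isClosed hC.isClosed isClosed_singleton) fun x hx => hx.1
  have hloc : ∀ z ∈ N, ∀ V ∈ 𝓝 z, ∃ U ⊆ V, IsOpen U ∧ z ∈ U ∧ (∀ x ∈ U, Z x = 0 → x = z) ∧
      Tendsto (fun ε => ∫ x in U, g x * peak n ε (Z x)) (𝓝[>] 0)
        (𝓝 (w z * (SignType.sign (fderiv ℝ Z z).det : ℝ))) := fun z hz V hV =>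
    tendsto_setIntegral_mul_peak hn hz.2 (h z hz.1 hz.2).1 (h z hz.1 hz.2).2.1 hgm hg
      (h z hz.1 hz.2).2.2.1 (h z hz.1 hz.2).2.2.2 hV
  -- Nondegenerate zeros are isolated, and the zero set in C is compact.
  have hfin : N.Finite := by
    choose! U _ hUo hzU hU _ using fun z hz => hloc z hz univ univ_mem
    obtain ⟨t, htN, ht⟩ := hNc.elim_nhds_subcover U fun z hz => (hUo z hz).mem_nhds (hzU z hz)
    refine t.finite_toSet.subset fun x hx => ?_
    obtain ⟨z, hz, hxz⟩ := mem_iUnion₂.1 (ht hx)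
    rw [hU z (htN z hz) x hxz hx.2]
    exact hz
  refine ⟨hfin, ?_⟩
  obtain ⟨V, hV, hVd⟩ := hfin.t2_separation
  choose! U hUV hUo hzU _ hUt using fun z hz => hloc z hz (V z) ((hV z).2.mem_nhds (hV z).1)
  set T := hfin.toFinset
  have hT : ∀ z, z ∈ T ↔ z ∈ N := fun z => hfin.mem_toFinset
  set O : Set (E n) := ⋃ z ∈ T, U z
  have hOo : IsOpen O := isOpen_biUnion fun z hz => hUo z ((hT z).1 hz)
  have hdisj : (T : Set (E n)).PairwiseDisjoint U := by
    intro a ha b hb hab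
    have ha' := (hT a).1 ha
    have hb' := (hT b).1 hb
    exact (hVd ha' hb' hab).mono (hUV a ha') (hUV b hb')
  have hint : ∀ ε > 0, Integrable fun x => g x * peak n ε (Z x) := by
    intro ε hε
    have h1 : ContinuousOn (fun x => peak n ε (Z x)) C := (continuous_peak hε).comp_continuousOn hZ
    have h2 : IntegrableOn (fun x => g x * peak n ε (Z x)) C := by
      refine Integrable.bdd_mul (c := M) (h1.integrableOn_compact hC) hgm.restrict ?_
      exact ae_of_all _ fun x => hg x
    rw [← integrable_indicator_iff hC.measurableSet] at h2
    refine h2.congr (ae_of_all _ fun x => ?_)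
    by_cases hx : x ∈ C <;> simp [hx, hg0]
  -- Outside the chosen neighbourhoods |Z| is bounded below on the compact remainder of C, where the
  -- peak is O(ε²).
  have hrest : Tendsto (fun ε => ∫ x in Oᶜ, g x * peak n ε (Z x)) (𝓝[>] 0) (𝓝 0) := by
    have hK : IsCompact (C \ O) := hC.diff hOo
    obtain ⟨m, hm, hmZ⟩ : ∃ m > 0, ∀ x ∈ C \ O, m ≤ ‖Z x‖ := by
      rcases (C \ O).eq_empty_or_nonempty with he | hne
      · exact ⟨1, one_pos, fun x hx => by simp [he] at hx⟩
      · obtain ⟨x, hx, hmin⟩ := hK.exists_isMinOn hne (hZ.mono sdiff_subset).norm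
        refine ⟨‖Z x‖, norm_pos_iff.2 fun h0 => hx.2 ?_, fun y hy => hmin hy⟩
        exact mem_iUnion₂.2 ⟨x, (hT x).2 ⟨hx.1, h0⟩, hzU x ⟨hx.1, h0⟩⟩
    have hM : 0 ≤ M := (abs_nonneg _).trans (hg 0)
    have hb : ∀ ε, ‖∫ x in Oᶜ, g x * peak n ε (Z x)‖ ≤
        M * (n * (sphereArea n)⁻¹ * ε ^ 2 * (m ^ (n + 2))⁻¹) * volume.real (C \ O) := by
      intro ε
      have h1 : ∫ x in Oᶜ, g x * peak n ε (Z x) = ∫ x in C \ O, g x * peak n ε (Z x) := by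
        refine setIntegral_eq_of_subset_of_forall_sdiff_eq_zero hOo.measurableSet.compl
          (fun x hx => hx.2) fun x hx => ?_
        have hxC : x ∉ C := fun hc => hx.2 ⟨hc, hx.1⟩
        rw [hg0 x hxC, zero_mul]
      rw [h1]
      refine norm_setIntegral_le_of_norm_le_const hK.measure_lt_top fun x hx => ?_
      rw [norm_mul, Real.norm_of_nonneg (peak_nonneg hn _ _)]
      exact mul_le_mul (hg x) (peak_le hn hm (hmZ x hx)) (peak_nonneg hn _ _) hM
    refine squeeze_zero_norm hb ?_
    have h1 : Continuous fun ε : ℝ => M * (n * (sphereArea n)⁻¹ * ε ^ 2 * (m ^ (n + 2))⁻¹) *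
        volume.real (C \ O) := by fun_prop
    have h2 := h1.tendsto 0
    simp only [ne_eq, OfNat.ofNat_ne_zero, not_false_eq_true, zero_pow, mul_zero, zero_mul] at h2
    exact h2.mono_left nhdsWithin_le_nhds
  have hsum : Tendsto (fun ε => ∑ z ∈ T, ∫ x in U z, g x * peak n ε (Z x)) (𝓝[>] 0)
      (𝓝 (∑ z ∈ T, w z * (SignType.sign (fderiv ℝ Z z).det : ℝ))) :=
    tendsto_finsetSum _ fun z hz => hUt z ((hT z).1 hz)
  rw [finsum_mem_eq_finite_toFinset_sum _ hfin]
  have := hsum.add hrest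
  rw [add_zero] at this
  refine this.congr' ?_
  filter_upwards [self_mem_nhdsWithin] with ε hε
  rw [← integral_add_compl hOo.measurableSet (hint ε hε)]
  congr 1
  rw [← integral_biUnion_finset T (fun z hz => (hUo z ((hT z).1 hz)).measurableSet) hdisj
    fun z _ => (hint ε hε).integrableOn]

end LocalDegree

/-! ### Determinants and the regularized Biot–Savart field in `ℝ³` -/

/-- The determinant of three vectors of `ℝ³`. -/
def det3 (a b c : E 3) : ℝ := orientDet ![a, b, c]

theorem det3_eq (a b c : E 3) : det3 a b c =
    a 0 * b 1 * c 2 - a 0 * b 2 * c 1 - a 1 * b 0 * c 2 + a 1 * b 2 * c 0 + a 2 * b 0 * c 1 -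
      a 2 * b 1 * c 0 := by
  rw [det3, orientDet, Matrix.det_fin_three]
  simp

theorem det3_add_left (a a' b c : E 3) : det3 (a + a') b c = det3 a b c + det3 a' b c := by
  simp only [det3_eq, PiLp.add_apply]; ring

theorem det3_smul_left (r : ℝ) (a b c : E 3) : det3 (r • a) b c = r * det3 a b c := by
  simp only [det3_eq, PiLp.smul_apply, smul_eq_mul]; ring

theorem det3_smul_mid (r : ℝ) (a b c : E 3) : det3 a (r • b) c = r * det3 a b c := by
  simp only [det3_eq, PiLp.smul_apply, smul_eq_mul]; ring

theorem det3_neg_left (a b c : E 3) : det3 (-a) b c = -det3 a b c := by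
  simp only [det3_eq, PiLp.neg_apply]; ring

theorem det3_neg_mid (a b c : E 3) : det3 a (-b) c = -det3 a b c := by
  simp only [det3_eq, PiLp.neg_apply]; ring

theorem det3_neg_right (a b c : E 3) : det3 a b (-c) = -det3 a b c := by
  simp only [det3_eq, PiLp.neg_apply]; ring

theorem det3_cyclic (a b c : E 3) : det3 a b c = det3 b c a := by
  simp only [det3_eq]; ring

theorem det3_swap (a b c : E 3) : det3 a b c = -det3 a c b := by
  simp only [det3_eq]; ring

theorem continuous_det3 {X : Type*} [TopologicalSpace X] {a b c : X → E 3} (ha : Continuous a)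
    (hb : Continuous b) (hc : Continuous c) : Continuous fun x => det3 (a x) (b x) (c x) := by
  simp only [det3_eq]
  fun_prop

theorem ContinuousOn.det3 {X : Type*} [TopologicalSpace X] {a b c : X → E 3} {s : Set X}
    (ha : ContinuousOn a s) (hb : ContinuousOn b s) (hc : ContinuousOn c s) :
    ContinuousOn (fun x => det3 (a x) (b x) (c x)) s := by
  simp only [det3_eq]
  fun_prop

theorem abs_det3_le (a b c : E 3) : |det3 a b c| ≤ 6 * (‖a‖ * ‖b‖ * ‖c‖) := by
  have h : ∀ i j k, |a i * b j * c k| ≤ ‖a‖ * ‖b‖ * ‖c‖ := by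
    intro i j k
    rw [abs_mul, abs_mul]
    have h1 := PiLp.norm_apply_le a i
    have h2 := PiLp.norm_apply_le b j
    have h3 := PiLp.norm_apply_le c k
    rw [Real.norm_eq_abs] at h1 h2 h3
    gcongr
  have h1 := abs_le.1 (h 0 1 2)
  have h2 := abs_le.1 (h 0 2 1)
  have h3 := abs_le.1 (h 1 0 2)
  have h4 := abs_le.1 (h 1 2 0)
  have h5 := abs_le.1 (h 2 0 1)
  have h6 := abs_le.1 (h 2 1 0)
  rw [det3_eq, abs_le]
  constructor <;> linarith [h1.1, h1.2, h2.1, h2.2, h3.1, h3.2, h4.1, h4.2, h5.1, h5.2, h6.1, h6.2]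

/-- The field `u / (|S²| (|u|² + ε²)^{3/2})`. -/
def bsField (ε : ℝ) (u : E 3) : E 3 := ((sphereArea 3)⁻¹ * (reg ε u ^ 3)⁻¹) • u

/-- The derivative of `bsField`. -/
def bsDeriv (ε : ℝ) (u v : E 3) : E 3 :=
  (sphereArea 3)⁻¹ • ((reg ε u ^ 3)⁻¹ • v + (-3 * (reg ε u ^ 5)⁻¹ * inner ℝ u v) • u)

theorem hasFDerivAt_bsField {ε : ℝ} (hε : 0 < ε) (u : E 3) :
    ∃ A : E 3 →L[ℝ] E 3, HasFDerivAt (bsField ε) A u ∧ ∀ v, A v = bsDeriv ε u v := by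
  have h1 := ((hasFDerivAt_reg_pow_inv hε 3 u).smul (hasFDerivAt_id u)).const_smul (sphereArea 3)⁻¹
  refine ⟨_, h1.congr_of_eventuallyEq (Eventually.of_forall fun x => ?_), fun v => ?_⟩
  · simp [bsField, smul_smul]
  · simp [bsDeriv]

theorem hasDerivAt_bsField {ε : ℝ} (hε : 0 < ε) {u : ℝ → E 3} {u' : E 3} {t : ℝ}
    (hu : HasDerivAt u u' t) : HasDerivAt (fun t => bsField ε (u t)) (bsDeriv ε (u t) u') t := by
  obtain ⟨A, hA, hA'⟩ := hasFDerivAt_bsField hε (u t)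
  rw [← hA']
  exact hA.comp_hasDerivAt t hu

theorem continuous_bsField {ε : ℝ} (hε : 0 < ε) : Continuous (bsField ε) :=
  continuous_iff_continuousAt.2 fun u => (hasFDerivAt_bsField hε u).choose_spec.1.continuousAt

theorem continuous_bsDeriv {ε : ℝ} (hε : 0 < ε) : Continuous fun p : E 3 × E 3 =>
    bsDeriv ε p.1 p.2 := by
  have h : ∀ k, Continuous fun p : E 3 × E 3 => (reg ε p.1 ^ k)⁻¹ := fun k =>
    (continuous_reg_pow_inv hε k).comp continuous_fst
  have h3 := h 3
  have h5 := h 5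
  unfold bsDeriv
  fun_prop

theorem bsField_neg (ε : ℝ) (u : E 3) : bsField ε (-u) = -bsField ε u := by
  simp [bsField, reg]

theorem norm_bsField_le (ε : ℝ) {u : E 3} {r : ℝ} (hr : 0 < r) (hu : r ≤ ‖u‖) :
    ‖bsField ε u‖ ≤ (sphereArea 3)⁻¹ * (r ^ 2)⁻¹ := by
  have hS := sphereArea_pos (n := 3) (by omega)
  have h1 := norm_le_reg ε u
  have h2 := reg_nonneg ε u
  have h0 : 0 < ‖u‖ := hr.trans_le hu
  rw [bsField, norm_smul, Real.norm_of_nonneg (by positivity), mul_assoc]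
  gcongr
  calc (reg ε u ^ 3)⁻¹ * ‖u‖ ≤ (‖u‖ ^ 3)⁻¹ * ‖u‖ := by gcongr
    _ = (‖u‖ ^ 2)⁻¹ := by field_simp
    _ ≤ (r ^ 2)⁻¹ := by gcongr

theorem tendsto_bsField {u : E 3} (hu : u ≠ 0) :
    Tendsto (fun ε => bsField ε u) (𝓝[>] 0) (𝓝 (bsField 0 u)) := by
  have := ((tendsto_reg_pow_inv hu 3).const_mul (sphereArea 3)⁻¹).smul_const u
  simpa only [bsField, reg_zero_left] using this

theorem real_inner_eq_three (u v : E 3) : inner ℝ u v = u 0 * v 0 + u 1 * v 1 + u 2 * v 2 := by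
  rw [PiLp.inner_apply, Fin.sum_univ_three]
  simp only [RCLike.inner_apply, conj_trivial]
  ring

/-- The divergence of the regularized field is the peak. -/
theorem det3_bsDeriv {ε : ℝ} (hε : 0 < ε) (u a b c : E 3) :
    det3 (bsDeriv ε u a) b c + det3 a (bsDeriv ε u b) c + det3 a b (bsDeriv ε u c) =
      peak 3 ε u * det3 a b c := by
  have h1 := reg_sq ε u
  have h2 := (reg_pos hε u).ne'
  -- With the common factor √(|u|² + ε²)^{-5} the claim becomes a polynomial identity in the
  -- coordinates.
  have h3 : (reg ε u ^ 3)⁻¹ = (reg ε u ^ 5)⁻¹ * (‖u‖ ^ 2 + ε ^ 2) := by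
    rw [← h1]; field_simp
  have h4 : ‖u‖ ^ 2 = u 0 * u 0 + u 1 * u 1 + u 2 * u 2 := by
    rw [← real_inner_self_eq_norm_sq, real_inner_eq_three]
  unfold bsDeriv peak
  rw [h3, h4]
  simp only [det3_eq, PiLp.add_apply, PiLp.smul_apply, smul_eq_mul, real_inner_eq_three]
  push_cast
  ring

/-! ### Coordinates -/

/-- The coordinates of the plane. -/
def planeEquiv : (ℝ × ℝ) ≃L[ℝ] E 2 :=
  LinearEquiv.toContinuousLinearEquiv
    { toFun := fun p => !₂[p.1, p.2]
      invFun := fun u => (u 0, u 1)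
      map_add' := fun p q => by ext i; fin_cases i <;> simp
      map_smul' := fun c p => by ext i; fin_cases i <;> simp
      left_inv := fun p => by simp
      right_inv := fun u => by ext i; fin_cases i <;> simp }

theorem planeEquiv_apply (p : ℝ × ℝ) : planeEquiv p = !₂[p.1, p.2] := rfl

theorem planeEquiv_symm_apply (u : E 2) : planeEquiv.symm u = (u 0, u 1) := rfl

theorem measurePreserving_planeEquiv : MeasurePreserving planeEquiv := by
  have h := (PiLp.volume_preserving_toLp (Fin 2)).comp (volume_preserving_finTwoArrow ℝ).symm
  exact h

/-- `ℝ³` as the product of a plane and a line. -/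
def spaceEquiv : E 3 ≃L[ℝ] E 2 × ℝ :=
  LinearEquiv.toContinuousLinearEquiv
    { toFun := fun u => (!₂[u 0, u 1], u 2)
      invFun := fun p => !₂[p.1 0, p.1 1, p.2]
      map_add' := fun p q => by
        ext i
        · fin_cases i <;> simp
        · simp
      map_smul' := fun c p => by
        ext i
        · fin_cases i <;> simp
        · simp
      left_inv := fun u => by ext i; fin_cases i <;> simp
      right_inv := fun p => by
        ext i
        · fin_cases i <;> simp
        · simp }

theorem spaceEquiv_apply (u : E 3) : spaceEquiv u = (!₂[u 0, u 1], u 2) := rfl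

theorem measurePreserving_spaceEquiv : MeasurePreserving spaceEquiv := by
  have h1 := (volume_preserving_piFinSuccAbove (fun _ : Fin 3 => ℝ) (Fin.last 2)).comp
    (PiLp.volume_preserving_ofLp (Fin 3))
  have h2 := (((MeasurePreserving.id (volume : Measure ℝ)).prod
    (PiLp.volume_preserving_toLp (Fin 2))).comp h1)
  have h3 := (Measure.measurePreserving_swap (μ := (volume : Measure ℝ))
    (ν := (volume : Measure (E 2)))).comp h2
  have h4 : ⇑spaceEquiv = Prod.swap ∘ Prod.map id (WithLp.toLp 2) ∘
      ⇑(MeasurableEquiv.piFinSuccAbove (fun _ : Fin 3 => ℝ) (Fin.last 2)) ∘ WithLp.ofLp := by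
    funext u
    ext i
    · fin_cases i <;> rfl
    · rfl
  rw [h4]
  exact h3

theorem measurableEmbedding_spaceEquiv : MeasurableEmbedding spaceEquiv :=
  spaceEquiv.toHomeomorph.measurableEmbedding

theorem det_eq_det3 (A : E 3 →L[ℝ] E 3) :
    A.det = det3 (A (stdVec 3 0)) (A (stdVec 3 1)) (A (stdVec 3 2)) := by
  have h := LinearMap.det_toMatrix (EuclideanSpace.basisFun (Fin 3) ℝ).toBasis (A : E 3 →ₗ[ℝ] E 3)
  rw [ContinuousLinearMap.det, ← h, Matrix.det_fin_three, det3_eq]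
  simp only [LinearMap.toMatrix_apply, OrthonormalBasis.coe_toBasis,
    OrthonormalBasis.coe_toBasis_repr_apply, EuclideanSpace.basisFun_apply,
    EuclideanSpace.basisFun_repr, ContinuousLinearMap.coe_coe]
  unfold stdVec
  ring

/-- The Jacobian of a map from the product of a plane and a line to `ℝ³`. -/
def prodJac (Z : E 2 × ℝ → E 3) (z : E 2 × ℝ) : ℝ :=
  det3 (fderiv ℝ Z z (stdVec 2 0, 0)) (fderiv ℝ Z z (stdVec 2 1, 0)) (fderiv ℝ Z z (0, 1))

theorem det_fderiv_comp_spaceEquiv (Z : E 2 × ℝ → E 3) (x : E 3) :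
    (fderiv ℝ (Z ∘ spaceEquiv) x).det = prodJac Z (spaceEquiv x) := by
  rw [det_eq_det3, prodJac, ContinuousLinearEquiv.comp_right_fderiv]
  have h0 : spaceEquiv (stdVec 3 0) = (stdVec 2 0, 0) := by
    rw [spaceEquiv_apply]
    ext i
    · fin_cases i <;> simp [stdVec_apply]
    · simp [stdVec_apply]
  have h1 : spaceEquiv (stdVec 3 1) = (stdVec 2 1, 0) := by
    rw [spaceEquiv_apply]
    ext i
    · fin_cases i <;> simp [stdVec_apply]
    · simp [stdVec_apply]
  have h2 : spaceEquiv (stdVec 3 2) = (0, 1) := by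
    rw [spaceEquiv_apply]
    ext i
    · fin_cases i <;> simp [stdVec_apply]
    · simp [stdVec_apply]
  simp only [ContinuousLinearMap.comp_apply, ContinuousLinearEquiv.coe_coe, h0, h1, h2]

/-- The version in which the limit is used: two parameters in the plane and one on the line, either
(s, t; r) for two curves and a direction or (u; t) for a surface and a curve. -/
theorem tendsto_integral_mul_peak_prod {C : Set (E 2 × ℝ)} (hC : IsCompact C)
    {Z : E 2 × ℝ → E 3} {g w : E 2 × ℝ → ℝ} (hZ : ContinuousOn Z C) (hgm : AEStronglyMeasurable g)
    {M : ℝ} (hg : ∀ x, |g x| ≤ M) (hg0 : ∀ x ∉ C, g x = 0)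
    (h : ∀ z ∈ C, Z z = 0 → ContDiffAt ℝ 1 Z z ∧ prodJac Z z ≠ 0 ∧ ContinuousAt w z ∧
      g =ᶠ[𝓝 z] fun x => w x * prodJac Z x) :
    {z | z ∈ C ∧ Z z = 0}.Finite ∧
    Tendsto (fun ε => ∫ x, g x * peak 3 ε (Z x)) (𝓝[>] 0)
      (𝓝 (∑ᶠ z ∈ {z | z ∈ C ∧ Z z = 0}, w z * (SignType.sign (prodJac Z z) : ℝ))) := by
  have hcont := spaceEquiv.continuous
  have key := tendsto_integral_mul_peak (n := 3) (Z := Z ∘ spaceEquiv) (g := g ∘ spaceEquiv)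
    (w := w ∘ spaceEquiv) (by omega) (spaceEquiv.toHomeomorph.isCompact_preimage.2 hC)
    (hZ.comp hcont.continuousOn fun x hx => hx)
    (hgm.comp_measurePreserving measurePreserving_spaceEquiv) (fun x => hg _) (fun x hx => hg0 _ hx)
    (fun x hx hx0 => by
      obtain ⟨h1, h2, h3, h4⟩ := h _ hx hx0
      refine ⟨h1.comp x spaceEquiv.contDiff.contDiffAt, ?_, h3.comp hcont.continuousAt, ?_⟩
      · rwa [det_fderiv_comp_spaceEquiv]
      · filter_upwards [hcont.continuousAt.eventually h4] with y hy
        rw [det_fderiv_comp_spaceEquiv]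
        exact hy)
  have himg : {z | z ∈ C ∧ Z z = 0} =
      spaceEquiv '' {x | x ∈ spaceEquiv.toHomeomorph ⁻¹' C ∧ (Z ∘ spaceEquiv) x = 0} := by
    ext z
    constructor
    · rintro ⟨hz, h0⟩
      refine ⟨spaceEquiv.symm z, ⟨?_, ?_⟩, spaceEquiv.apply_symm_apply z⟩
      · change spaceEquiv (spaceEquiv.symm z) ∈ C
        rwa [spaceEquiv.apply_symm_apply]
      · rwa [Function.comp_apply, spaceEquiv.apply_symm_apply]
    · rintro ⟨x, ⟨hx, h0⟩, rfl⟩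
      exact ⟨hx, h0⟩
  refine ⟨by rw [himg]; exact key.1.image _, ?_⟩
  rw [himg, finsum_mem_image spaceEquiv.injective.injOn]
  have h1 : ∀ x, (SignType.sign (fderiv ℝ (Z ∘ spaceEquiv) x).det : ℝ) =
      (SignType.sign (prodJac Z (spaceEquiv x)) : ℝ) := fun x => by
    rw [det_fderiv_comp_spaceEquiv]
  simp only [h1] at key
  refine key.2.congr fun ε => ?_
  exact measurePreserving_spaceEquiv.integral_comp measurableEmbedding_spaceEquiv
    fun x => g x * peak 3 ε (Z x)

/-! ### The tent function -/

/-- The tent function, a partition of unity under integer translations. -/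
def tent (t : ℝ) : ℝ := max 0 (1 - |t|)

theorem continuous_tent : Continuous tent := by unfold tent; fun_prop

theorem tent_eq_zero {t : ℝ} (ht : t ∉ Icc (-1 : ℝ) 1) : tent t = 0 := by
  refine max_eq_left ?_
  by_contra h
  exact ht (abs_le.1 (by linarith))

theorem tent_add_tent_sub {t : ℝ} (ht : t ∈ Ico (0 : ℝ) 1) : tent t + tent (t - 1) = 1 := by
  obtain ⟨h0, h1⟩ := ht
  rw [tent, tent, abs_of_nonneg h0, abs_of_nonpos (by linarith), max_eq_right (by linarith),
    max_eq_right (by linarith)]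
  ring

theorem tent_one : tent 1 = 0 := by simp [tent]

/-- The integer translates of the tent add up to one, so it can replace the indicator function of a
period. Unlike the indicator it is continuous, so zeros at the ends of the period need no separate
treatment when localizing. -/
theorem integral_tent_mul {h : ℝ → ℝ} (hc : Continuous h) (hp : Function.Periodic h 1) :
    ∫ t, tent t * h t = ∫ t in (0 : ℝ)..1, h t := by
  have hi : ∀ a b : ℝ, IntervalIntegrable (fun t => tent t * h t) volume a b := fun a b =>
    (continuous_tent.mul hc).intervalIntegrable a b
  have h1 : ∫ t, tent t * h t = ∫ t in (-1 : ℝ)..1, tent t * h t := by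
    rw [intervalIntegral.integral_of_le (by norm_num), ← integral_Icc_eq_integral_Ioc]
    refine (setIntegral_eq_integral_of_forall_compl_eq_zero fun t ht => ?_).symm
    rw [tent_eq_zero ht, zero_mul]
  have h2 : ∫ t in (-1 : ℝ)..0, tent t * h t = ∫ t in (0 : ℝ)..1, tent (t - 1) * h t := by
    have := intervalIntegral.integral_comp_sub_right (a := 0) (b := 1) (fun t => tent t * h t) 1
    rw [zero_sub, sub_self] at this
    rw [← this]
    refine intervalIntegral.integral_congr fun t _ => ?_
    rw [← hp (t - 1), sub_add_cancel]
  have hj : IntervalIntegrable (fun t => tent (t - 1) * h t) volume 0 1 :=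
    ((continuous_tent.comp (continuous_sub_right 1)).mul hc).intervalIntegrable 0 1
  rw [h1, ← intervalIntegral.integral_add_adjacent_intervals (hi (-1) 0) (hi 0 1), h2,
    ← intervalIntegral.integral_add hj (hi 0 1)]
  rw [intervalIntegral.integral_of_le zero_le_one, intervalIntegral.integral_of_le zero_le_one,
    ← integral_Ico_eq_integral_Ioc, ← integral_Ico_eq_integral_Ioc]
  refine setIntegral_congr_fun measurableSet_Ico fun t ht => ?_
  have := tent_add_tent_sub ht
  rw [← add_mul, add_comm (tent (t - 1)), this, one_mul]

/-- A solution t in [0, 1) and its translate t - 1 carry weights with sum one, so the weighted count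
over [-1, 1] is the plain count over one period. -/
theorem finsum_tent_mul {α : Type*} {P : α → ℝ → Prop} {F : α → ℝ → ℝ}
    (hP : ∀ a t, P a (t + 1) ↔ P a t) (hF : ∀ a t, F a (t + 1) = F a t)
    (hfin : {q : α × ℝ | q.2 ∈ Icc (-1 : ℝ) 1 ∧ P q.1 q.2}.Finite) :
    ∑ᶠ q ∈ {q : α × ℝ | q.2 ∈ Icc (-1 : ℝ) 1 ∧ P q.1 q.2}, tent q.2 * F q.1 q.2 =
      ∑ᶠ q ∈ {q : α × ℝ | q.2 ∈ Ico (0 : ℝ) 1 ∧ P q.1 q.2}, F q.1 q.2 := by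
  set A := {q : α × ℝ | q.2 ∈ Ico (0 : ℝ) 1 ∧ P q.1 q.2}
  set B := {q : α × ℝ | q.2 ∈ Ico (-1 : ℝ) 0 ∧ P q.1 q.2}
  set D := {q : α × ℝ | q.2 ∈ Icc (-1 : ℝ) 1 ∧ P q.1 q.2}
  have hA : A ⊆ D := fun q hq => ⟨⟨by linarith [hq.1.1], hq.1.2.le⟩, hq.2⟩
  have hB : B ⊆ D := fun q hq => ⟨⟨hq.1.1, by linarith [hq.1.2]⟩, hq.2⟩
  have hAf := hfin.subset hA
  have hBf := hfin.subset hB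
  have hdisj : Disjoint A B := by
    rw [Set.disjoint_left]
    intro q h1 h2
    linarith [h1.1.1, h2.1.2]
  have h1 : ∑ᶠ q ∈ D, tent q.2 * F q.1 q.2 = ∑ᶠ q ∈ A ∪ B, tent q.2 * F q.1 q.2 := by
    refine finsum_mem_inter_support_eq _ _ _ (Subset.antisymm ?_
      (inter_subset_inter_left _ (union_subset hA hB)))
    · rintro q ⟨hq, hs⟩
      refine ⟨?_, hs⟩
      by_contra hne
      -- The only point of [-1, 1] outside both half-open intervals is 1, where the tent vanishes.
      have h2 : q.2 = 1 := by
        by_contra h3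
        rcases lt_or_ge q.2 0 with h | h
        · exact hne (Or.inr ⟨⟨hq.1.1, h⟩, hq.2⟩)
        · exact hne (Or.inl ⟨⟨h, lt_of_le_of_ne hq.1.2 h3⟩, hq.2⟩)
      exact hs (by simp only [h2, tent_one, zero_mul])
  have hBA : B = (fun q : α × ℝ => (q.1, q.2 - 1)) '' A := by
    ext q
    constructor
    · intro hq
      refine ⟨(q.1, q.2 + 1), ⟨⟨by simp only; linarith [hq.1.1], by simp only; linarith [hq.1.2]⟩,
        (hP _ _).2 hq.2⟩, by simp⟩
    · rintro ⟨p, hp, rfl⟩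
      refine ⟨⟨by simp only; linarith [hp.1.1], by simp only; linarith [hp.1.2]⟩, ?_⟩
      rw [← hP, sub_add_cancel]
      exact hp.2
  have hinj : InjOn (fun q : α × ℝ => (q.1, q.2 - 1)) A := by
    intro p _ q _ h
    simp only [Prod.mk.injEq, sub_left_inj] at h
    exact Prod.ext h.1 h.2
  rw [h1, finsum_mem_union hdisj hAf hBf, hBA, finsum_mem_image hinj,
    ← finsum_mem_add_distrib hAf]
  refine finsum_mem_congr rfl fun q hq => ?_
  have h3 : F q.1 (q.2 - 1) = F q.1 q.2 := by rw [← hF, sub_add_cancel]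
  simp only
  rw [h3, ← add_mul, tent_add_tent_sub hq.1, one_mul]

/-! ### The Gauss integral of two closed curves -/

theorem integral_swap {F : ℝ → ℝ → ℝ} (h : Continuous fun p : ℝ × ℝ => F p.1 p.2) (a b c d : ℝ) :
    ∫ x in a..b, ∫ y in c..d, F x y = ∫ y in c..d, ∫ x in a..b, F x y := by
  refine intervalIntegral_intervalIntegral_swap ?_
  have h1 : IntegrableOn (fun p : ℝ × ℝ => F p.1 p.2) (uIcc a b ×ˢ uIcc c d) :=
    h.continuousOn.integrableOn_compact (isCompact_uIcc.prod isCompact_uIcc)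
  exact h1.mono_set (prod_mono uIoc_subset_uIcc uIoc_subset_uIcc)

theorem continuous_integral {X : Type*} [TopologicalSpace X] {F : X → ℝ → ℝ}
    (h : Continuous fun p : X × ℝ => F p.1 p.2) (a b : ℝ) :
    Continuous fun x => ∫ t in a..b, F x t :=
  intervalIntegral.continuous_parametric_intervalIntegral_of_continuous' h a b

section TripleIntegral

variable {H : ℝ → ℝ → ℝ → ℝ} {a b c d e f : ℝ}

theorem triple_integral_eq_zero_fst (h : Continuous fun p : ℝ × ℝ × ℝ => H p.1 p.2.1 p.2.2)
    (h0 : ∀ t r, ∫ s in a..b, H s t r = 0) :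
    ∫ s in a..b, ∫ t in c..d, ∫ r in e..f, H s t r = 0 := by
  rw [integral_swap (F := fun s t => ∫ r in e..f, H s t r)
    (continuous_integral (X := ℝ × ℝ) (F := fun p r => H p.1 p.2 r) (h.comp (by fun_prop :
      Continuous fun q : (ℝ × ℝ) × ℝ => (q.1.1, q.1.2, q.2))) e f)]
  refine (intervalIntegral.integral_congr fun t _ => ?_).trans intervalIntegral.integral_zero
  rw [integral_swap (F := fun s r => H s t r)
    (h.comp (by fun_prop : Continuous fun q : ℝ × ℝ => (q.1, t, q.2)))]
  simp [h0]

theorem triple_integral_eq_zero_snd (h : Continuous fun p : ℝ × ℝ × ℝ => H p.1 p.2.1 p.2.2)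
    (h0 : ∀ s r, ∫ t in c..d, H s t r = 0) :
    ∫ s in a..b, ∫ t in c..d, ∫ r in e..f, H s t r = 0 := by
  refine (intervalIntegral.integral_congr fun s _ => ?_).trans intervalIntegral.integral_zero
  rw [integral_swap (F := fun t r => H s t r)
    (h.comp (by fun_prop : Continuous fun q : ℝ × ℝ => (s, q.1, q.2)))]
  simp [h0]

theorem triple_integral_add {H' : ℝ → ℝ → ℝ → ℝ}
    (h : Continuous fun p : ℝ × ℝ × ℝ => H p.1 p.2.1 p.2.2)
    (h' : Continuous fun p : ℝ × ℝ × ℝ => H' p.1 p.2.1 p.2.2) :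
    ∫ s in a..b, ∫ t in c..d, ∫ r in e..f, (H s t r + H' s t r) =
      (∫ s in a..b, ∫ t in c..d, ∫ r in e..f, H s t r) +
        ∫ s in a..b, ∫ t in c..d, ∫ r in e..f, H' s t r := by
  have h3 : ∀ G : ℝ → ℝ → ℝ → ℝ, (Continuous fun p : ℝ × ℝ × ℝ => G p.1 p.2.1 p.2.2) →
      Continuous fun p : ℝ × ℝ => ∫ r in e..f, G p.1 p.2 r := fun G hG =>
    continuous_integral (X := ℝ × ℝ) (F := fun p r => G p.1 p.2 r) (hG.comp (by fun_prop :
      Continuous fun q : (ℝ × ℝ) × ℝ => (q.1.1, q.1.2, q.2))) e f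
  have h2 : ∀ G : ℝ → ℝ → ℝ → ℝ, (Continuous fun p : ℝ × ℝ × ℝ => G p.1 p.2.1 p.2.2) →
      Continuous fun s => ∫ t in c..d, ∫ r in e..f, G s t r := fun G hG =>
    continuous_integral (X := ℝ) (F := fun s t => ∫ r in e..f, G s t r) (h3 G hG) c d
  rw [← intervalIntegral.integral_add ((h2 H h).intervalIntegrable a b)
    ((h2 H' h').intervalIntegrable a b)]
  refine intervalIntegral.integral_congr fun s _ => ?_
  refine Eq.trans ?_ (intervalIntegral.integral_add
    (((h3 H h).comp (by fun_prop : Continuous fun t : ℝ => (s, t))).intervalIntegrable c d)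
    (((h3 H' h').comp (by fun_prop : Continuous fun t : ℝ => (s, t))).intervalIntegrable c d))
  refine intervalIntegral.integral_congr fun t _ => ?_
  exact intervalIntegral.integral_add
    ((h.comp (by fun_prop : Continuous fun r : ℝ => (s, t, r))).intervalIntegrable e f)
    ((h'.comp (by fun_prop : Continuous fun r : ℝ => (s, t, r))).intervalIntegrable e f)

end TripleIntegral

/-! ### Closed smooth curves and their regularized Gauss integrals -/

theorem periodic_deriv {k : ℝ → E 3} (hp : Function.Periodic k 1) :
    Function.Periodic (deriv k) 1 := by
  intro t
  rw [← deriv_comp_add_const]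
  congr 1
  funext s
  exact hp s

theorem ContDiff.continuous_deriv_top {k : ℝ → E 3} (hk : ContDiff ℝ ∞ k) : Continuous (deriv k) :=
  hk.continuous_deriv (by simp)

theorem ContDiff.hasDerivAt_top {k : ℝ → E 3} (hk : ContDiff ℝ ∞ k) (t : ℝ) :
    HasDerivAt k (deriv k t) t :=
  (hk.differentiable (by simp) t).hasDerivAt

theorem integral_deriv_periodic_eq_zero {h h' : ℝ → ℝ} (hd : ∀ t, HasDerivAt h (h' t) t)
    (hc : Continuous h') (hp : h 1 = h 0) : ∫ t in (0 : ℝ)..1, h' t = 0 := by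
  rw [intervalIntegral.integral_eq_sub_of_hasDerivAt (fun t _ => hd t) (hc.intervalIntegrable 0 1),
    hp, sub_self]

theorem hasDerivAt_det3_left {a : ℝ → E 3} {a' : E 3} {t : ℝ} (h : HasDerivAt a a' t) (b c : E 3) :
    HasDerivAt (fun t => det3 (a t) b c) (det3 a' b c) t := by
  have hi : ∀ i, HasDerivAt (fun t => a t i) (a' i) t := fun i =>
    (EuclideanSpace.proj (𝕜 := ℝ) i).hasFDerivAt.comp_hasDerivAt t h
  simp only [det3_eq]
  exact (((((((hi 0).mul_const _).mul_const _).sub (((hi 0).mul_const _).mul_const _)).sub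
    (((hi 1).mul_const _).mul_const _)).add (((hi 1).mul_const _).mul_const _)).add
    (((hi 2).mul_const _).mul_const _)).sub (((hi 2).mul_const _).mul_const _)

/-- The integral of the regularized Biot–Savart form over the product of two closed curves. -/
def gaussIntegral (ε : ℝ) (k l : ℝ → E 3) : ℝ :=
  ∫ s in (0 : ℝ)..1, ∫ t in (0 : ℝ)..1, det3 (bsField ε (k s - l t)) (deriv k s) (-deriv l t)

section Curves

attribute [local irreducible] det3 bsField bsDeriv peak

variable {k l : ℝ → E 3}

theorem continuous_gaussIntegrand {ε : ℝ} (hε : 0 < ε) (hk : ContDiff ℝ ∞ k) (hl : ContDiff ℝ ∞ l) :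
    Continuous fun p : ℝ × ℝ => det3 (bsField ε (k p.1 - l p.2)) (deriv k p.1) (-deriv l p.2) := by
  have h1 := hk.continuous
  have h2 := hl.continuous
  have h3 := ContDiff.continuous_deriv_top hk
  have h4 := ContDiff.continuous_deriv_top hl
  have h5 := continuous_bsField hε
  exact continuous_det3 (by fun_prop) (by fun_prop) (by fun_prop)

/-- The field is odd and the determinant changes sign when the two tangent vectors are exchanged;
the two signs cancel. -/
theorem gaussIntegral_comm {ε : ℝ} (hε : 0 < ε) (hk : ContDiff ℝ ∞ k) (hl : ContDiff ℝ ∞ l) :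
    gaussIntegral ε k l = gaussIntegral ε l k := by
  rw [gaussIntegral, integral_swap (continuous_gaussIntegrand hε hk hl), gaussIntegral]
  refine intervalIntegral.integral_congr fun t _ => intervalIntegral.integral_congr fun s _ => ?_
  rw [← neg_sub (l t), bsField_neg, det3_neg_left, det3_neg_right, det3_neg_right, neg_neg,
    ← det3_swap]

/-- The parameters range over [-1, 1] because this is the support of the tent. The lower bound keeps
the field bounded; the upper bound tells how far a curve must be moved. -/
theorem exists_dist_bounds (hk : Continuous k) (hl : Continuous l) (hne : ∀ s t, k s ≠ l t) :
    ∃ m > 0, ∃ M > 0, ∀ s ∈ Icc (-1 : ℝ) 1, ∀ t ∈ Icc (-1 : ℝ) 1,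
      m ≤ ‖k s - l t‖ ∧ ‖k s - l t‖ ≤ M := by
  have hc : ContinuousOn (fun p : ℝ × ℝ => ‖k p.1 - l p.2‖) (Icc (-1) 1 ×ˢ Icc (-1) 1) :=
    (by fun_prop : Continuous fun p : ℝ × ℝ => ‖k p.1 - l p.2‖).continuousOn
  have hK : IsCompact (Icc (-1 : ℝ) 1 ×ˢ Icc (-1 : ℝ) 1) := isCompact_Icc.prod isCompact_Icc
  have hne' : (Icc (-1 : ℝ) 1 ×ˢ Icc (-1 : ℝ) 1).Nonempty := ⟨(0, 0), by simp, by simp⟩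
  obtain ⟨p, hp, hmin⟩ := hK.exists_isMinOn hne' hc
  obtain ⟨q, hq, hmax⟩ := hK.exists_isMaxOn hne' hc
  refine ⟨‖k p.1 - l p.2‖, norm_pos_iff.2 (sub_ne_zero.2 (hne _ _)), ‖k q.1 - l q.2‖,
    norm_pos_iff.2 (sub_ne_zero.2 (hne _ _)), fun s hs t ht => ⟨?_, ?_⟩⟩
  · exact hmin (a := (s, t)) ⟨hs, ht⟩
  · exact hmax (a := (s, t)) ⟨hs, ht⟩

theorem exists_deriv_bound (hk : ContDiff ℝ ∞ k) : ∃ B, 0 ≤ B ∧ ∀ s ∈ Icc (0 : ℝ) 1, ‖deriv k s‖ ≤ B := by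
  obtain ⟨B, hB⟩ := isCompact_Icc.exists_bound_of_continuousOn
    (ContDiff.continuous_deriv_top hk).continuousOn (s := Icc (0 : ℝ) 1)
  exact ⟨B, (norm_nonneg _).trans (hB 0 (by simp)), hB⟩

theorem exists_gaussIntegral_bound (hk : ContDiff ℝ ∞ k) (hl : ContDiff ℝ ∞ l) :
    ∃ B, 0 ≤ B ∧ ∀ (ε : ℝ) (x : E 3), ∀ s ∈ Icc (0 : ℝ) 1, ∀ t ∈ Icc (0 : ℝ) 1, ∀ r > 0,
      r ≤ ‖x‖ → |det3 (bsField ε x) (deriv k s) (-deriv l t)| ≤ B * (r ^ 2)⁻¹ := by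
  obtain ⟨B, hB0, hB⟩ := exists_deriv_bound hk
  obtain ⟨B', hB0', hB'⟩ := exists_deriv_bound hl
  have hS := sphereArea_pos (n := 3) (by omega)
  refine ⟨6 * ((sphereArea 3)⁻¹ * B * B'), by positivity, fun ε x s hs t ht r hr hx => ?_⟩
  refine (abs_det3_le _ _ _).trans ?_
  rw [norm_neg]
  calc 6 * (‖bsField ε x‖ * ‖deriv k s‖ * ‖deriv l t‖)
      ≤ 6 * ((sphereArea 3)⁻¹ * (r ^ 2)⁻¹ * B * B') := by
        gcongr
        · exact norm_bsField_le ε hr hx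
        · exact hB s hs
        · exact hB' t ht
    _ = _ := by ring

theorem tendsto_gaussIntegral (hk : ContDiff ℝ ∞ k) (hl : ContDiff ℝ ∞ l)
    (hne : ∀ s t, k s ≠ l t) :
    Tendsto (fun ε => gaussIntegral ε k l) (𝓝[>] 0) (𝓝 (gaussIntegral 0 k l)) := by
  obtain ⟨m, hm, M, hM, hmM⟩ := exists_dist_bounds hk.continuous hl.continuous hne
  obtain ⟨B, hB0, hB⟩ := exists_gaussIntegral_bound hk hl
  have hI : ∀ {s : ℝ}, s ∈ uIoc (0 : ℝ) 1 → s ∈ Icc (0 : ℝ) 1 := fun hs => by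
    rw [uIoc_of_le zero_le_one] at hs
    exact Ioc_subset_Icc_self hs
  have hI' : ∀ {s : ℝ}, s ∈ Icc (0 : ℝ) 1 → s ∈ Icc (-1 : ℝ) 1 := fun hs =>
    ⟨by linarith [hs.1], hs.2⟩
  have hb : ∀ (ε : ℝ), ∀ s ∈ Icc (0 : ℝ) 1, ∀ t ∈ Icc (0 : ℝ) 1,
      ‖det3 (bsField ε (k s - l t)) (deriv k s) (-deriv l t)‖ ≤ B * (m ^ 2)⁻¹ :=
    fun ε s hs t ht => hB ε _ s hs t ht m hm (hmM s (hI' hs) t (hI' ht)).1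
  have hcont : ∀ {ε : ℝ}, 0 < ε → Continuous fun p : ℝ × ℝ =>
      det3 (bsField ε (k p.1 - l p.2)) (deriv k p.1) (-deriv l p.2) := fun hε =>
    continuous_gaussIntegrand hε hk hl
  refine intervalIntegral.tendsto_integral_filter_of_dominated_convergence
    (fun _ => B * (m ^ 2)⁻¹) ?_ ?_ intervalIntegrable_const ?_
  · filter_upwards [self_mem_nhdsWithin] with ε hε
    exact (continuous_integral (F := fun s t => det3 (bsField ε (k s - l t)) (deriv k s)
      (-deriv l t)) (hcont hε) 0 1).aestronglyMeasurable
  · refine Eventually.of_forall fun ε => ae_of_all _ fun s hs => ?_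
    have h1 := intervalIntegral.norm_integral_le_of_norm_le_const (a := 0) (b := 1)
      fun t ht => hb ε s (hI hs) t (hI ht)
    simpa using h1
  · refine ae_of_all _ fun s hs => ?_
    refine intervalIntegral.tendsto_integral_filter_of_dominated_convergence
      (fun _ => B * (m ^ 2)⁻¹) ?_ ?_ intervalIntegrable_const ?_
    · filter_upwards [self_mem_nhdsWithin] with ε hε
      exact ((hcont hε).comp (by fun_prop : Continuous fun t : ℝ => (s, t))).aestronglyMeasurable
    · exact Eventually.of_forall fun ε => ae_of_all _ fun t ht => hb ε s (hI hs) t (hI ht)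
    · refine ae_of_all _ fun t _ => ?_
      have h1 := tendsto_bsField (sub_ne_zero.2 (hne s t))
      have h2 : Continuous fun x : E 3 => det3 x (deriv k s) (-deriv l t) :=
        continuous_det3 continuous_id continuous_const continuous_const
      exact (h2.tendsto _).comp h1

/-- The integral over a box, periodic in two directions, of the divergence of the regularized
field along a family of points. -/
theorem triple_integral_peak {ε : ℝ} (hε : 0 < ε) {Z : ℝ → ℝ → ℝ → E 3} {a b : ℝ → E 3} {c : E 3}
    (hZ : Continuous fun p : ℝ × ℝ × ℝ => Z p.1 p.2.1 p.2.2) (ha : Continuous a)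
    (hb : Continuous b) (hZs : ∀ s t r, HasDerivAt (fun s => Z s t r) (a s) s)
    (hZt : ∀ s t r, HasDerivAt (fun t => Z s t r) (b t) t)
    (hZr : ∀ s t r, HasDerivAt (fun r => Z s t r) c r)
    (hs : ∀ t r, Z 1 t r = Z 0 t r) (ht : ∀ s r, Z s 1 r = Z s 0 r) (R : ℝ) :
    ∫ s in (0 : ℝ)..1, ∫ t in (0 : ℝ)..1, ∫ r in (0 : ℝ)..R,
        peak 3 ε (Z s t r) * det3 c (a s) (b t) =
      ∫ s in (0 : ℝ)..1, ∫ t in (0 : ℝ)..1,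
        (det3 (bsField ε (Z s t R)) (a s) (b t) - det3 (bsField ε (Z s t 0)) (a s) (b t)) := by
  have h6 := continuous_bsDeriv hε
  have hD : ∀ u : ℝ → ℝ → E 3, (Continuous fun p : ℝ × ℝ => u p.1 p.2) →
      Continuous fun p : ℝ × ℝ × ℝ => bsDeriv ε (Z p.1 p.2.1 p.2.2) (u p.1 p.2.1) := fun u hu =>
    h6.comp (hZ.prodMk (hu.comp (by fun_prop : Continuous fun p : ℝ × ℝ × ℝ => (p.1, p.2.1))))
  have hA : Continuous fun p : ℝ × ℝ × ℝ =>
      det3 (bsDeriv ε (Z p.1 p.2.1 p.2.2) c) (a p.1) (b p.2.1) :=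
    continuous_det3 (hD (fun _ _ => c) continuous_const) (by fun_prop) (by fun_prop)
  have hB : Continuous fun p : ℝ × ℝ × ℝ =>
      det3 (bsDeriv ε (Z p.1 p.2.1 p.2.2) (a p.1)) (b p.2.1) c :=
    continuous_det3 (hD (fun s _ => a s) (by fun_prop)) (by fun_prop) (by fun_prop)
  have hC : Continuous fun p : ℝ × ℝ × ℝ =>
      det3 (bsDeriv ε (Z p.1 p.2.1 p.2.2) (b p.2.1)) c (a p.1) :=
    continuous_det3 (hD (fun _ t => b t) (by fun_prop)) (by fun_prop) (by fun_prop)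
  -- Of the three terms of the divergence, those differentiated in s and in t are total derivatives
  -- of periodic functions and integrate to zero. Only the term differentiated in r leaves boundary
  -- values.
  have hB0 : ∫ s in (0 : ℝ)..1, ∫ t in (0 : ℝ)..1, ∫ r in (0 : ℝ)..R,
      det3 (bsDeriv ε (Z s t r) (a s)) (b t) c = 0 := by
    refine triple_integral_eq_zero_fst
      (H := fun s t r => det3 (bsDeriv ε (Z s t r) (a s)) (b t) c) hB fun t r => ?_
    refine integral_deriv_periodic_eq_zero
      (h := fun s => det3 (bsField ε (Z s t r)) (b t) c)
      (fun s => hasDerivAt_det3_left (hasDerivAt_bsField hε (hZs s t r)) _ _)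
      (hB.comp (by fun_prop : Continuous fun s : ℝ => (s, t, r))) ?_
    rw [hs]
  have hC0 : ∫ s in (0 : ℝ)..1, ∫ t in (0 : ℝ)..1, ∫ r in (0 : ℝ)..R,
      det3 (bsDeriv ε (Z s t r) (b t)) c (a s) = 0 := by
    refine triple_integral_eq_zero_snd
      (H := fun s t r => det3 (bsDeriv ε (Z s t r) (b t)) c (a s)) hC fun s r => ?_
    refine integral_deriv_periodic_eq_zero
      (h := fun t => det3 (bsField ε (Z s t r)) c (a s))
      (fun t => hasDerivAt_det3_left (hasDerivAt_bsField hε (hZt s t r)) _ _)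
      (hC.comp (by fun_prop : Continuous fun t : ℝ => (s, t, r))) ?_
    rw [ht]
  have hA0 : ∫ s in (0 : ℝ)..1, ∫ t in (0 : ℝ)..1, ∫ r in (0 : ℝ)..R,
      det3 (bsDeriv ε (Z s t r) c) (a s) (b t) = ∫ s in (0 : ℝ)..1, ∫ t in (0 : ℝ)..1,
        (det3 (bsField ε (Z s t R)) (a s) (b t) - det3 (bsField ε (Z s t 0)) (a s) (b t)) := by
    refine intervalIntegral.integral_congr fun s _ => intervalIntegral.integral_congr fun t _ => ?_
    exact intervalIntegral.integral_eq_sub_of_hasDerivAt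
      (f := fun r => det3 (bsField ε (Z s t r)) (a s) (b t))
      (fun r _ => hasDerivAt_det3_left (hasDerivAt_bsField hε (hZr s t r)) _ _)
      ((hA.comp (by fun_prop : Continuous fun r : ℝ => (s, t, r))).intervalIntegrable 0 R)
  have hsum := triple_integral_add (a := 0) (b := 1) (c := 0) (d := 1) (e := 0) (f := R)
    (H := fun s t r => det3 (bsDeriv ε (Z s t r) c) (a s) (b t) +
      det3 (bsDeriv ε (Z s t r) (a s)) (b t) c)
    (H' := fun s t r => det3 (bsDeriv ε (Z s t r) (b t)) c (a s)) (hA.add hB) hC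
  rw [triple_integral_add (H := fun s t r => det3 (bsDeriv ε (Z s t r) c) (a s) (b t))
    (H' := fun s t r => det3 (bsDeriv ε (Z s t r) (a s)) (b t) c) hA hB, hB0, hC0, hA0, add_zero,
    add_zero] at hsum
  rw [← hsum]
  refine intervalIntegral.integral_congr fun s _ => intervalIntegral.integral_congr fun t _ =>
    intervalIntegral.integral_congr fun r _ => ?_
  have h7 := det3_bsDeriv hε (Z s t r) c (a s) (b t)
  rw [← det3_cyclic c (bsDeriv ε (Z s t r) (a s)) (b t)]
  rw [det3_cyclic (bsDeriv ε (Z s t r) (b t)) c (a s)]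
  exact h7.symm

/-- The change of the Gauss integral under a translation of the first curve. -/
theorem gaussIntegral_sub_translate {ε : ℝ} (hε : 0 < ε) (hk : ContDiff ℝ ∞ k)
    (hl : ContDiff ℝ ∞ l) (hkp : Function.Periodic k 1) (hlp : Function.Periodic l 1) (v : E 3)
    (R : ℝ) :
    gaussIntegral ε k l - gaussIntegral ε (fun s => k s - R • v) l =
      ∫ s in (0 : ℝ)..1, ∫ t in (0 : ℝ)..1, ∫ r in (0 : ℝ)..R,
        peak 3 ε (k s - l t - r • v) * det3 v (deriv k s) (-deriv l t) := by
  have h1 := hk.continuous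
  have h2 := hl.continuous
  have h3 := ContDiff.continuous_deriv_top hk
  have h4 := ContDiff.continuous_deriv_top hl
  have hk' : ContDiff ℝ ∞ fun s => k s - R • v := hk.sub contDiff_const
  have hg := continuous_gaussIntegrand hε hk hl
  have hg' := continuous_gaussIntegrand hε hk' hl
  have key := triple_integral_peak hε (Z := fun s t r => k s - l t - r • v) (a := deriv k)
    (b := fun t => -deriv l t) (c := -v) (by fun_prop) h3 h4.neg
    (fun s t r => ((ContDiff.hasDerivAt_top hk s).sub_const _).sub_const _)
    (fun s t r => ((ContDiff.hasDerivAt_top hl t).const_sub _).sub_const _)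
    (fun s t r => by simpa using ((hasDerivAt_id r).smul_const v).const_sub (k s - l t))
    (fun t r => by rw [show k 1 = k 0 by simpa using hkp 0])
    (fun s r => by rw [show l 1 = l 0 by simpa using hlp 0]) R
  have hi : ∀ {k' : ℝ → E 3}, (Continuous fun p : ℝ × ℝ =>
      det3 (bsField ε (k' p.1 - l p.2)) (deriv k' p.1) (-deriv l p.2)) →
      IntervalIntegrable (fun s => ∫ t in (0 : ℝ)..1,
        det3 (bsField ε (k' s - l t)) (deriv k' s) (-deriv l t)) volume 0 1 := fun {k'} h =>
    (continuous_integral (F := fun s t => det3 (bsField ε (k' s - l t)) (deriv k' s)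
      (-deriv l t)) h 0 1).intervalIntegrable 0 1
  have hdiff : gaussIntegral ε (fun s => k s - R • v) l - gaussIntegral ε k l =
      ∫ s in (0 : ℝ)..1, ∫ t in (0 : ℝ)..1,
        (det3 (bsField ε (k s - l t - R • v)) (deriv k s) (-deriv l t) -
          det3 (bsField ε (k s - l t - (0 : ℝ) • v)) (deriv k s) (-deriv l t)) := by
    rw [gaussIntegral, gaussIntegral, ← intervalIntegral.integral_sub (hi hg') (hi hg)]
    refine intervalIntegral.integral_congr fun s _ => ?_
    refine (intervalIntegral.integral_sub
      ((hg'.comp (by fun_prop : Continuous fun t : ℝ => (s, t))).intervalIntegrable 0 1)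
      ((hg.comp (by fun_prop : Continuous fun t : ℝ => (s, t))).intervalIntegrable 0 1)).symm.trans
      (intervalIntegral.integral_congr fun t _ => ?_)
    simp only [Function.comp_apply, zero_smul, sub_zero, deriv_sub_const]
    rw [sub_right_comm]
  rw [← neg_sub, hdiff, ← key]
  simp only [det3_neg_left, mul_neg, intervalIntegral.integral_neg, neg_neg]

/-- After translation by R v the curves are at distance at least R - M, and the field is at most a
constant times the inverse square of the distance, uniformly in ε. -/
theorem abs_gaussIntegral_translate_le (hk : ContDiff ℝ ∞ k) (hl : ContDiff ℝ ∞ l)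
    (hne : ∀ s t, k s ≠ l t) {v : E 3} (hv : ‖v‖ = 1) :
    ∃ B M : ℝ, ∀ ε R : ℝ, M < R → |gaussIntegral ε (fun s => k s - R • v) l| ≤
      B * ((R - M) ^ 2)⁻¹ := by
  obtain ⟨m, hm, M, hM, hmM⟩ := exists_dist_bounds hk.continuous hl.continuous hne
  obtain ⟨B, hB0, hB⟩ := exists_gaussIntegral_bound hk hl
  refine ⟨B, M, fun ε R hR => ?_⟩
  have hI : ∀ {s : ℝ}, s ∈ uIoc (0 : ℝ) 1 → s ∈ Icc (0 : ℝ) 1 := fun hs => by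
    rw [uIoc_of_le zero_le_one] at hs
    exact Ioc_subset_Icc_self hs
  have hI' : ∀ {s : ℝ}, s ∈ Icc (0 : ℝ) 1 → s ∈ Icc (-1 : ℝ) 1 := fun hs =>
    ⟨by linarith [hs.1], hs.2⟩
  have h1 : ∀ s ∈ uIoc (0 : ℝ) 1, ∀ t ∈ uIoc (0 : ℝ) 1,
      ‖det3 (bsField ε (k s - R • v - l t)) (deriv (fun s => k s - R • v) s) (-deriv l t)‖ ≤
        B * ((R - M) ^ 2)⁻¹ := by
    intro s hs t ht
    rw [deriv_sub_const]
    refine hB ε _ s (hI hs) t (hI ht) (R - M) (by linarith) ?_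
    have h2 := (hmM s (hI' (hI hs)) t (hI' (hI ht))).2
    have h3 : R = ‖R • v‖ := by rw [norm_smul, hv, mul_one, Real.norm_of_nonneg (by linarith)]
    have h4 : k s - R • v - l t = (k s - l t) - R • v := by abel
    have h5 := norm_sub_norm_le (R • v) (k s - l t)
    rw [h4, ← norm_neg, neg_sub]
    linarith
  have h2 := intervalIntegral.norm_integral_le_of_norm_le_const (a := (0 : ℝ)) (b := 1)
    (f := fun s => ∫ t in (0 : ℝ)..1, det3 (bsField ε (k s - R • v - l t))
      (deriv (fun s => k s - R • v) s) (-deriv l t)) (C := B * ((R - M) ^ 2)⁻¹) fun s hs => by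
    have := intervalIntegral.norm_integral_le_of_norm_le_const (a := (0 : ℝ)) (b := 1)
      fun t ht => h1 s hs t ht
    simpa using this
  simpa [gaussIntegral] using h2

end Curves

/-! ### The Gauss integral as a signed count of directions -/

section Direction

variable {k l : ℝ → E 3}

theorem prodJac_eq {Z : E 2 × ℝ → E 3} {z : E 2 × ℝ} {A : E 2 × ℝ →L[ℝ] E 3}
    (h : HasFDerivAt Z A z) :
    prodJac Z z = det3 (A (stdVec 2 0, 0)) (A (stdVec 2 1, 0)) (A (0, 1)) := by
  rw [prodJac, h.fderiv]

/-- The derivative of `(u, r) ↦ k (u 0) - l (u 1) - r v`. -/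
theorem prodJac_rays (hk : ContDiff ℝ ∞ k) (hl : ContDiff ℝ ∞ l) (v : E 3) (z : E 2 × ℝ) :
    prodJac (fun z : E 2 × ℝ => k (z.1 0) - l (z.1 1) - z.2 • v) z =
      -det3 v (deriv k (z.1 0)) (-deriv l (z.1 1)) := by
  have hc : ∀ i : Fin 2, HasFDerivAt (fun z : E 2 × ℝ => z.1 i)
      ((EuclideanSpace.proj (𝕜 := ℝ) i).comp (ContinuousLinearMap.fst ℝ (E 2) ℝ)) z := fun i =>
    ((EuclideanSpace.proj (𝕜 := ℝ) i).comp (ContinuousLinearMap.fst ℝ (E 2) ℝ)).hasFDerivAt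
  have h1 := (ContDiff.hasDerivAt_top hk (z.1 0)).hasFDerivAt.comp z (hc 0)
  have h2 := (ContDiff.hasDerivAt_top hl (z.1 1)).hasFDerivAt.comp z (hc 1)
  have h3 := (hasFDerivAt_snd (𝕜 := ℝ) (p := z)).smul_const v
  have h4 : HasFDerivAt (fun z : E 2 × ℝ => k (z.1 0) - l (z.1 1) - z.2 • v) _ z :=
    (h1.sub h2).sub h3
  rw [prodJac_eq h4, ← det3_cyclic, ← det3_neg_left]
  simp [stdVec_apply]

theorem contDiff_rays (hk : ContDiff ℝ ∞ k) (hl : ContDiff ℝ ∞ l) (v : E 3) :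
    ContDiff ℝ ∞ fun z : E 2 × ℝ => k (z.1 0) - l (z.1 1) - z.2 • v := by
  have hc : ∀ i : Fin 2, ContDiff ℝ ∞ fun z : E 2 × ℝ => z.1 i := fun i =>
    ((EuclideanSpace.proj (𝕜 := ℝ) i).comp (ContinuousLinearMap.fst ℝ (E 2) ℝ)).contDiff
  exact ((hk.comp (hc 0)).sub (hl.comp (hc 1))).sub (contDiff_snd.smul contDiff_const)

/-- The box `[-1, 1]² × [0, R]`. -/
def rayBox (R : ℝ) : Set (E 2 × ℝ) :=
  {z | z.1 0 ∈ Icc (-1 : ℝ) 1 ∧ z.1 1 ∈ Icc (-1 : ℝ) 1 ∧ z.2 ∈ Icc 0 R}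

theorem isCompact_rayBox (R : ℝ) : IsCompact (rayBox R) := by
  have h : rayBox R = (planeEquiv '' (Icc (-1 : ℝ) 1 ×ˢ Icc (-1 : ℝ) 1)) ×ˢ Icc 0 R := by
    ext z
    simp only [rayBox, mem_ofPred_eq, mem_prod, mem_image]
    constructor
    · rintro ⟨h0, h1, h2⟩
      refine ⟨⟨planeEquiv.symm z.1, ?_, planeEquiv.apply_symm_apply _⟩, h2⟩
      rw [planeEquiv_symm_apply]
      exact ⟨h0, h1⟩
    · rintro ⟨⟨p, ⟨h0, h1⟩, hp⟩, h2⟩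
      rw [← hp, planeEquiv_apply]
      exact ⟨h0, h1, h2⟩
  rw [h]
  exact ((isCompact_Icc.prod isCompact_Icc).image planeEquiv.continuous).prod isCompact_Icc

theorem tent_mul_indicator_rayBox (R : ℝ) (φ : E 2 × ℝ → ℝ) (z : E 2 × ℝ) :
    (rayBox R).indicator (fun z => tent (z.1 0) * tent (z.1 1) * φ z) z =
      tent (z.1 0) * (tent (z.1 1) * (Icc 0 R).indicator (fun r => φ (z.1, r)) z.2) := by
  by_cases h0 : z.1 0 ∈ Icc (-1 : ℝ) 1
  · by_cases h1 : z.1 1 ∈ Icc (-1 : ℝ) 1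
    · by_cases h2 : z.2 ∈ Icc 0 R
      · rw [indicator_of_mem (show z ∈ rayBox R from ⟨h0, h1, h2⟩), indicator_of_mem h2, mul_assoc]
      · rw [indicator_of_notMem (fun h : z ∈ rayBox R => h2 h.2.2), indicator_of_notMem h2]
        simp
    · rw [indicator_of_notMem (fun h : z ∈ rayBox R => h1 h.2.1), tent_eq_zero h1]
      simp
  · rw [indicator_of_notMem (fun h : z ∈ rayBox R => h0 h.1), tent_eq_zero h0]
    simp

theorem integral_plane {h : ℝ → ℝ → ℝ} (hc : Continuous fun p : ℝ × ℝ => h p.1 p.2)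
    (h1 : ∀ t, Function.Periodic (fun s => h s t) 1) (h2 : ∀ s, Function.Periodic (h s) 1) :
    ∫ u : E 2, tent (u 0) * (tent (u 1) * h (u 0) (u 1)) =
      ∫ s in (0 : ℝ)..1, ∫ t in (0 : ℝ)..1, h s t := by
  have he : MeasurableEmbedding planeEquiv := planeEquiv.toHomeomorph.measurableEmbedding
  rw [← measurePreserving_planeEquiv.integral_comp he]
  simp only [planeEquiv_apply, PiLp.toLp_apply, Matrix.cons_val_zero, Matrix.cons_val_one]
  have hct : Continuous fun p : ℝ × ℝ => tent p.1 * (tent p.2 * h p.1 p.2) :=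
    (continuous_tent.comp continuous_fst).mul ((continuous_tent.comp continuous_snd).mul hc)
  have hint : Integrable fun p : ℝ × ℝ => tent p.1 * (tent p.2 * h p.1 p.2) := by
    refine hct.integrable_of_hasCompactSupport
      (HasCompactSupport.of_support_subset_isCompact
        ((isCompact_Icc (a := (-1 : ℝ)) (b := 1)).prod (isCompact_Icc (a := (-1 : ℝ)) (b := 1)))
        fun p hp => ?_)
    by_contra hne
    refine hp ?_
    by_cases h3 : p.1 ∈ Icc (-1 : ℝ) 1
    · have h4 : p.2 ∉ Icc (-1 : ℝ) 1 := fun h4 => hne ⟨h3, h4⟩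
      simp [tent_eq_zero h4]
    · simp [tent_eq_zero h3]
  rw [Measure.volume_eq_prod] at hint ⊢
  rw [integral_prod _ hint]
  have h3 : ∀ s, ∫ t, tent s * (tent t * h s t) = tent s * ∫ t in (0 : ℝ)..1, h s t := fun s => by
    rw [integral_const_mul, integral_tent_mul (h := h s) (hc.comp (by fun_prop :
      Continuous fun t : ℝ => (s, t))) (h2 s)]
  simp only [h3]
  rw [integral_tent_mul (continuous_integral hc 0 1)]
  intro s
  have : ∀ t, h (s + 1) t = h s t := fun t => h1 t s
  simp only [this]


/-- The integrand over `(s, t)` for the translations by `r v`, `0 ≤ r ≤ R`. -/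
def rayIntegral (ε : ℝ) (k l : ℝ → E 3) (v : E 3) (R s t : ℝ) : ℝ :=
  ∫ r in (0 : ℝ)..R, peak 3 ε (k s - l t - r • v) * det3 v (deriv k s) (-deriv l t)

theorem continuous_rayIntegrand {ε : ℝ} (hε : 0 < ε) (hk : ContDiff ℝ ∞ k) (hl : ContDiff ℝ ∞ l)
    (v : E 3) : Continuous fun p : (ℝ × ℝ) × ℝ =>
      peak 3 ε (k p.1.1 - l p.1.2 - p.2 • v) * det3 v (deriv k p.1.1) (-deriv l p.1.2) := by
  have h1 := hk.continuous
  have h2 := hl.continuous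
  have h3 := ContDiff.continuous_deriv_top hk
  have h4 := ContDiff.continuous_deriv_top hl
  have h5 := continuous_peak (n := 3) hε
  exact (h5.comp (by fun_prop)).mul (continuous_det3 continuous_const (by fun_prop) (by fun_prop))

/-- The tents make the weight continuous across s, t = ±1, so the cut-off to the box is visible only
at r = 0 and r = R, where the hypothesis excludes zeros. The peak then concentrates at the zeros,
each with the sign of its Jacobian, which is minus the determinant shown. -/
theorem tendsto_rayIntegral (hk : ContDiff ℝ ∞ k) (hl : ContDiff ℝ ∞ l)
    (hkp : Function.Periodic k 1) (hlp : Function.Periodic l 1) {v : E 3} {R : ℝ}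
    (hR : 0 ≤ R) (h : ∀ z ∈ rayBox R, k (z.1 0) - l (z.1 1) - z.2 • v = 0 → z.2 ∈ Ioo 0 R ∧
      det3 v (deriv k (z.1 0)) (-deriv l (z.1 1)) ≠ 0) :
    {z | z ∈ rayBox R ∧ k (z.1 0) - l (z.1 1) - z.2 • v = 0}.Finite ∧
    Tendsto (fun ε => ∫ s in (0 : ℝ)..1, ∫ t in (0 : ℝ)..1, rayIntegral ε k l v R s t) (𝓝[>] 0)
      (𝓝 (∑ᶠ z ∈ {z | z ∈ rayBox R ∧ k (z.1 0) - l (z.1 1) - z.2 • v = 0},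
        tent (z.1 0) * tent (z.1 1) *
          (SignType.sign (det3 v (deriv k (z.1 0)) (-deriv l (z.1 1))) : ℝ))) := by
  have h1 := hk.continuous
  have h2 := hl.continuous
  have h3 := ContDiff.continuous_deriv_top hk
  have h4 := ContDiff.continuous_deriv_top hl
  have hC := isCompact_rayBox R
  set Z : E 2 × ℝ → E 3 := fun z => k (z.1 0) - l (z.1 1) - z.2 • v with hZ
  set w : E 2 × ℝ → ℝ := fun z => tent (z.1 0) * tent (z.1 1) with hw
  have hZc := contDiff_rays hk hl v
  have hJ : ∀ z, prodJac Z z = -det3 v (deriv k (z.1 0)) (-deriv l (z.1 1)) :=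
    prodJac_rays hk hl v
  have hJc : Continuous (prodJac Z) := by
    have : prodJac Z = fun z => -det3 v (deriv k (z.1 0)) (-deriv l (z.1 1)) := funext hJ
    rw [this]
    exact (continuous_det3 continuous_const (by fun_prop) (by fun_prop)).neg
  have ht := continuous_tent
  have hwc : Continuous w := by fun_prop
  obtain ⟨M, hM⟩ := hC.exists_bound_of_continuousOn (hwc.mul hJc).continuousOn
  have hgm : AEStronglyMeasurable ((rayBox R).indicator fun z => w z * prodJac Z z) :=
    (hwc.mul hJc).aestronglyMeasurable.indicator hC.measurableSet
  have key := tendsto_integral_mul_peak_prod hC (Z := Z) (w := w)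
    (g := (rayBox R).indicator fun z => w z * prodJac Z z) hZc.continuous.continuousOn hgm
    (M := max M 0) (fun z => ?_) (fun z hz => indicator_of_notMem hz _) (fun z hz hz0 => ?_)
  rotate_left
  · by_cases hz : z ∈ rayBox R
    · rw [indicator_of_mem hz]
      exact (hM z hz).trans (le_max_left _ _)
    · rw [indicator_of_notMem hz, abs_zero]
      exact le_max_right _ _
  · obtain ⟨hr, hd⟩ := h z hz hz0
    refine ⟨(hZc.of_le (by simp)).contDiffAt, by rw [hJ]; exact neg_ne_zero.2 hd,
      hwc.continuousAt, ?_⟩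
    have : ∀ᶠ y in 𝓝 z, y.2 ∈ Ioo 0 R :=
      continuous_snd.continuousAt.eventually (Ioo_mem_nhds hr.1 hr.2)
    filter_upwards [this] with y hy
    by_cases hy' : y ∈ rayBox R
    · rw [indicator_of_mem hy']
    · rw [indicator_of_notMem hy']
      -- Here r is interior, so a point outside the box has s or t outside [-1, 1], and its tent
      -- factor makes both sides vanish.
      by_cases h5 : y.1 0 ∈ Icc (-1 : ℝ) 1
      · have h6 : y.1 1 ∉ Icc (-1 : ℝ) 1 := fun h6 => hy' ⟨h5, h6, Ioo_subset_Icc_self hy⟩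
        simp [hw, tent_eq_zero h6]
      · simp [hw, tent_eq_zero h5]
  refine ⟨key.1, ?_⟩
  have hneg := key.2.neg
  have hsum : -∑ᶠ z ∈ {z | z ∈ rayBox R ∧ Z z = 0}, w z * (SignType.sign (prodJac Z z) : ℝ) =
      ∑ᶠ z ∈ {z | z ∈ rayBox R ∧ Z z = 0},
        w z * (SignType.sign (det3 v (deriv k (z.1 0)) (-deriv l (z.1 1))) : ℝ) := by
    rw [← finsum_mem_neg_distrib _ key.1]
    refine finsum_mem_congr rfl fun z _ => ?_
    rw [hJ, Left.sign_neg, SignType.coe_neg, mul_neg, neg_neg]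
  rw [hsum] at hneg
  refine hneg.congr' ?_
  filter_upwards [self_mem_nhdsWithin] with ε hε
  have hpc : Continuous fun z => prodJac Z z * peak 3 ε (Z z) :=
    hJc.mul ((continuous_peak (n := 3) hε).comp hZc.continuous)
  have hg1 : ∀ z, (rayBox R).indicator (fun z => w z * prodJac Z z) z * peak 3 ε (Z z) =
      (rayBox R).indicator (fun z => tent (z.1 0) * tent (z.1 1) *
        (prodJac Z z * peak 3 ε (Z z))) z := fun z => by
    by_cases hz : z ∈ rayBox R
    · rw [indicator_of_mem hz, indicator_of_mem hz, mul_assoc]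
    · rw [indicator_of_notMem hz, indicator_of_notMem hz, zero_mul]
  have hint : Integrable ((rayBox R).indicator (fun z => tent (z.1 0) * tent (z.1 1) *
      (prodJac Z z * peak 3 ε (Z z)))) :=
    (integrable_indicator_iff hC.measurableSet).2
      ((hwc.mul hpc).continuousOn.integrableOn_compact hC)
  simp only [hg1]
  rw [Measure.volume_eq_prod] at hint ⊢
  rw [integral_prod _ hint, ← integral_neg]
  have hin : ∀ u : E 2, -∫ r, (rayBox R).indicator (fun z => tent (z.1 0) * tent (z.1 1) *
      (prodJac Z z * peak 3 ε (Z z))) (u, r) =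
      tent (u 0) * (tent (u 1) * rayIntegral ε k l v R (u 0) (u 1)) := by
    intro u
    simp only [tent_mul_indicator_rayBox]
    rw [integral_const_mul, integral_const_mul, integral_indicator measurableSet_Icc,
      integral_Icc_eq_integral_Ioc, ← intervalIntegral.integral_of_le hR, ← mul_neg, ← mul_neg,
      ← intervalIntegral.integral_neg, rayIntegral]
    congr 2
    refine intervalIntegral.integral_congr fun r _ => ?_
    rw [hJ]
    simp only [hZ]
    ring
  simp only [hin]
  have hkd := periodic_deriv hkp
  have hld := periodic_deriv hlp
  refine integral_plane (h := rayIntegral ε k l v R)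
    (continuous_integral (X := ℝ × ℝ) (F := fun p r => peak 3 ε (k p.1 - l p.2 - r • v) *
      det3 v (deriv k p.1) (-deriv l p.2)) (continuous_rayIntegrand hε hk hl v) 0 R) ?_ ?_
  · intro t s
    simp only [rayIntegral]
    rw [hkp s, hkd s]
  · intro s t
    simp only [rayIntegral]
    rw [hlp t, hld t]

theorem exists_mem_Ico_curve (hkp : Function.Periodic k 1) (s : ℝ) :
    ∃ s' ∈ Ico (0 : ℝ) 1, k s = k s' ∧ deriv k s = deriv k s' := by
  have hp : Function.Periodic (fun s => (k s, deriv k s)) 1 := fun s =>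
    Prod.ext (hkp s) (periodic_deriv hkp s)
  obtain ⟨s', hs', h⟩ := hp.exists_mem_Ico₀ one_pos s
  exact ⟨s', hs', (Prod.mk.injEq _ _ _ _ ▸ h).1, (Prod.mk.injEq _ _ _ _ ▸ h).2⟩

theorem finsum_tent_tent_mul {P : ℝ → ℝ → Prop} {F : ℝ → ℝ → ℝ}
    (hP1 : ∀ s t, P (s + 1) t ↔ P s t) (hP2 : ∀ s t, P s (t + 1) ↔ P s t)
    (hF1 : ∀ s t, F (s + 1) t = F s t) (hF2 : ∀ s t, F s (t + 1) = F s t)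
    (hfin : {q : ℝ × ℝ | q.2 ∈ Icc (-1 : ℝ) 1 ∧ q.1 ∈ Icc (-1 : ℝ) 1 ∧ P q.1 q.2}.Finite) :
    ∑ᶠ q ∈ {q : ℝ × ℝ | q.2 ∈ Icc (-1 : ℝ) 1 ∧ q.1 ∈ Icc (-1 : ℝ) 1 ∧ P q.1 q.2},
        tent q.1 * tent q.2 * F q.1 q.2 =
      ∑ᶠ q ∈ {q : ℝ × ℝ | q.1 ∈ Ico (0 : ℝ) 1 ∧ q.2 ∈ Ico (0 : ℝ) 1 ∧ P q.1 q.2}, F q.1 q.2 := by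
  have h1 := finsum_tent_mul (P := fun s t => s ∈ Icc (-1 : ℝ) 1 ∧ P s t)
    (F := fun s t => tent s * F s t) (fun s t => by rw [hP2]) (fun s t => by rw [hF2]) hfin
  have hsw : {q : ℝ × ℝ | q.2 ∈ Ico (0 : ℝ) 1 ∧ q.1 ∈ Icc (-1 : ℝ) 1 ∧ P q.1 q.2} =
      Prod.swap '' {q : ℝ × ℝ | q.2 ∈ Icc (-1 : ℝ) 1 ∧ q.1 ∈ Ico (0 : ℝ) 1 ∧ P q.2 q.1} := by
    ext q
    rw [image_swap_eq_preimage_swap]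
    exact ⟨fun h => ⟨h.2.1, h.1, h.2.2⟩, fun h => ⟨h.2.1, h.1, h.2.2⟩⟩
  have hsw' : {q : ℝ × ℝ | q.1 ∈ Ico (0 : ℝ) 1 ∧ q.2 ∈ Ico (0 : ℝ) 1 ∧ P q.1 q.2} =
      Prod.swap '' {q : ℝ × ℝ | q.2 ∈ Ico (0 : ℝ) 1 ∧ q.1 ∈ Ico (0 : ℝ) 1 ∧ P q.2 q.1} := by
    ext q
    rw [image_swap_eq_preimage_swap]
    exact Iff.rfl
  have hfin' : {q : ℝ × ℝ | q.2 ∈ Icc (-1 : ℝ) 1 ∧ q.1 ∈ Ico (0 : ℝ) 1 ∧ P q.2 q.1}.Finite := by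
    refine Finite.of_finite_image (f := Prod.swap) ?_ Prod.swap_injective.injOn
    rw [← hsw]
    exact hfin.subset fun q hq => ⟨Ico_subset_Icc_self ⟨by linarith [hq.1.1], hq.1.2⟩, hq.2⟩
  have h2 := finsum_tent_mul (P := fun t s => t ∈ Ico (0 : ℝ) 1 ∧ P s t)
    (F := fun t s => F s t) (fun t s => by rw [hP1]) (fun t s => by rw [hF1]) hfin'
  rw [hsw, finsum_mem_image Prod.swap_injective.injOn] at h1
  rw [hsw', finsum_mem_image Prod.swap_injective.injOn]
  refine Eq.trans (finsum_mem_congr rfl fun q _ => ?_) (h1.trans h2)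
  ring

/-- The Gauss integral counts, with signs, the pairs of parameters at which the direction from the
second curve to the first one is a given regular value. -/
theorem gaussIntegral_zero_eq_finsum (hk : ContDiff ℝ ∞ k) (hl : ContDiff ℝ ∞ l)
    (hkp : Function.Periodic k 1) (hlp : Function.Periodic l 1) (hne : ∀ s t, k s ≠ l t) {v : E 3}
    (hv : ‖v‖ = 1) (hreg : ∀ s ∈ Ico (0 : ℝ) 1, ∀ t ∈ Ico (0 : ℝ) 1,
      ‖k s - l t‖⁻¹ • (k s - l t) = v → det3 v (deriv k s) (-deriv l t) ≠ 0) :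
    {q : ℝ × ℝ | q.1 ∈ Ico (0 : ℝ) 1 ∧ q.2 ∈ Ico (0 : ℝ) 1 ∧
      ‖k q.1 - l q.2‖⁻¹ • (k q.1 - l q.2) = v}.Finite ∧
    gaussIntegral 0 k l = ∑ᶠ q ∈ {q : ℝ × ℝ | q.1 ∈ Ico (0 : ℝ) 1 ∧ q.2 ∈ Ico (0 : ℝ) 1 ∧
      ‖k q.1 - l q.2‖⁻¹ • (k q.1 - l q.2) = v},
        (SignType.sign (det3 v (deriv k q.1) (-deriv l q.2)) : ℝ) := by
  obtain ⟨B, M₁, hB⟩ := abs_gaussIntegral_translate_le hk hl hne hv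
  obtain ⟨m, hm, M₂, hM₂, hmM⟩ := exists_dist_bounds hk.continuous hl.continuous hne
  have hkd := periodic_deriv hkp
  have hld := periodic_deriv hlp
  have hreg' : ∀ s t, ‖k s - l t‖⁻¹ • (k s - l t) = v → det3 v (deriv k s) (-deriv l t) ≠ 0 := by
    intro s t h
    obtain ⟨s', hs', h1, h2⟩ := exists_mem_Ico_curve hkp s
    obtain ⟨t', ht', h3, h4⟩ := exists_mem_Ico_curve hlp t
    rw [h1, h3] at h
    rw [h2, h4]
    exact hreg s' hs' t' ht' h
  set D := {q : ℝ × ℝ | q.2 ∈ Icc (-1 : ℝ) 1 ∧ q.1 ∈ Icc (-1 : ℝ) 1 ∧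
    ‖k q.1 - l q.2‖⁻¹ • (k q.1 - l q.2) = v} with hD
  -- At a zero the parameter r must be the distance |k(s) - l(t)|, because v is a unit vector. Thus
  -- zeros in the box correspond to pairs (s, t) with direction v.
  set j : ℝ × ℝ → E 2 × ℝ := fun q => (planeEquiv q, ‖k q.1 - l q.2‖) with hj
  have hjinj : Function.Injective j := fun p q h => planeEquiv.injective (Prod.ext_iff.1 h).1
  have hnorm : ∀ z : E 2 × ℝ, 0 ≤ z.2 → k (z.1 0) - l (z.1 1) - z.2 • v = 0 →
      ‖k (z.1 0) - l (z.1 1)‖ = z.2 ∧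
      ‖k (z.1 0) - l (z.1 1)‖⁻¹ • (k (z.1 0) - l (z.1 1)) = v := by
    intro z hz h0
    have h1 := sub_eq_zero.1 h0
    have h2 : ‖k (z.1 0) - l (z.1 1)‖ = z.2 := by
      rw [h1, norm_smul, hv, mul_one, Real.norm_of_nonneg hz]
    refine ⟨h2, ?_⟩
    have h3 : z.2 ≠ 0 := by
      rw [← h2]
      exact norm_ne_zero_iff.2 (sub_ne_zero.2 (hne _ _))
    rw [h2, h1, smul_smul, inv_mul_cancel₀ h3, one_smul]
  -- Once R exceeds every distance between the curves, the set of zeros no longer depends on R.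
  have hzero : ∀ R, M₂ < R →
      {z | z ∈ rayBox R ∧ k (z.1 0) - l (z.1 1) - z.2 • v = 0} = j '' D := by
    intro R hR
    ext z
    constructor
    · rintro ⟨⟨h0, h1, h2⟩, h3⟩
      obtain ⟨h4, h5⟩ := hnorm z h2.1 h3
      refine ⟨(z.1 0, z.1 1), ⟨h1, h0, h5⟩, ?_⟩
      refine Prod.ext ?_ h4
      rw [← planeEquiv_symm_apply]
      exact planeEquiv.apply_symm_apply _
    · rintro ⟨q, ⟨h1, h0, h5⟩, rfl⟩
      have h6 := hmM q.1 h0 q.2 h1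
      have h7 : (planeEquiv q) 0 = q.1 ∧ (planeEquiv q) 1 = q.2 := by simp [planeEquiv_apply]
      simp only [hj, rayBox, mem_ofPred_eq, h7.1, h7.2]
      refine ⟨⟨h0, h1, norm_nonneg _, by linarith [h6.2]⟩, ?_⟩
      rw [← h5, smul_smul, mul_inv_cancel₀ (by linarith [h6.1] : ‖k q.1 - l q.2‖ ≠ 0) , one_smul,
        sub_self]
  have hlim : ∀ R, max M₁ M₂ < R → D.Finite ∧ Tendsto
      (fun ε => ∫ s in (0 : ℝ)..1, ∫ t in (0 : ℝ)..1, rayIntegral ε k l v R s t) (𝓝[>] 0)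
      (𝓝 (∑ᶠ q ∈ {q : ℝ × ℝ | q.1 ∈ Ico (0 : ℝ) 1 ∧ q.2 ∈ Ico (0 : ℝ) 1 ∧
        ‖k q.1 - l q.2‖⁻¹ • (k q.1 - l q.2) = v},
        (SignType.sign (det3 v (deriv k q.1) (-deriv l q.2)) : ℝ))) := by
    intro R hR
    have hR2 := (le_max_right M₁ M₂).trans_lt hR
    have key := tendsto_rayIntegral hk hl hkp hlp (v := v) (R := R) (by linarith) fun z hz hz0 => by
      obtain ⟨h1, h2⟩ := hnorm z hz.2.2.1 hz0
      have h3 := hmM (z.1 0) hz.1 (z.1 1) hz.2.1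
      exact ⟨⟨by linarith [h3.1], by linarith [h3.2]⟩, hreg' _ _ h2⟩
    rw [hzero R hR2, finsum_mem_image hjinj.injOn] at key
    have hfin := Finite.of_finite_image key.1 hjinj.injOn
    refine ⟨hfin, ?_⟩
    have h7 : ∀ q : ℝ × ℝ, (j q).1 0 = q.1 ∧ (j q).1 1 = q.2 := by simp [hj, planeEquiv_apply]
    simp only [h7] at key
    rw [hD, finsum_tent_tent_mul
      (P := fun s t => ‖k s - l t‖⁻¹ • (k s - l t) = v)
      (F := fun s t => (SignType.sign (det3 v (deriv k s) (-deriv l t)) : ℝ))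
      (fun s t => by rw [hkp s]) (fun s t => by rw [hlp t]) (fun s t => by rw [hkd s])
      (fun s t => by rw [hld t]) hfin] at key
    exact key.2
  refine ⟨(hlim (max M₁ M₂ + 1) (by linarith)).1.subset fun q hq =>
    ⟨⟨by linarith [hq.2.1.1], hq.2.1.2.le⟩, ⟨by linarith [hq.1.1], hq.1.2.le⟩, hq.2.2⟩, ?_⟩
  set N := ∑ᶠ q ∈ {q : ℝ × ℝ | q.1 ∈ Ico (0 : ℝ) 1 ∧ q.2 ∈ Ico (0 : ℝ) 1 ∧
    ‖k q.1 - l q.2‖⁻¹ • (k q.1 - l q.2) = v},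
    (SignType.sign (det3 v (deriv k q.1) (-deriv l q.2)) : ℝ)
  -- As ε → 0 for fixed R, the Gauss integral minus the signed count is bounded by the Gauss
  -- integral of the translated curve. The left side is independent of R, so letting R → ∞ gives
  -- equality.
  have hbound : ∀ᶠ R in atTop, |gaussIntegral 0 k l - N| ≤ B * ((R - M₁) ^ 2)⁻¹ := by
    filter_upwards [eventually_gt_atTop (max M₁ M₂)] with R hR
    have h1 := ((tendsto_gaussIntegral hk hl hne).sub (hlim R hR).2).abs
    refine le_of_tendsto h1 ?_
    filter_upwards [self_mem_nhdsWithin] with ε hε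
    have h2 := gaussIntegral_sub_translate hε hk hl hkp hlp v R
    have h3 := hB ε R ((le_max_left _ _).trans_lt hR)
    simp only [rayIntegral]
    rw [← h2, sub_sub_cancel]
    exact h3
  have hlim0 : Tendsto (fun R : ℝ => B * ((R - M₁) ^ 2)⁻¹) atTop (𝓝 (B * 0)) := by
    refine Tendsto.const_mul _ (tendsto_inv_atTop_zero.comp ?_)
    exact (tendsto_pow_atTop two_ne_zero).comp (tendsto_atTop_add_const_right _ (-M₁) tendsto_id)
  rw [mul_zero] at hlim0
  have := ge_of_tendsto hlim0 hbound
  exact sub_eq_zero.1 (abs_nonpos_iff.1 this)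

end Direction

/-! ### The degree of the Gauss map of two knots -/

theorem finsum_mem_sigma {ι β M : Type*} [Fintype ι] [AddCommMonoid M] {P : ι → Set β}
    (hP : ∀ i, (P i).Finite) (f : ι × β → M) :
    {q : ι × β | q.2 ∈ P q.1}.Finite ∧
      ∑ᶠ q ∈ {q : ι × β | q.2 ∈ P q.1}, f q = ∑ i, ∑ᶠ b ∈ P i, f (i, b) := by
  have hU : {q : ι × β | q.2 ∈ P q.1} = ⋃ i, Prod.mk i '' P i := by
    ext ⟨i, b⟩
    simp
  have hf : ∀ i, (Prod.mk i '' P i).Finite := fun i => (hP i).image _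
  rw [hU]
  refine ⟨finite_iUnion hf, ?_⟩
  rw [finsum_mem_iUnion ?_ hf, finsum_eq_sum_of_fintype]
  · exact Finset.sum_congr rfl fun i _ => finsum_mem_image (Prod.mk_right_injective i).injOn
  · intro i j hij
    rw [Function.onFun, Set.disjoint_left]
    rintro _ ⟨a, _, rfl⟩ ⟨b, _, h⟩
    exact hij (Prod.ext_iff.1 h).1.symm

section KnotGaussMap

variable {r₁ r₂ : ℕ} {K₁ : OrientedKnot r₁} {K₂ : OrientedKnot r₂}

theorem curve_ne (hK : Disjoint K₁.carrier K₂.carrier) (i : Fin r₁) (j : Fin r₂) (s t : ℝ) :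
    K₁.curve i s ≠ K₂.curve j t := fun h =>
  Set.disjoint_left.1 hK ⟨i, s, rfl⟩ ⟨j, t, h.symm⟩

theorem diagForm_pair (x y ξ η : E 3) :
    diagForm 3 (pair x y) ![pair ξ 0, pair 0 η] = det3 (bsField 0 (x - y)) ξ (-η) := by
  rw [diagForm_eq, ContinuousAlternatingMap.compContinuousLinearMap_apply, diffMap_pair,
    pointForm_apply, bsField, det3_smul_left, reg_zero_left, contract_apply, volForm_apply, det3]
  congr 2
  funext i
  refine Fin.cases rfl (fun i => ?_) i
  fin_cases i
  · exact (diffMap_pair ξ 0).trans (sub_zero ξ)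
  · exact (diffMap_pair 0 η).trans (zero_sub η)

theorem productIntegral_diagForm :
    productIntegral K₁ K₂ (diagForm 3) =
      ∑ i, ∑ j, gaussIntegral 0 (K₁.curve i) (K₂.curve j) := by
  refine Finset.sum_congr rfl fun i _ => Finset.sum_congr rfl fun j _ =>
    intervalIntegral.integral_congr fun s _ => intervalIntegral.integral_congr fun t _ => ?_
  exact diagForm_pair _ _ _ _

theorem knotGaussMap_apply (i : Fin r₁) (j : Fin r₂) (p : ℝ × ℝ) :
    knotGaussMap K₁ K₂ i j p = ‖K₁.curve i p.1 - K₂.curve j p.2‖⁻¹ •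
      (K₁.curve i p.1 - K₂.curve j p.2) := by
  rw [knotGaussMap, gaussMap, pr1_pair, pr2_pair]

theorem hasFDerivAt_normalize {u : E 3} (hu : u ≠ 0) :
    ∃ L : E 3 →L[ℝ] ℝ, HasFDerivAt (fun x : E 3 => ‖x‖⁻¹ • x)
      (‖u‖⁻¹ • ContinuousLinearMap.id ℝ (E 3) + L.smulRight u) u := by
  have h1 : HasFDerivAt (fun x : E 3 => ‖x‖⁻¹) (fderiv ℝ (fun x : E 3 => ‖x‖⁻¹) u) u :=
    (((contDiffAt_norm ℝ hu).inv (norm_ne_zero_iff.2 hu)).differentiableAt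
      one_ne_zero).hasFDerivAt
  exact ⟨_, h1.smul (hasFDerivAt_id u)⟩

theorem det3_smul_add (r c d : ℝ) (u a b : E 3) :
    det3 (r • u) (r • a + c • u) (-(d • u) + -(r • b)) = r ^ 2 * det3 (r • u) a (-b) := by
  simp only [det3_eq, PiLp.add_apply, PiLp.smul_apply, PiLp.neg_apply, smul_eq_mul]
  ring

/-- Normalizing a vector changes its derivative by radial terms, and these disappear in a
determinant whose first entry is radial. So the Jacobian of the Gauss map has the sign of det(v, k',
-l'). -/
theorem hasFDerivAt_knotGaussMap (hK : Disjoint K₁.carrier K₂.carrier) (i : Fin r₁) (j : Fin r₂)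
    (p : ℝ × ℝ) : ∃ A : ℝ × ℝ →L[ℝ] E 3, HasFDerivAt (knotGaussMap K₁ K₂ i j) A p ∧
      det3 (knotGaussMap K₁ K₂ i j p) (A (1, 0)) (A (0, 1)) =
        (‖K₁.curve i p.1 - K₂.curve j p.2‖⁻¹) ^ 2 * det3 (knotGaussMap K₁ K₂ i j p)
          (deriv (K₁.curve i) p.1) (-deriv (K₂.curve j) p.2) := by
  set u := K₁.curve i p.1 - K₂.curve j p.2 with hu
  obtain ⟨L, hL⟩ := hasFDerivAt_normalize (sub_ne_zero.2 (curve_ne hK i j p.1 p.2))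
  have h1 := (ContDiff.hasDerivAt_top (K₁.smooth i) p.1).hasFDerivAt.comp p hasFDerivAt_fst
  have h2 := (ContDiff.hasDerivAt_top (K₂.smooth j) p.2).hasFDerivAt.comp p hasFDerivAt_snd
  have h3 := HasFDerivAt.comp p hL (h1.sub h2)
  have hF : knotGaussMap K₁ K₂ i j = (fun x : E 3 => ‖x‖⁻¹ • x) ∘
      (K₁.curve i ∘ Prod.fst - K₂.curve j ∘ Prod.snd) := funext fun q => knotGaussMap_apply i j q
  rw [hF]
  refine ⟨_, h3, ?_⟩
  refine Eq.trans ?_ (det3_smul_add ‖u‖⁻¹ (L (deriv (K₁.curve i) p.1))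
    (L (deriv (K₂.curve j) p.2)) u (deriv (K₁.curve i) p.1) (deriv (K₂.curve j) p.2))
  simp [hu]

theorem sphereJacobian_knotGaussMap (hK : Disjoint K₁.carrier K₂.carrier)
    (q : Fin r₁ × Fin r₂ × ℝ × ℝ) :
    sphereJacobian (knotGaussMap K₁ K₂) q =
      (‖K₁.curve q.1 q.2.2.1 - K₂.curve q.2.1 q.2.2.2‖⁻¹) ^ 2 *
        det3 (knotGaussMap K₁ K₂ q.1 q.2.1 q.2.2)
          (deriv (K₁.curve q.1) q.2.2.1) (-deriv (K₂.curve q.2.1) q.2.2.2) := by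
  obtain ⟨A, hA, h⟩ := hasFDerivAt_knotGaussMap hK q.1 q.2.1 q.2.2
  rw [← h, sphereJacobian, hA.fderiv]
  rfl

/-- The critical values of the Gauss map, multiplied by the positive reals, form a null set. -/
theorem volume_cone_critical (hK : Disjoint K₁.carrier K₂.carrier) (i : Fin r₁) (j : Fin r₂) :
    volume {w : E 3 | ∃ p : ℝ × ℝ, sphereJacobian (knotGaussMap K₁ K₂) (i, j, p) = 0 ∧
      ∃ r : ℝ, w = r • knotGaussMap K₁ K₂ i j p} = 0 := by
  -- The cone over the Gauss map has Jacobian r² times the spherical Jacobian. Critical points thus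
  -- become points where a map between spaces of dimension three has zero determinant, and their
  -- image is null.
  set Φ : E 2 × ℝ → E 3 := fun z => z.2 • knotGaussMap K₁ K₂ i j (planeEquiv.symm z.1) with hΦ
  have hd : ∀ z, HasFDerivAt Φ (fderiv ℝ Φ z) z ∧
      prodJac Φ z = z.2 ^ 2 * sphereJacobian (knotGaussMap K₁ K₂) (i, j, planeEquiv.symm z.1) := by
    intro z
    obtain ⟨A, hA, -⟩ := hasFDerivAt_knotGaussMap hK i j (planeEquiv.symm z.1)
    have h1 := HasFDerivAt.comp z hA ((planeEquiv.symm : E 2 →L[ℝ] ℝ × ℝ).hasFDerivAt.comp z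
      (hasFDerivAt_fst (𝕜 := ℝ) (p := z)))
    have h2 : HasFDerivAt Φ _ z := (hasFDerivAt_snd (𝕜 := ℝ) (p := z)).smul h1
    refine ⟨h2.differentiableAt.hasFDerivAt, ?_⟩
    have h3 : planeEquiv.symm (stdVec 2 0) = (1, 0) := by simp [planeEquiv_symm_apply, stdVec_apply]
    have h4 : planeEquiv.symm (stdVec 2 1) = (0, 1) := by simp [planeEquiv_symm_apply, stdVec_apply]
    rw [prodJac_eq h2, sphereJacobian, hA.fderiv]
    simp only [_root_.add_apply, _root_.smul_apply, ContinuousLinearMap.comp_apply,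
      ContinuousLinearMap.coe_fst', ContinuousLinearEquiv.coe_coe,
      ContinuousLinearMap.smulRight_apply, ContinuousLinearMap.coe_snd', h3, h4, zero_smul,
      add_zero, map_zero, smul_zero, one_smul, zero_add]
    rw [det3_smul_left, det3_smul_mid, det3_cyclic, det3_cyclic, det3]
    ring
  have key := addHaar_image_eq_zero_of_det_fderivWithin_eq_zero (volume : Measure (E 3))
    (f := Φ ∘ spaceEquiv) (f' := fderiv ℝ (Φ ∘ spaceEquiv)) (s := {x | sphereJacobian
      (knotGaussMap K₁ K₂) (i, j, planeEquiv.symm (spaceEquiv x).1) = 0})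
    (fun x _ => ((hd _).1.differentiableAt.comp x
      spaceEquiv.differentiableAt).hasFDerivAt.hasFDerivWithinAt)
    (fun x hx => by
      rw [det_fderiv_comp_spaceEquiv, (hd _).2, show sphereJacobian _ _ = 0 from hx, mul_zero])
  refine measure_mono_null ?_ key
  rintro w ⟨p, hp, r, rfl⟩
  refine ⟨spaceEquiv.symm (planeEquiv p, r), ?_, ?_⟩
  · simpa using hp
  · simp [hΦ]

/-- If every unit vector were a critical value, the cones over the critical values would cover ℝ³
minus the origin, which is not a null set. -/
theorem exists_isRegularValue (hK : Disjoint K₁.carrier K₂.carrier) :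
    ∃ v, IsRegularValue (knotGaussMap K₁ K₂) v := by
  by_contra! hcon
  have hnull : volume (⋃ i, ⋃ j, {w : E 3 | ∃ p : ℝ × ℝ,
      sphereJacobian (knotGaussMap K₁ K₂) (i, j, p) = 0 ∧
      ∃ r : ℝ, w = r • knotGaussMap K₁ K₂ i j p}) = 0 :=
    measure_iUnion_null fun i => measure_iUnion_null fun j => volume_cone_critical hK i j
  have hsub : ({0}ᶜ : Set (E 3)) ⊆ ⋃ i, ⋃ j, {w : E 3 | ∃ p : ℝ × ℝ,
      sphereJacobian (knotGaussMap K₁ K₂) (i, j, p) = 0 ∧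
      ∃ r : ℝ, w = r • knotGaussMap K₁ K₂ i j p} := by
    intro w hw
    have hw0 : ‖w‖ ≠ 0 := norm_ne_zero_iff.2 hw
    have h1 : ‖‖w‖⁻¹ • w‖ = 1 := by
      rw [norm_smul, norm_inv, norm_norm, inv_mul_cancel₀ hw0]
    have h2 : ∃ q ∈ torusFiber (knotGaussMap K₁ K₂) (‖w‖⁻¹ • w),
        sphereJacobian (knotGaussMap K₁ K₂) q = 0 := by
      by_contra! h
      exact hcon _ ⟨h1, h⟩
    obtain ⟨⟨i, j, p⟩, ⟨-, -, hq⟩, hq0⟩ := h2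
    refine mem_iUnion.2 ⟨i, mem_iUnion.2 ⟨j, p, hq0, ‖w‖, ?_⟩⟩
    change knotGaussMap K₁ K₂ i j p = _ at hq
    rw [hq, smul_smul, mul_inv_cancel₀ hw0, one_smul]
  have h3 : volume (univ : Set (E 3)) = 0 := by
    rw [← union_compl_self {(0 : E 3)}]
    exact measure_union_null (measure_singleton _) (measure_mono_null hsub hnull)
  exact (NeZero.ne (volume : Measure (E 3))) (Measure.measure_univ_eq_zero.1 h3)

/-- The integral of the Biot–Savart form over the product of two knots counts, with signs, the
preimages of a regular value of the Gauss map. -/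
theorem productIntegral_eq_finsum (hK : Disjoint K₁.carrier K₂.carrier) {v : E 3}
    (hv : IsRegularValue (knotGaussMap K₁ K₂) v) :
    (torusFiber (knotGaussMap K₁ K₂) v).Finite ∧
    productIntegral K₁ K₂ (diagForm 3) = ((∑ᶠ q ∈ torusFiber (knotGaussMap K₁ K₂) v,
      (SignType.sign (sphereJacobian (knotGaussMap K₁ K₂) q) : ℤ) : ℤ) : ℝ) := by
  have hpos : ∀ i j s t, 0 < (‖K₁.curve i s - K₂.curve j t‖⁻¹) ^ 2 := fun i j s t =>
    pow_pos (inv_pos.2 (norm_pos_iff.2 (sub_ne_zero.2 (curve_ne hK i j s t)))) 2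
  have h := fun i j => gaussIntegral_zero_eq_finsum (K₁.smooth i) (K₂.smooth j) (K₁.periodic i)
    (K₂.periodic j) (curve_ne hK i j) hv.1 fun s hs t ht hst => by
      have h1 := hv.2 (i, j, s, t) ⟨hs, ht, (knotGaussMap_apply i j (s, t)).trans hst⟩
      rw [sphereJacobian_knotGaussMap hK, knotGaussMap_apply] at h1
      simp only [hst] at h1
      exact right_ne_zero_of_mul h1
  set P : Fin r₁ → Fin r₂ → Set (ℝ × ℝ) := fun i j => {q : ℝ × ℝ | q.1 ∈ Ico (0 : ℝ) 1 ∧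
    q.2 ∈ Ico (0 : ℝ) 1 ∧ ‖K₁.curve i q.1 - K₂.curve j q.2‖⁻¹ •
      (K₁.curve i q.1 - K₂.curve j q.2) = v}
  have hT : torusFiber (knotGaussMap K₁ K₂) v = {q | q.2 ∈ {q' : Fin r₂ × ℝ × ℝ |
      q'.2 ∈ P q.1 q'.1}} := by
    ext q
    simp only [torusFiber, knotGaussMap_apply, P, mem_ofPred_eq]
  have hj := fun i => finsum_mem_sigma (fun j => (h i j).1)
    fun q => (SignType.sign (sphereJacobian (knotGaussMap K₁ K₂) (i, q)) : ℝ)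
  have hi := finsum_mem_sigma (fun i => (hj i).1)
    fun q => (SignType.sign (sphereJacobian (knotGaussMap K₁ K₂) q) : ℝ)
  rw [hT]
  refine ⟨hi.1, ?_⟩
  have hcast := (Int.castAddHom ℝ).map_finsum_mem
    (fun q => (SignType.sign (sphereJacobian (knotGaussMap K₁ K₂) q) : ℤ)) hi.1
  simp only [Int.coe_castAddHom, SignType.intCast_cast] at hcast
  rw [hcast, hi.2, productIntegral_diagForm]
  refine Finset.sum_congr rfl fun i _ => ?_
  rw [(hj i).2]
  refine Finset.sum_congr rfl fun j _ => ?_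
  rw [(h i j).2]
  refine finsum_mem_congr rfl fun q hq => ?_
  rw [sphereJacobian_knotGaussMap hK, sign_mul, sign_pos (hpos _ _ _ _), one_mul,
    knotGaussMap_apply]
  simp only [hq.2.2]

/-- The signed count at any regular value equals one and the same integral. This proves at once that
the integral is an integer and that the count does not depend on the value. -/
theorem exists_isDegree (hK : Disjoint K₁.carrier K₂.carrier) :
    ∃ ℓ : ℤ, productIntegral K₁ K₂ (diagForm 3) = ℓ ∧ IsDegree (knotGaussMap K₁ K₂) ℓ := by
  obtain ⟨v, hv⟩ := exists_isRegularValue hK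
  refine ⟨_, (productIntegral_eq_finsum hK hv).2, ⟨v, hv⟩, fun v' hv' => ?_⟩
  have h := productIntegral_eq_finsum hK hv'
  refine ⟨h.1, ?_⟩
  rw [(productIntegral_eq_finsum hK hv).2] at h
  exact_mod_cast h.2.symm

end KnotGaussMap

/-! ### Stokes' theorem on the half plane -/

/-- The half plane `x_1 ≥ 0`. -/
def halfPlane : Set (E 2) := {u | 0 ≤ u 0}

theorem range_halfSpaceModel : range (𝓡∂ 2) = halfPlane :=
  range_modelWithCornersEuclideanHalfSpace 2

theorem interior_halfPlane : interior halfPlane = {u : E 2 | 0 < u 0} := by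
  rw [← range_halfSpaceModel]
  exact interior_range_modelWithCornersEuclideanHalfSpace 2

theorem uniqueDiffOn_halfPlane : UniqueDiffOn ℝ halfPlane := by
  rw [← range_halfSpaceModel]
  exact (𝓡∂ 2).uniqueDiffOn

theorem isClosed_halfPlane : IsClosed halfPlane := by
  rw [← range_halfSpaceModel]
  exact (𝓡∂ 2).isClosed_range

theorem halfPlane_subset_closure_interior : halfPlane ⊆ closure (interior halfPlane) := by
  rw [← range_halfSpaceModel]
  exact (𝓡∂ 2).range_subset_closure_interior

/-- The derivative of a function on the half plane. -/
abbrev halfDeriv {G : Type*} [NormedAddCommGroup G] [NormedSpace ℝ G] (f : E 2 → G) (u : E 2) :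
    E 2 →L[ℝ] G := fderivWithin ℝ f halfPlane u

theorem halfDeriv_eq_zero {G : Type*} [NormedAddCommGroup G] [NormedSpace ℝ G] {f : E 2 → G}
    {K : Set (E 2)} (hK : IsClosed K) (hf : ∀ u ∉ K, f u = 0) {u : E 2} (hu : u ∉ K) :
    halfDeriv f u = 0 := by
  have h : f =ᶠ[𝓝[halfPlane] u] fun _ => 0 := by
    filter_upwards [mem_nhdsWithin_of_mem_nhds (hK.isOpen_compl.mem_nhds hu)] with v hv
    exact hf v hv
  rw [halfDeriv, h.fderivWithin_eq (hf u hu), fderivWithin_const_apply]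

theorem planeEquiv_mem_halfPlane (p : ℝ × ℝ) : planeEquiv p ∈ halfPlane ↔ 0 ≤ p.1 := by
  rw [planeEquiv_apply]
  rfl

/-- This is the divergence theorem on a box with one edge on the boundary line. The functions vanish
on the other three edges, and the sign comes from the outward normal -e_1. -/
theorem halfPlane_divergence {P Q : E 2 → ℝ} (hP : ContDiffOn ℝ 1 P halfPlane)
    (hQ : ContDiffOn ℝ 1 Q halfPlane) {K : Set (E 2)} (hK : IsCompact K)
    (hP0 : ∀ u ∉ K, P u = 0) (hQ0 : ∀ u ∉ K, Q u = 0) :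
    ∫ u in halfPlane, (halfDeriv Q u (stdVec 2 0) - halfDeriv P u (stdVec 2 1)) =
      -∫ q, Q (planeEquiv (0, q)) := by
  obtain ⟨R, hR0, hR⟩ : ∃ R : ℝ, 0 < R ∧ ∀ p : ℝ × ℝ, planeEquiv p ∈ K → |p.1| < R ∧ |p.2| < R := by
    obtain ⟨R, hR⟩ := (hK.image planeEquiv.symm.continuous).isBounded.subset_ball 0
    refine ⟨max R 1, by positivity, fun p hp => ?_⟩
    have h1 := hR ⟨_, hp, planeEquiv.symm_apply_apply p⟩
    rw [mem_ball_zero_iff, Prod.norm_def, max_lt_iff] at h1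
    exact ⟨h1.1.trans_le (le_max_left _ _), h1.2.trans_le (le_max_left _ _)⟩
  have he : MeasurableEmbedding planeEquiv := planeEquiv.toHomeomorph.measurableEmbedding
  have hcl := hK.isClosed
  set D : E 2 → ℝ := fun u => halfDeriv Q u (stdVec 2 0) - halfDeriv P u (stdVec 2 1) with hD
  have hD0 : ∀ u ∉ K, D u = 0 := fun u hu => by
    simp [hD, halfDeriv_eq_zero hcl hP0 hu, halfDeriv_eq_zero hcl hQ0 hu]
  have hDc : ContinuousOn D halfPlane :=
    ((hQ.continuousOn_fderivWithin uniqueDiffOn_halfPlane (by simp)).clm_apply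
      continuousOn_const).sub
    ((hP.continuousOn_fderivWithin uniqueDiffOn_halfPlane (by simp)).clm_apply continuousOn_const)
  -- The box [0, R] × [-R, R] contains the part of the support in the half plane.
  set a : ℝ × ℝ := (0, -R)
  set b : ℝ × ℝ := (R, R)
  have hab : a ≤ b := ⟨hR0.le, by simp only [a, b]; linarith⟩
  have hbox : ∀ p ∈ Icc a b, planeEquiv p ∈ halfPlane := fun p hp =>
    (planeEquiv_mem_halfPlane p).2 hp.1.1
  have hint : ∫ u in halfPlane, D u = ∫ p in Icc a b, D (planeEquiv p) := by
    rw [← measurePreserving_planeEquiv.setIntegral_preimage_emb he]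
    refine setIntegral_eq_of_subset_of_forall_sdiff_eq_zero
      (isClosed_halfPlane.preimage planeEquiv.continuous).measurableSet hbox fun p hp => hD0 _ ?_
    intro hpK
    obtain ⟨h1, h2⟩ := hR p hpK
    have h3 := (planeEquiv_mem_halfPlane p).1 hp.1
    exact hp.2 ⟨⟨h3, (abs_lt.1 h2).1.le⟩, ⟨(abs_lt.1 h1).2.le, (abs_lt.1 h2).2.le⟩⟩
  have hder : ∀ {G : E 2 → ℝ}, ContDiffOn ℝ 1 G halfPlane → ∀ p ∈ Ioo a.1 b.1 ×ˢ Ioo a.2 b.2 \ ∅,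
      HasFDerivAt (G ∘ planeEquiv)
        ((halfDeriv G (planeEquiv p)).comp (planeEquiv : ℝ × ℝ →L[ℝ] E 2)) p := by
    intro G hG p hp
    have h1 : halfPlane ∈ 𝓝 (planeEquiv p) := by
      rw [← mem_interior_iff_mem_nhds, interior_halfPlane, planeEquiv_apply]
      exact hp.1.1.1
    have h2 : HasFDerivAt G (halfDeriv G (planeEquiv p)) (planeEquiv p) :=
      ((hG.differentiableOn one_ne_zero _ (mem_of_mem_nhds h1)).hasFDerivWithinAt).hasFDerivAt h1
    exact h2.comp p planeEquiv.hasFDerivAt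
  have hcont : ∀ {G : E 2 → ℝ}, ContinuousOn G halfPlane →
      ContinuousOn (fun p => G (planeEquiv p)) (Icc a b) := fun hG =>
    hG.comp planeEquiv.continuous.continuousOn hbox
  have he0 : planeEquiv (1, 0) = stdVec 2 0 := by
    rw [planeEquiv_apply]; ext i; fin_cases i <;> simp [stdVec_apply]
  have he1 : planeEquiv (0, 1) = stdVec 2 1 := by
    rw [planeEquiv_apply]; ext i; fin_cases i <;> simp [stdVec_apply]
  have hDeq : ∀ p, D (planeEquiv p) =
      ((halfDeriv Q (planeEquiv p)).comp (planeEquiv : ℝ × ℝ →L[ℝ] E 2)) (1, 0) +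
      (-((halfDeriv P (planeEquiv p)).comp (planeEquiv : ℝ × ℝ →L[ℝ] E 2))) (0, 1) := fun p => by
    simp [hD, he0, he1, sub_eq_add_neg]
  have hz : ∀ {G : E 2 → ℝ} {p : ℝ × ℝ}, (∀ u ∉ K, G u = 0) → (R ≤ |p.1| ∨ R ≤ |p.2|) →
      G (planeEquiv p) = 0 := fun {G p} hG hp => hG _ fun hpK =>
    hp.elim (fun h => (hR p hpK).1.not_ge h) fun h => (hR p hpK).2.not_ge h
  have key := integral_divergence_prod_Icc_of_hasFDerivAt_off_countable_of_le
    (fun p => Q (planeEquiv p)) (fun p => -P (planeEquiv p)) _ _ a b hab ∅ countable_empty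
    (hcont hQ.continuousOn) (hcont hP.continuousOn).neg (hder hQ) (fun p hp => (hder hP p hp).neg)
    (by
      simp only [← hDeq]
      exact (hcont hDc).integrableOn_compact isCompact_Icc)
  simp only [← hDeq] at key
  have hb1 : |R| = R := abs_of_pos hR0
  have h1 : ∀ x, P (planeEquiv (x, b.2)) = 0 := fun x => hz hP0 (Or.inr hb1.ge)
  have h2 : ∀ x, P (planeEquiv (x, a.2)) = 0 := fun x => hz hP0 (Or.inr (by simp [a, hb1]))
  have h3 : ∀ y, Q (planeEquiv (b.1, y)) = 0 := fun y => hz hQ0 (Or.inl hb1.ge)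
  rw [hint, key]
  simp only [h1, h2, h3, neg_zero, intervalIntegral.integral_zero, sub_zero, zero_add, zero_sub]
  rw [intervalIntegral.integral_of_le hab.2, setIntegral_eq_integral_of_forall_compl_eq_zero]
  intro y hy
  refine hz hQ0 (Or.inr ?_)
  by_contra hlt
  rw [not_le, abs_lt] at hlt
  exact hy ⟨hlt.1, hlt.2.le⟩

/-- The antisymmetrization of a bilinear form on the plane, evaluated at the standard basis. -/
def alt (B : E 2 →L[ℝ] E 2 →L[ℝ] ℝ) : ℝ :=
  B (stdVec 2 0) (stdVec 2 1) - B (stdVec 2 1) (stdVec 2 0)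

theorem eq_stdVec_add (u : E 2) : u = u 0 • stdVec 2 0 + u 1 • stdVec 2 1 := by
  ext i
  fin_cases i <;> simp [stdVec_apply]

theorem det_plane (A : E 2 →L[ℝ] E 2) :
    A.det = A (stdVec 2 0) 0 * A (stdVec 2 1) 1 - A (stdVec 2 1) 0 * A (stdVec 2 0) 1 := by
  have h := LinearMap.det_toMatrix (EuclideanSpace.basisFun (Fin 2) ℝ).toBasis (A : E 2 →ₗ[ℝ] E 2)
  rw [ContinuousLinearMap.det, ← h, Matrix.det_fin_two]
  simp [LinearMap.toMatrix_apply, stdVec]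

theorem alt_bilinearComp (B : E 2 →L[ℝ] E 2 →L[ℝ] ℝ) (A : E 2 →L[ℝ] E 2) :
    alt (B.bilinearComp A A) = A.det * alt B := by
  rw [det_plane, alt, alt, ContinuousLinearMap.bilinearComp_apply,
    ContinuousLinearMap.bilinearComp_apply]
  generalize A (stdVec 2 0) = x
  generalize A (stdVec 2 1) = y
  conv_lhs => rw [eq_stdVec_add x, eq_stdVec_add y]
  simp only [map_add, map_smul, _root_.add_apply, _root_.smul_apply, smul_eq_mul]
  ring

/-- The (not yet antisymmetrized) exterior derivative of `φ F^* a` on the half plane. -/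
def pullDeriv (a : E 3 → E 3 →L[ℝ] ℝ) (φ : E 2 → ℝ) (F : E 2 → E 3) (u : E 2) :
    E 2 →L[ℝ] E 2 →L[ℝ] ℝ :=
  (halfDeriv φ u).smulRight ((a (F u)).comp (halfDeriv F u)) +
    φ u • (fderiv ℝ a (F u)).bilinearComp (halfDeriv F u) (halfDeriv F u)

theorem alt_pullDeriv (a : E 3 → E 3 →L[ℝ] ℝ) (φ : E 2 → ℝ) (F : E 2 → E 3) (u : E 2) :
    alt (pullDeriv a φ F u) =
      (halfDeriv φ u (stdVec 2 0) * a (F u) (halfDeriv F u (stdVec 2 1)) +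
        φ u * fderiv ℝ a (F u) (halfDeriv F u (stdVec 2 0)) (halfDeriv F u (stdVec 2 1))) -
      (halfDeriv φ u (stdVec 2 1) * a (F u) (halfDeriv F u (stdVec 2 0)) +
        φ u * fderiv ℝ a (F u) (halfDeriv F u (stdVec 2 1)) (halfDeriv F u (stdVec 2 0))) :=
  rfl

/-! ### Stokes' theorem for a map of a piece of the half plane -/

section Local

variable {T : Set (E 2)}

theorem uniqueDiffOn_of_nhdsWithin (hTH : T ⊆ halfPlane) (hT : ∀ u ∈ T, T ∈ 𝓝[halfPlane] u) :
    UniqueDiffOn ℝ T := fun u hu =>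
  (uniqueDiffOn_halfPlane u (hTH hu)).mono_nhds (nhdsWithin_le_of_mem (hT u hu))

theorem contDiffOn_halfDeriv {G : Type*} [NormedAddCommGroup G] [NormedSpace ℝ G] {F : E 2 → G}
    (hTH : T ⊆ halfPlane) (hT : ∀ u ∈ T, T ∈ 𝓝[halfPlane] u) (hF : ContDiffOn ℝ ∞ F T) :
    ContDiffOn ℝ ∞ (halfDeriv F) T := by
  refine (hF.fderivWithin (m := ∞) (uniqueDiffOn_of_nhdsWithin hTH hT) (by simp)).congr
    fun u hu => ?_
  exact fderivWithin_of_mem_nhdsWithin (hT u hu) (uniqueDiffOn_halfPlane u (hTH hu))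
    (hF.differentiableOn (by simp) u hu)

theorem contDiffOn_halfPlane_of_support {G : Type*} [NormedAddCommGroup G] [NormedSpace ℝ G]
    {n : ℕ∞ω} {f : E 2 → G} {K : Set (E 2)} (hT : ∀ u ∈ T, T ∈ 𝓝[halfPlane] u)
    (hK : IsClosed K) (hKT : K ⊆ T) (hf : ContDiffOn ℝ n f T) (hf0 : ∀ u ∉ K, f u = 0) :
    ContDiffOn ℝ n f halfPlane := by
  intro u _
  by_cases hu : u ∈ K
  · exact (hf u (hKT hu)).mono_of_mem_nhdsWithin (hT u (hKT hu))
  · have h : f =ᶠ[𝓝[halfPlane] u] fun _ => 0 := by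
      filter_upwards [mem_nhdsWithin_of_mem_nhds (hK.isOpen_compl.mem_nhds hu)] with v hv
      exact hf0 v hv
    exact contDiffWithinAt_const.congr_of_eventuallyEq h (hf0 u hu)

/-- The divergence theorem is applied to the components φ a_F(∂_i F) of the pulled-back one-form. In
the antisymmetrized derivative the second derivatives of F cancel, which leaves exactly `pullDeriv`.
-/
theorem local_stokes (hTH : T ⊆ halfPlane) (hT : ∀ u ∈ T, T ∈ 𝓝[halfPlane] u) {K : Set (E 2)}
    (hK : IsCompact K) (hKT : K ⊆ T) {φ : E 2 → ℝ} (hφ : ContDiffOn ℝ ∞ φ T)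
    (hφ0 : ∀ u ∉ K, φ u = 0) {F : E 2 → E 3} (hF : ContDiffOn ℝ ∞ F T) {a : E 3 → E 3 →L[ℝ] ℝ}
    (ha : ContDiff ℝ 1 a) :
    ∫ u in halfPlane, alt (pullDeriv a φ F u) =
      -∫ q, φ (planeEquiv (0, q)) * a (F (planeEquiv (0, q)))
        (halfDeriv F (planeEquiv (0, q)) (stdVec 2 1)) := by
  have hDF := contDiffOn_halfDeriv hTH hT hF
  set P : Fin 2 → E 2 → ℝ := fun i u => φ u * a (F u) (halfDeriv F u (stdVec 2 i)) with hPdef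
  have hP0 : ∀ i, ∀ u ∉ K, P i u = 0 := fun i u hu => by simp [hPdef, hφ0 u hu]
  have hP : ∀ i, ContDiffOn ℝ 1 (P i) halfPlane := fun i => by
    refine contDiffOn_halfPlane_of_support hT hK.isClosed hKT ?_ (hP0 i)
    exact (hφ.of_le (by simp)).mul ((ha.comp_contDiffOn (hF.of_le (by simp))).clm_apply
      ((hDF.of_le (by simp)).clm_apply contDiffOn_const))
  rw [← halfPlane_divergence (hP 0) (hP 1) hK (hP0 0) (hP0 1)]
  refine setIntegral_congr_fun isClosed_halfPlane.measurableSet fun u huH => ?_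
  by_cases hu : u ∈ K
  · have huT := hKT hu
    have hw : ∀ {G : Type} [NormedAddCommGroup G] [NormedSpace ℝ G] {f : E 2 → G},
        ContDiffOn ℝ ∞ f T → HasFDerivWithinAt f (halfDeriv f u) halfPlane u := fun hf =>
      (((hf u huT).mono_of_mem_nhdsWithin (hT u huT)).differentiableWithinAt
        (by simp)).hasFDerivWithinAt
    have ha' : HasFDerivWithinAt (fun u => a (F u)) ((fderiv ℝ a (F u)).comp (halfDeriv F u))
        halfPlane u :=
      ((ha.differentiable one_ne_zero (F u)).hasFDerivAt).comp_hasFDerivWithinAt u (hw hF)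
    have hPd : ∀ i, halfDeriv (P i) u = _ := fun i =>
      ((hw hφ).mul (ha'.clm_apply ((hw hDF).clm_apply
        (hasFDerivWithinAt_const (stdVec 2 i) u halfPlane)))).fderivWithin
          (uniqueDiffOn_halfPlane u huH)
    -- Symmetry also holds at boundary points, because the half plane lies in the closure of its
    -- interior.
    have hsymm : halfDeriv (halfDeriv F) u (stdVec 2 0) (stdVec 2 1) =
        halfDeriv (halfDeriv F) u (stdVec 2 1) (stdVec 2 0) :=
      (((hF u huT).mono_of_mem_nhdsWithin (hT u huT)).isSymmSndFDerivWithinAt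
        (by simp only [minSmoothness_of_isRCLikeNormedField]; exact WithTop.coe_le_coe.2 (le_top : (2 : ℕ∞) ≤ ⊤))
        uniqueDiffOn_halfPlane (halfPlane_subset_closure_interior huH) huH) _ _
    rw [hPd, hPd, alt_pullDeriv]
    simp [hsymm]
    ring
  · have h1 := halfDeriv_eq_zero hK.isClosed hφ0 hu
    rw [halfDeriv_eq_zero hK.isClosed (hP0 0) hu, halfDeriv_eq_zero hK.isClosed (hP0 1) hu]
    simp [alt_pullDeriv, h1, hφ0 u hu]

end Local

/-! ### Stokes' theorem on a compact surface, up to the boundary integrals in charts -/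

section SurfaceStokes

variable {S : Type} [TopologicalSpace S] [ChartedSpace (EuclideanHalfSpace 2) S]

/-- The preferred chart at `c`, with values in the half plane. -/
abbrev hchart (c : S) : PartialEquiv S (E 2) := extChartAt (𝓡∂ 2) c

theorem hchart_mem_halfPlane (c z : S) : hchart c z ∈ halfPlane := by
  rw [← range_halfSpaceModel]
  exact mem_range_self _

theorem hchart_target_subset (c : S) : (hchart c).target ⊆ halfPlane := by
  rw [← range_halfSpaceModel]
  exact extChartAt_target_subset_range c

theorem hchart_target_mem (c : S) : ∀ u ∈ (hchart c).target, (hchart c).target ∈ 𝓝[halfPlane] u := by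
  rw [← range_halfSpaceModel]
  exact fun u hu => extChartAt_target_mem_nhdsWithin_of_mem hu

/-- Chart images are relatively open in the closed half plane and need not be open in the plane. -/
theorem measurableSet_hchart (c : S) {U : Set S} (hU : IsOpen U) :
    MeasurableSet ((hchart c).target ∩ (hchart c).symm ⁻¹' U) := by
  have hc := continuousOn_extChartAt_symm (I := 𝓡∂ 2) c
  obtain ⟨O, hO, h⟩ := continuousOn_iff'.1 hc U hU
  have hT : MeasurableSet (hchart c).target := by
    have h1 : (hchart c).target =
        (𝓡∂ 2).symm ⁻¹' (chartAt (EuclideanHalfSpace 2) c).target ∩ range (𝓡∂ 2) :=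
      extChartAt_target (I := 𝓡∂ 2) c
    rw [h1]
    exact ((chartAt (EuclideanHalfSpace 2) c).open_target.preimage
      (𝓡∂ 2).continuous_symm).measurableSet.inter (𝓡∂ 2).isClosed_range.measurableSet
  rw [inter_comm, h]
  exact hO.measurableSet.inter hT

theorem measurableSet_hchart_target (c : S) : MeasurableSet (hchart c).target := by
  simpa using measurableSet_hchart c isOpen_univ

theorem hchart_image_eq (c : S) (U : Set S) :
    hchart c '' ((hchart c).source ∩ U) = (hchart c).target ∩ (hchart c).symm ⁻¹' U :=
  (hchart c).image_source_inter_eq' U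

theorem integrableOn_chart [CompactSpace S] (c : S) {η : E 2 → ℝ}
    (hη : ContinuousOn η (hchart c).target) {A : Set S} (hA : IsClosed A)
    (hAc : A ⊆ (hchart c).source)
    (h0 : ∀ u ∈ (hchart c).target, (hchart c).symm u ∉ A → η u = 0) :
    IntegrableOn η (hchart c).target := by
  have hK : IsCompact (hchart c '' A) :=
    hA.isCompact.image_of_continuousOn ((continuousOn_extChartAt c).mono hAc)
  have hKT : hchart c '' A ⊆ (hchart c).target := by
    rintro _ ⟨z, hz, rfl⟩
    exact (hchart c).map_source (hAc hz)
  refine ((hη.mono hKT).integrableOn_compact hK).of_forall_sdiff_eq_zero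
    (measurableSet_hchart_target c) fun u hu => h0 u hu.1 fun h => hu.2 ?_
  exact ⟨_, h, (hchart c).right_inv hu.1⟩

theorem comp_hchart_symm_eventuallyEq_zero {φ : S → ℝ} (c : S) {u : E 2} (hu : u ∈ (hchart c).target)
    (h : (hchart c).symm u ∉ tsupport φ) : φ ∘ (hchart c).symm =ᶠ[𝓝 u] fun _ => 0 := by
  have h1 : (tsupport φ)ᶜ ∈ 𝓝 ((hchart c).symm u) := (isClosed_tsupport φ).isOpen_compl.mem_nhds h
  filter_upwards [(continuousAt_extChartAt_symm'' hu).preimage_mem_nhds h1] with v hv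
  exact image_eq_zero_of_notMem_tsupport (f := φ) hv

/-- The coefficient of `d(φ f^* a)` in the chart at `c`. -/
def pullDensity (a : E 3 → E 3 →L[ℝ] ℝ) (f : S → E 3) (c : S) (φ : S → ℝ) (u : E 2) : ℝ :=
  alt (pullDeriv a (φ ∘ (hchart c).symm) (f ∘ (hchart c).symm) u)

theorem pullDensity_eq_zero {a : E 3 → E 3 →L[ℝ] ℝ} {f : S → E 3} {φ : S → ℝ} (c : S) {u : E 2} (hu : u ∈ (hchart c).target)
    (h : (hchart c).symm u ∉ tsupport φ) : pullDensity a f c φ u = 0 := by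
  have h1 := comp_hchart_symm_eventuallyEq_zero c hu h
  have h2 : halfDeriv (φ ∘ (hchart c).symm) u = 0 := by
    rw [halfDeriv, (h1.filter_mono nhdsWithin_le_nhds).fderivWithin_eq h1.self_of_nhds,
      fderivWithin_const_apply]
  rw [pullDensity, alt_pullDeriv, h2, h1.self_of_nhds]
  simp

variable [IsManifold (𝓡∂ 2) ∞ S]

theorem contDiffOn_comp_hchart_symm {G : Type*} [NormedAddCommGroup G] [NormedSpace ℝ G] {φ : S → G}
    (hφ : ContMDiff (𝓡∂ 2) 𝓘(ℝ, G) ∞ φ) (c : S) :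
    ContDiffOn ℝ ∞ (φ ∘ (hchart c).symm) (hchart c).target :=
  contMDiffOn_iff_contDiffOn.1 (hφ.comp_contMDiffOn (contMDiffOn_extChartAt_symm c))

theorem hasFDerivWithinAt_comp_hchart_symm {G : Type*} [NormedAddCommGroup G] [NormedSpace ℝ G]
    {φ : S → G} (hφ : ContMDiff (𝓡∂ 2) 𝓘(ℝ, G) ∞ φ) (c : S) {u : E 2} (hu : u ∈ (hchart c).target) :
    HasFDerivWithinAt (φ ∘ (hchart c).symm) (halfDeriv (φ ∘ (hchart c).symm) u) halfPlane u :=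
  (((contDiffOn_comp_hchart_symm hφ c u hu).mono_of_mem_nhdsWithin
    (hchart_target_mem c u hu)).differentiableWithinAt (by simp)).hasFDerivWithinAt

/-- The derivative of a coordinate change. -/
abbrev chartJac (c c' z : S) : E 2 →L[ℝ] E 2 := tangentCoordChange (𝓡∂ 2) c c' z

theorem hasFDerivWithinAt_chartJac {c c' z : S}
    (hz : z ∈ (hchart c).source ∩ (hchart c').source) :
    HasFDerivWithinAt (hchart c' ∘ (hchart c).symm) (chartJac c c' z) halfPlane (hchart c z) := by
  rw [← range_halfSpaceModel]
  exact hasFDerivWithinAt_tangentCoordChange hz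

theorem halfDeriv_chart_change {G : Type*} [NormedAddCommGroup G] [NormedSpace ℝ G] {φ : S → G}
    (hφ : ContMDiff (𝓡∂ 2) 𝓘(ℝ, G) ∞ φ) {c c' z : S}
    (hz : z ∈ (hchart c).source ∩ (hchart c').source) :
    halfDeriv (φ ∘ (hchart c).symm) (hchart c z) =
      (halfDeriv (φ ∘ (hchart c').symm) (hchart c' z)).comp (chartJac c c' z) := by
  have hz' : (hchart c).symm (hchart c z) = z := (hchart c).left_inv hz.1
  have h1 := hasFDerivWithinAt_comp_hchart_symm hφ c' ((hchart c').map_source hz.2)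
  have h2 := hasFDerivWithinAt_chartJac hz
  have h3 : (hchart c' ∘ (hchart c).symm) (hchart c z) = hchart c' z := by
    rw [Function.comp_apply, hz']
  rw [← h3] at h1
  have h4 := h1.comp _ h2 (fun v _ => hchart_mem_halfPlane c' _)
  rw [h3] at h4
  refine HasFDerivWithinAt.fderivWithin (h4.congr_of_eventuallyEq ?_ ?_)
    (uniqueDiffOn_halfPlane _ (hchart_mem_halfPlane c z))
  · have h5 : (hchart c').source ∈ 𝓝 ((hchart c).symm (hchart c z)) := by
      rw [hz']
      exact extChartAt_source_mem_nhds' hz.2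
    filter_upwards [mem_nhdsWithin_of_mem_nhds ((continuousAt_extChartAt_symm''
      ((hchart c).map_source hz.1)).preimage_mem_nhds h5)] with v hv
    exact congrArg φ ((hchart c').left_inv hv).symm
  · exact congrArg φ ((hchart c').left_inv (by rw [hz']; exact hz.2)).symm

theorem det_chartJac_pos (hS : HasOrientedCharts S) {c c' z : S}
    (hz : z ∈ (hchart c).source ∩ (hchart c').source) : 0 < (chartJac c c' z).det := hS c c' z hz

/-- Densities that transform with the Jacobian of the coordinate change have the same integral
over the common domain of two charts. -/
theorem setIntegral_chart_change (hS : HasOrientedCharts S) (c c' : S) {η η' : E 2 → ℝ}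
    (hη : ∀ z ∈ (hchart c).source ∩ (hchart c').source,
      η (hchart c z) = (chartJac c c' z).det * η' (hchart c' z)) :
    ∫ u in hchart c '' ((hchart c).source ∩ (hchart c').source), η u =
      ∫ u in hchart c' '' ((hchart c').source ∩ (hchart c).source), η' u := by
  set W := (hchart c).source ∩ (hchart c').source
  set τ := hchart c' ∘ (hchart c).symm with hτ
  have himg : hchart c' '' ((hchart c').source ∩ (hchart c).source) = τ '' (hchart c '' W) := by
    rw [inter_comm, hτ, image_comp]
    congr 1
    exact ((hchart c).leftInvOn.mono inter_subset_left).image_image.symm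
  have hm : MeasurableSet (hchart c '' W) := by
    rw [hchart_image_eq]
    exact measurableSet_hchart c (isOpen_extChartAt_source c')
  have hsub : hchart c '' W ⊆ halfPlane := by
    rintro _ ⟨z, _, rfl⟩
    exact hchart_mem_halfPlane c z
  rw [himg, integral_image_eq_integral_abs_det_fderiv_smul volume hm
    (f' := fun u => chartJac c c' ((hchart c).symm u)) ?_ ?_]
  · refine setIntegral_congr_fun hm ?_
    rintro _ ⟨z, hz, rfl⟩
    have h1 : (hchart c).symm (hchart c z) = z := (hchart c).left_inv hz.1
    simp only [hτ, Function.comp_apply]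
    rw [h1, hη z hz, abs_of_pos (det_chartJac_pos hS hz), smul_eq_mul]
  · rintro _ ⟨z, hz, rfl⟩
    rw [show (hchart c).symm (hchart c z) = z from (hchart c).left_inv hz.1]
    exact (hasFDerivWithinAt_chartJac hz).mono hsub
  · rintro _ ⟨z, hz, rfl⟩ _ ⟨y, hy, rfl⟩ h
    simp only [hτ, Function.comp_apply] at h
    rw [show (hchart c).symm (hchart c z) = z from (hchart c).left_inv hz.1,
      show (hchart c).symm (hchart c y) = y from (hchart c).left_inv hy.1] at h
    rw [(hchart c').injOn hz.2 hy.2 h]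

variable {a : E 3 → E 3 →L[ℝ] ℝ} {f : S → E 3} {φ : S → ℝ}

/-- The expression `pullDeriv` contains only first derivatives of φ and f, so the chain rule turns
it into its pull-back by the coordinate change as a bilinear form. Antisymmetrization then produces
the determinant. -/
theorem pullDensity_chart_change (hf : ContMDiff (𝓡∂ 2) 𝓘(ℝ, E 3) ∞ f)
    (hφ : ContMDiff (𝓡∂ 2) 𝓘(ℝ, ℝ) ∞ φ) {c c' z : S}
    (hz : z ∈ (hchart c).source ∩ (hchart c').source) :
    pullDensity a f c φ (hchart c z) =
      (chartJac c c' z).det * pullDensity a f c' φ (hchart c' z) := by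
  rw [pullDensity, pullDensity, ← alt_bilinearComp]
  congr 1
  have h1 : (hchart c).symm (hchart c z) = z := (hchart c).left_inv hz.1
  have h2 : (hchart c').symm (hchart c' z) = z := (hchart c').left_inv hz.2
  rw [pullDeriv, pullDeriv, halfDeriv_chart_change hf hz, halfDeriv_chart_change hφ hz]
  simp only [Function.comp_apply, h1, h2]
  rfl

theorem continuousOn_pullDensity (ha : ContDiff ℝ 1 a) (hf : ContMDiff (𝓡∂ 2) 𝓘(ℝ, E 3) ∞ f)
    (hφ : ContMDiff (𝓡∂ 2) 𝓘(ℝ, ℝ) ∞ φ) (c : S) :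
    ContinuousOn (pullDensity a f c φ) (hchart c).target := by
  have h1 := contDiffOn_comp_hchart_symm hf c
  have h2 := contDiffOn_comp_hchart_symm hφ c
  have h3 := (contDiffOn_halfDeriv (hchart_target_subset c) (hchart_target_mem c) h1).continuousOn
  have h4 := (contDiffOn_halfDeriv (hchart_target_subset c) (hchart_target_mem c) h2).continuousOn
  have h5 := (ha.continuous_fderiv one_ne_zero).comp_continuousOn h1.continuousOn
  have h6 := ha.continuous.comp_continuousOn h1.continuousOn
  have h7 := h2.continuousOn
  have hF : ∀ i, ContinuousOn (fun u => halfDeriv (f ∘ (hchart c).symm) u (stdVec 2 i))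
      (hchart c).target := fun i => h3.clm_apply continuousOn_const
  have hΦ : ∀ i, ContinuousOn (fun u => halfDeriv (φ ∘ (hchart c).symm) u (stdVec 2 i))
      (hchart c).target := fun i => h4.clm_apply continuousOn_const
  have h8 : pullDensity a f c φ = fun u => _ := funext fun u => alt_pullDeriv a _ _ u
  rw [h8]
  exact (((hΦ 0).mul (h6.clm_apply (hF 1))).add (h7.mul ((h5.clm_apply (hF 0)).clm_apply (hF 1)))).sub
    (((hΦ 1).mul (h6.clm_apply (hF 0))).add (h7.mul ((h5.clm_apply (hF 1)).clm_apply (hF 0))))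

theorem pullDensity_sum {ι : Type*} (t : Finset ι) {ρ : ι → S → ℝ}
    (hρ : ∀ i, ContMDiff (𝓡∂ 2) 𝓘(ℝ, ℝ) ∞ (ρ i)) (c : S) {u : E 2} (hu : u ∈ (hchart c).target) :
    ∑ i ∈ t, pullDensity a f c (ρ i) u = pullDensity a f c (fun x => ∑ i ∈ t, ρ i x) u := by
  have h1 : halfDeriv ((fun x => ∑ i ∈ t, ρ i x) ∘ (hchart c).symm) u =
      ∑ i ∈ t, halfDeriv (ρ i ∘ (hchart c).symm) u :=
    (HasFDerivWithinAt.fun_sum fun i _ =>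
      hasFDerivWithinAt_comp_hchart_symm (hρ i) c hu).fderivWithin
        (uniqueDiffOn_halfPlane u (hchart_target_subset c hu))
  simp only [pullDensity, alt_pullDeriv]
  rw [h1]
  simp only [_root_.sum_apply, Finset.sum_mul, Finset.sum_sub_distrib, Finset.sum_add_distrib,
    Function.comp_apply]

/-- Stokes' theorem for a form supported in one chart. -/
theorem chart_stokes [CompactSpace S] (ha : ContDiff ℝ 1 a) (hf : ContMDiff (𝓡∂ 2) 𝓘(ℝ, E 3) ∞ f)
    (hφ : ContMDiff (𝓡∂ 2) 𝓘(ℝ, ℝ) ∞ φ) (c : S) (hc : tsupport φ ⊆ (hchart c).source) :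
    ∫ u in (hchart c).target, pullDensity a f c φ u =
      -∫ q in {q : ℝ | planeEquiv (0, q) ∈ (hchart c).target},
        φ ((hchart c).symm (planeEquiv (0, q))) *
          a (f ((hchart c).symm (planeEquiv (0, q))))
            (halfDeriv (f ∘ (hchart c).symm) (planeEquiv (0, q)) (stdVec 2 1)) := by
  set T := (hchart c).target with hT
  set K := hchart c '' tsupport φ
  have hK : IsCompact K :=
    (isClosed_tsupport φ).isCompact.image_of_continuousOn ((continuousOn_extChartAt c).mono hc)
  have hKT : K ⊆ T := by
    rintro _ ⟨z, hz, rfl⟩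
    exact (hchart c).map_source (hc hz)
  -- The inverse chart has no meaning outside its domain, so the cut-off function is extended by
  -- zero there. Both functions agree near each point of the target within the half plane.
  set ψ : E 2 → ℝ := T.indicator (φ ∘ (hchart c).symm) with hψ
  have hψT : ∀ u ∈ T, ψ u = φ ((hchart c).symm u) := fun u hu => indicator_of_mem hu _
  have hψ0 : ∀ u ∉ K, ψ u = 0 := by
    intro u hu
    by_cases huT : u ∈ T
    · rw [hψT u huT]
      exact image_eq_zero_of_notMem_tsupport fun h => hu ⟨_, h, (hchart c).right_inv huT⟩
    · exact indicator_of_notMem huT _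
  have hψs : ContDiffOn ℝ ∞ ψ T :=
    (contDiffOn_comp_hchart_symm hφ c).congr fun u hu => hψT u hu
  have key := local_stokes (hchart_target_subset c) (hchart_target_mem c) hK hKT hψs hψ0
    (contDiffOn_comp_hchart_symm hf c) ha
  have hl : ∫ u in halfPlane, alt (pullDeriv a ψ (f ∘ (hchart c).symm) u) =
      ∫ u in T, pullDensity a f c φ u := by
    rw [setIntegral_eq_of_subset_of_forall_sdiff_eq_zero isClosed_halfPlane.measurableSet
      (hchart_target_subset c)]
    · refine setIntegral_congr_fun (measurableSet_hchart_target c) fun u hu => ?_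
      have h1 : ψ =ᶠ[𝓝[halfPlane] u] φ ∘ (hchart c).symm := by
        filter_upwards [hchart_target_mem c u hu] with v hv
        exact hψT v hv
      rw [pullDensity, pullDeriv, pullDeriv, halfDeriv, h1.fderivWithin_eq (hψT u hu), hψT u hu]
      rfl
    · intro u hu
      have h1 : u ∉ K := fun h => hu.2 (hKT h)
      rw [alt_pullDeriv, halfDeriv_eq_zero hK.isClosed hψ0 h1, hψ0 u h1]
      simp
  rw [← hl, key]
  congr 1
  rw [← setIntegral_eq_integral_of_forall_compl_eq_zero
    (s := {q : ℝ | planeEquiv (0, q) ∈ T})]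
  · have hm : MeasurableSet {q : ℝ | planeEquiv (0, q) ∈ T} :=
      (planeEquiv.continuous.comp (by fun_prop : Continuous fun q : ℝ => ((0 : ℝ), q))).measurable
        (measurableSet_hchart_target c)
    refine setIntegral_congr_fun hm fun q hq => ?_
    simp only [hψT _ hq, Function.comp_apply]
  · intro q hq
    have : ψ (planeEquiv (0, q)) = 0 := indicator_of_notMem (show planeEquiv (0, q) ∉ T from hq) _
    rw [this, zero_mul]

theorem exists_partition [CompactSpace S] [T2Space S] :
    ∃ (t : Finset S) (ρ : S → S → ℝ), (∀ c, ContMDiff (𝓡∂ 2) 𝓘(ℝ, ℝ) ∞ (ρ c)) ∧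
      (∀ c, tsupport (ρ c) ⊆ (hchart c).source) ∧ (∀ c x, 0 ≤ ρ c x) ∧
      ∀ x, ∑ c ∈ t, ρ c x = 1 := by
  obtain ⟨ρ, hρ⟩ := SmoothPartitionOfUnity.exists_isSubordinate_chartAt_source (𝓡∂ 2) S
  have hfin := ρ.locallyFinite.finite_nonempty_of_compact
  refine ⟨hfin.toFinset, fun c => ρ c, fun c => (ρ c).contMDiff, fun c => ?_, ρ.nonneg,
    fun x => ?_⟩
  · rw [hchart, extChartAt_source]
    exact hρ c
  · rw [← ρ.sum_eq_one (mem_univ x)]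
    refine (finsum_eq_sum_of_support_subset _ fun c hc => ?_).symm
    simp only [Finite.coe_toFinset, mem_ofPred_eq]
    exact ⟨x, hc⟩

variable {t : Finset S} {ρ : S → S → ℝ}

/-- Stokes' theorem for a compact surface, with the integrals over the surface and its boundary
computed by a partition of unity. -/
theorem surface_stokes [CompactSpace S] (hS : HasOrientedCharts S) (ha : ContDiff ℝ 1 a)
    (hf : ContMDiff (𝓡∂ 2) 𝓘(ℝ, E 3) ∞ f) (hρ : ∀ c, ContMDiff (𝓡∂ 2) 𝓘(ℝ, ℝ) ∞ (ρ c))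
    (hρs : ∀ c, tsupport (ρ c) ⊆ (hchart c).source) (hρ1 : ∀ x, ∑ c ∈ t, ρ c x = 1) :
    ∑ c ∈ t, ∫ u in (hchart c).target, ρ c ((hchart c).symm u) *
        pullDensity a f c (fun _ => 1) u =
      ∑ c ∈ t, ∫ u in (hchart c).target, pullDensity a f c (ρ c) u := by
  have hcont : ∀ c c' d, ContinuousOn (fun u => ρ c' ((hchart c).symm u) *
      pullDensity a f c (ρ d) u) (hchart c).target := fun c c' d =>
    (contDiffOn_comp_hchart_symm (hρ c') c).continuousOn.mul
      (continuousOn_pullDensity ha hf (hρ d) c)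
  have hi1 : ∀ c c', IntegrableOn (fun u => ρ c' ((hchart c).symm u) * pullDensity a f c (ρ c) u)
      (hchart c).target := fun c c' =>
    integrableOn_chart c (hcont c c' c) (isClosed_tsupport _) (hρs c) fun u hu h => by
      rw [pullDensity_eq_zero c hu h, mul_zero]
  have hi2 : ∀ c d, IntegrableOn (fun u => ρ c ((hchart c).symm u) * pullDensity a f c (ρ d) u)
      (hchart c).target := fun c d =>
    integrableOn_chart c (hcont c c d) (isClosed_tsupport _) (hρs c) fun u hu h => by
      rw [image_eq_zero_of_notMem_tsupport h, zero_mul]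
  -- The product of ρ_{c'} with d(ρ_c f^*a) is supported in both chart domains, so its integral may
  -- be computed in either chart.
  have hchange : ∀ c c', ∫ u in (hchart c).target, ρ c' ((hchart c).symm u) *
      pullDensity a f c (ρ c) u = ∫ u in (hchart c').target, ρ c' ((hchart c').symm u) *
      pullDensity a f c' (ρ c) u := by
    intro c c'
    have hr : ∀ d d' : S, ∀ η : E 2 → ℝ,
        (∀ u ∈ (hchart d).target, (hchart d).symm u ∉ (hchart d').source → η u = 0) →
        ∫ u in (hchart d).target, η u =
          ∫ u in hchart d '' ((hchart d).source ∩ (hchart d').source), η u := by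
      intro d d' η h0
      rw [hchart_image_eq]
      exact setIntegral_eq_of_subset_of_forall_sdiff_eq_zero (measurableSet_hchart_target d)
        inter_subset_left fun u hu => h0 u hu.1 fun h => hu.2 ⟨hu.1, h⟩
    rw [hr c c' _ fun u hu h => ?_, hr c' c _ fun u hu h => ?_]
    · refine setIntegral_chart_change hS c c' fun z hz => ?_
      rw [pullDensity_chart_change hf (hρ c) hz,
        show (hchart c).symm (hchart c z) = z from (hchart c).left_inv hz.1,
        show (hchart c').symm (hchart c' z) = z from (hchart c').left_inv hz.2]
      ring
    · rw [pullDensity_eq_zero c' hu fun h' => h (hρs c h'), mul_zero]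
    · rw [image_eq_zero_of_notMem_tsupport fun h' => h (hρs c' h'), zero_mul]
  -- Inserting the partition of unity once more moves every term into the chart at c'. After the
  -- sums are exchanged, the forms d(ρ_c f^*a) add up to d(f^*a) in that chart.
  have h1 : ∀ c ∈ t, ∫ u in (hchart c).target, pullDensity a f c (ρ c) u =
      ∑ c' ∈ t, ∫ u in (hchart c').target, ρ c' ((hchart c').symm u) *
        pullDensity a f c' (ρ c) u := by
    intro c _
    simp only [← hchange]
    rw [← integral_finsetSum _ fun c' _ => hi1 c c']
    refine setIntegral_congr_fun (measurableSet_hchart_target c) fun u _ => ?_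
    simp only [← Finset.sum_mul, hρ1, one_mul]
  rw [Finset.sum_congr rfl h1, Finset.sum_comm]
  refine Finset.sum_congr rfl fun c' _ => ?_
  rw [← integral_finsetSum _ fun c _ => hi2 c' c]
  refine setIntegral_congr_fun (measurableSet_hchart_target c') fun u hu => ?_
  simp only [← Finset.mul_sum]
  rw [pullDensity_sum t hρ c' hu]
  simp only [hρ1]

end SurfaceStokes

/-! ### The boundary of a Seifert surface -/

/-- The slope of q is the slope of ψ divided by the slope of φ between q(s₀) and q(s). Taking
`dslope` for the latter avoids a case distinction when q(s) = q(s₀), so that continuity of q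
suffices. -/
theorem hasDerivAt_of_comp {φ ψ q : ℝ → ℝ} {φ' ψ' s₀ : ℝ} (hφ : HasDerivAt φ φ' (q s₀))
    (hφ0 : φ' ≠ 0) (hψ : HasDerivAt ψ ψ' s₀) (hq : ContinuousAt q s₀)
    (h : ∀ᶠ s in 𝓝 s₀, φ (q s) = ψ s) : HasDerivAt q (ψ' / φ') s₀ := by
  have hD : Tendsto (fun s => dslope φ (q s₀) (q s)) (𝓝 s₀) (𝓝 φ') := by
    have h1 := (continuousAt_dslope_same.2 hφ.differentiableAt).tendsto
    rw [dslope_same, hφ.deriv] at h1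
    exact h1.comp hq
  rw [hasDerivAt_iff_tendsto_slope] at hψ ⊢
  refine (hψ.div (hD.mono_left nhdsWithin_le_nhds) hφ0).congr' ?_
  have h2 : ∀ᶠ s in 𝓝 s₀, dslope φ (q s₀) (q s) ≠ 0 := hD.eventually_ne hφ0
  filter_upwards [mem_nhdsWithin_of_mem_nhds h, mem_nhdsWithin_of_mem_nhds h2] with s hs hs2
  have h3 := sub_smul_dslope φ (q s₀) (q s)
  rw [hs, h.self_of_nhds, smul_eq_mul] at h3
  rw [Pi.div_apply, slope_def_field, slope_def_field, ← h3]
  field_simp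

/-- Taking inner products with the common tangent direction w reduces the claim to real-valued
functions. -/
theorem hasDerivAt_reparam {γ k : ℝ → E 3} {q : ℝ → ℝ} {w : E 3} {c s₀ : ℝ} (hc : c ≠ 0)
    (hw : w ≠ 0) (hγ : HasDerivAt γ (c • w) (q s₀)) (hk : HasDerivAt k w s₀)
    (hq : ContinuousAt q s₀) (h : ∀ᶠ s in 𝓝 s₀, γ (q s) = k s) : HasDerivAt q c⁻¹ s₀ := by
  have h1 : HasDerivAt (fun t => inner ℝ w (γ t)) (inner ℝ w (c • w)) (q s₀) :=
    (innerSL ℝ w).hasFDerivAt.comp_hasDerivAt _ hγ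
  have h2 : HasDerivAt (fun t => inner ℝ w (k t)) (inner ℝ w w) s₀ :=
    (innerSL ℝ w).hasFDerivAt.comp_hasDerivAt _ hk
  have hw' : inner ℝ w w ≠ 0 := inner_self_ne_zero.2 hw
  rw [real_inner_smul_right] at h1
  have h3 := hasDerivAt_of_comp h1 (mul_ne_zero hc hw') h2 hq
    (h.mono fun s hs => by rw [hs])
  rwa [div_mul_cancel_right₀ hw'] at h3

section Boundary

variable {S : Type} [TopologicalSpace S] [ChartedSpace (EuclideanHalfSpace 2) S]

theorem isCompact_carrier {r : ℕ} (K : OrientedKnot r) : IsCompact K.carrier := by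
  have h : K.carrier = ⋃ i, K.curve i '' Icc 0 1 := by
    ext p
    simp only [OrientedKnot.carrier, mem_ofPred_eq, mem_iUnion, mem_image]
    constructor
    · rintro ⟨i, t, rfl⟩
      obtain ⟨t', ht', h, -⟩ := exists_mem_Ico_curve (K.periodic i) t
      exact ⟨i, t', Ico_subset_Icc_self ht', h.symm⟩
    · rintro ⟨i, t, -, h⟩
      exact ⟨i, t, h⟩
  rw [h]
  exact isCompact_iUnion fun i => isCompact_Icc.image (K.smooth i).continuous

/-- The restriction of f to the compact boundary is a continuous injection, hence an embedding, so
the knot lifts continuously. Differentiability in charts is recovered afterwards from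
`hasDerivAt_reparam`. -/
theorem exists_boundary_lift [CompactSpace S] {r : ℕ} {K : OrientedKnot r} {f : S → E 3}
    (hf : IsSeifertSurface K f) :
    ∃ b : Fin r → ℝ → S, (∀ i, Continuous (b i)) ∧ (∀ i s, b i s ∈ (𝓡∂ 2).boundary S) ∧
      ∀ i s, f (b i s) = K.curve i s := by
  obtain ⟨hfs, -, hpre, hbij, -⟩ := hf
  have h1 : ∀ i s, ∃ x ∈ (𝓡∂ 2).boundary S, f x = K.curve i s := fun i s =>
    hbij.surjOn ⟨i, s, rfl⟩
  choose b hb hfb using h1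
  refine ⟨b, fun i => ?_, hb, hfb⟩
  have hcl : IsClosed ((𝓡∂ 2).boundary S) := by
    rw [← hpre]
    exact (isCompact_carrier K).isClosed.preimage hfs.continuous
  have : CompactSpace ((𝓡∂ 2).boundary S) := isCompact_iff_compactSpace.1 hcl.isCompact
  have hemb : IsClosedEmbedding fun x : (𝓡∂ 2).boundary S => f x :=
    (hfs.continuous.comp continuous_subtype_val).isClosedEmbedding
      fun x y h => Subtype.ext (hbij.injOn x.2 y.2 h)
  have h2 : Continuous fun s => (⟨b i s, hb i s⟩ : (𝓡∂ 2).boundary S) := by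
    rw [hemb.isEmbedding.continuous_iff]
    have : (fun x : (𝓡∂ 2).boundary S => f x) ∘ (fun s => ⟨b i s, hb i s⟩) = K.curve i :=
      funext fun s => hfb i s
    rw [this]
    exact (K.smooth i).continuous
  exact continuous_subtype_val.comp h2

variable [IsManifold (𝓡∂ 2) ∞ S]

theorem isInteriorPoint_iff_hchart {c x : S} (hx : x ∈ (hchart c).source) :
    (𝓡∂ 2).IsInteriorPoint x ↔ 0 < hchart c x 0 := by
  have h := (𝓡∂ 2).isInteriorPoint_iff_of_mem_atlas (n := ∞) (by simp)
    (chart_mem_atlas (EuclideanHalfSpace 2) c) (by rwa [← extChartAt_source (𝓡∂ 2)])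
  refine h.trans ⟨fun h1 => ?_, fun h1 => ?_⟩
  · have h2 := interior_mono (hchart_target_subset c) h1
    rw [interior_halfPlane] at h2
    exact h2
  · have h2 : halfPlane ∈ 𝓝 (hchart c x) := by
      rw [← mem_interior_iff_mem_nhds, interior_halfPlane]
      exact h1
    have h3 := hchart_target_mem c _ ((hchart c).map_source hx)
    rw [nhdsWithin_eq_nhds.2 h2] at h3
    exact mem_interior_iff_mem_nhds.2 h3

theorem mem_boundary_iff_hchart {c x : S} (hx : x ∈ (hchart c).source) :
    x ∈ (𝓡∂ 2).boundary S ↔ hchart c x 0 = 0 := by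
  have h1 : x ∈ (𝓡∂ 2).boundary S ↔ ¬(𝓡∂ 2).IsInteriorPoint x :=
    (𝓡∂ 2).isBoundaryPoint_iff_not_isInteriorPoint x
  rw [h1, isInteriorPoint_iff_hchart hx, not_lt]
  exact ⟨fun h => le_antisymm h (hchart_mem_halfPlane c x), fun h => h.le⟩

theorem frame_eq {f : S → E 3} (hf : ContMDiff (𝓡∂ 2) 𝓘(ℝ, E 3) ∞ f) {c x : S}
    (hx : x ∈ (hchart c).source) (i : Fin 2) :
    frame f x i = halfDeriv (f ∘ (hchart c).symm) (hchart c x) (chartJac x c x (stdVec 2 i)) := by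
  have h1 := halfDeriv_chart_change hf (c := x) (c' := c) (z := x) ⟨mem_extChartAt_source x, hx⟩
  rw [← ContinuousLinearMap.comp_apply, ← h1, frame,
    MDifferentiableAt.mfderiv ((hf x).mdifferentiableAt (by simp)), range_halfSpaceModel]
  rfl

/-- At a boundary point, coordinate changes preserve the boundary direction. -/
theorem chartJac_boundary (hS : HasOrientedCharts S) {c c' x : S}
    (hx : x ∈ (hchart c).source ∩ (hchart c').source) (hb : x ∈ (𝓡∂ 2).boundary S) :
    ∃ μ : ℝ, 0 < μ ∧ chartJac c c' x (stdVec 2 1) = μ • stdVec 2 1 := by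
  set u := hchart c x
  have h0 : u 0 = 0 := (mem_boundary_iff_hchart hx.1).1 hb
  set A := chartJac c c' x
  have hA := hasFDerivWithinAt_chartJac hx
  have hA0 : HasFDerivWithinAt (fun v => (hchart c' ((hchart c).symm v)) 0)
      ((EuclideanSpace.proj (𝕜 := ℝ) 0).comp A) halfPlane u :=
    (EuclideanSpace.proj (𝕜 := ℝ) (0 : Fin 2)).hasFDerivAt.comp_hasFDerivWithinAt u hA
  -- The first coordinate of a coordinate change is nonnegative and vanishes at a boundary point.
  -- Its derivative is therefore nonnegative on inward vectors; applied to e_2 and -e_2, this shows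
  -- that the boundary direction is preserved, and the positive determinant fixes its sense.
  have hmin : IsLocalMinOn (fun v => (hchart c' ((hchart c).symm v)) 0) halfPlane u := by
    refine Eventually.of_forall fun v => ?_
    have h1 : (hchart c).symm u = x := (hchart c).left_inv hx.1
    have h2 : (hchart c' ((hchart c).symm u)) 0 = 0 := by
      rw [h1]
      exact (mem_boundary_iff_hchart hx.2).1 hb
    exact h2.le.trans (hchart_mem_halfPlane c' _)
  have hpos : ∀ y : E 2, 0 ≤ y 0 → 0 ≤ (A y) 0 := by
    intro y hy
    refine hmin.hasFDerivWithinAt_nonneg hA0 (mem_posTangentConeAt_of_segment_subset ?_)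
    rw [segment_eq_image']
    rintro _ ⟨r, hr, rfl⟩
    simp only [halfPlane, mem_ofPred_eq, PiLp.add_apply, PiLp.smul_apply, h0, smul_eq_mul,
      add_sub_cancel_left, zero_add]
    exact mul_nonneg hr.1 hy
  have h10 : (A (stdVec 2 1)) 0 = 0 := by
    refine le_antisymm ?_ (hpos _ (by simp [stdVec_apply]))
    have := hpos (-stdVec 2 1) (by simp [stdVec_apply])
    rw [map_neg, PiLp.neg_apply] at this
    linarith
  have h00 : 0 ≤ (A (stdVec 2 0)) 0 := hpos _ (by simp [stdVec_apply])
  have hdet : 0 < A.det := det_chartJac_pos hS hx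
  rw [det_plane, h10, zero_mul, sub_zero] at hdet
  refine ⟨A (stdVec 2 1) 1, pos_of_mul_pos_right hdet h00, ?_⟩
  have := eq_stdVec_add (A (stdVec 2 1))
  rwa [h10, zero_smul, zero_add] at this

variable {r : ℕ} {K : OrientedKnot r} {f : S → E 3}

theorem planeEquiv_boundary {c x : S} (hx : x ∈ (hchart c).source)
    (hb : x ∈ (𝓡∂ 2).boundary S) : planeEquiv (0, hchart c x 1) = hchart c x := by
  have h := (mem_boundary_iff_hchart hx).1 hb
  rw [planeEquiv_apply]
  ext i
  fin_cases i
  · exact h.symm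
  · rfl

/-- The boundary coordinate of a lifted knot has a negative derivative, by which the tangent
vectors of the boundary and of the knot are related. -/
theorem hasDerivAt_boundary_coordinate (hS : HasOrientedCharts S) (hf : IsSeifertSurface K f)
    {b : Fin r → ℝ → S} (hbc : ∀ i, Continuous (b i)) (hb : ∀ i s, b i s ∈ (𝓡∂ 2).boundary S)
    (hfb : ∀ i s, f (b i s) = K.curve i s) {c : S} {i : Fin r} {s : ℝ}
    (hs : b i s ∈ (hchart c).source) :
    ∃ d : ℝ, d < 0 ∧ HasDerivAt (fun s => hchart c (b i s) 1) d s ∧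
      d • halfDeriv (f ∘ (hchart c).symm) (hchart c (b i s)) (stdVec 2 1) =
        deriv (K.curve i) s := by
  obtain ⟨hfs, -, -, -, hor⟩ := hf
  obtain ⟨e, he, hframe⟩ := hor _ (hb i s) i s (hfb i s)
  obtain ⟨μ, hμ, hjac⟩ := chartJac_boundary hS (c := b i s) (c' := c)
    ⟨mem_extChartAt_source _, hs⟩ (hb i s)
  rw [frame_eq hfs hs, hjac, map_smul] at hframe
  set g := halfDeriv (f ∘ (hchart c).symm) (hchart c (b i s)) (stdVec 2 1) with hg
  -- The oriented boundary tangent is minus the second frame vector, so the chart's second boundary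
  -- direction is a negative multiple of the velocity of the knot.
  have hgk : g = (-(μ⁻¹ * e)) • deriv (K.curve i) s := by
    rw [neg_smul, mul_smul, ← hframe, smul_neg, neg_neg, smul_smul, inv_mul_cancel₀ hμ.ne',
      one_smul]
  have hc0 : -(μ⁻¹ * e) < 0 := neg_lt_zero.2 (mul_pos (inv_pos.2 hμ) he)
  refine ⟨(-(μ⁻¹ * e))⁻¹, inv_lt_zero.2 hc0, ?_, ?_⟩
  · have hu := (hchart c).map_source hs
    have hpu := planeEquiv_boundary hs (hb i s)
    have h1 := hasFDerivWithinAt_comp_hchart_symm hfs c hu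
    rw [← hpu] at h1
    have hline : HasDerivAt (fun q : ℝ => planeEquiv (0, q)) (stdVec 2 1)
        (hchart c (b i s) 1) := by
      have h2 := planeEquiv.hasFDerivAt.comp_hasDerivAt (hchart c (b i s) 1)
        ((hasDerivAt_const _ (0 : ℝ)).prodMk (hasDerivAt_id (hchart c (b i s) 1)))
      have h3 : planeEquiv (0, 1) = stdVec 2 1 := by
        rw [planeEquiv_apply]; ext i; fin_cases i <;> simp [stdVec_apply]
      rw [← h3]
      exact h2
    have hγ : HasDerivAt (fun q : ℝ => f ((hchart c).symm (planeEquiv (0, q)))) g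
        (hchart c (b i s) 1) := by
      have h3 := h1.comp_hasDerivWithinAt (s := univ) _ hline.hasDerivWithinAt
        fun q _ => (planeEquiv_mem_halfPlane _).2 le_rfl
      rw [hpu] at h3
      exact hasDerivWithinAt_univ.1 h3
    have hcont : ContinuousAt (fun s => hchart c (b i s)) s :=
      ContinuousAt.comp (g := hchart c) (continuousAt_extChartAt' hs) (hbc i).continuousAt
    refine hasDerivAt_reparam (γ := fun q : ℝ => f ((hchart c).symm (planeEquiv (0, q))))
      (w := deriv (K.curve i) s) hc0.ne (K.regular i s) ?_
      (ContDiff.hasDerivAt_top (K.smooth i) s) ?_ ?_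
    · rw [← hgk]
      exact hγ
    · exact (EuclideanSpace.proj (𝕜 := ℝ) (1 : Fin 2)).continuous.continuousAt.comp hcont
    · filter_upwards [(hbc i).continuousAt.preimage_mem_nhds
        (extChartAt_source_mem_nhds' (I := 𝓡∂ 2) hs)] with s' hs'
      rw [planeEquiv_boundary hs' (hb i s'),
        show (hchart c).symm (hchart c (b i s')) = b i s' from (hchart c).left_inv hs', hfb]
  · rw [hgk, smul_smul, inv_mul_cancel₀ hc0.ne, one_smul]

/-- The boundary integral in a chart, as an integral over the knot. -/
theorem chart_boundary_integral [CompactSpace S] (hS : HasOrientedCharts S)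
    (hf : IsSeifertSurface K f) {b : Fin r → ℝ → S} (hbc : ∀ i, Continuous (b i))
    (hb : ∀ i s, b i s ∈ (𝓡∂ 2).boundary S) (hfb : ∀ i s, f (b i s) = K.curve i s)
    {a : E 3 → E 3 →L[ℝ] ℝ} (ha : Continuous a) {φ : S → ℝ} (hφ : Continuous φ) {c : S}
    (hc : tsupport φ ⊆ (hchart c).source) :
    -∫ q in {q : ℝ | planeEquiv (0, q) ∈ (hchart c).target},
        φ ((hchart c).symm (planeEquiv (0, q))) *
          a (f ((hchart c).symm (planeEquiv (0, q))))
            (halfDeriv (f ∘ (hchart c).symm) (planeEquiv (0, q)) (stdVec 2 1)) =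
      ∑ i, ∫ s in (0 : ℝ)..1, φ (b i s) * a (K.curve i s) (deriv (K.curve i) s) := by
  set B := {q : ℝ | planeEquiv (0, q) ∈ (hchart c).target} with hB
  set h : ℝ → ℝ := fun q => φ ((hchart c).symm (planeEquiv (0, q))) *
    a (f ((hchart c).symm (planeEquiv (0, q))))
      (halfDeriv (f ∘ (hchart c).symm) (planeEquiv (0, q)) (stdVec 2 1)) with hh
  -- V i collects the parameters of one period whose boundary points lie in the chart domain.
  set V : Fin r → Set ℝ := fun i => Ico 0 1 ∩ b i ⁻¹' (hchart c).source with hV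
  set q : Fin r → ℝ → ℝ := fun i s => hchart c (b i s) 1 with hq
  have hVm : ∀ i, MeasurableSet (V i) := fun i => measurableSet_Ico.inter
    ((isOpen_extChartAt_source (I := 𝓡∂ 2) c).preimage (hbc i)).measurableSet
  have hd : ∀ i s, ∃ d : ℝ, s ∈ V i → d < 0 ∧ HasDerivAt (q i) d s ∧
      d • halfDeriv (f ∘ (hchart c).symm) (hchart c (b i s)) (stdVec 2 1) =
        deriv (K.curve i) s := fun i s => by
    by_cases hs : s ∈ V i
    · obtain ⟨d, h⟩ := hasDerivAt_boundary_coordinate hS hf hbc hb hfb hs.2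
      exact ⟨d, fun _ => h⟩
    · exact ⟨0, fun h => absurd h hs⟩
  choose d hd using hd
  have hqeq : ∀ i, ∀ s ∈ V i, (hchart c).symm (planeEquiv (0, q i s)) = b i s := by
    intro i s hs
    rw [hq, planeEquiv_boundary hs.2 (hb i s)]
    exact (hchart c).left_inv hs.2
  have hqinj : ∀ i j, ∀ s ∈ V i, ∀ s' ∈ V j, q i s = q j s' → i = j ∧ s = s' := by
    intro i j s hs s' hs' hqq
    have h1 : b i s = b j s' := by rw [← hqeq i s hs, ← hqeq j s' hs', hqq]
    exact K.simple i j s hs.1 s' hs'.1 (by rw [← hfb, ← hfb, h1])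
  -- The boundary in the chart is the union of the images of these parameter sets. They are
  -- disjoint, and each is parametrized injectively, because f is injective on the boundary and the
  -- knot is simple.
  have hBU : B = ⋃ i, q i '' V i := by
    ext y
    simp only [mem_iUnion, mem_image]
    constructor
    · intro hy
      set x := (hchart c).symm (planeEquiv (0, y))
      have hx : x ∈ (hchart c).source := (hchart c).map_target hy
      have hxe : hchart c x = planeEquiv (0, y) := (hchart c).right_inv hy
      have hxb : x ∈ (𝓡∂ 2).boundary S := by
        rw [mem_boundary_iff_hchart hx, hxe, planeEquiv_apply]
        rfl
      obtain ⟨i, t, ht⟩ := hf.2.2.2.1.mapsTo hxb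
      obtain ⟨s, hs, hts, -⟩ := exists_mem_Ico_curve (K.periodic i) t
      have h1 : b i s = x := hf.2.2.2.1.injOn (hb i s) hxb (by rw [hfb, ← hts, ht])
      refine ⟨i, s, ⟨hs, ?_⟩, ?_⟩
      · change b i s ∈ (hchart c).source
        rw [h1]
        exact hx
      · simp only [hq]
        rw [h1, hxe, planeEquiv_apply]
        rfl
    · rintro ⟨i, s, hs, rfl⟩
      change planeEquiv (0, hchart c (b i s) 1) ∈ (hchart c).target
      rw [planeEquiv_boundary hs.2 (hb i s)]
      exact (hchart c).map_source hs.2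
  have hqm : ∀ i, MeasurableSet (q i '' V i) := fun i =>
    measurable_image_of_fderivWithin (hVm i) (fun s hs =>
      (hd i s hs).2.1.hasDerivWithinAt.hasFDerivWithinAt)
      fun s hs s' hs' hss => (hqinj i i s hs s' hs' hss).2
  have hline : Continuous fun q : ℝ => planeEquiv (0, q) :=
    planeEquiv.continuous.comp (by fun_prop)
  have hmaps : MapsTo (fun q : ℝ => planeEquiv (0, q)) B (hchart c).target := fun q hq => hq
  have hcont : ContinuousOn h B := by
    have h1 := contDiffOn_comp_hchart_symm hf.1 c
    have h2 := (contDiffOn_halfDeriv (hchart_target_subset c) (hchart_target_mem c)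
      h1).continuousOn
    have h3 : ContinuousOn (fun u => φ ((hchart c).symm u) * a (f ((hchart c).symm u))
        (halfDeriv (f ∘ (hchart c).symm) u (stdVec 2 1))) (hchart c).target :=
      (hφ.comp_continuousOn (continuousOn_extChartAt_symm c)).mul
        ((ha.comp_continuousOn h1.continuousOn).clm_apply (h2.clm_apply continuousOn_const))
    exact h3.comp hline.continuousOn hmaps
  have hint : IntegrableOn h B := by
    have hKc : IsCompact (hchart c '' tsupport φ) :=
      (isClosed_tsupport φ).isCompact.image_of_continuousOn ((continuousOn_extChartAt c).mono hc)
    set C : Set ℝ := {q | planeEquiv (0, q) ∈ hchart c '' tsupport φ}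
    have hC : IsCompact C := by
      refine IsCompact.of_isClosed_subset
        (hKc.image (EuclideanSpace.proj (𝕜 := ℝ) (1 : Fin 2)).continuous)
        (hKc.isClosed.preimage hline) fun y hy => ⟨_, hy, ?_⟩
      rw [planeEquiv_apply]
      rfl
    have hCB : C ⊆ B := by
      rintro y ⟨z, hz, hzy⟩
      change planeEquiv (0, y) ∈ (hchart c).target
      rw [← hzy]
      exact (hchart c).map_source (hc hz)
    have hBm : MeasurableSet B := by
      rw [hBU]
      exact MeasurableSet.iUnion hqm
    refine ((hcont.mono hCB).integrableOn_compact hC).of_forall_sdiff_eq_zero hBm fun y hy => ?_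
    have h1 : (hchart c).symm (planeEquiv (0, y)) ∉ tsupport φ := fun h1 =>
      hy.2 ⟨_, h1, (hchart c).right_inv hy.1⟩
    simp only [hh]
    rw [image_eq_zero_of_notMem_tsupport h1, zero_mul]
  rw [hBU, integral_iUnion_fintype hqm ?_ fun i => hint.mono_set (hBU ▸ subset_iUnion (fun i => q i '' V i) i),
    ← Finset.sum_neg_distrib]
  · refine Finset.sum_congr rfl fun i _ => ?_
    rw [integral_image_eq_integral_abs_deriv_smul (hVm i)
      (fun s hs => (hd i s hs).2.1.hasDerivWithinAt)
      (fun s hs s' hs' hss => (hqinj i i s hs s' hs' hss).2), ← integral_neg,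
      intervalIntegral.integral_of_le zero_le_one, ← integral_Ico_eq_integral_Ioc]
    rw [setIntegral_eq_of_subset_of_forall_sdiff_eq_zero (s := V i) measurableSet_Ico
      inter_subset_left]
    · refine setIntegral_congr_fun (hVm i) fun s hs => ?_
      simp only [hh]
      -- The boundary coordinate decreases along the knot, so its absolute derivative is -d. This
      -- cancels the minus sign of the boundary term, and d times the boundary tangent is the
      -- velocity of the knot.
      rw [hqeq i s hs, hfb, abs_of_neg (hd i s hs).1, hq, planeEquiv_boundary hs.2 (hb i s),
        ← (hd i s hs).2.2, map_smul, smul_eq_mul, smul_eq_mul]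
      ring
    · intro s hs
      rw [image_eq_zero_of_notMem_tsupport fun h1 => hs.2 ⟨hs.1, hc h1⟩, zero_mul]
  · intro i j hij
    rw [Function.onFun, Set.disjoint_left]
    rintro _ ⟨s, hs, rfl⟩ ⟨s', hs', h1⟩
    exact hij (hqinj i j s hs s' hs' h1.symm).1

variable {t : Finset S} {ρ : S → S → ℝ}

/-- Stokes' theorem for a surface bounded by a knot. -/
theorem knot_stokes [CompactSpace S] (hS : HasOrientedCharts S) (hf : IsSeifertSurface K f)
    {a : E 3 → E 3 →L[ℝ] ℝ} (ha : ContDiff ℝ 1 a)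
    (hρ : ∀ c, ContMDiff (𝓡∂ 2) 𝓘(ℝ, ℝ) ∞ (ρ c))
    (hρs : ∀ c, tsupport (ρ c) ⊆ (hchart c).source) (hρ1 : ∀ x, ∑ c ∈ t, ρ c x = 1) :
    ∑ i, ∫ s in (0 : ℝ)..1, a (K.curve i s) (deriv (K.curve i) s) =
      ∑ c ∈ t, ∫ u in (hchart c).target, ρ c ((hchart c).symm u) *
        pullDensity a f c (fun _ => 1) u := by
  obtain ⟨b, hbc, hb, hfb⟩ := exists_boundary_lift hf
  rw [surface_stokes hS ha hf.1 hρ hρs hρ1]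
  have h1 : ∀ c ∈ t, ∫ u in (hchart c).target, pullDensity a f c (ρ c) u =
      ∑ i, ∫ s in (0 : ℝ)..1, ρ c (b i s) * a (K.curve i s) (deriv (K.curve i) s) := fun c _ => by
    rw [chart_stokes ha hf.1 (hρ c) c (hρs c),
      chart_boundary_integral hS hf hbc hb hfb ha.continuous (hρ c).continuous (hρs c)]
  rw [Finset.sum_congr rfl h1, Finset.sum_comm]
  refine Finset.sum_congr rfl fun i _ => ?_
  have hi : ∀ c ∈ t, IntervalIntegrable
      (fun s => ρ c (b i s) * a (K.curve i s) (deriv (K.curve i) s)) volume 0 1 := fun c _ => by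
    refine Continuous.intervalIntegrable ?_ 0 1
    exact ((hρ c).continuous.comp (hbc i)).mul
      ((ha.continuous.comp (K.smooth i).continuous).clm_apply
        (ContDiff.continuous_deriv_top (K.smooth i)))
  rw [← intervalIntegral.integral_finsetSum hi]
  refine intervalIntegral.integral_congr fun s _ => ?_
  simp only [← Finset.sum_mul, hρ1, one_mul]

end Boundary

/-! ### Intersection numbers of a surface and a curve -/

theorem contDiff_bsField {ε : ℝ} (hε : 0 < ε) : ContDiff ℝ 1 (bsField ε) := by
  have h1 : ContDiff ℝ 1 fun u : E 3 => reg ε u :=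
    ((contDiff_norm_sq ℝ).add contDiff_const).sqrt fun x => by positivity
  exact (contDiff_const.mul ((h1.pow 3).inv fun u => (pow_pos (reg_pos hε u) 3).ne')).smul
    contDiff_id

theorem det3_add_mid (a b b' c : E 3) : det3 a (b + b') c = det3 a b c + det3 a b' c := by
  simp only [det3_eq, PiLp.add_apply]
  ring

/-- The bilinear form `(b, ξ) ↦ det (b, ξ, w)`. -/
def detForm (w : E 3) : E 3 →L[ℝ] E 3 →L[ℝ] ℝ :=
  LinearMap.mkContinuous₂
    (LinearMap.mk₂ ℝ (fun b ξ => det3 b ξ w) (fun b b' ξ => det3_add_left b b' ξ w)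
      (fun r b ξ => det3_smul_left r b ξ w) (fun b ξ ξ' => det3_add_mid b ξ ξ' w)
      (fun r b ξ => det3_smul_mid r b ξ w))
    (6 * ‖w‖) fun b ξ => (abs_det3_le b ξ w).trans_eq (by ring)

theorem det3_comp_det (L : E 2 →L[ℝ] E 3) (A : E 2 →L[ℝ] E 2) (v : E 3) :
    det3 (L (A (stdVec 2 0))) (L (A (stdVec 2 1))) v =
      A.det * det3 (L (stdVec 2 0)) (L (stdVec 2 1)) v := by
  rw [det_plane]
  conv_lhs => rw [eq_stdVec_add (A (stdVec 2 0)), eq_stdVec_add (A (stdVec 2 1))]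
  simp only [map_add, map_smul, det3_eq, PiLp.add_apply, PiLp.smul_apply, smul_eq_mul]
  ring

/-! ### A piece of a surface against a closed curve -/

section Sheet

attribute [local irreducible] det3 bsField bsDeriv peak

variable {K : Set (E 2)} {W : E 2 → ℝ} {F F₀ F₁ : E 2 → E 3} {l : ℝ → E 3} {ε : ℝ}

theorem integral_det3_bsDeriv_eq_zero (hε : 0 < ε) (hl : ContDiff ℝ ∞ l)
    (hlp : Function.Periodic l 1) (x a b : E 3) :
    ∫ t in (0 : ℝ)..1, det3 a b (bsDeriv ε (x - l t) (-deriv l t)) = 0 := by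
  have h1 := hl.continuous
  have h2 := ContDiff.continuous_deriv_top hl
  have h3 := continuous_bsDeriv hε
  refine integral_deriv_periodic_eq_zero (h := fun t => det3 a b (bsField ε (x - l t)))
    (fun t => ?_) (continuous_det3 continuous_const continuous_const
      (h3.comp (by fun_prop : Continuous fun t => (x - l t, -deriv l t)))) ?_
  · simp only [← det3_cyclic _ a b]
    exact hasDerivAt_det3_left (hasDerivAt_bsField hε ((ContDiff.hasDerivAt_top hl t).const_sub x))
      a b
  · rw [show l 1 = l 0 by simpa using hlp 0]

/-- By Fubini the integral over t may be taken first. There the second summand is a total derivative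
over a period and vanishes, while the first is periodic and can be weighted by the tent. -/
theorem integral_sheet (hK : IsCompact K) (hW : ContinuousOn W K) (hF : ContinuousOn F K)
    (hF₀ : ContinuousOn F₀ K) (hF₁ : ContinuousOn F₁ K) (hε : 0 < ε) (hl : ContDiff ℝ ∞ l)
    (hlp : Function.Periodic l 1) :
    IntervalIntegrable (fun t => ∫ u in K, W u * (peak 3 ε (F u - l t) *
      det3 (F₀ u) (F₁ u) (-deriv l t) -
        det3 (F₀ u) (F₁ u) (bsDeriv ε (F u - l t) (-deriv l t)))) volume 0 1 ∧
    ∫ t in (0 : ℝ)..1, ∫ u in K, W u * (peak 3 ε (F u - l t) *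
      det3 (F₀ u) (F₁ u) (-deriv l t) -
        det3 (F₀ u) (F₁ u) (bsDeriv ε (F u - l t) (-deriv l t))) =
      ∫ z in K ×ˢ Icc (-1 : ℝ) 1, W z.1 * tent z.2 * det3 (F₀ z.1) (F₁ z.1) (-deriv l z.2) *
        peak 3 ε (F z.1 - l z.2) := by
  have h1 := hl.continuous
  have h2 := ContDiff.continuous_deriv_top hl
  have h3 := continuous_bsDeriv hε
  have h4 := continuous_peak (n := 3) hε
  have hfst : ∀ {G : Type} [TopologicalSpace G] {H : E 2 → G}, ContinuousOn H K →
      ContinuousOn (fun z : E 2 × ℝ => H z.1) (K ×ˢ univ) := fun hH =>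
    hH.comp continuousOn_fst fun z hz => hz.1
  have hsnd : ∀ {H : ℝ → E 3}, Continuous H →
      ContinuousOn (fun z : E 2 × ℝ => H z.2) (K ×ˢ univ) := fun hH =>
    (hH.comp continuous_snd).continuousOn
  have hZ : ContinuousOn (fun z : E 2 × ℝ => F z.1 - l z.2) (K ×ˢ univ) := (hfst hF).sub (hsnd h1)
  have hD : ContinuousOn (fun z : E 2 × ℝ => det3 (F₀ z.1) (F₁ z.1) (-deriv l z.2)) (K ×ˢ univ) :=
    ContinuousOn.det3 (hfst hF₀) (hfst hF₁) (hsnd h2.neg)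
  have hP : ContinuousOn (fun z : E 2 × ℝ => peak 3 ε (F z.1 - l z.2)) (K ×ˢ univ) :=
    h4.comp_continuousOn hZ
  have hB : ContinuousOn (fun z : E 2 × ℝ =>
      det3 (F₀ z.1) (F₁ z.1) (bsDeriv ε (F z.1 - l z.2) (-deriv l z.2))) (K ×ˢ univ) :=
    ContinuousOn.det3 (hfst hF₀) (hfst hF₁) (h3.comp_continuousOn (hZ.prodMk (hsnd h2.neg)))
  have hJ := ((hfst hW).mul ((hP.mul hD).sub hB)).mono (prod_mono_right (subset_univ (Icc (0 : ℝ) 1)))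
  have hJi : IntegrableOn (fun z : E 2 × ℝ => W z.1 * (peak 3 ε (F z.1 - l z.2) *
      det3 (F₀ z.1) (F₁ z.1) (-deriv l z.2) -
        det3 (F₀ z.1) (F₁ z.1) (bsDeriv ε (F z.1 - l z.2) (-deriv l z.2)))) (K ×ˢ Ioc (0 : ℝ) 1) :=
    (hJ.integrableOn_compact (hK.prod isCompact_Icc)).mono_set (prod_mono_right Ioc_subset_Icc_self)
  have hG : ContinuousOn (fun z : E 2 × ℝ => W z.1 * tent z.2 *
      det3 (F₀ z.1) (F₁ z.1) (-deriv l z.2) * peak 3 ε (F z.1 - l z.2)) (K ×ˢ univ) :=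
    (((hfst hW).mul (continuous_tent.comp continuous_snd).continuousOn).mul hD).mul hP
  have hGi := (hG.mono (prod_mono_right (subset_univ (Icc (-1 : ℝ) 1)))).integrableOn_compact
    (μ := volume) (hK.prod isCompact_Icc)
  rw [Measure.volume_eq_prod] at hJi hGi
  rw [IntegrableOn, ← Measure.prod_restrict] at hJi
  refine ⟨?_, ?_⟩
  · rw [intervalIntegrable_iff_integrableOn_Ioc_of_le zero_le_one]
    exact hJi.integral_prod_right
  · rw [intervalIntegral.integral_of_le zero_le_one, ← integral_integral_swap hJi,
      Measure.volume_eq_prod, setIntegral_prod _ hGi]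
    refine setIntegral_congr_fun hK.measurableSet fun u hu => ?_
    have hc1 : Continuous fun t => peak 3 ε (F u - l t) * det3 (F₀ u) (F₁ u) (-deriv l t) :=
      (h4.comp (by fun_prop)).mul (continuous_det3 continuous_const continuous_const (by fun_prop))
    have hc2 : Continuous fun t => det3 (F₀ u) (F₁ u) (bsDeriv ε (F u - l t) (-deriv l t)) :=
      continuous_det3 continuous_const continuous_const
        (h3.comp (by fun_prop : Continuous fun t => (F u - l t, -deriv l t)))
    have hl' := periodic_deriv hlp
    have hper : Function.Periodic (fun t => peak 3 ε (F u - l t) *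
        det3 (F₀ u) (F₁ u) (-deriv l t)) 1 := fun t => by
      simp only [hlp t, hl' t]
    simp only
    rw [integral_const_mul, ← intervalIntegral.integral_of_le zero_le_one,
      intervalIntegral.integral_sub (hc1.intervalIntegrable 0 1) (hc2.intervalIntegrable 0 1),
      integral_det3_bsDeriv_eq_zero hε hl hlp, sub_zero, ← integral_tent_mul hc1 hper,
      ← integral_const_mul, setIntegral_eq_integral_of_forall_compl_eq_zero]
    · refine integral_congr_ae (Eventually.of_forall fun t => ?_)
      simp only
      ring
    · intro t ht
      rw [tent_eq_zero ht]
      ring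

end Sheet

/-! ### Localization at the intersection points in a chart -/

section Intersection

variable {S : Type} [TopologicalSpace S] [ChartedSpace (EuclideanHalfSpace 2) S]
  {f : S → E 3} {l : ℝ → E 3}

/-- The compact set of the chart domain corresponding to the support of `ρ`. -/
abbrev chartSupport (c : S) (ρ : S → ℝ) : Set (E 2) := hchart c '' tsupport ρ

theorem isCompact_chartSupport [CompactSpace S] {c : S} {ρ : S → ℝ}
    (hρ : tsupport ρ ⊆ (hchart c).source) : IsCompact (chartSupport c ρ) :=
  (isClosed_tsupport ρ).isCompact.image_of_continuousOn ((continuousOn_extChartAt c).mono hρ)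

theorem chartSupport_subset {c : S} {ρ : S → ℝ} (hρ : tsupport ρ ⊆ (hchart c).source) :
    chartSupport c ρ ⊆ (hchart c).target := by
  rintro _ ⟨z, hz, rfl⟩
  exact (hchart c).map_source (hρ hz)

variable [IsManifold (𝓡∂ 2) ∞ S]

/-- The vector fields spanning the surface in the chart at `c`. -/
abbrev chartFrame (f : S → E 3) (c : S) (i : Fin 2) (u : E 2) : E 3 :=
  halfDeriv (f ∘ (hchart c).symm) u (stdVec 2 i)

theorem sign_det3_frame (hS : HasOrientedCharts S) (hf : ContMDiff (𝓡∂ 2) 𝓘(ℝ, E 3) ∞ f)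
    {c x : S} (hx : x ∈ (hchart c).source) (v : E 3) :
    SignType.sign (det3 (frame f x 0) (frame f x 1) v) =
      SignType.sign (det3 (chartFrame f c 0 (hchart c x)) (chartFrame f c 1 (hchart c x)) v) := by
  rw [frame_eq hf hx, frame_eq hf hx, det3_comp_det, sign_mul,
    sign_pos (det_chartJac_pos hS ⟨mem_extChartAt_source x, hx⟩), one_mul]

theorem continuousOn_chartFrame (hf : ContMDiff (𝓡∂ 2) 𝓘(ℝ, E 3) ∞ f) (c : S) (i : Fin 2) :
    ContinuousOn (chartFrame f c i) (hchart c).target :=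
  (contDiffOn_halfDeriv (hchart_target_subset c) (hchart_target_mem c)
    (contDiffOn_comp_hchart_symm hf c)).continuousOn.clm_apply continuousOn_const

/-- The zeros of f(x) - l(t) are the intersection points, nondegenerate by transversality. The
weights ρ and tent kill the points outside the compact product near a zero, so the integrand is
locally a continuous weight times the Jacobian. -/
theorem tendsto_sheet [CompactSpace S] (hS : HasOrientedCharts S)
    (hf : ContMDiff (𝓡∂ 2) 𝓘(ℝ, E 3) ∞ f) (hl : ContDiff ℝ ∞ l)
    (hbd : ∀ x ∈ (𝓡∂ 2).boundary S, ∀ t, f x ≠ l t)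
    (htr : ∀ x t, f x = l t → det3 (frame f x 0) (frame f x 1) (deriv l t) ≠ 0) {c : S}
    {ρ : S → ℝ} (hρ : ContMDiff (𝓡∂ 2) 𝓘(ℝ, ℝ) ∞ ρ) (hρs : tsupport ρ ⊆ (hchart c).source) :
    {p : S × ℝ | p.1 ∈ tsupport ρ ∧ p.2 ∈ Icc (-1 : ℝ) 1 ∧ f p.1 = l p.2}.Finite ∧
    Tendsto (fun ε => ∫ z in chartSupport c ρ ×ˢ Icc (-1 : ℝ) 1, ρ ((hchart c).symm z.1) *
        tent z.2 * det3 (chartFrame f c 0 z.1) (chartFrame f c 1 z.1) (-deriv l z.2) *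
          peak 3 ε (f ((hchart c).symm z.1) - l z.2)) (𝓝[>] 0)
      (𝓝 (∑ᶠ p ∈ {p : S × ℝ | p.1 ∈ tsupport ρ ∧ p.2 ∈ Icc (-1 : ℝ) 1 ∧ f p.1 = l p.2},
        ρ p.1 * tent p.2 *
          (SignType.sign (det3 (frame f p.1 0) (frame f p.1 1) (-deriv l p.2)) : ℝ))) := by
  have hKc := isCompact_chartSupport hρs
  have hKT := chartSupport_subset hρs
  set K := chartSupport c ρ with hK
  set T := (hchart c).target
  have hC : IsCompact (K ×ˢ Icc (-1 : ℝ) 1) := hKc.prod isCompact_Icc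
  have hl1 := hl.continuous
  have hl2 := ContDiff.continuous_deriv_top hl
  have hFs := contDiffOn_comp_hchart_symm hf c
  have hρs' := contDiffOn_comp_hchart_symm hρ c
  set Z : E 2 × ℝ → E 3 := fun z => f ((hchart c).symm z.1) - l z.2 with hZ
  set w : E 2 × ℝ → ℝ := fun z => ρ ((hchart c).symm z.1) * tent z.2 with hw
  set J : E 2 × ℝ → ℝ := fun z =>
    det3 (chartFrame f c 0 z.1) (chartFrame f c 1 z.1) (-deriv l z.2) with hJ
  have hCT : MapsTo Prod.fst (K ×ˢ Icc (-1 : ℝ) 1) T := fun z hz => hKT hz.1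
  have hZc : ContinuousOn Z (K ×ˢ Icc (-1 : ℝ) 1) :=
    (hFs.continuousOn.comp continuousOn_fst hCT).sub (hl1.comp continuous_snd).continuousOn
  have hwc : ContinuousOn w (K ×ˢ Icc (-1 : ℝ) 1) :=
    (hρs'.continuousOn.comp continuousOn_fst hCT).mul
      (continuous_tent.comp continuous_snd).continuousOn
  have hJc : ContinuousOn J (K ×ˢ Icc (-1 : ℝ) 1) :=
    ContinuousOn.det3 ((continuousOn_chartFrame hf c 0).comp continuousOn_fst hCT)
      ((continuousOn_chartFrame hf c 1).comp continuousOn_fst hCT)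
      (hl2.neg.comp continuous_snd).continuousOn
  obtain ⟨M, hM⟩ := hC.exists_bound_of_continuousOn (hwc.mul hJc)
  set g : E 2 × ℝ → ℝ := (K ×ˢ Icc (-1 : ℝ) 1).indicator fun z => w z * J z with hg
  have hgm : AEStronglyMeasurable g :=
    (aestronglyMeasurable_indicator_iff hC.measurableSet).2
      ((hwc.mul hJc).aestronglyMeasurable hC.measurableSet)
  have hjac : ∀ z : E 2 × ℝ, z.1 ∈ interior T → ContDiffAt ℝ 1 Z z ∧ prodJac Z z = J z := by
    intro z hz
    have hzT := mem_interior_iff_mem_nhds.1 hz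
    have hF : ContDiffAt ℝ ∞ (f ∘ (hchart c).symm) z.1 := hFs.contDiffAt hzT
    have hH : halfPlane ∈ 𝓝 z.1 := mem_of_superset hzT (hchart_target_subset c)
    have h1 := ((hF.differentiableAt (by simp)).hasFDerivAt).comp z
      (hasFDerivAt_fst (𝕜 := ℝ) (p := z))
    have h2 := ((ContDiff.hasDerivAt_top hl z.2).hasFDerivAt).comp z
      (hasFDerivAt_snd (𝕜 := ℝ) (p := z))
    have h3 : HasFDerivAt Z _ z := h1.sub h2
    refine ⟨(((hF.comp z contDiffAt_fst).sub
      (hl.contDiffAt.comp z contDiffAt_snd)).of_le (by simp)), ?_⟩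
    rw [prodJac_eq h3]
    simp [hJ, chartFrame, halfDeriv, fderivWithin_of_mem_nhds hH]
  -- The curve avoids the image of the boundary, so every zero lies over an interior point of the
  -- chart, where the one-sided derivative is the ordinary one.
  have hzero : ∀ z ∈ K ×ˢ Icc (-1 : ℝ) 1, Z z = 0 → z.1 ∈ interior T ∧ J z ≠ 0 := by
    rintro z ⟨⟨x, hx, hxz⟩, -⟩ h0
    have hxs := hρs hx
    have hsx : (hchart c).symm z.1 = x := by rw [← hxz]; exact (hchart c).left_inv hxs
    have hfx : f x = l z.2 := by
      rw [← hsx]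
      exact sub_eq_zero.1 h0
    have hint : (𝓡∂ 2).IsInteriorPoint x := by
      rw [ModelWithCorners.isInteriorPoint_iff_not_isBoundaryPoint]
      exact fun hb => hbd x hb z.2 hfx
    refine ⟨?_, ?_⟩
    · rw [← hxz]
      exact ((𝓡∂ 2).isInteriorPoint_iff_of_mem_atlas (n := ∞) (by simp)
        (chart_mem_atlas (EuclideanHalfSpace 2) c)
        (by rwa [← extChartAt_source (𝓡∂ 2)])).1 hint
    · have h1 := htr x z.2 hfx
      have h2 := sign_det3_frame hS hf hxs (deriv l z.2)
      rw [hxz] at h2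
      simp only [hJ]
      rw [det3_neg_right, neg_ne_zero]
      rwa [← sign_ne_zero, ← h2, sign_ne_zero]
  have key := tendsto_integral_mul_peak_prod hC hZc (w := w) hgm (M := max M 0) (fun z => ?_)
    (fun z hz => indicator_of_notMem hz _) (fun z hz hz0 => ?_)
  rotate_left
  · by_cases hz : z ∈ K ×ˢ Icc (-1 : ℝ) 1
    · rw [hg, indicator_of_mem hz]
      exact (hM z hz).trans (le_max_left _ _)
    · rw [hg, indicator_of_notMem hz, abs_zero]
      exact le_max_right _ _
  · obtain ⟨hi, hJ0⟩ := hzero z hz hz0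
    refine ⟨(hjac z hi).1, by rwa [(hjac z hi).2], ?_, ?_⟩
    · exact ((hρs'.contDiffAt (mem_interior_iff_mem_nhds.1 hi)).continuousAt.comp
        continuousAt_fst).mul (continuous_tent.comp continuous_snd).continuousAt
    · filter_upwards [continuousAt_fst.preimage_mem_nhds (isOpen_interior.mem_nhds hi)] with y hy
      rw [(hjac y hy).2]
      by_cases hyC : y ∈ K ×ˢ Icc (-1 : ℝ) 1
      · rw [hg, indicator_of_mem hyC]
      · rw [hg, indicator_of_notMem hyC]
        by_cases hyK : y.1 ∈ K
        · have h1 : y.2 ∉ Icc (-1 : ℝ) 1 := fun h => hyC ⟨hyK, h⟩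
          have h2 := tent_eq_zero h1
          simp only [hw]
          rw [h2]
          ring
        · have h1 : (hchart c).symm y.1 ∉ tsupport ρ := fun h =>
            hyK ⟨_, h, (hchart c).right_inv (interior_subset hy)⟩
          have h2 : ρ ((hchart c).symm y.1) = 0 := image_eq_zero_of_notMem_tsupport h1
          simp only [hw]
          rw [h2]
          ring
  set P := {p : S × ℝ | p.1 ∈ tsupport ρ ∧ p.2 ∈ Icc (-1 : ℝ) 1 ∧ f p.1 = l p.2} with hP
  have himg : {z | z ∈ K ×ˢ Icc (-1 : ℝ) 1 ∧ Z z = 0} =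
      (fun p : S × ℝ => (hchart c p.1, p.2)) '' P := by
    ext z
    constructor
    · rintro ⟨⟨⟨x, hx, hxz⟩, ht⟩, h0⟩
      have hsx : (hchart c).symm z.1 = x := by rw [← hxz]; exact (hchart c).left_inv (hρs hx)
      refine ⟨(x, z.2), ⟨hx, ht, ?_⟩, Prod.ext hxz rfl⟩
      rw [← hsx]
      exact sub_eq_zero.1 h0
    · rintro ⟨p, ⟨hx, ht, hp⟩, rfl⟩
      refine ⟨⟨⟨p.1, hx, rfl⟩, ht⟩, ?_⟩
      simp only [hZ]
      rw [show (hchart c).symm (hchart c p.1) = p.1 from (hchart c).left_inv (hρs hx), hp, sub_self]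
  have hinj : InjOn (fun p : S × ℝ => (hchart c p.1, p.2)) P := fun p hp q hq h =>
    Prod.ext ((hchart c).injOn (hρs hp.1) (hρs hq.1) (Prod.ext_iff.1 h).1) (Prod.ext_iff.1 h).2
  rw [himg, finsum_mem_image hinj] at key
  refine ⟨Finite.of_finite_image key.1 hinj, ?_⟩
  have hlim : ∑ᶠ p ∈ P, w (hchart c p.1, p.2) *
      (SignType.sign (prodJac Z (hchart c p.1, p.2)) : ℝ) = ∑ᶠ p ∈ P, ρ p.1 * tent p.2 *
          (SignType.sign (det3 (frame f p.1 0) (frame f p.1 1) (-deriv l p.2)) : ℝ) := by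
    refine finsum_mem_congr rfl fun p hp => ?_
    have hz : (hchart c p.1, p.2) ∈ {z | z ∈ K ×ˢ Icc (-1 : ℝ) 1 ∧ Z z = 0} := by
      rw [himg]
      exact ⟨p, hp, rfl⟩
    rw [(hjac _ (hzero _ hz.1 hz.2).1).2, sign_det3_frame hS hf (hρs hp.1)]
    simp only [hw]
    rw [show (hchart c).symm (hchart c p.1) = p.1 from (hchart c).left_inv (hρs hp.1)]
  rw [hlim] at key
  refine key.2.congr fun ε => ?_
  rw [← integral_indicator hC.measurableSet]
  refine integral_congr_ae (Eventually.of_forall fun z => ?_)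
  by_cases hz : z ∈ K ×ˢ Icc (-1 : ℝ) 1
  · simp only [hg, indicator_of_mem hz, hw, hJ, hZ]
  · simp only [hg, indicator_of_notMem hz, zero_mul]

end Intersection

/-! ### Linking numbers -/

/-- Points outside the support of ρ_c have weight zero, so every sum may be taken over M, and the
weights at each point add up to one. -/
theorem sum_finsum_partition {X α : Type*} [TopologicalSpace X] {t : Finset X} {ρ : X → X → ℝ}
    {M : Set (X × α)}
    (hfin : ∀ c ∈ t, {p : X × α | p.1 ∈ tsupport (ρ c) ∧ p ∈ M}.Finite)
    (hρ1 : ∀ x, ∑ c ∈ t, ρ c x = 1) (F : X × α → ℝ) :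
    M.Finite ∧ ∑ c ∈ t, ∑ᶠ p ∈ {p : X × α | p.1 ∈ tsupport (ρ c) ∧ p ∈ M}, ρ c p.1 * F p =
      ∑ᶠ p ∈ M, F p := by
  have hM : M.Finite := by
    refine (t.finite_toSet.biUnion hfin).subset fun p hp => ?_
    obtain ⟨c, hc, h⟩ := Finset.exists_ne_zero_of_sum_ne_zero
      (by rw [hρ1 p.1]; exact one_ne_zero : ∑ c ∈ t, ρ c p.1 ≠ 0)
    exact mem_biUnion hc ⟨subset_tsupport _ h, hp⟩
  refine ⟨hM, ?_⟩
  calc _ = ∑ c ∈ t, ∑ᶠ p ∈ M, ρ c p.1 * F p := by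
        refine Finset.sum_congr rfl fun c _ => finsum_mem_inter_support_eq' _ _ _ fun p hp => ?_
        exact ⟨fun h => h.2, fun h => ⟨subset_tsupport _ (left_ne_zero_of_mul hp), h⟩⟩
    _ = ∑ p ∈ hM.toFinset, ∑ c ∈ t, ρ c p.1 * F p := by
        simp only [finsum_mem_eq_finite_toFinset_sum _ hM]
        exact Finset.sum_comm
    _ = _ := by
        simp only [← Finset.sum_mul, hρ1, one_mul]
        exact (finsum_mem_eq_finite_toFinset_sum _ hM).symm

section Linking

variable {S : Type} [TopologicalSpace S] [ChartedSpace (EuclideanHalfSpace 2) S]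
  {r : ℕ} {K : OrientedKnot r} {f : S → E 3} {t : Finset S}
  {ρ : S → S → ℝ} {l : ℝ → E 3} {ε : ℝ}

/-- The exterior derivative of ξ ↦ det(B(x - y), ξ, w) consists of two of the three terms of
`det3_bsDeriv`. Hence it is the peak times the determinant minus the third term, which is a
derivative along w. -/
theorem pullDensity_detForm (hε : 0 < ε) (c : S) (u : E 2) (y w : E 3) :
    pullDensity (fun x => detForm w (bsField ε (x - y))) f c (fun _ => 1) u =
      peak 3 ε (f ((hchart c).symm u) - y) * det3 (chartFrame f c 0 u) (chartFrame f c 1 u) w -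
        det3 (chartFrame f c 0 u) (chartFrame f c 1 u)
          (bsDeriv ε (f ((hchart c).symm u) - y) w) := by
  have hd : ∀ ξ η, fderiv ℝ (fun x => detForm w (bsField ε (x - y)))
      (f ((hchart c).symm u)) ξ η = det3 (bsDeriv ε (f ((hchart c).symm u) - y) ξ) η w := by
    intro ξ η
    obtain ⟨A, hA, hA'⟩ := hasFDerivAt_bsField hε (f ((hchart c).symm u) - y)
    have h1 := (detForm w).hasFDerivAt.comp (f ((hchart c).symm u))
      (hA.comp (f ((hchart c).symm u)) ((hasFDerivAt_id _).sub_const y))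
    have h2 : HasFDerivAt (fun x => detForm w (bsField ε (x - y))) _ (f ((hchart c).symm u)) := h1
    rw [h2.fderiv, ← hA']
    rfl
  have h0 : halfDeriv ((fun _ : S => (1 : ℝ)) ∘ (hchart c).symm) u = 0 :=
    fderivWithin_const_apply (1 : ℝ)
  have h3 := det3_bsDeriv hε (f ((hchart c).symm u) - y) (chartFrame f c 0 u)
    (chartFrame f c 1 u) w
  have h4 := det3_swap (bsDeriv ε (f ((hchart c).symm u) - y) (chartFrame f c 1 u))
    (chartFrame f c 0 u) w
  have h5 := det3_cyclic (bsDeriv ε (f ((hchart c).symm u) - y) (chartFrame f c 1 u)) w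
    (chartFrame f c 0 u)
  have h6 := det3_cyclic w (chartFrame f c 0 u)
    (bsDeriv ε (f ((hchart c).symm u) - y) (chartFrame f c 1 u))
  rw [pullDensity, alt_pullDeriv, h0]
  simp only [Function.comp_apply, _root_.zero_apply, zero_mul, zero_add, one_mul, hd]
  linarith

theorem detSK_eq {r : ℕ} (f : S → E 3) (K : OrientedKnot r) (q : S × Fin r × ℝ) :
    detSK f K q = det3 (frame f q.1 0) (frame f q.1 1) (deriv (K.curve q.2.1) q.2.2) := rfl

theorem detKS_eq {r : ℕ} (f : S → E 3) (K : OrientedKnot r) : detKS f K = detSK f K :=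
  funext fun _ => det3_cyclic _ _ _

/-- The rows of the diagonal form the block row (1, 1), and the block determinant formula subtracts
the right block from the left one. -/
theorem orientDet_pair_diag {n : ℕ} (a b : Fin n → E n) :
    orientDet (Fin.append (fun i => pair (a i) (b i)) fun i => diagEmb n (stdVec n i)) =
      orientDet fun i => a i - b i := by
  have h : (Matrix.of fun i j => Fin.append (fun i => pair (a i) (b i))
      (fun i => diagEmb n (stdVec n i)) i j).submatrix finSumFinEquiv finSumFinEquiv =
      Matrix.fromBlocks (Matrix.of fun i j => a i j) (Matrix.of fun i j => b i j) 1 1 := by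
    ext i j
    rcases i with i | i <;> rcases j with j | j <;>
      simp only [Matrix.submatrix_apply, finSumFinEquiv_apply_left, finSumFinEquiv_apply_right,
        Matrix.of_apply, Fin.append_left, Fin.append_right, pair, diagEmb, stdVec_apply,
        Matrix.fromBlocks_apply₁₁, Matrix.fromBlocks_apply₁₂, Matrix.fromBlocks_apply₂₁,
        Matrix.fromBlocks_apply₂₂, Matrix.one_apply, eq_comm]
  rw [orientDet, ← Matrix.det_submatrix_equiv_self finSumFinEquiv, h, Matrix.det_fromBlocks_one₂₂,
    Matrix.mul_one]
  rfl

/-- The single vector of the second factor enters as its negative, hence the sign. For K × S there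
are two such vectors and the signs cancel. -/
theorem detSKdiag_eq {r : ℕ} (f : S → E 3) (K : OrientedKnot r) (q : S × Fin r × ℝ) :
    detSKdiag f K q = -detSK f K q := by
  have h := orientDet_pair_diag ![frame f q.1 0, frame f q.1 1, 0]
    ![0, 0, deriv (K.curve q.2.1) q.2.2]
  rw [detSK_eq, ← det3_neg_right, detSKdiag, det3]
  convert h using 2
  · funext i
    fin_cases i <;> rfl
  · funext i
    fin_cases i <;> simp

theorem detKSdiag_eq {r : ℕ} (f : S → E 3) (K : OrientedKnot r) : detKSdiag f K = detSK f K := by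
  funext q
  have h := orientDet_pair_diag ![deriv (K.curve q.2.1) q.2.2, 0, 0]
    ![0, frame f q.1 0, frame f q.1 1]
  rw [← detKS_eq]
  have h1 : detKS f K q = det3 (deriv (K.curve q.2.1) q.2.2) (-frame f q.1 0)
      (-frame f q.1 1) := by
    rw [det3_neg_right, det3_neg_mid, neg_neg]
    rfl
  rw [h1, detKSdiag, det3]
  convert h using 2
  · funext i
    fin_cases i <;> rfl
  · funext i
    fin_cases i <;> simp

variable [IsManifold (𝓡∂ 2) ∞ S]

/-- Stokes' theorem for the one-form of `pullDensity_detForm`, with the point y of the other curve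
and its velocity w held fixed. -/
theorem sum_integral_det3_bsField [CompactSpace S] (hε : 0 < ε) (hS : HasOrientedCharts S)
    (hf : IsSeifertSurface K f) (hρ : ∀ c, ContMDiff (𝓡∂ 2) 𝓘(ℝ, ℝ) ∞ (ρ c))
    (hρs : ∀ c, tsupport (ρ c) ⊆ (hchart c).source) (hρ1 : ∀ x, ∑ c ∈ t, ρ c x = 1) (y w : E 3) :
    ∑ i, ∫ s in (0 : ℝ)..1, det3 (bsField ε (K.curve i s - y)) (deriv (K.curve i) s) w =
      ∑ c ∈ t, ∫ u in chartSupport c (ρ c), ρ c ((hchart c).symm u) *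
        (peak 3 ε (f ((hchart c).symm u) - y) * det3 (chartFrame f c 0 u) (chartFrame f c 1 u) w -
          det3 (chartFrame f c 0 u) (chartFrame f c 1 u)
            (bsDeriv ε (f ((hchart c).symm u) - y) w)) := by
  have ha : ContDiff ℝ 1 fun x : E 3 => detForm w (bsField ε (x - y)) :=
    (detForm w).contDiff.comp ((contDiff_bsField hε).comp (contDiff_id.sub contDiff_const))
  refine (knot_stokes hS hf ha hρ hρs hρ1).trans (Finset.sum_congr rfl fun c _ => ?_)
  rw [setIntegral_eq_of_subset_of_forall_sdiff_eq_zero (measurableSet_hchart_target c)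
    (chartSupport_subset (hρs c))]
  · refine setIntegral_congr_fun (isCompact_chartSupport (hρs c)).measurableSet fun u _ => ?_
    rw [pullDensity_detForm hε]
  · intro u hu
    have h1 : (hchart c).symm u ∉ tsupport (ρ c) := fun h =>
      hu.2 ⟨_, h, (hchart c).right_inv hu.1⟩
    rw [show ρ c ((hchart c).symm u) = 0 from image_eq_zero_of_notMem_tsupport h1, zero_mul]

/-- Integrating the preceding identity over the second curve with w = -l' makes the subtracted term
a total derivative, and only the peak survives. -/
theorem sum_gaussIntegral_eq [CompactSpace S] (hε : 0 < ε) (hS : HasOrientedCharts S)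
    (hf : IsSeifertSurface K f) (hρ : ∀ c, ContMDiff (𝓡∂ 2) 𝓘(ℝ, ℝ) ∞ (ρ c))
    (hρs : ∀ c, tsupport (ρ c) ⊆ (hchart c).source) (hρ1 : ∀ x, ∑ c ∈ t, ρ c x = 1)
    (hl : ContDiff ℝ ∞ l) (hlp : Function.Periodic l 1) :
    ∑ i, gaussIntegral ε (K.curve i) l =
      ∑ c ∈ t, ∫ z in chartSupport c (ρ c) ×ˢ Icc (-1 : ℝ) 1, ρ c ((hchart c).symm z.1) *
        tent z.2 * det3 (chartFrame f c 0 z.1) (chartFrame f c 1 z.1) (-deriv l z.2) *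
          peak 3 ε (f ((hchart c).symm z.1) - l z.2) := by
  have hsheet := fun c : S => integral_sheet (isCompact_chartSupport (hρs c))
    ((contDiffOn_comp_hchart_symm (hρ c) c).continuousOn.mono (chartSupport_subset (hρs c)))
    ((contDiffOn_comp_hchart_symm hf.1 c).continuousOn.mono (chartSupport_subset (hρs c)))
    ((continuousOn_chartFrame hf.1 c 0).mono (chartSupport_subset (hρs c)))
    ((continuousOn_chartFrame hf.1 c 1).mono (chartSupport_subset (hρs c))) hε hl hlp
  have hcont := fun i => continuous_gaussIntegrand hε (K.smooth i) hl
  calc ∑ i, gaussIntegral ε (K.curve i) l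
      = ∑ i, ∫ τ in (0 : ℝ)..1, ∫ s in (0 : ℝ)..1,
          det3 (bsField ε (K.curve i s - l τ)) (deriv (K.curve i) s) (-deriv l τ) :=
        Finset.sum_congr rfl fun i _ => integral_swap (hcont i) 0 1 0 1
    _ = ∫ τ in (0 : ℝ)..1, ∑ i, ∫ s in (0 : ℝ)..1,
          det3 (bsField ε (K.curve i s - l τ)) (deriv (K.curve i) s) (-deriv l τ) := by
        rw [intervalIntegral.integral_finsetSum]
        intro i _
        exact (continuous_integral ((hcont i).comp continuous_swap) 0 1).intervalIntegrable 0 1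
    _ = _ := by
        simp only [sum_integral_det3_bsField hε hS hf hρ hρs hρ1]
        refine (intervalIntegral.integral_finsetSum fun c _ => (hsheet c).1).trans ?_
        exact Finset.sum_congr rfl fun c _ => (hsheet c).2

/-- Both sides of `sum_gaussIntegral_eq` are taken to the limit ε → 0: the left side tends to the
Gauss integral, the right side to the weighted count of intersection points. The partition of unity
and the tents then drop out, and the velocity -l' accounts for the minus sign. -/
theorem sum_gaussIntegral_zero_eq_finsum [CompactSpace S] [T2Space S] (hS : HasOrientedCharts S)
    (hf : IsSeifertSurface K f) (hl : ContDiff ℝ ∞ l) (hlp : Function.Periodic l 1)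
    (hne : ∀ i s τ, K.curve i s ≠ l τ)
    (htr : ∀ x τ, f x = l τ → det3 (frame f x 0) (frame f x 1) (deriv l τ) ≠ 0) :
    {q : S × ℝ | q.2 ∈ Ico (0 : ℝ) 1 ∧ f q.1 = l q.2}.Finite ∧
    ∑ i, gaussIntegral 0 (K.curve i) l =
      -∑ᶠ q ∈ {q : S × ℝ | q.2 ∈ Ico (0 : ℝ) 1 ∧ f q.1 = l q.2},
        (SignType.sign (det3 (frame f q.1 0) (frame f q.1 1) (deriv l q.2)) : ℝ) := by
  obtain ⟨t, ρ, hρ, hρs, -, hρ1⟩ := exists_partition (S := S)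
  have hbd : ∀ x ∈ (𝓡∂ 2).boundary S, ∀ τ, f x ≠ l τ := by
    intro x hx τ h
    obtain ⟨i, s, hs⟩ := hf.2.2.2.1.mapsTo hx
    exact hne i s τ (hs.trans h)
  have hsheet := fun c : S => tendsto_sheet hS hf.1 hl hbd htr (hρ c) (hρs c)
  have hsum := sum_finsum_partition (M := {q : S × ℝ | q.2 ∈ Icc (-1 : ℝ) 1 ∧ f q.1 = l q.2})
    (fun c (_ : c ∈ t) => (hsheet c).1) hρ1 fun p => tent p.2 *
      (SignType.sign (det3 (frame f p.1 0) (frame f p.1 1) (-deriv l p.2)) : ℝ)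
  have hl' := periodic_deriv hlp
  have hper := finsum_tent_mul (P := fun x τ => f x = l τ)
    (F := fun x τ => (SignType.sign (det3 (frame f x 0) (frame f x 1) (-deriv l τ)) : ℝ))
    (fun x τ => by rw [hlp τ]) (fun x τ => by rw [hl' τ]) hsum.1
  have hlim : Tendsto (fun ε => ∑ i, gaussIntegral ε (K.curve i) l) (𝓝[>] 0)
      (𝓝 (∑ᶠ q ∈ {q : S × ℝ | q.2 ∈ Ico (0 : ℝ) 1 ∧ f q.1 = l q.2},
        (SignType.sign (det3 (frame f q.1 0) (frame f q.1 1) (-deriv l q.2)) : ℝ))) := by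
    rw [← hper, ← hsum.2]
    refine ((tendsto_finsetSum t fun c _ => (hsheet c).2).congr' ?_).trans (le_of_eq ?_)
    · filter_upwards [self_mem_nhdsWithin] with ε hε
      exact (sum_gaussIntegral_eq hε hS hf hρ hρs hρ1 hl hlp).symm
    · simp only [mul_assoc]
      rfl
  have hfin : {q : S × ℝ | q.2 ∈ Ico (0 : ℝ) 1 ∧ f q.1 = l q.2}.Finite := by
    refine hsum.1.subset fun q hq => ⟨⟨?_, hq.1.2.le⟩, hq.2⟩
    linarith [hq.1.1]
  refine ⟨hfin, ?_⟩
  · have hlim' := tendsto_finsetSum Finset.univ fun i (_ : i ∈ Finset.univ) =>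
      tendsto_gaussIntegral (K.smooth i) hl (hne i)
    rw [tendsto_nhds_unique hlim' hlim, ← finsum_mem_neg_distrib _ hfin]
    refine finsum_mem_congr rfl fun q _ => ?_
    rw [det3_neg_right, Left.sign_neg, SignType.coe_neg]

theorem isSignedCount_detSK [CompactSpace S] [T2Space S] {r' : ℕ} {K' : OrientedKnot r'}
    (hS : HasOrientedCharts S) (hf : IsSeifertSurface K f) (hK : Disjoint K.carrier K'.carrier)
    (htr : IsTransverseTo f K') {d : ℤ}
    (hd : ∑ i, ∑ j, gaussIntegral 0 (K.curve i) (K'.curve j) = d) :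
    IsSignedCount (meetingPoints f K') (detSK f K') (-d) := by
  have h := fun j => sum_gaussIntegral_zero_eq_finsum hS hf (K'.smooth j) (K'.periodic j)
    (fun i s τ => curve_ne hK i j s τ) fun x τ hx => by
      obtain ⟨τ', hτ', h1, h2⟩ := exists_mem_Ico_curve (K'.periodic j) τ
      rw [h2]
      exact htr (x, j, τ') ⟨hτ', hx.trans h1⟩
  have hσ := finsum_mem_sigma (fun j => (h j).1) fun q : Fin r' × S × ℝ =>
    (SignType.sign (detSK f K' (q.2.1, q.1, q.2.2)) : ℝ)
  have hinj : Function.Injective fun q : Fin r' × S × ℝ => (q.2.1, q.1, q.2.2) := by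
    rintro ⟨a, b, c⟩ ⟨a', b', c'⟩ h
    simp only [Prod.mk.injEq] at h ⊢
    tauto
  have himg : meetingPoints f K' = (fun q : Fin r' × S × ℝ => (q.2.1, q.1, q.2.2)) ''
      {q | q.2 ∈ {p : S × ℝ | p.2 ∈ Ico (0 : ℝ) 1 ∧ f p.1 = K'.curve q.1 p.2}} := by
    ext q
    constructor
    · exact fun hq => ⟨(q.2.1, q.1, q.2.2), hq, rfl⟩
    · rintro ⟨p, hp, rfl⟩
      exact hp
  have hfin : (meetingPoints f K').Finite := by
    rw [himg]
    exact hσ.1.image _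
  refine ⟨hfin, ?_⟩
  have hcast := (Int.castAddHom ℝ).map_finsum_mem
    (fun q => (SignType.sign (detSK f K' q) : ℤ)) hfin
  simp only [Int.coe_castAddHom, SignType.intCast_cast] at hcast
  rw [← Int.cast_inj (α := ℝ), hcast, himg, finsum_mem_image hinj.injOn, hσ.2, Int.cast_neg, ← hd,
    Finset.sum_comm, ← Finset.sum_neg_distrib]
  refine Finset.sum_congr rfl fun j _ => ?_
  rw [(h j).2, neg_neg]
  rfl

end Linking

theorem IsSignedCount.neg {α : Type*} {P : Set α} {J : α → ℝ} {d : ℤ} (h : IsSignedCount P J d) :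
    IsSignedCount P (fun q => -J q) (-d) := by
  refine ⟨h.1, ?_⟩
  rw [← h.2, ← finsum_mem_neg_distrib _ h.1]
  refine finsum_mem_congr rfl fun q _ => ?_
  rw [Left.sign_neg, SignType.coe_neg]

theorem gaussIntegral_zero_comm {k l : ℝ → E 3} (hk : ContDiff ℝ ∞ k) (hl : ContDiff ℝ ∞ l)
    (hne : ∀ s t, k s ≠ l t) : gaussIntegral 0 k l = gaussIntegral 0 l k := by
  refine tendsto_nhds_unique (tendsto_gaussIntegral hk hl hne)
    ((tendsto_gaussIntegral hl hk fun s t => (hne t s).symm).congr' ?_)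
  filter_upwards [self_mem_nhdsWithin] with ε hε
  exact gaussIntegral_comm hε hl hk

/-- The Gauss integral is symmetric in the two knots, so the count for surfaces bounded by K₁ also
applies to surfaces bounded by K₂. The remaining signs come from the determinants on the diagonal.
-/
theorem isLinkingNumber_of_productIntegral {r₁ r₂ : ℕ} {K₁ : OrientedKnot r₁}
    {K₂ : OrientedKnot r₂} (hK : Disjoint K₁.carrier K₂.carrier) {ℓ : ℤ}
    (h : productIntegral K₁ K₂ (diagForm 3) = ℓ) : IsLinkingNumber K₁ K₂ ℓ := by
  rw [productIntegral_diagForm] at h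
  have h' : ∑ j, ∑ i, gaussIntegral 0 (K₂.curve j) (K₁.curve i) = ℓ := by
    rw [← h, Finset.sum_comm]
    exact Finset.sum_congr rfl fun i _ => Finset.sum_congr rfl fun j _ =>
      gaussIntegral_zero_comm (K₂.smooth j) (K₁.smooth i) (curve_ne hK.symm j i)
  refine ⟨fun S₁ _ _ _ _ _ f₁ hS hf htr => ?_, fun S₂ _ _ _ _ _ f₂ hS hf htr => ?_⟩
  · have h1 := isSignedCount_detSK hS hf hK htr h
    refine ⟨?_, h1⟩
    rw [funext (detSKdiag_eq f₁ K₂), ← neg_neg ℓ]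
    exact h1.neg
  · have h1 := isSignedCount_detSK hS hf hK.symm htr h'
    rw [detKSdiag_eq, detKS_eq]
    exact ⟨h1, h1⟩

end BiotSavart

end

theorem mainTheorem8 :
    (∀ (n : ℕ) (hn : 3 ≤ n),
      -- the Biot–Savart form of the diagonal and of the origin
      (∃ S : BiotSavart.Current (n + n) n,
        BiotSavart.IsGreenOf (BiotSavart.diagCurrent n) S ∧
        (∀ θ : BiotSavart.TestForm (n + n) n,
          Integrable (fun x : BiotSavart.E n =>
            BiotSavart.green (θ : BiotSavart.E (n + n) → BiotSavart.Cov (n + n) n)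
              (BiotSavart.diagEmb n x)
              fun i => BiotSavart.diagEmb n (BiotSavart.stdVec n i)) ∧
          S θ = ∫ x : BiotSavart.E n,
            BiotSavart.green (θ : BiotSavart.E (n + n) → BiotSavart.Cov (n + n) n)
              (BiotSavart.diagEmb n x)
              fun i => BiotSavart.diagEmb n (BiotSavart.stdVec n i)) ∧
        BiotSavart.Represents (by omega) (BiotSavart.diagForm n) (BiotSavart.currentCodiff S) ∧
        BiotSavart.currentD (BiotSavart.currentCodiff S) = BiotSavart.diagCurrent n) ∧
      (∃ S₀ : BiotSavart.Current n 0,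
        BiotSavart.IsGreenOf (BiotSavart.diracCurrent n) S₀ ∧
        BiotSavart.Represents (by omega) (BiotSavart.pointForm n)
          (BiotSavart.currentCodiff S₀)) ∧
      (∀ z, BiotSavart.diagForm n z =
        (BiotSavart.pointForm n (BiotSavart.diffMap n z)).compContinuousLinearMap
          (BiotSavart.diffMap n)) ∧
      -- blow-up extendibility
      BiotSavart.IsBlowUpExtendible (BiotSavart.diag n) (BiotSavart.diagForm n) ∧
      -- existence of the Green kernels, and the form as the sum of the Biot–Savart kernels
      (∀ k ≤ n, ∃ K, BiotSavart.IsGreenKernel n k K) ∧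
      (∀ K : ℕ → BiotSavart.E (n + n) → BiotSavart.Cov (n + n) n,
        (∀ k ≤ n, BiotSavart.IsGreenKernel n k (K k)) →
        (∀ z ∉ BiotSavart.diag n,
          BiotSavart.diagForm n z =
            ∑ k ∈ Finset.range (n + 1), BiotSavart.codiffY (K k) z) ∧
        (∀ z ∉ BiotSavart.diag n, BiotSavart.codiffY (K 0) z = 0) ∧
        (∀ j, j + 1 ≤ n →
          BiotSavart.IsKernel (k := j + 1) (l := j) (by omega) (BiotSavart.codiffY (K (j + 1)))
            (fun θ y => (-1 : ℝ) ^ n • BiotSavart.codiff (BiotSavart.green θ) y))) ∧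
      -- pull-back of the volume form of the sphere under the Gauss map
      (∀ z ∉ BiotSavart.diag n,
        ‖BiotSavart.gaussMap n z‖ = 1 ∧
        BiotSavart.diagForm n z =
          (BiotSavart.sphereVol n (BiotSavart.gaussMap n z)).compContinuousLinearMap
            (fderiv ℝ (BiotSavart.gaussMap n) z))) ∧
    -- Gauss's linking formula
    (∀ (r₁ r₂ : ℕ) (K₁ : BiotSavart.OrientedKnot r₁) (K₂ : BiotSavart.OrientedKnot r₂),
      Disjoint K₁.carrier K₂.carrier →
      ∃ ℓ : ℤ, BiotSavart.IsLinkingNumber K₁ K₂ ℓ ∧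
        BiotSavart.productIntegral K₁ K₂ (BiotSavart.diagForm 3) = ℓ ∧
        BiotSavart.IsDegree (BiotSavart.knotGaussMap K₁ K₂) ℓ) := by
  refine ⟨fun n hn => ⟨⟨BiotSavart.greenDiag n, BiotSavart.isGreenOf_diag hn, fun θ =>
      ⟨BiotSavart.integrable_green_diag hn θ, ?_⟩, BiotSavart.represents_diagForm hn _,
      BiotSavart.currentD_currentCodiff_greenDiag hn⟩,
    ⟨BiotSavart.greenPoint n, BiotSavart.isGreenOf_point hn,
      BiotSavart.represents_pointForm hn _⟩,
    BiotSavart.diagForm_eq, BiotSavart.isBlowUpExtendible_diagForm (by omega),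
    fun k hk => ⟨_, BiotSavart.isGreenKernel_newtonForm hn ⟨k, Nat.lt_succ_of_le hk⟩⟩,
    fun K hK => ⟨fun z hz => BiotSavart.diagForm_eq_sum_codiffY hn hK hz,
      fun z hz => BiotSavart.codiffY_green_zero hn (hK 0 (Nat.zero_le n)) hz,
      fun j hj => BiotSavart.isKernel_codiffY hn hj _ (hK (j + 1) hj)⟩,
    fun z hz => ⟨BiotSavart.norm_gaussMap hz,
      BiotSavart.diagForm_eq_sphereVol (by omega) hz⟩⟩, fun r₁ r₂ K₁ K₂ hK => ?_⟩
  · exact (BiotSavart.greenDiag_apply hn θ).trans (BiotSavart.integral_green_diag_eq hn θ).symm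
  · obtain ⟨ℓ, hℓ, hdeg⟩ := BiotSavart.exists_isDegree hK
    exact ⟨ℓ, BiotSavart.isLinkingNumber_of_productIntegral hK hℓ, hℓ, hdeg⟩
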